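/- Let $\mathbb{F}$ be an arbitrary field, let $n\ge 1$ and $d\ge 0$ be integers, write $[n]=\{1,\dots,n\}$ and let $\binom{[n]}{d}$ be the set of $d$-element subsets of $[n]$. Let $\mathrm{Gr}_{\mathbb{F}}(d,n)\subseteq\mathbb{P}^{\binom{n}{d}-1}(\mathbb{F})$ be the Plücker-embedded Grassmannian, i.e. the set of points $[V_S]_{S\in\binom{[n]}{d}}$, where $V$ is a $d\times n$ matrix whose row span is a $d$-dimensional subspace of $\mathbb{F}^n$ and $V_S$ is the $d\times d$ minor of $V$ on the columns in $S$. Let $\mathrm{Gr}^2_{\mathbb{F}}(d,n)$ be its image under $[p_S]_S\mapsto[p_S^2]_S$. For $m\ge 0$ and ${\bf a}=(a_S)_{S\subseteq[m]}\in\mathbb{F}^{2^m}$ put $f_{\bf a}=\sum_{S\subseteq[m]}a_S\prod_{i\in[m]\setminus S}x_i$. The group $\mathrm{SL}_2(\mathbb{F})^m\rtimes S_m$ acts on polynomials of degree at most one in each of the variables $x_1,\dots,x_m$: a permutation $\pi\in S_m$ sends $f$ to $f(x_{\pi(1)},\dots,x_{\pi(m)})$, and $\gamma=(\gamma_i)_i\in\mathrm{SL}_2(\mathbb{F})^m$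 with $\gamma_i=\begin{pmatrix}\alpha_i&\beta_i\\ \kappa_i&\delta_i\end{pmatrix}$ sends $f$ to $\prod_{i=1}^m(\kappa_ix_i+\delta_i)\cdot f\left(\frac{\alpha_1x_1+\beta_1}{\kappa_1x_1+\delta_1},\dots,\frac{\alpha_mx_m+\beta_m}{\kappa_mx_m+\delta_m}\right)$. Define $\gamma\cdot{\bf a}$ by $f_{\gamma\cdot{\bf a}}=\gamma\cdot f_{\bf a}$ and, for a polynomial $H$ in the coordinates $a_S$, define $(\gamma\cdot H)({\bf a})=H(\gamma\cdot{\bf a})$. For $m\ge 3$ let \begin{align*} \mathrm{HypDet}({\bf a})={}&a_\emptyset^2a_{123}^2+a_1^2a_{23}^2+a_2^2a_{13}^2+a_3^2a_{12}^2-2a_\emptyset a_1a_{23}a_{123}-2a_\emptyset a_2a_{13}a_{123}-2a_\emptyset a_3a_{12}a_{123}\\ &-2a_1a_2a_{13}a_{23}-2a_1a_3a_{12}a_{23}-2a_2a_3a_{12}a_{13}+4a_\emptyset a_{23}a_{13}a_{12}+4a_{123}a_1a_2a_3 . \end{align*} Let ${\bf q}=(q_S)_{S\in\binom{[n]}{d}}$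 be a nonzero vector over $\mathbb{F}$, viewed as a point of $\mathbb{P}^{\binom{n}{d}-1}(\mathbb{F})$, and let ${\bf a}=(a_S)_{S\subseteq[n-1]}\in\mathbb{F}^{2^{n-1}}$ be given by $$a_S=\begin{cases}q_S&\text{if }|S|=d,\\ q_{S\cup\{n\}}&\text{if }|S|=d-1,\\ 0&\text{otherwise.}\end{cases}$$ Then ${\bf q}$ belongs to $\mathrm{Gr}^2_{\mathbb{F}}(d,n)$ if and only if both of the following hold: (i) for all $i,j\in[n]$ and all $S\subseteq[n]\setminus\{i,j\}$ with $|S|=d-1$, the product $q_{S\cup\{i\}}\,q_{S\cup\{j\}}$ is a square in $\mathbb{F}$; (ii) for every $\gamma\in\mathrm{SL}_2(\mathbb{F})^{n-1}\rtimes S_{n-1}$, $(\gamma\cdot\mathrm{HypDet})({\bf a})=0$ (this condition is empty when $n-1<3$). -/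

import Mathlib

open scoped LinearAlgebra.Projectivization

noncomputable section

namespace HypDetGr

/-- The set `([n] choose d)` of `d`-element subsets of `[n]`. -/
abbrev Subsets (d n : ℕ) : Type := {S : Finset (Fin n) // S.card = d}

variable {F : Type*} [Field F]

/-! ### The Plücker-embedded Grassmannian and its coordinatewise square -/

/-- The vector of maximal minors `V_S` of a `d × n` matrix `V`: `V_S` is the determinant of the
submatrix of `V` on the columns in `S`, taken in increasing order. -/
def pluckerVector {d n : ℕ} (V : Matrix (Fin d) (Fin n) F) : Subsets d n → F :=
  fun S => (V.submatrix id (S.1.orderEmbOfFin S.2)).det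

variable (F) in
/-- The Grassmannian `Gr_F(d,n)` inside `ℙ^{(n choose d) - 1}(F)` under the Plücker embedding:
a `d`-dimensional subspace `L` of `F^n` is sent to the vector of maximal minors of a `d × n`
matrix whose row span is `L`. -/
def grassmannian (d n : ℕ) : Set (ℙ F (Subsets d n → F)) :=
  {p | ∃ L : Submodule F (Fin n → F), Module.finrank F L = d ∧
    ∃ V : Matrix (Fin d) (Fin n) F, Submodule.span F (Set.range V.row) = L ∧
      ∃ h : pluckerVector V ≠ 0, p = Projectivization.mk F (pluckerVector V) h}

theorem sq_ne_zero_of_ne_zero {ι : Type*} {p : ι → F} (hp : p ≠ 0) :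
    (fun S => p S ^ 2) ≠ 0 := by
  intro h
  apply hp
  funext S
  have hS : p S ^ 2 = 0 := congrFun h S
  simpa using hS

/-- The morphism `[p_S]_S ↦ [(p_S)^2]_S` of projective space. -/
def squareMap {ι : Type*} : ℙ F (ι → F) → ℙ F (ι → F) :=
  Projectivization.lift
    (fun p => Projectivization.mk F (fun S => p.1 S ^ 2) (sq_ne_zero_of_ne_zero p.2))
    (by
      intro a b t hab
      rw [Projectivization.mk_eq_mk_iff']
      refine ⟨t ^ 2, ?_⟩
      funext S
      simp [hab, mul_pow])

variable (F) in
/-- `Gr²_F(d,n)`, the image of the Grassmannian under the coordinatewise square. -/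
def grassmannianSq (d n : ℕ) : Set (ℙ F (Subsets d n → F)) :=
  squareMap '' grassmannian F d n

/-! ### The action of `SL₂(F)^m ⋊ S_m` on vectors indexed by the subsets of `[m]` -/

/-- The monomial `x^S = ∏_{i ∈ S} x_i`, as an exponent vector. -/
def expo {m : ℕ} (S : Finset (Fin m)) : Fin m →₀ ℕ := ∑ i ∈ S, Finsupp.single i 1

/-- The multiaffine polynomial `f_a = ∑_S a_S x^{[m] \ S}`. -/
def polyOf {m : ℕ} (a : Finset (Fin m) → F) : MvPolynomial (Fin m) F :=
  ∑ S : Finset (Fin m), MvPolynomial.monomial (expo Sᶜ) (a S)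

/-- The vector `a_S = coeff(f, x^{[m] \ S})` of a multiaffine polynomial `f`. -/
def coeffVec {m : ℕ} (f : MvPolynomial (Fin m) F) : Finset (Fin m) → F :=
  fun S => f.coeff (expo Sᶜ)

/-- For `γ ∈ SL₂(F)^m` with `γ_i = (a_i, b_i; c_i, d_i)` and `f` multiaffine,
`γ · f = ∏_i (c_i x_i + d_i) · f((a_1 x_1 + b_1)/(c_1 x_1 + d_1), …)`: the monomial
`x^{[m] \ S}` becomes `∏_{i ∉ S} (a_i x_i + b_i) ∏_{i ∈ S} (c_i x_i + d_i)`. -/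
def slAct {m : ℕ} (γ : Fin m → Matrix.SpecialLinearGroup (Fin 2) F)
    (f : MvPolynomial (Fin m) F) : MvPolynomial (Fin m) F :=
  ∑ S : Finset (Fin m), MvPolynomial.C (coeffVec f S) *
    ((∏ i ∈ Sᶜ, (MvPolynomial.C ((γ i).1 0 0) * MvPolynomial.X i +
        MvPolynomial.C ((γ i).1 0 1))) *
      ∏ i ∈ S, (MvPolynomial.C ((γ i).1 1 0) * MvPolynomial.X i +
        MvPolynomial.C ((γ i).1 1 1)))

variable (F) in
/-- The group `SL₂(F)^m ⋊ S_m`, with `S_m` permuting the factors. -/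
abbrev Grp (m : ℕ) : Type _ :=
  (Fin m → Matrix.SpecialLinearGroup (Fin 2) F) ⋊[mulAutArrow] Equiv.Perm (Fin m)

/-- The transformation of multiaffine polynomials by an element `(γ, π)`: first
`π · f = f(x_{π(1)}, …, x_{π(m)})`, then `γ`. -/
def actPoly {m : ℕ} (g : Grp F m) (f : MvPolynomial (Fin m) F) : MvPolynomial (Fin m) F :=
  slAct g.left (MvPolynomial.rename g.right f)

/-- The transformation of vectors, defined by `f_{g · a} = g · f_a`. -/
def actVec {m : ℕ} (g : Grp F m) (a : Finset (Fin m) → F) : Finset (Fin m) → F :=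
  coeffVec (actPoly g (polyOf a))

/-- Cayley's `2 × 2 × 2` hyperdeterminant in the coordinates `a_S`, `S ⊆ {1, 2, 3} ⊆ [m]`. -/
def hypDet {m : ℕ} (hm : 3 ≤ m) (a : Finset (Fin m) → F) : F :=
  let i : Fin m := ⟨0, by omega⟩
  let j : Fin m := ⟨1, by omega⟩
  let k : Fin m := ⟨2, by omega⟩
  a ∅ ^ 2 * a {i, j, k} ^ 2 + a {i} ^ 2 * a {j, k} ^ 2
    + a {j} ^ 2 * a {i, k} ^ 2 + a {k} ^ 2 * a {i, j} ^ 2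
    - 2 * a ∅ * a {i} * a {j, k} * a {i, j, k}
    - 2 * a ∅ * a {j} * a {i, k} * a {i, j, k}
    - 2 * a ∅ * a {k} * a {i, j} * a {i, j, k}
    - 2 * a {i} * a {j} * a {i, k} * a {j, k}
    - 2 * a {i} * a {k} * a {i, j} * a {j, k}
    - 2 * a {j} * a {k} * a {i, j} * a {i, k}
    + 4 * a ∅ * a {j, k} * a {i, k} * a {i, j}
    + 4 * a {i, j, k} * a {i} * a {j} * a {k}

/-! ### The vector associated with a point of projective space -/

theorem card_insert_eq {n d : ℕ} {S : Finset (Fin n)} {i : Fin n} (hi : i ∉ S)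
    (hS : S.card + 1 = d) : (insert i S).card = d := by
  rw [Finset.card_insert_of_notMem hi, hS]

theorem last_notMem {m : ℕ} (S : Finset (Fin m)) :
    Fin.last m ∉ S.map Fin.castSuccEmb := by
  intro h
  obtain ⟨x, -, hx⟩ := Finset.mem_map.1 h
  exact (Fin.castSucc_lt_last x).ne hx

/-- With `n = m + 1`, the vector `a` indexed by the subsets `S` of `[n-1]`: `a_S = q_S` if
`|S| = d`, `a_S = q_{S ∪ n}` if `|S| = d - 1`, and `a_S = 0` otherwise. -/
def assocVec {d m : ℕ} (q : Subsets d (m + 1) → F) : Finset (Fin m) → F := fun S =>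
  if h : S.card = d then q ⟨S.map Fin.castSuccEmb, by rw [Finset.card_map, h]⟩
  else if h' : S.card + 1 = d then
    q ⟨insert (Fin.last m) (S.map Fin.castSuccEmb),
      card_insert_eq (last_notMem S) (by rw [Finset.card_map, h'])⟩
  else 0

end HypDetGr

end

set_option linter.unusedSectionVars false
namespace HypDetGr

/-! ### Determinants of rank-one and rank-two updates. -/

section MatrixUpdates

variable {R : Type*} [CommRing R] {ι : Type*} [Fintype ι] [DecidableEq ι]

open Matrix

/-! Determinantal representations. Encode `q` as the multiaffine form Φ = ∑ q_S x^S. By Cauchy–Binet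
(`det_gram_eq_multiaffine`), `q` lies in the squared Grassmannian iff Φ = c · det(V X Vᵀ) for a
constant c, with X the diagonal matrix of the variables (`mk_mem_grassmannianSq_iff`). Such forms
are recognised by the Rayleigh differences R_ij = ∂_iΦ ∂_jΦ − Φ ∂_i∂_jΦ. Rank-one updates show that
R_ij is the square of v_iᵀ adj(V X Vᵀ) v_j when c = 1 (`rayleigh_of_eq_det`). Conversely, if all
R_ij with i ≠ j are squares, V can be built one index at a time (`exists_gram`); the new column is
found by choosing the signs of the roots of R_im compatibly, one prime factor of Φ|_{x_m=0} at a
time (`exists_signed_roots`, `exists_multiaffine_eq_of_extension`).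

Hyperdeterminants. R_ij is quadratic in x_k, and its discriminant is the hyperdeterminant in the
directions i, j, k with the remaining coordinates at the weights (x_l, 1) (`rayleigh_eq_quadratic`).
So squares make hyperdeterminants vanish. Conversely, if the discriminants vanish for all k ≠ n,
then outside characteristic two R_ij = u(x_n) s²; as R_ij is homogeneous of even degree, u can be
replaced by a constant, and (i) makes that constant a square. In characteristic two the vanishing
removes the odd exponents instead (`isSquare_rayleigh_of_hdAt`). The vector `assocVec q` is the
tensor of `q` with the last coordinate put at (1,1); hence membership is equivalent to (i) together
with the identical vanishing `Good` of the hyperdeterminants of `assocVec q`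
(`mk_mem_grassmannianSq_iff_good`).

From orbits to identities. Condition (ii) says only that the hyperdeterminants vanish at weights in
F (`PG`, `forall_hypDet_iff`). In each weight a hyperdeterminant is a binary quartic, and in
characteristic two the square of a binary quadratic form, so `PG` implies `Good` unless F has three
elements (`PG.good_of_exists_ne`, `PG.good_of_two_eq_zero`). Over the field with three elements s³t
− st³ vanishes at every rational point, and another argument is needed.

Three elements. With one free weight the hyperdeterminants still vanish (`PG.hdAt_update_eq_zero`);
with two free weights they are a constant times a product of two such quartics
(`PG.exists_eq_quartic`), and the situation is called bad if the constant is nonzero. If nothing is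
bad, everything vanishes (`PG.good_of_forall_not_bad`). In suitable coordinates, badness of five
indices means that first derivatives vanish and no mixed second derivative does
(`PG.bad_iff_of_null`). By induction on the support all slices are good, so every coordinate has two
values at which nothing is bad; two indices outside a bad set then lead to seven indices with the
same derivative pattern or to another forbidden configuration (`PG.not_badSet_of_tame`). With at
most one index outside, the two consecutive degrees in `assocVec q` exclude badness
(`PG.bad_iff_of_hom`, `PG.not_bad_of_hom`), except for five indices in degrees two and three, where
(i) is used again (`PG.not_badSet_vtx_of_card`). -/

theorem det_add_vecMulVec_of_isUnit (S : Matrix ι ι R) (hS : IsUnit S.det) (u v : ι → R) :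
    (S + vecMulVec u v).det = S.det + v ⬝ᵥ (S.adjugate *ᵥ u) := by
  have h := Matrix.det_add_replicateCol_mul_replicateRow (ι := Unit) hS u v
  rw [← vecMulVec_eq] at h
  rw [h, Matrix.det_eq_elem_of_subsingleton _ ()]
  have hdet : S.det * (S⁻¹ : Matrix ι ι R).det = 1 := by
    rw [← Matrix.det_mul, Matrix.mul_nonsing_inv _ hS, Matrix.det_one]
  have e : (replicateRow Unit v * S⁻¹ * replicateCol Unit u) () () = v ⬝ᵥ (S⁻¹ *ᵥ u) := by
    rw [Matrix.mul_assoc]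
    rfl
  rw [Matrix.add_apply, e, Matrix.one_apply_eq, Matrix.inv_def, Matrix.smul_mulVec, dotProduct_smul,
    smul_eq_mul, mul_add, mul_one, ← mul_assoc, Ring.mul_inverse_cancel _ hS, one_mul]

/-- Both sides are polynomial in the entries, so over a domain a nonzero determinant suffices: the
invertible case applies in the fraction field. -/
theorem det_add_vecMulVec {R : Type*} [CommRing R] [IsDomain R]
    (S : Matrix ι ι R) (hS : S.det ≠ 0) (u v : ι → R) :
    (S + vecMulVec u v).det = S.det + v ⬝ᵥ (S.adjugate *ᵥ u) := by
  let φ := algebraMap R (FractionRing R)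
  have hφ : Function.Injective φ := IsFractionRing.injective R (FractionRing R)
  apply hφ
  have h := det_add_vecMulVec_of_isUnit (S.map φ)
    (by rw [← RingHom.mapMatrix_apply, ← RingHom.map_det, isUnit_iff_ne_zero]
        exact (map_ne_zero_iff φ hφ).2 hS) (φ ∘ u) (φ ∘ v)
  have e1 : (S.map φ + vecMulVec (φ ∘ u) (φ ∘ v)) = (S + vecMulVec u v).map φ := by
    ext i j; simp [vecMulVec_apply]
  rw [e1, ← RingHom.mapMatrix_apply, ← RingHom.map_det, ← RingHom.mapMatrix_apply,
    ← RingHom.map_det, ← RingHom.map_adjugate] at h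
  rw [h, map_add, RingHom.map_dotProduct]
  congr 2
  funext i
  rw [Function.comp_apply, RingHom.map_mulVec]
  rfl

/-- The update has the form UV with U of width two, so det(1 + V S⁻¹ U) is a 2 × 2 determinant; the
extra factor det S clears the denominators. -/
theorem det_add_two_vecMulVec_of_isUnit (S : Matrix ι ι R) (hS : IsUnit S.det)
    (u u' v v' : ι → R) :
    S.det * (S + vecMulVec u u' + vecMulVec v v').det =
      (S.det + u' ⬝ᵥ (S.adjugate *ᵥ u)) * (S.det + v' ⬝ᵥ (S.adjugate *ᵥ v)) -
        (u' ⬝ᵥ (S.adjugate *ᵥ v)) * (v' ⬝ᵥ (S.adjugate *ᵥ u)) := by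
  let U : Matrix ι (Fin 2) R := Matrix.of fun i k => ![u i, v i] k
  let V : Matrix (Fin 2) ι R := Matrix.of ![u', v']
  have hUV : S + vecMulVec u u' + vecMulVec v v' = S + U * V := by
    ext i j
    simp [U, V, Matrix.mul_apply, Fin.sum_univ_two, vecMulVec_apply, add_assoc]
  have hinv : S⁻¹ = Ring.inverse S.det • S.adjugate := Matrix.inv_def S
  have hc : S.det * Ring.inverse S.det = 1 := Ring.mul_inverse_cancel _ hS
  rw [hUV, Matrix.det_add_mul U V hS, Matrix.det_fin_two]
  have e (a b : Fin 2) : (V * S⁻¹ * U) a b =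
      Ring.inverse S.det * ((V a) ⬝ᵥ (S.adjugate *ᵥ (fun i => U i b))) := by
    rw [Matrix.mul_assoc, hinv, Matrix.smul_mul, Matrix.mul_smul, Matrix.smul_apply, smul_eq_mul]
    rfl
  simp only [Matrix.add_apply, e]
  have hV0 : V 0 = u' := rfl
  have hV1 : V 1 = v' := rfl
  have hU0 : (fun i => U i 0) = u := rfl
  have hU1 : (fun i => U i 1) = v := rfl
  rw [hV0, hV1, hU0, hU1]
  simp only [Matrix.one_apply_eq, ne_eq, zero_ne_one, not_false_eq_true, Matrix.one_apply_ne,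
    one_ne_zero, zero_add]
  linear_combination (S.det * (u' ⬝ᵥ (S.adjugate *ᵥ u) + v' ⬝ᵥ (S.adjugate *ᵥ v)) +
    (u' ⬝ᵥ (S.adjugate *ᵥ u) * v' ⬝ᵥ (S.adjugate *ᵥ v) -
      u' ⬝ᵥ (S.adjugate *ᵥ v) * v' ⬝ᵥ (S.adjugate *ᵥ u)) *
        (S.det * Ring.inverse S.det + 1)) * hc

theorem det_add_two_vecMulVec {R : Type*} [CommRing R] [IsDomain R]
    (S : Matrix ι ι R) (hS : S.det ≠ 0) (u u' v v' : ι → R) :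
    S.det * (S + vecMulVec u u' + vecMulVec v v').det =
      (S.det + u' ⬝ᵥ (S.adjugate *ᵥ u)) * (S.det + v' ⬝ᵥ (S.adjugate *ᵥ v)) -
        (u' ⬝ᵥ (S.adjugate *ᵥ v)) * (v' ⬝ᵥ (S.adjugate *ᵥ u)) := by
  let φ := algebraMap R (FractionRing R)
  have hφ : Function.Injective φ := IsFractionRing.injective R (FractionRing R)
  apply hφ
  have h := det_add_two_vecMulVec_of_isUnit (S.map φ)
    (by rw [← RingHom.mapMatrix_apply, ← RingHom.map_det, isUnit_iff_ne_zero]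
        exact (map_ne_zero_iff φ hφ).2 hS) (φ ∘ u) (φ ∘ u') (φ ∘ v) (φ ∘ v')
  have e1 : S.map φ + vecMulVec (φ ∘ u) (φ ∘ u') + vecMulVec (φ ∘ v) (φ ∘ v') =
      (S + vecMulVec u u' + vecMulVec v v').map φ := by
    ext i j; simp [vecMulVec_apply]
  have e2 (a b : ι → R) : (φ ∘ a) ⬝ᵥ (φ.mapMatrix S.adjugate *ᵥ (φ ∘ b)) =
      φ (a ⬝ᵥ (S.adjugate *ᵥ b)) := by
    rw [RingHom.map_dotProduct]
    congr 1
    funext i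
    rw [Function.comp_apply, RingHom.map_mulVec]
    rfl
  rw [e1, ← RingHom.mapMatrix_apply, ← RingHom.map_det, ← RingHom.mapMatrix_apply,
    ← RingHom.map_det, ← RingHom.map_adjugate, e2, e2, e2, e2] at h
  simpa only [map_mul, map_sub, map_add] using h

end MatrixUpdates

/-! ### Multiaffine polynomials, shifts and Rayleigh differences. -/

section Tensors

open MvPolynomial

variable {σ : Type*} [DecidableEq σ] [Fintype σ] {R : Type*} [CommRing R]

/-- The multiaffine polynomial with coefficients `q`. -/
noncomputable def multiaffine (q : Finset σ → R) : MvPolynomial σ R :=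
  ∑ T : Finset σ, C (q T) * ∏ i ∈ T, X i

/-- Coefficients of the part free of `x_i`. -/
def del (i : σ) (q : Finset σ → R) : Finset σ → R := fun T => if i ∈ T then 0 else q T

/-- Coefficients of the partial derivative in `x_i`. -/
def con (i : σ) (q : Finset σ → R) : Finset σ → R := fun T => if i ∈ T then 0 else q (insert i T)

theorem multiaffine_eq_add (i : σ) (q : Finset σ → R) :
    multiaffine q = multiaffine (del i q) + X i * multiaffine (con i q) := by
  have h (f : Finset σ → MvPolynomial σ R) :
      ∑ T : Finset σ, f T = ∑ T : Finset σ, (if i ∈ T then 0 else f T + f (insert i T)) := by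
    have h1 : ∑ T : Finset σ, (if i ∈ T then 0 else f (insert i T)) =
        ∑ T : Finset σ, (if i ∈ T then f T else 0) := by
      rw [← Finset.sum_filter_add_sum_filter_not Finset.univ (fun T => i ∈ T),
        ← Finset.sum_filter_add_sum_filter_not (Finset.univ : Finset (Finset σ)) (fun T => i ∈ T)
          (fun T => if i ∈ T then f T else 0)]
      rw [Finset.sum_eq_zero (s := {x | i ∈ x}) (by intro T hT; simp at hT; simp [hT]), zero_add]
      rw [Finset.sum_eq_zero (s := {x | i ∉ x}) (f := fun T => if i ∈ T then f T else 0)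
        (by intro T hT; simp at hT; simp [hT]), add_zero]
      refine Finset.sum_nbij' (fun T => insert i T) (fun T => T.erase i) ?_ ?_ ?_ ?_ ?_
      · intro T; simp
      · intro T; simp
      · intro T hT; simp at hT; simp [hT]
      · intro T hT; simp at hT; simp [Finset.insert_erase hT]
      · intro T hT; simp at hT; simp [hT]
    have h2 : ∑ T : Finset σ, (if i ∈ T then 0 else f T + f (insert i T)) =
        ∑ T : Finset σ, (if i ∈ T then 0 else f T) +
          ∑ T : Finset σ, (if i ∈ T then 0 else f (insert i T)) := by
      rw [← Finset.sum_add_distrib]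
      refine Finset.sum_congr rfl fun T _ => ?_
      split_ifs <;> simp
    rw [h2, h1, ← Finset.sum_add_distrib]
    refine Finset.sum_congr rfl fun T _ => ?_
    split_ifs <;> simp
  unfold multiaffine
  rw [h, Finset.mul_sum, ← Finset.sum_add_distrib]
  refine Finset.sum_congr rfl fun T _ => ?_
  by_cases hT : i ∈ T
  · simp [del, con, hT]
  · simp [del, con, hT, Finset.prod_insert hT]; ring

theorem multiaffine_eq_sum_monomial (q : Finset σ → R) :
    multiaffine q = ∑ T : Finset σ, monomial (∑ i ∈ T, Finsupp.single i 1) (q T) := by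
  refine Finset.sum_congr rfl fun T _ => ?_
  rw [← mul_one (q T), ← C_mul_monomial, monomial_sum_one, mul_one]
  rfl

theorem sum_single_apply (T : Finset σ) (i : σ) :
    (∑ j ∈ T, Finsupp.single j 1 : σ →₀ ℕ) i = if i ∈ T then 1 else 0 := by
  simp [Finsupp.finsetSum_apply, Finsupp.single_apply]

theorem sum_single_injective :
    Function.Injective fun T : Finset σ => (∑ i ∈ T, Finsupp.single i 1 : σ →₀ ℕ) := by
  intro T U h
  ext i
  have := DFunLike.congr_fun h i
  simp only [sum_single_apply] at this
  by_cases h1 : i ∈ T <;> by_cases h2 : i ∈ U <;> simp_all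

theorem coeff_multiaffine (q : Finset σ → R) (T : Finset σ) :
    (multiaffine q).coeff (∑ i ∈ T, Finsupp.single i 1) = q T := by
  rw [multiaffine_eq_sum_monomial, coeff_sum, Finset.sum_eq_single T]
  · simp
  · intro U _ hU
    rw [coeff_monomial, if_neg fun h => hU (sum_single_injective h)]
  · simp

theorem multiaffine_injective :
    Function.Injective (multiaffine : (Finset σ → R) → MvPolynomial σ R) := by
  intro q r h
  funext T
  rw [← coeff_multiaffine q T, h, coeff_multiaffine]

@[simp] theorem multiaffine_zero : multiaffine (0 : Finset σ → R) = 0 := by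
  simp [multiaffine]

theorem multiaffine_eq_zero {q : Finset σ → R} : multiaffine q = 0 ↔ q = 0 := by
  rw [← multiaffine_zero (σ := σ) (R := R)]
  exact multiaffine_injective.eq_iff

theorem degreeOf_multiaffine_le (i : σ) (q : Finset σ → R) : degreeOf i (multiaffine q) ≤ 1 := by
  rw [multiaffine_eq_sum_monomial]
  refine (degreeOf_sum_le _ _ _).trans (Finset.sup_le fun T _ => ?_)
  refine degreeOf_le_iff.2 fun e he => ?_
  have := support_monomial_subset he
  rw [Finset.mem_singleton] at this
  rw [this, sum_single_apply]
  split_ifs <;> simp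

theorem degreeOf_multiaffine_eq_zero {i : σ} {q : Finset σ → R} (h : ∀ T, i ∈ T → q T = 0) :
    degreeOf i (multiaffine q) = 0 := by
  rw [multiaffine_eq_sum_monomial, ← Nat.le_zero]
  refine (degreeOf_sum_le _ _ _).trans (Finset.sup_le fun T _ => ?_)
  refine degreeOf_le_iff.2 fun e he => ?_
  by_cases hT : i ∈ T
  · simp [h T hT] at he
  · have := support_monomial_subset he
    rw [Finset.mem_singleton] at this
    rw [this, sum_single_apply, if_neg hT]

theorem degreeOf_multiaffine_del (i : σ) (q : Finset σ → R) :
    degreeOf i (multiaffine (del i q)) = 0 :=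
  degreeOf_multiaffine_eq_zero fun T hT => by simp [del, hT]

theorem degreeOf_multiaffine_con (i : σ) (q : Finset σ → R) :
    degreeOf i (multiaffine (con i q)) = 0 :=
  degreeOf_multiaffine_eq_zero fun T hT => by simp [con, hT]

/-- `q` is supported on the subsets of cardinality `d`. -/
def IsHomTensor (d : ℕ) (q : Finset σ → R) : Prop := ∀ T, q T ≠ 0 → T.card = d

theorem IsHomTensor.isHomogeneous {d : ℕ} {q : Finset σ → R} (h : IsHomTensor d q) :
    (multiaffine q).IsHomogeneous d := by
  rw [multiaffine_eq_sum_monomial]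
  refine IsHomogeneous.sum _ _ _ fun T _ => ?_
  by_cases hT : q T = 0
  · rw [hT, monomial_zero]; exact isHomogeneous_zero _ _ _
  · refine isHomogeneous_monomial _ ?_
    rw [← h T hT]
    simp [map_sum]

theorem IsHomTensor.del {d : ℕ} {q : Finset σ → R} (h : IsHomTensor d q) (i : σ) :
    IsHomTensor d (del i q) := by
  intro T hT
  apply h
  intro h0
  apply hT
  simp [HypDetGr.del, h0]

theorem IsHomTensor.con {d : ℕ} {q : Finset σ → R} (h : IsHomTensor (d + 1) q) (i : σ) :
    IsHomTensor d (con i q) := by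
  intro T hT
  by_cases hi : i ∈ T
  · simp [HypDetGr.con, hi] at hT
  · have := h (insert i T) (by simpa [HypDetGr.con, hi] using hT)
    rw [Finset.card_insert_of_notMem hi] at this
    omega

theorem IsHomTensor.con_zero {q : Finset σ → R} (h : IsHomTensor 0 q) (i : σ) :
    HypDetGr.con i q = 0 := by
  funext T
  by_contra hT
  by_cases hi : i ∈ T
  · simp [HypDetGr.con, hi] at hT
  · have := h (insert i T) (by simpa [HypDetGr.con, hi] using hT)
    simp at this

theorem IsHomTensor.totalDegree_le {d : ℕ} {q : Finset σ → R} (h : IsHomTensor d q) :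
    (multiaffine q).totalDegree ≤ d := h.isHomogeneous.totalDegree_le

theorem con_con (i j : σ) (q : Finset σ → R) (h : i ≠ j) : con i (con j q) = con j (con i q) := by
  funext T
  simp only [con, Finset.mem_insert, h, h.symm, false_or, Finset.insert_comm i j T]
  split_ifs <;> rfl

theorem con_del (i j : σ) (q : Finset σ → R) (h : i ≠ j) : con i (del j q) = del j (con i q) := by
  funext T
  simp only [con, del, Finset.mem_insert, h.symm, false_or]
  split_ifs <;> rfl

theorem del_del (i j : σ) (q : Finset σ → R) : del i (del j q) = del j (del i q) := by
  funext T
  simp only [del]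
  split_ifs <;> rfl

/-- The substitution `x_i ↦ x_i + 1`. -/
noncomputable def shift (i : σ) : MvPolynomial σ R →ₐ[R] MvPolynomial σ R :=
  aeval fun j => X j + if j = i then 1 else 0

theorem shift_eq_self {i : σ} {p : MvPolynomial σ R} (h : degreeOf i p = 0) : shift i p = p := by
  have hv : i ∉ p.vars := fun hi => mem_vars_iff_degreeOf_ne_zero.1 hi h
  have h2 : (shift i : MvPolynomial σ R →ₐ[R] MvPolynomial σ R) p =
      aeval (X : σ → MvPolynomial σ R) p := by
    refine eval₂Hom_congr' rfl (fun j hj _ => ?_) rfl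
    have : j ≠ i := fun h => hv (h ▸ hj)
    simp [this]
  rw [h2, aeval_X_left_apply]

/-- For a polynomial of degree at most one in x_i, the derivative is a finite difference. On a
determinant V X Vᵀ this difference is a rank-one update. -/
theorem shift_multiaffine (i : σ) (q : Finset σ → R) :
    shift i (multiaffine q) = multiaffine q + multiaffine (con i q) := by
  conv_lhs => rw [multiaffine_eq_add i q]
  rw [map_add, map_mul, shift_eq_self (degreeOf_multiaffine_del i q),
    shift_eq_self (degreeOf_multiaffine_con i q)]
  conv_rhs => rw [multiaffine_eq_add i q]
  simp [shift]
  ring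

/-- The substitution `x_i ↦ 0`. -/
noncomputable def zeroAt (i : σ) : MvPolynomial σ R →ₐ[R] MvPolynomial σ R :=
  aeval fun j => if j = i then 0 else X j

theorem zeroAt_eq_self {i : σ} {p : MvPolynomial σ R} (h : degreeOf i p = 0) :
    zeroAt i p = p := by
  have hv : i ∉ p.vars := fun hi => mem_vars_iff_degreeOf_ne_zero.1 hi h
  have h2 : (zeroAt i : MvPolynomial σ R →ₐ[R] MvPolynomial σ R) p =
      aeval (X : σ → MvPolynomial σ R) p := by
    refine eval₂Hom_congr' rfl (fun j hj _ => ?_) rfl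
    have : j ≠ i := fun h => hv (h ▸ hj)
    simp [this]
  rw [h2, aeval_X_left_apply]

theorem zeroAt_multiaffine (i : σ) (q : Finset σ → R) :
    zeroAt i (multiaffine q) = multiaffine (del i q) := by
  conv_lhs => rw [multiaffine_eq_add i q]
  rw [map_add, map_mul, zeroAt_eq_self (degreeOf_multiaffine_del i q)]
  simp [zeroAt]

theorem multiaffine_smul (c : R) (q : Finset σ → R) :
    multiaffine (fun T => c * q T) = C c * multiaffine q := by
  simp [multiaffine, Finset.mul_sum, mul_assoc]

/-- The Rayleigh difference `∂_i F ∂_j F - F ∂_i ∂_j F`. -/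
noncomputable def rayleigh (q : Finset σ → R) (i j : σ) : MvPolynomial σ R :=
  multiaffine (con i q) * multiaffine (con j q) - multiaffine q * multiaffine (con i (con j q))

/-- Expressed through shifts alone, the Rayleigh difference becomes computable from updated
determinants. -/
theorem rayleigh_eq_shift (q : Finset σ → R) {i j : σ} :
    rayleigh q i j = (shift i (multiaffine q) - multiaffine q) *
      (shift j (multiaffine q) - multiaffine q) - multiaffine q *
      (shift i (shift j (multiaffine q)) - shift i (multiaffine q) - shift j (multiaffine q) +
        multiaffine q) := by
  simp only [shift_multiaffine, map_add, rayleigh]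
  ring

theorem zeroAt_rayleigh (q : Finset σ → R) {i j k : σ} (hi : i ≠ k) (hj : j ≠ k) :
    zeroAt k (rayleigh q i j) = rayleigh (del k q) i j := by
  simp only [rayleigh, map_sub, map_mul, zeroAt_multiaffine, con_del _ _ _ hi, con_del _ _ _ hj]

end Tensors

/-! ### Rayleigh differences of det(V X Vᵀ). -/

section Gram

open MvPolynomial Matrix

variable {σ : Type*} [DecidableEq σ] [Fintype σ] {K : Type*} [Field K] {d : ℕ}

/-- The matrix `V X Vᵀ` with `X` the diagonal matrix of the variables. -/
noncomputable def gram (V : Matrix (Fin d) σ K) : Matrix (Fin d) (Fin d) (MvPolynomial σ K) :=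
  Matrix.of fun r s => ∑ i, C (V r i) * X i * C (V s i)

/-- The columns of `V` as vectors of constant polynomials. -/
noncomputable def pcol (V : Matrix (Fin d) σ K) (i : σ) : Fin d → MvPolynomial σ K :=
  fun r => C (V r i)

/-- The entries `v_iᵀ adj(V X Vᵀ) v_j`. -/
noncomputable def adjEntry (V : Matrix (Fin d) σ K) (i j : σ) : MvPolynomial σ K :=
  pcol V i ⬝ᵥ ((gram V).adjugate *ᵥ pcol V j)

theorem gram_apply (V : Matrix (Fin d) σ K) (r s : Fin d) :
    gram V r s = ∑ i, C (V r i) * X i * C (V s i) := rfl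

theorem gram_transpose (V : Matrix (Fin d) σ K) : (gram V)ᵀ = gram V := by
  ext r s
  rw [transpose_apply, gram_apply, gram_apply]
  exact congrArg _ (Finset.sum_congr rfl fun i _ => by ring)

theorem adjEntry_comm (V : Matrix (Fin d) σ K) (i j : σ) : adjEntry V i j = adjEntry V j i := by
  unfold adjEntry
  rw [dotProduct_mulVec, dotProduct_comm, ← mulVec_transpose, adjugate_transpose, gram_transpose]

theorem shift_gram (V : Matrix (Fin d) σ K) (i : σ) :
    (shift i : MvPolynomial σ K →ₐ[K] _).toRingHom.mapMatrix (gram V) =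
      gram V + vecMulVec (pcol V i) (pcol V i) := by
  ext1 r s
  simp only [RingHom.mapMatrix_apply, Matrix.map_apply, Matrix.add_apply, gram_apply,
    vecMulVec_apply, pcol, AlgHom.toRingHom_eq_coe, RingHom.coe_coe, map_sum, map_mul]
  have h (j : σ) : (shift i : MvPolynomial σ K →ₐ[K] _) (X j) = X j + if j = i then 1 else 0 := by
    simp [shift]
  have hC (a : K) : (shift i : MvPolynomial σ K →ₐ[K] _) (C a) = C a := by
    simp [shift]
  simp only [h, hC, mul_add, add_mul, Finset.sum_add_distrib]
  congr 1
  simp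

theorem shift_det_gram (V : Matrix (Fin d) σ K) (i : σ) :
    shift i (gram V).det = (gram V + vecMulVec (pcol V i) (pcol V i)).det := by
  rw [← shift_gram, ← RingHom.map_det]
  rfl

theorem shift_shift_det_gram (V : Matrix (Fin d) σ K) (i j : σ) :
    shift i (shift j (gram V).det) =
      (gram V + vecMulVec (pcol V i) (pcol V i) + vecMulVec (pcol V j) (pcol V j)).det := by
  rw [shift_det_gram, ← shift_gram V i]
  have h2 : vecMulVec (pcol V j) (pcol V j) =
      (shift i : MvPolynomial σ K →ₐ[K] _).toRingHom.mapMatrix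
        (vecMulVec (pcol V j) (pcol V j)) := by
    ext1 r s
    simp [vecMulVec_apply, pcol, shift]
  conv_rhs => rw [h2]
  rw [← map_add, ← RingHom.map_det]
  rfl

theorem multiaffine_con_of_eq_det {q : Finset σ → K} {V : Matrix (Fin d) σ K}
    (h : multiaffine q = (gram V).det) (h0 : q ≠ 0) (i : σ) :
    multiaffine (con i q) = adjEntry V i i := by
  have hd : (gram V).det ≠ 0 := by rw [← h]; exact fun h => h0 (multiaffine_eq_zero.1 h)
  have := shift_multiaffine i q
  rw [h, shift_det_gram, det_add_vecMulVec _ hd] at this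
  exact (add_left_cancel this).symm

/-- Shifting x_i and x_j adds v_i v_iᵀ and v_j v_jᵀ to the matrix. The two-update formula leaves
only the product of the two off-diagonal entries, and these agree because the matrix is symmetric.
-/
theorem rayleigh_of_eq_det {q : Finset σ → K} {V : Matrix (Fin d) σ K}
    (h : multiaffine q = (gram V).det) (h0 : q ≠ 0) (i j : σ) :
    rayleigh q i j = adjEntry V i j ^ 2 := by
  have hd : (gram V).det ≠ 0 := by rw [← h]; exact fun h => h0 (multiaffine_eq_zero.1 h)
  rw [rayleigh_eq_shift, h, shift_shift_det_gram, shift_det_gram, shift_det_gram]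
  have h1 := det_add_two_vecMulVec _ hd (pcol V i) (pcol V i) (pcol V j) (pcol V j)
  rw [det_add_vecMulVec _ hd, det_add_vecMulVec _ hd]
  change _ = (_ + adjEntry V i i) * (_ + adjEntry V j j) - adjEntry V i j * adjEntry V j i at h1
  rw [adjEntry_comm V j i] at h1
  change (_ + adjEntry V i i - _) * (_ + adjEntry V j j - _) - _ *
    (_ - (_ + adjEntry V i i) - (_ + adjEntry V j j) + _) = _
  linear_combination -h1

end Gram

/-! ### Prime factors of multiaffine polynomials. -/

section Sqfree

theorem dvd_of_squarefree_of_forall_prime {R : Type*} [CommRing R] [IsDomain R]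
    [UniqueFactorizationMonoid R] {a x : R} (ha : Squarefree a)
    (h : ∀ p, Prime p → p ∣ a → p ∣ x) : a ∣ x := by
  induction a using UniqueFactorizationMonoid.induction_on_prime with
  | h₁ => exact absurd ha not_squarefree_zero
  | h₂ x hx => exact hx.dvd
  | h₃ b p hb hp ih =>
    obtain ⟨y, hy⟩ := ih ha.of_mul_right fun r hr hrb => h r hr (hrb.mul_left p)
    have hpx := h p hp (dvd_mul_right p b)
    rw [hy] at hpx ⊢
    rcases hp.dvd_or_dvd hpx with h1 | ⟨z, hz⟩
    · obtain ⟨c, hc⟩ := h1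
      exact absurd (ha p ⟨c, by rw [hc]; ring⟩) hp.not_isUnit
    · exact ⟨z, by rw [hz]; ring⟩

open MvPolynomial

variable {σ : Type*} {K : Type*} [Field K]

theorem exists_degreeOf_pos_of_prime {p : MvPolynomial σ K} (hp : Prime p) :
    ∃ i, degreeOf i p ≠ 0 := by
  by_contra! h
  have hv : p.vars = ∅ := Finset.eq_empty_of_forall_notMem fun i hi =>
    mem_vars_iff_degreeOf_ne_zero.1 hi (h i)
  rw [vars_eq_empty_iff_eq_C] at hv
  have h0 : p.coeff 0 ≠ 0 := fun h0 => hp.ne_zero (by rw [hv, h0, C_0])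
  exact hp.not_isUnit (by rw [hv]; exact (isUnit_iff_ne_zero.2 h0).map C)

/-- A repeated prime factor involves some variable, in which the product would have degree at least
two. -/
theorem squarefree_of_degreeOf_le {f : MvPolynomial σ K} (h0 : f ≠ 0)
    (h : ∀ i, degreeOf i f ≤ 1) : Squarefree f := by
  rw [squarefree_iff_irreducible_sq_not_dvd_of_ne_zero h0]
  rintro p hp ⟨g, hg⟩
  obtain ⟨i, hi⟩ := exists_degreeOf_pos_of_prime hp.prime
  have hp0 := hp.ne_zero
  have hg0 : g ≠ 0 := by rintro rfl; simp at hg; exact h0 hg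
  have := h i
  rw [hg, degreeOf_mul_eq (mul_ne_zero hp0 hp0) hg0, degreeOf_mul_eq hp0 hp0] at this
  omega

theorem not_dvd_of_degreeOf_eq_zero {p f : MvPolynomial σ K} {i : σ} (hp : degreeOf i p ≠ 0)
    (hf : degreeOf i f = 0) (h0 : f ≠ 0) : ¬ p ∣ f := by
  rintro ⟨g, hg⟩
  have hp0 : p ≠ 0 := by rintro rfl; simp at hp
  have hg0 : g ≠ 0 := by rintro rfl; simp at hg; exact h0 hg
  rw [hg, degreeOf_mul_eq hp0 hg0] at hf
  omega

end Sqfree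

/-! ### Adding a column to a determinantal representation. -/

section Extension

open MvPolynomial Matrix

variable {σ : Type*} [DecidableEq σ] [Fintype σ] {K : Type*} [Field K]

/-- Each variable occurs in at most one prime factor of a multiaffine polynomial. This is why a sign
can be fixed for each variable without conflicts between primes. -/
theorem associated_of_degreeOf_le_one {f p p' : MvPolynomial σ K} {i : σ} (hf : f ≠ 0)
    (hi : degreeOf i f ≤ 1) (hp : Prime p) (hp' : Prime p') (hd : p ∣ f) (hd' : p' ∣ f)
    (h : degreeOf i p ≠ 0) (h' : degreeOf i p' ≠ 0) : Associated p p' := by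
  obtain ⟨g, rfl⟩ := hd
  have hg : g ≠ 0 := right_ne_zero_of_mul hf
  rw [degreeOf_mul_eq hp.ne_zero hg] at hi
  rcases hp'.dvd_or_dvd hd' with h1 | h1
  · exact (hp'.associated_of_dvd hp h1).symm
  · exact absurd h1 (not_dvd_of_degreeOf_eq_zero h' (by omega) hg)

theorem vars_eq_of_associated {p p' : MvPolynomial σ K} (hp : p ≠ 0) (h : Associated p p') :
    p.vars = p'.vars := by
  have hp' : p' ≠ 0 := h.ne_zero_iff.1 hp
  ext i
  rw [mem_vars_iff_degreeOf_ne_zero, mem_vars_iff_degreeOf_ne_zero]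
  obtain ⟨a, ha⟩ := h.dvd
  obtain ⟨b, hb⟩ := h.symm.dvd
  have ha0 : a ≠ 0 := by rintro rfl; simp at ha; exact hp' ha
  have hb0 : b ≠ 0 := by rintro rfl; simp at hb; exact hp hb
  have e1 : degreeOf i p' = degreeOf i p + degreeOf i a := by
    conv_lhs => rw [ha]
    exact degreeOf_mul_eq hp ha0
  have e2 : degreeOf i p = degreeOf i p' + degreeOf i b := by
    conv_lhs => rw [hb]
    exact degreeOf_mul_eq hp' hb0
  omega

theorem eq_zero_of_dvd_of_totalDegree_lt {f g : MvPolynomial σ K} (h : f ∣ g)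
    (hd : g.totalDegree < f.totalDegree) : g = 0 := by
  by_contra hg
  obtain ⟨c, rfl⟩ := h
  rw [totalDegree_mul_of_isDomain (left_ne_zero_of_mul hg) (right_ne_zero_of_mul hg)] at hd
  omega

theorem exists_eq_mul_C_of_dvd {f g : MvPolynomial σ K} (h : f ∣ g)
    (hd : g.totalDegree ≤ f.totalDegree) : ∃ c : K, g = f * C c := by
  by_cases hg : g = 0
  · exact ⟨0, by simp [hg]⟩
  obtain ⟨c, rfl⟩ := h
  rw [totalDegree_mul_of_isDomain (left_ne_zero_of_mul hg) (right_ne_zero_of_mul hg)] at hd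
  have hc : c.totalDegree = 0 := by omega
  rw [totalDegree_eq_zero_iff_eq_C] at hc
  exact ⟨c.coeff 0, by rw [← hc]⟩

theorem exists_right_inverse_of_det_gram_ne_zero {d : ℕ} (V : Matrix (Fin d) σ K)
    (h : (gram V).det ≠ 0) : ∃ U : Matrix σ (Fin d) K, V * U = 1 := by
  have hinj : Function.Injective (fun w : Fin d → K => w ᵥ* V) := by
    have : ∀ w : Fin d → K, w ᵥ* V = 0 → w = 0 := by
      intro w hw
      by_contra hw0
      apply h
      rw [← Matrix.exists_vecMul_eq_zero_iff]
      refine ⟨fun r => C (w r), ?_, ?_⟩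
      · intro h0
        apply hw0
        funext r
        have := congrFun h0 r
        simpa using this
      · funext s
        simp only [vecMul, dotProduct, gram_apply, Pi.zero_apply, Finset.mul_sum]
        rw [Finset.sum_comm]
        refine Finset.sum_eq_zero fun i _ => ?_
        have hi := congrFun hw i
        simp only [vecMul, dotProduct, Pi.zero_apply] at hi
        have : ∑ r, C (w r) * (C (V r i) * X i * C (V s i)) =
            C (∑ r, w r * V r i) * (X i * C (V s i) : MvPolynomial σ K) := by
          rw [map_sum, Finset.sum_mul]
          refine Finset.sum_congr rfl fun r _ => ?_
          rw [C_mul]; ring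
        rw [this, hi, C_0, zero_mul]
    intro a b hab
    have := this (a - b) (by rw [sub_vecMul]; exact sub_eq_zero.2 hab)
    exact sub_eq_zero.1 this
  rw [Matrix.vecMul_injective_iff] at hinj
  have hsurj := hinj.rank_matrix
  rw [← Matrix.mulVec_surjective_iff_exists_right_inverse]
  have : LinearMap.range V.mulVecLin = ⊤ := by
    apply Submodule.eq_top_of_finrank_eq
    change V.rank = _
    simp [hsurj]
  exact LinearMap.range_eq_top.1 this

theorem adjEntry_of_col_eq_zero {d : ℕ} {V : Matrix (Fin d) σ K} {i : σ} (h : ∀ r, V r i = 0)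
    (j : σ) : adjEntry V i j = 0 := by
  have : pcol V i = 0 := by
    funext r
    simp [pcol, h r]
  rw [adjEntry, this, zero_dotProduct]

theorem sum_C_mul_adjEntry {d : ℕ} (V : Matrix (Fin d) σ K) (w : σ → MvPolynomial σ K)
    (u : Fin d → MvPolynomial σ K) :
    ∑ i, w i * (pcol V i ⬝ᵥ ((gram V).adjugate *ᵥ u)) =
      ∑ s, (∑ i, w i * C (V s i)) * ((gram V).adjugate *ᵥ u) s := by
  simp only [dotProduct, pcol, Finset.mul_sum, Finset.sum_mul]
  rw [Finset.sum_comm]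
  exact Finset.sum_congr rfl fun s _ => Finset.sum_congr rfl fun i _ => by ring

theorem sum_X_mul_adjEntry {d : ℕ} (V : Matrix (Fin d) σ K) (r : Fin d)
    (u : Fin d → MvPolynomial σ K) :
    ∑ i, C (V r i) * X i * (pcol V i ⬝ᵥ ((gram V).adjugate *ᵥ u)) = (gram V).det * u r := by
  rw [sum_C_mul_adjEntry V (fun i => C (V r i) * X i) u]
  have : (gram V *ᵥ ((gram V).adjugate *ᵥ u)) r = (gram V).det * u r := by
    rw [mulVec_mulVec, mul_adjugate, smul_mulVec, one_mulVec]
    rfl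
  rw [← this]
  rfl

/-- The compatible choice of signs for the square roots of the Rayleigh differences. -/
theorem exists_signed_roots {d : ℕ} {J : Finset σ} {V : Matrix (Fin d) σ K}
    (hV : ∀ i ∉ J, ∀ r, V r i = 0) {f₀ f₁ : Finset σ → K} (h₀ : f₀ ≠ 0)
    (hdet : multiaffine f₀ = (gram V).det) {g : σ → MvPolynomial σ K}
    (hg : ∀ i ∈ J, multiaffine (con i f₀) * multiaffine f₁ -
      multiaffine f₀ * multiaffine (con i f₁) = g i ^ 2) :
    ∃ g' : σ → MvPolynomial σ K, (∀ i ∈ J, g' i = g i ∨ g' i = -g i) ∧ (∀ i ∉ J, g' i = 0) ∧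
      ∀ p, Prime p → p ∣ multiaffine f₀ → ∃ j ∈ J, ¬ p ∣ multiaffine (con j f₀) ∧
        ∀ i, p ∣ g' i * multiaffine (con j f₀) - g' j * adjEntry V i j := by
  classical
  set F := multiaffine f₀ with hF
  have hF0 : F ≠ 0 := fun h => h₀ (multiaffine_eq_zero.1 h)
  have hh (i : σ) : multiaffine (con i f₀) = adjEntry V i i := multiaffine_con_of_eq_det hdet h₀ i
  have hr (i j : σ) : adjEntry V i i * adjEntry V j j - F * multiaffine (con i (con j f₀)) =
      adjEntry V i j ^ 2 := by
    rw [← rayleigh_of_eq_det hdet h₀ i j, rayleigh, hh, hh]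
  simp only [hh] at hg ⊢
  have hJ (j : σ) (hj : degreeOf j F ≠ 0) : j ∈ J := by
    by_contra hjJ
    apply hj
    rw [hF, multiaffine_eq_add j f₀, hh, adjEntry_of_col_eq_zero (hV j hjJ), mul_zero, add_zero]
    exact degreeOf_multiaffine_del j f₀
  have hdeg {p : MvPolynomial σ K} (hpF : p ∣ F) (j : σ) (hj : degreeOf j p ≠ 0) :
      degreeOf j F ≠ 0 := fun h => not_dvd_of_degreeOf_eq_zero hj h hF0 hpF
  -- A reference index that depends only on the variables of a prime, hence is shared by associated
  -- primes; the fallback `i` plays no role, since the primes considered contain a variable.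
  let pick : Finset σ → σ → σ := fun s i => if h : s.Nonempty then h.choose else i
  -- The root `g i` already matches the reference root modulo the prime factor that contains x_i;
  -- otherwise its sign is flipped.
  let cond : σ → Prop := fun i => ∃ p : MvPolynomial σ K, Prime p ∧ p ∣ F ∧ degreeOf i p ≠ 0 ∧
    p ∣ g i * adjEntry V (pick p.vars i) (pick p.vars i) -
      g (pick p.vars i) * adjEntry V i (pick p.vars i)
  let g' : σ → MvPolynomial σ K := fun i => if i ∈ J then (if cond i then g i else -g i) else 0
  refine ⟨g', fun i hi => ?_, fun i hi => by simp [g', hi], fun p hp hpF => ?_⟩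
  · by_cases h : cond i <;> simp [g', hi, h]
  obtain ⟨i₀, hi₀⟩ := exists_degreeOf_pos_of_prime hp
  have hne : p.vars.Nonempty := ⟨i₀, mem_vars_iff_degreeOf_ne_zero.2 hi₀⟩
  let j := hne.choose
  have hpick (i : σ) : pick p.vars i = j := by simp [pick, hne, j]
  have hjp : degreeOf j p ≠ 0 := mem_vars_iff_degreeOf_ne_zero.1 hne.choose_spec
  have hjJ : j ∈ J := hJ j (hdeg hpF j hjp)
  have hcj : cond j := ⟨p, hp, hpF, hjp, by rw [hpick, sub_self]; exact dvd_zero _⟩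
  have hgj : g' j = g j := by simp [g', hjJ, hcj]
  refine ⟨j, hjJ, ?_, fun i => ?_⟩
  · rw [← hh]
    refine not_dvd_of_degreeOf_eq_zero hjp (degreeOf_multiaffine_con j f₀) fun h => ?_
    apply hdeg hpF j hjp
    rw [hF, multiaffine_eq_add j f₀, h, mul_zero, add_zero]
    exact degreeOf_multiaffine_del j f₀
  by_cases hiJ : i ∈ J
  swap
  · rw [adjEntry_of_col_eq_zero (hV i hiJ)]
    simp [g', hiJ]
  -- If x_i does not occur in p, the shift in x_i fixes p, so p divides ∂_i of f₀; then p divides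
  -- both squares, and the congruence is trivial.
  by_cases hip : degreeOf i p = 0
  · have h1 : p ∣ adjEntry V i i := by
      obtain ⟨c, hc⟩ := hpF
      have e := shift_multiaffine i f₀
      rw [← hF, hh, hc, map_mul, shift_eq_self hip] at e
      exact ⟨shift i c - c, by linear_combination -e⟩
    have h2 : p ∣ g i := by
      refine hp.dvd_of_dvd_pow (n := 2) ?_
      rw [← hg i hiJ]
      exact dvd_sub (h1.mul_right _) (hpF.mul_right _)
    have h3 : p ∣ adjEntry V i j := by
      refine hp.dvd_of_dvd_pow (n := 2) ?_
      rw [← hr i j]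
      exact dvd_sub (h1.mul_right _) (hpF.mul_right _)
    have h4 : p ∣ g' i := by
      by_cases h : cond i <;> simp [g', hiJ, h, h2]
    exact dvd_sub (h4.mul_right _) (h3.mul_left _)
  -- The two sign choices multiply to a multiple of f₀, so one of them works modulo the prime p.
  · have hprod : p ∣ (g i * adjEntry V j j - g j * adjEntry V i j) *
        (g i * adjEntry V j j + g j * adjEntry V i j) := by
      have e : (g i * adjEntry V j j - g j * adjEntry V i j) *
          (g i * adjEntry V j j + g j * adjEntry V i j) =
          F * (adjEntry V j j * (multiaffine (con i (con j f₀)) * multiaffine f₁ -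
            adjEntry V j j * multiaffine (con i f₁)) +
            multiaffine (con j f₁) * adjEntry V i j ^ 2) := by
        linear_combination (-(adjEntry V j j ^ 2)) * hg i hiJ + adjEntry V i j ^ 2 * hg j hjJ +
          adjEntry V j j * multiaffine f₁ * hr i j
      rw [e]
      exact hpF.mul_right _
    rw [hgj]
    by_cases hc : cond i
    · have hgi : g' i = g i := by simp [g', hiJ, hc]
      obtain ⟨p', hp', hp'F, hip', h⟩ := hc
      have hass : Associated p' p := associated_of_degreeOf_le_one hF0
        (degreeOf_multiaffine_le i f₀) hp' hp hp'F hpF hip' hip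
      rw [vars_eq_of_associated hp'.ne_zero hass, hpick] at h
      rw [hgi]
      exact hass.symm.dvd.trans h
    · have hgi : g' i = -g i := by simp [g', hiJ, hc]
      rcases hp.dvd_or_dvd hprod with h | h
      · exact absurd ⟨p, hp, hpF, hip, by rw [hpick]; exact h⟩ hc
      · rw [hgi]
        have := h.neg_right
        convert this using 1
        ring

/-- Modulo each prime factor of f₀ the signed roots g are proportional to a column of Vᵀ adj(V X Vᵀ)
V, so linear relations modulo f₀ between the rows of that matrix pass to g. Degree bounds turn the
resulting congruences into equalities g = Vᵀ adj(V X Vᵀ) v with v constant. -/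
theorem exists_multiaffine_eq_of_extension {e : ℕ} {J : Finset σ} {V : Matrix (Fin (e + 1)) σ K}
    (hV : ∀ i ∉ J, ∀ r, V r i = 0) {f₀ f₁ : Finset σ → K} (h₀ : f₀ ≠ 0)
    (hom₀ : IsHomTensor (e + 1) f₀) (hom₁ : IsHomTensor e f₁)
    (hdet : multiaffine f₀ = (gram V).det)
    (hsq : ∀ i ∈ J, IsSquare (multiaffine (con i f₀) * multiaffine f₁ -
      multiaffine f₀ * multiaffine (con i f₁))) :
    ∃ v : Fin (e + 1) → K, multiaffine f₁ =
      (fun r => C (v r)) ⬝ᵥ ((gram V).adjugate *ᵥ (fun r => C (v r))) := by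
  classical
  have hex (i : σ) : ∃ g, i ∈ J → multiaffine (con i f₀) * multiaffine f₁ -
      multiaffine f₀ * multiaffine (con i f₁) = g ^ 2 := by
    by_cases hi : i ∈ J
    · obtain ⟨g, hg⟩ := hsq i hi
      exact ⟨g, fun _ => by rw [hg, sq]⟩
    · exact ⟨0, fun h => absurd h hi⟩
  choose g₀ hg₀ using hex
  obtain ⟨g, hgs, hgJ, key⟩ := exists_signed_roots hV h₀ hdet hg₀
  have hF0 : multiaffine f₀ ≠ 0 := fun h => h₀ (multiaffine_eq_zero.1 h)
  have hsqf : Squarefree (multiaffine f₀) :=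
    squarefree_of_degreeOf_le hF0 fun i => degreeOf_multiaffine_le i f₀
  have hFdeg : (multiaffine f₀).totalDegree = e + 1 := hom₀.isHomogeneous.totalDegree hF0
  have hg2 (i : σ) (hi : i ∈ J) : multiaffine (con i f₀) * multiaffine f₁ -
      multiaffine f₀ * multiaffine (con i f₁) = g i ^ 2 := by
    rw [hg₀ i hi]
    rcases hgs i hi with h | h <;> rw [h] <;> ring
  have hgdeg (i : σ) : (g i).totalDegree ≤ e := by
    by_cases hi : i ∈ J
    swap
    · rw [hgJ i hi]; simp
    have h1 : (g i ^ 2).totalDegree ≤ 2 * e := by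
      rw [← hg2 i hi]
      refine (totalDegree_sub _ _).trans (max_le ?_ ?_)
      · refine (totalDegree_mul _ _).trans ?_
        have := (hom₀.con i).totalDegree_le
        have := hom₁.totalDegree_le
        omega
      · rcases e with _ | e
        · rw [hom₁.con_zero i]; simp
        · refine (totalDegree_mul _ _).trans ?_
          have := (hom₁.con i).totalDegree_le
          omega
    by_cases hz : g i = 0
    · rw [hz]; simp
    rw [sq, totalDegree_mul_of_isDomain hz hz] at h1
    omega
  -- Transfer of relations: f₀ is squarefree, so divisibility may be tested one prime at a time, and
  -- modulo each prime g is proportional to a column.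
  have hA (w : σ → MvPolynomial σ K)
      (hw : ∀ j, multiaffine f₀ ∣ ∑ i, w i * adjEntry V i j) :
      multiaffine f₀ ∣ ∑ i, w i * g i := by
    refine dvd_of_squarefree_of_forall_prime hsqf fun p hp hpF => ?_
    obtain ⟨j, -, hj, h⟩ := key p hp hpF
    refine (hp.dvd_or_dvd (a := multiaffine (con j f₀)) ?_).resolve_left hj
    have e : multiaffine (con j f₀) * ∑ i, w i * g i =
        ∑ i, w i * (g i * multiaffine (con j f₀) - g j * adjEntry V i j) +
          g j * ∑ i, w i * adjEntry V i j := by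
      rw [Finset.mul_sum, Finset.mul_sum, ← Finset.sum_add_distrib]
      exact Finset.sum_congr rfl fun i _ => by ring
    rw [e]
    exact dvd_add (Finset.dvd_sum fun i _ => (h i).mul_left _) ((hpF.trans (hw j)).mul_left _)
  -- The columns satisfy V X (·) ≡ 0 modulo f₀, hence so does g; the degree is at most e + 1, so the
  -- quotient is a constant. These constants form the new column v.
  have hB (r : Fin (e + 1)) : ∃ c : K,
      ∑ i, C (V r i) * X i * g i = multiaffine f₀ * C c := by
    refine exists_eq_mul_C_of_dvd (hA _ fun j => ?_) ?_
    · have := sum_X_mul_adjEntry V r (pcol V j)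
      rw [hdet]
      exact ⟨_, this⟩
    · refine (totalDegree_finsetSum _ _).trans (Finset.sup_le fun i _ => ?_)
      refine (totalDegree_mul _ _).trans ?_
      have h1 := totalDegree_mul (C (V r i)) (X i : MvPolynomial σ K)
      rw [totalDegree_C, totalDegree_X] at h1
      have := hgdeg i
      omega
  choose v hv using hB
  obtain ⟨U, hU⟩ := exists_right_inverse_of_det_gram_ne_zero V (hdet ▸ hF0)
  -- The same transfer for the kernel of V; here the degree is at most e, so the multiple of f₀ is
  -- zero. Thus g lies in the row space of V.
  have hker (k : σ → K) (hk : ∀ r, ∑ i, V r i * k i = 0) : ∑ i, C (k i) * g i = 0 := by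
    refine eq_zero_of_dvd_of_totalDegree_lt (hA _ fun j => ?_) ?_
    · change _ ∣ ∑ i, C (k i) * (pcol V i ⬝ᵥ ((gram V).adjugate *ᵥ pcol V j))
      rw [sum_C_mul_adjEntry V (fun i => C (k i)) (pcol V j)]
      convert dvd_zero _
      refine Finset.sum_eq_zero fun s _ => ?_
      have : ∑ i, C (k i) * C (V s i) = (C (∑ i, V s i * k i) : MvPolynomial σ K) := by
        rw [map_sum]
        exact Finset.sum_congr rfl fun i _ => by rw [C_mul]; ring
      rw [this, hk, C_0, zero_mul]
    · rw [hFdeg]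
      refine Nat.lt_succ_of_le ((totalDegree_finsetSum _ _).trans (Finset.sup_le fun i _ => ?_))
      refine (totalDegree_mul _ _).trans ?_
      rw [totalDegree_C]
      have := hgdeg i
      omega
  let y : Fin (e + 1) → MvPolynomial σ K := fun r => ∑ i, C (U i r) * g i
  have hy (i : σ) : g i = pcol V i ⬝ᵥ y := by
    -- The i-th column of 1 − UV lies in the kernel of V because U is a right inverse.
    have h1 := hker (fun l => (if l = i then 1 else 0) - ∑ s, U l s * V s i) (fun r => by
      simp only [mul_sub, Finset.sum_sub_distrib, mul_ite, mul_one, mul_zero, Finset.sum_ite_eq',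
        Finset.mem_univ, if_true]
      have h2 : ∑ l, V r l * ∑ s, U l s * V s i = (V * U * V) r i := by
        simp only [Matrix.mul_apply, Finset.sum_mul, Finset.mul_sum]
        rw [Finset.sum_comm]
        exact Finset.sum_congr rfl fun s _ => Finset.sum_congr rfl fun l _ => by ring
      rw [h2, hU, Matrix.one_mul, sub_self])
    simp only [map_sub, sub_mul, Finset.sum_sub_distrib] at h1
    have h3 : ∑ l, (C (if l = i then 1 else 0) : MvPolynomial σ K) * g l = g i := by
      rw [Finset.sum_eq_single i] <;> simp +contextual
    rw [h3, sub_eq_zero] at h1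
    rw [h1]
    simp only [dotProduct, y, pcol, map_sum, C_mul, Finset.sum_mul, Finset.mul_sum]
    rw [Finset.sum_comm]
    exact Finset.sum_congr rfl fun s _ => Finset.sum_congr rfl fun l _ => by ring
  let w : Fin (e + 1) → MvPolynomial σ K := fun r => C (v r)
  have hSy : gram V *ᵥ y = (gram V).det • w := by
    funext r
    rw [Pi.smul_apply, smul_eq_mul, ← hdet]
    change _ = _ * C (v r)
    rw [← hv r]
    simp only [mulVec, dotProduct, gram_apply, Finset.sum_mul]
    rw [Finset.sum_comm]
    refine Finset.sum_congr rfl fun i _ => ?_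
    rw [hy i]
    simp only [dotProduct, Finset.mul_sum, pcol]
    exact Finset.sum_congr rfl fun s _ => by ring
  have hyw : y = (gram V).adjugate *ᵥ w := by
    have h1 : (gram V).adjugate *ᵥ (gram V *ᵥ y) = (gram V).adjugate *ᵥ ((gram V).det • w) := by
      rw [hSy]
    rw [mulVec_mulVec, adjugate_mul, smul_mulVec, one_mulVec, mulVec_smul] at h1
    funext r
    have := congrFun h1 r
    simp only [Pi.smul_apply, smul_eq_mul] at this
    exact mul_left_cancel₀ (hdet ▸ hF0) this
  refine ⟨v, ?_⟩
  change _ = w ⬝ᵥ ((gram V).adjugate *ᵥ w)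
  set t := w ⬝ᵥ ((gram V).adjugate *ᵥ w) with ht
  have hdet0 : (gram V).det ≠ 0 := hdet ▸ hF0
  have hgw (i : σ) : pcol V i ⬝ᵥ ((gram V).adjugate *ᵥ w) = g i := by rw [← hyw, ← hy i]
  have hgw' (i : σ) : w ⬝ᵥ ((gram V).adjugate *ᵥ pcol V i) = g i := by
    rw [← hgw i, dotProduct_mulVec, dotProduct_comm, ← mulVec_transpose, adjugate_transpose,
      gram_transpose]
  have hshift (i : σ) : shift i (gram V + vecMulVec w w).det =
      (gram V + vecMulVec (pcol V i) (pcol V i) + vecMulVec w w).det := by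
    have h2 : vecMulVec w w = (shift i : MvPolynomial σ K →ₐ[K] _).toRingHom.mapMatrix
        (vecMulVec w w) := by
      ext1 r s
      simp [vecMulVec_apply, w, shift]
    rw [← shift_gram V i]
    conv_rhs => rw [h2]
    rw [← map_add, ← RingHom.map_det]
    rfl
  -- The candidate t satisfies the same quadratic identities as f₁. Subtracting them shows that f₀
  -- divides ∂_i f₀ · (f₁ − t).
  have ht2 (i : σ) : multiaffine (con i f₀) * t - multiaffine f₀ * (shift i t - t) = g i ^ 2 := by
    have h1 := det_add_two_vecMulVec _ hdet0 (pcol V i) (pcol V i) w w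
    rw [← hshift i, det_add_vecMulVec _ hdet0, hgw, hgw', ← hdet, ← ht, map_add,
      shift_multiaffine] at h1
    have h3 : pcol V i ⬝ᵥ ((gram V).adjugate *ᵥ pcol V i) = multiaffine (con i f₀) :=
      (multiaffine_con_of_eq_det hdet h₀ i).symm
    rw [h3] at h1
    linear_combination -h1
  have hG (i : σ) (hi : i ∈ J) : multiaffine f₀ ∣ multiaffine (con i f₀) * (multiaffine f₁ - t) :=
    ⟨multiaffine (con i f₁) - (shift i t - t), by linear_combination hg2 i hi - ht2 i⟩
  have hdvd : multiaffine f₀ ∣ multiaffine f₁ - t := by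
    refine dvd_of_squarefree_of_forall_prime hsqf fun p hp hpF => ?_
    obtain ⟨j, hjJ, hj, -⟩ := key p hp hpF
    exact (hp.dvd_or_dvd (hpF.trans (hG j hjJ))).resolve_left hj
  -- f₁ − t has degree at most e, while f₀ has degree e + 1.
  refine sub_eq_zero.1 (eq_zero_of_dvd_of_totalDegree_lt hdvd ?_)
  rw [hFdeg]
  refine Nat.lt_succ_of_le ((totalDegree_sub _ _).trans (max_le hom₁.totalDegree_le ?_))
  rw [ht, ← hyw]
  refine (totalDegree_finsetSum_le fun r _ => ?_)
  refine (totalDegree_mul _ _).trans ?_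
  rw [totalDegree_C, zero_add]
  refine (totalDegree_finsetSum_le fun i _ => ?_)
  refine (totalDegree_mul _ _).trans ?_
  rw [totalDegree_C, zero_add]
  exact hgdeg i

end Extension

/-! ### Square Rayleigh differences give a determinantal representation. -/

section ExistsGram

open MvPolynomial Matrix

variable {σ : Type*} [DecidableEq σ] [Fintype σ] {K : Type*} [Field K]

theorem multiaffine_of_forall_eq_zero {q : Finset σ → K} (h : ∀ T, T ≠ ∅ → q T = 0) :
    multiaffine q = C (q ∅) := by
  rw [multiaffine, Finset.sum_eq_single ∅ (fun T _ hT => by rw [h T hT]; simp) (by simp)]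
  simp

/-- The matrix `V` with the row `e_i` added at the top. -/
def consSingle {d : ℕ} (i : σ) (V : Matrix (Fin d) σ K) : Matrix (Fin (d + 1)) σ K :=
  Matrix.of fun r j => Fin.cases (if j = i then 1 else 0) (fun r => V r j) r

@[simp] theorem consSingle_zero {d : ℕ} (i : σ) (V : Matrix (Fin d) σ K) (j : σ) :
    consSingle i V 0 j = if j = i then 1 else 0 := rfl

@[simp] theorem consSingle_succ {d : ℕ} (i : σ) (V : Matrix (Fin d) σ K) (r : Fin d) (j : σ) :
    consSingle i V r.succ j = V r j := rfl

theorem det_gram_cons {d : ℕ} {V : Matrix (Fin d) σ K} {i : σ} (h : ∀ r, V r i = 0) :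
    (gram (consSingle i V)).det = X i * (gram V).det := by
  rw [det_succ_row_zero, Finset.sum_eq_single 0]
  · simp only [Fin.val_zero, pow_zero, one_mul]
    congr 1
    · rw [gram_apply, Finset.sum_eq_single i]
      · simp
      · intro j _ hj; simp [hj]
      · simp
  · intro s _ hs
    obtain ⟨s, rfl⟩ := Fin.exists_succ_eq.2 hs
    have : gram (consSingle i V) 0 s.succ = 0 := by
      rw [gram_apply]
      refine Finset.sum_eq_zero fun j _ => ?_
      by_cases hj : j = i
      · subst hj; simp [h]
      · simp [hj]
    rw [this]; simp
  · simp

/-- Filling the zero column i by v adds the rank-one matrix x_i v vᵀ. -/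
theorem det_gram_update {d : ℕ} {V : Matrix (Fin d) σ K} {i : σ} (h : ∀ r, V r i = 0)
    (h0 : (gram V).det ≠ 0) (v : Fin d → K) :
    (gram (Matrix.of fun r j => if j = i then v r else V r j)).det = (gram V).det +
      X i * ((fun r => C (v r)) ⬝ᵥ ((gram V).adjugate *ᵥ (fun r => C (v r)))) := by
  have e : gram (Matrix.of fun r j => if j = i then v r else V r j) = gram V +
      vecMulVec ((X i : MvPolynomial σ K) • fun r => C (v r)) (fun r => C (v r)) := by
    ext1 r s
    rw [Matrix.add_apply, gram_apply, gram_apply, Fintype.sum_eq_add_sum_compl i,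
      Fintype.sum_eq_add_sum_compl (f := fun j => C (V r j) * X j * C (V s j)) i]
    have : ∑ j ∈ {i}ᶜ, C ((Matrix.of fun r j => if j = i then v r else V r j) r j) * X j *
        C ((Matrix.of fun r j => if j = i then v r else V r j) s j) =
        ∑ j ∈ {i}ᶜ, (C (V r j) * X j * C (V s j) : MvPolynomial σ K) := by
      refine Finset.sum_congr rfl fun j hj => ?_
      have hj : j ≠ i := by simpa using hj
      simp [hj]
    rw [this]
    simp [vecMulVec_apply, h]
    ring
  rw [e, det_add_vecMulVec _ h0, mulVec_smul, dotProduct_smul, smul_eq_mul]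

theorem rayleigh_of_del_eq_zero {q : Finset σ → K} {m : σ} (h : del m q = 0) {i j : σ}
    (hi : i ≠ m) (hj : j ≠ m) : rayleigh q i j = X m ^ 2 * rayleigh (con m q) i j := by
  have z (k : σ) : con k (0 : Finset σ → K) = 0 := by funext T; simp [con]
  have e1 (k : σ) (hk : k ≠ m) : multiaffine (con k q) = X m * multiaffine (con k (con m q)) := by
    rw [multiaffine_eq_add m, ← con_del k m q hk, h, z, con_con m k q hk.symm]; simp
  have e2 : multiaffine (con i (con j q)) = X m * multiaffine (con i (con j (con m q))) := by
    rw [multiaffine_eq_add m, ← con_del i m _ hi, ← con_del j m q hj, h, z, z,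
      con_con m i _ hi.symm, con_con m j q hj.symm]; simp
  have e3 : multiaffine q = X m * multiaffine (con m q) := by
    conv_lhs => rw [multiaffine_eq_add m, h]
    simp
  rw [rayleigh, rayleigh, e1 i hi, e1 j hj, e2, e3]
  ring

/-- The terms containing x_m cancel, which leaves exactly the expression that the extension lemma
requires to be a square. -/
theorem rayleigh_right (q : Finset σ → K) {i m : σ} (hi : i ≠ m) :
    rayleigh q i m = multiaffine (con i (del m q)) * multiaffine (con m q) -
      multiaffine (del m q) * multiaffine (con i (con m q)) := by
  rw [rayleigh, multiaffine_eq_add m q, multiaffine_eq_add m (con i q), con_del i m q hi,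
    con_con m i q hi.symm]
  ring

theorem isSquare_of_isSquare_X_sq_mul {m : σ} {r : MvPolynomial σ K}
    (h : IsSquare (X m ^ 2 * r)) : IsSquare r := by
  obtain ⟨s, hs⟩ := h
  have hX : Prime (X m : MvPolynomial σ K) := X_prime
  have : X m ∣ s := by
    refine hX.dvd_of_dvd_pow (n := 2) ⟨X m * r, ?_⟩
    rw [sq, ← hs]; ring
  obtain ⟨t, rfl⟩ := this
  refine ⟨t, mul_left_cancel₀ (pow_ne_zero 2 hX.ne_zero) ?_⟩
  rw [hs]; ring

theorem rayleigh_smul (c : K) (q : Finset σ → K) (i j : σ) :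
    rayleigh (fun T => c * q T) i j = C c ^ 2 * rayleigh q i j := by
  have e (k : σ) (q : Finset σ → K) : con k (fun T => c * q T) = fun T => c * con k q T := by
    funext T; simp [con]
  simp only [rayleigh, e, multiaffine_smul]
  ring

/-- Induction on the set of variables. If the part free of x_m vanishes, the form is x_m times one
of lower degree and V gains the row e_m. Otherwise the part free of x_m has a representation by
induction, and the extension lemma supplies column m. -/
theorem exists_gram {J : Finset σ} {d : ℕ} {q : Finset σ → K} (hom : IsHomTensor d q)
    (hJ : ∀ T, q T ≠ 0 → T ⊆ J) (h0 : q ≠ 0)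
    (hsq : ∀ i ∈ J, ∀ j ∈ J, i ≠ j → IsSquare (rayleigh q i j)) :
    ∃ (c : K) (V : Matrix (Fin d) σ K), (∀ i ∉ J, ∀ r, V r i = 0) ∧
      multiaffine q = C c * (gram V).det := by
  induction J using Finset.induction_on generalizing d q with
  | empty =>
    have hT (T) (h : q T ≠ 0) : T = ∅ := Finset.subset_empty.1 (hJ T h)
    obtain ⟨T, hq⟩ := Function.ne_iff.1 h0
    have hd := hom T hq
    rw [hT T hq, Finset.card_empty] at hd
    subst hd
    refine ⟨q ∅, 0, fun _ _ _ => rfl, ?_⟩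
    rw [multiaffine_of_forall_eq_zero fun T h => by_contra fun h' => h (hT T h')]
    simp
  | insert m J hm ih =>
    rcases d with _ | e
    · refine ⟨q ∅, 0, fun _ _ _ => rfl, ?_⟩
      rw [multiaffine_of_forall_eq_zero fun T h => by_contra fun h' =>
        h (Finset.card_eq_zero.1 (hom T h'))]
      simp
    have hne {i : σ} (hi : i ∈ J) : i ≠ m := fun h => hm (h ▸ hi)
    by_cases hdel : del m q = 0
    · have hc0 : con m q ≠ 0 := by
        intro h
        apply h0
        rw [← multiaffine_eq_zero, multiaffine_eq_add m, hdel, h]; simp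
      obtain ⟨c, V, hV, e1⟩ := ih (hom.con m) (fun T hT => by
          have hmT : m ∉ T := fun h => hT (by simp [con, h])
          have := hJ (insert m T) (by simpa [con, hmT] using hT)
          intro x hx
          have h1 := this (Finset.mem_insert_of_mem hx)
          rcases Finset.mem_insert.1 h1 with h | h
          · exact absurd (h ▸ hx) hmT
          · exact h) hc0 (fun i hi j hj hij => by
          have := hsq i (Finset.mem_insert_of_mem hi) j (Finset.mem_insert_of_mem hj) hij
          rw [rayleigh_of_del_eq_zero hdel (hne hi) (hne hj)] at this
          exact isSquare_of_isSquare_X_sq_mul this)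
      refine ⟨c, consSingle m V, fun i hi r => ?_, ?_⟩
      · rw [Finset.mem_insert, not_or] at hi
        refine Fin.cases ?_ (fun r => ?_) r
        · simp [hi.1]
        · simp [hV i hi.2 r]
      · rw [det_gram_cons (hV m hm), multiaffine_eq_add m, hdel, e1]
        simp
        ring
    · obtain ⟨c, V, hV, e1⟩ := ih (hom.del m) (fun T hT => by
          have hmT : m ∉ T := fun h => hT (by simp [del, h])
          have := hJ T (by simpa [del, hmT] using hT)
          intro x hx
          rcases Finset.mem_insert.1 (this hx) with h | h
          · exact absurd (h ▸ hx) hmT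
          · exact h) hdel (fun i hi j hj hij => by
          have := hsq i (Finset.mem_insert_of_mem hi) j (Finset.mem_insert_of_mem hj) hij
          rw [← zeroAt_rayleigh q (hne hi) (hne hj)]
          exact this.map (zeroAt m))
      have hF0 : multiaffine (del m q) ≠ 0 := fun h => hdel (multiaffine_eq_zero.1 h)
      have hc : c ≠ 0 := by rintro rfl; apply hF0; rw [e1]; simp
      -- Dividing by c makes the part free of x_m an exact determinant; a square factor c⁻² does not
      -- affect the Rayleigh condition.
      let q' : Finset σ → K := fun T => c⁻¹ * q T
      have hq' : q = fun T => c * q' T := by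
        funext T; simp [q', hc]
      have hdel' : del m q' = fun T => c⁻¹ * del m q T := by
        funext T; simp [q', del]
      have hdet : multiaffine (del m q') = (gram V).det := by
        rw [hdel', multiaffine_smul, e1, ← mul_assoc, ← C_mul, inv_mul_cancel₀ hc]; simp
      have hom' : IsHomTensor (e + 1) q' := fun T hT => hom T (right_ne_zero_of_mul hT)
      have h0' : del m q' ≠ 0 := by
        intro h
        have : (gram V).det = 0 := by rw [← hdet, h]; simp
        rw [this, mul_zero] at e1
        exact hF0 e1
      obtain ⟨v, hv⟩ := exists_multiaffine_eq_of_extension hV h0' (hom'.del m) (hom'.con m) hdet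
        (fun i hi => by
          rw [← rayleigh_right q' (hne hi), rayleigh_smul]
          have := hsq i (Finset.mem_insert_of_mem hi) m (Finset.mem_insert_self m J) (hne hi)
          exact ((even_two.isSquare_pow (C c⁻¹)).mul this))
      refine ⟨c, Matrix.of fun r j => if j = m then v r else V r j, fun i hi r => ?_, ?_⟩
      · rw [Finset.mem_insert, not_or] at hi
        simp [hi.1, hV i hi.2 r]
      · rw [det_gram_update (hV m hm) (by rw [← hdet]; exact fun h => h0' (multiaffine_eq_zero.1 h)),
          ← hv, ← hdet, ← multiaffine_eq_add, ← multiaffine_smul, ← hq']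

end ExistsGram

/-! ### Cauchy–Binet and the squared Grassmannian. -/

section CauchyBinet

open MvPolynomial Matrix

theorem det_mul_eq_sum_functions {d n : ℕ} {R : Type*} [CommRing R] (A : Matrix (Fin d) (Fin n) R)
    (B : Matrix (Fin n) (Fin d) R) :
    (A * B).det = ∑ f : Fin d → Fin n, (∏ i, A i (f i)) * (B.submatrix f id).det := by
  have h : A * B = fun i => ∑ j : Fin n, A i j • B.row j := by
    funext i k
    simp [Matrix.mul_apply, Matrix.row]
  change detRowAlternating (A * B) = _
  rw [h]
  change (detRowAlternating (n := Fin d) (R := R)).toMultilinearMap _ = _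
  rw [MultilinearMap.map_sum]
  refine Finset.sum_congr rfl fun f _ => ?_
  rw [MultilinearMap.map_smul_univ]
  rfl

/-- The Cauchy–Binet formula: in the expansion over functions only injective ones survive, and these
are pairs of a subset and a permutation. -/
theorem det_mul_eq_sum_subsets {d n : ℕ} {R : Type*} [CommRing R] (A : Matrix (Fin d) (Fin n) R)
    (B : Matrix (Fin n) (Fin d) R) :
    (A * B).det = ∑ S : Subsets d n, (A.submatrix id (S.1.orderEmbOfFin S.2)).det *
      (B.submatrix (S.1.orderEmbOfFin S.2) id).det := by
  classical
  rw [det_mul_eq_sum_functions]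
  let T : Finset (Fin d → Fin n) := Finset.univ.filter fun f => Function.Injective f
  rw [← Finset.sum_subset (Finset.subset_univ T) (by
    intro f _ hf
    have : ¬ Function.Injective f := by simpa [T] using hf
    rw [Function.Injective] at this
    push Not at this
    obtain ⟨a, b, hab, hne⟩ := this
    rw [det_zero_of_row_eq hne (by funext k; simp [hab]), mul_zero])]
  have h1 (S : Subsets d n) : (A.submatrix id (S.1.orderEmbOfFin S.2)).det *
      (B.submatrix (S.1.orderEmbOfFin S.2) id).det = ∑ τ : Equiv.Perm (Fin d),
        (∏ i, A i (S.1.orderEmbOfFin S.2 (τ i))) *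
          (B.submatrix (S.1.orderEmbOfFin S.2 ∘ τ) id).det := by
    rw [← det_transpose, det_apply', Finset.sum_mul]
    refine Finset.sum_congr rfl fun τ _ => ?_
    have : B.submatrix (S.1.orderEmbOfFin S.2 ∘ τ) id =
        (B.submatrix (S.1.orderEmbOfFin S.2) id).submatrix τ id := rfl
    rw [this, det_permute]
    simp only [transpose_apply, submatrix_apply, id]
    ring
  simp only [h1]
  rw [Finset.sum_sigma']
  symm
  refine Finset.sum_bij (fun x _ => x.1.1.orderEmbOfFin x.1.2 ∘ x.2) ?_ ?_ ?_ ?_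
  · intro x _
    simp only [T, Finset.mem_filter, Finset.mem_univ, true_and]
    exact (x.1.1.orderEmbOfFin x.1.2).injective.comp x.2.injective
  · rintro ⟨⟨S, hS⟩, τ⟩ _ ⟨⟨S', hS'⟩, τ'⟩ _ h
    have hr : Set.range (S.orderEmbOfFin hS ∘ τ) = Set.range (S'.orderEmbOfFin hS' ∘ τ') := by
      rw [h]
    rw [τ.surjective.range_comp, τ'.surjective.range_comp, Finset.range_orderEmbOfFin,
      Finset.range_orderEmbOfFin, Finset.coe_inj] at hr
    subst hr
    have : τ = τ' := by
      ext i
      have := congrFun h i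
      exact congrArg Fin.val ((S.orderEmbOfFin hS).injective this)
    rw [this]
  · intro f hf
    have hf : Function.Injective f := by simpa [T] using hf
    have hS : (Finset.univ.image f).card = d := by
      rw [Finset.card_image_of_injective _ hf]; simp
    have hex (i : Fin d) : ∃ k, (Finset.univ.image f).orderEmbOfFin hS k = f i := by
      have : f i ∈ Set.range ((Finset.univ.image f).orderEmbOfFin hS) := by
        rw [Finset.range_orderEmbOfFin]; simp
      exact this
    choose τ hτ using hex
    have hinj : Function.Injective τ := by
      intro a b hab
      apply hf
      rw [← hτ, ← hτ, hab]
    refine ⟨⟨⟨_, hS⟩, Equiv.ofBijective τ (Finite.injective_iff_bijective.1 hinj)⟩, by simp, ?_⟩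
    funext i
    exact hτ i
  · intro x _
    rfl

variable {F : Type*} [Field F]

/-- The extension by zero of a vector indexed by the `d`-element subsets. -/
def extTensor {d n : ℕ} (q : Subsets d n → F) : Finset (Fin n) → F :=
  fun T => if h : T.card = d then q ⟨T, h⟩ else 0

theorem extTensor_apply {d n : ℕ} (q : Subsets d n → F) (T : Subsets d n) :
    extTensor q T.1 = q T := by
  simp [extTensor, T.2]

theorem isHomTensor_extTensor {d n : ℕ} (q : Subsets d n → F) : IsHomTensor d (extTensor q) := by
  intro T hT
  by_contra h
  exact hT (by simp [extTensor, h])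

theorem extTensor_injective {d n : ℕ} :
    Function.Injective (extTensor : (Subsets d n → F) → Finset (Fin n) → F) := by
  intro p q h
  funext T
  rw [← extTensor_apply p, h, extTensor_apply]

/-- The diagonal matrix X multiplies column i by x_i, so the Cauchy–Binet term of S is V_S · x^S ·
V_S. -/
theorem det_gram_eq_multiaffine {d n : ℕ} (V : Matrix (Fin d) (Fin n) F) :
    (gram V).det = multiaffine (extTensor fun S => pluckerVector V S ^ 2) := by
  let A : Matrix (Fin d) (Fin n) (MvPolynomial (Fin n) F) := Matrix.of fun r i => C (V r i) * X i
  let B : Matrix (Fin n) (Fin d) (MvPolynomial (Fin n) F) := Matrix.of fun i s => C (V s i)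
  have h : gram V = A * B := by
    ext1 r s
    simp [gram_apply, Matrix.mul_apply, A, B]
  rw [h, det_mul_eq_sum_subsets, multiaffine]
  have h2 (S : Subsets d n) : (A.submatrix id (S.1.orderEmbOfFin S.2)).det *
      (B.submatrix (S.1.orderEmbOfFin S.2) id).det = C (extTensor (fun S => pluckerVector V S ^ 2) S.1) *
        (∏ i ∈ S.1, X i : MvPolynomial (Fin n) F) := by
    have e1 : (A.submatrix id (S.1.orderEmbOfFin S.2)).det = C (pluckerVector V S) * (∏ i ∈ S.1, X i :
        MvPolynomial (Fin n) F) := by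
      have : A.submatrix id (S.1.orderEmbOfFin S.2) = Matrix.of fun r k => X (S.1.orderEmbOfFin S.2 k) *
          ((C : F →+* MvPolynomial (Fin n) F).mapMatrix
            (V.submatrix id (S.1.orderEmbOfFin S.2))) r k := by
        ext1 r k
        simp [A, mul_comm]
      rw [this, det_mul_row, ← RingHom.map_det, mul_comm]
      congr 1
      have hS : Finset.univ.map (S.1.orderEmbOfFin S.2).toEmbedding = S.1 := by
        rw [← Finset.coe_inj]; simp
      conv_rhs => rw [← hS, Finset.prod_map]
      rfl
    have e2 : (B.submatrix (S.1.orderEmbOfFin S.2) id).det = C (pluckerVector V S) := by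
      rw [pluckerVector, RingHom.map_det, ← det_transpose]
      rfl
    rw [e1, e2, extTensor_apply, C_pow]
    ring
  simp only [h2]
  have h3 := Finset.sum_subset (Finset.filter_subset (fun S : Finset (Fin n) => S.card = d)
    Finset.univ) (f := fun S => C (extTensor (fun S => pluckerVector V S ^ 2) S) *
        (∏ i ∈ S, X i : MvPolynomial (Fin n) F)) (fun S _ hS => by
      have : S.card ≠ d := by simpa using hS
      simp [extTensor, this])
  rw [← h3]
  symm
  exact Finset.sum_subtype (p := fun S : Finset (Fin n) => S.card = d) _ (fun S => by simp) _

theorem finrank_span_row_of_pluckerVector_ne_zero {d n : ℕ} {V : Matrix (Fin d) (Fin n) F}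
    (h : pluckerVector V ≠ 0) : Module.finrank F (Submodule.span F (Set.range V.row)) = d := by
  obtain ⟨S, hS⟩ := Function.ne_iff.1 h
  have h1 : LinearIndependent F (V.submatrix id (S.1.orderEmbOfFin S.2)).row := by
    rw [linearIndependent_rows_iff_isUnit, isUnit_iff_isUnit_det]
    exact isUnit_iff_ne_zero.2 hS
  have h2 : LinearIndependent F V.row :=
    LinearIndependent.of_comp (LinearMap.funLeft F F (S.1.orderEmbOfFin S.2)) h1
  rw [finrank_span_eq_card h2]
  simp

/-- The constant c is the projective freedom, so it need not be a square. Since `q` is nonzero, some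
maximal minor is nonzero, and V has rank d automatically. -/
theorem mk_mem_grassmannianSq_iff {d n : ℕ} {q : Subsets d n → F} (hq : q ≠ 0) :
    Projectivization.mk F q hq ∈ grassmannianSq F d n ↔
      ∃ (c : F) (V : Matrix (Fin d) (Fin n) F),
        multiaffine (extTensor q) = C c * (gram V).det := by
  have key (c : F) (V : Matrix (Fin d) (Fin n) F) :
      multiaffine (extTensor q) = C c * (gram V).det ↔ q = fun S => c * pluckerVector V S ^ 2 := by
    rw [det_gram_eq_multiaffine, ← multiaffine_smul, multiaffine_injective.eq_iff]
    have : (fun T => c * extTensor (fun S => pluckerVector V S ^ 2) T) =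
        extTensor (fun S => c * pluckerVector V S ^ 2) := by
      funext T
      simp only [extTensor]
      split_ifs <;> simp
    rw [this, extTensor_injective.eq_iff]
  simp only [key]
  constructor
  · rintro ⟨p, ⟨L, -, V, -, hV, rfl⟩, h⟩
    change Projectivization.mk F _ _ = _ at h
    rw [Projectivization.mk_eq_mk_iff'] at h
    obtain ⟨c, hc⟩ := h
    by_cases hc0 : c = 0
    · exfalso
      have : (fun S => pluckerVector V S ^ 2) = 0 := by rw [← hc, hc0, zero_smul]
      exact sq_ne_zero_of_ne_zero hV this
    refine ⟨c⁻¹, V, ?_⟩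
    funext S
    have := congrFun hc S
    simp only [Pi.smul_apply, smul_eq_mul] at this
    change c * q S = pluckerVector V S ^ 2 at this
    rw [← this]
    field_simp
  · rintro ⟨c, V, hV⟩
    have h : pluckerVector V ≠ 0 := by
      rintro h
      apply hq
      rw [hV]
      funext S
      simp [h]
    refine ⟨Projectivization.mk F (pluckerVector V) h,
      ⟨_, finrank_span_row_of_pluckerVector_ne_zero h, V, rfl, h, rfl⟩, ?_⟩
    change Projectivization.mk F _ _ = _
    rw [Projectivization.mk_eq_mk_iff']
    have hc : c ≠ 0 := by
      rintro rfl
      apply hq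
      rw [hV]
      funext S
      simp
    refine ⟨c⁻¹, ?_⟩
    rw [hV]
    funext S
    simp [hc]

end CauchyBinet

/-! ### Multilinear forms, hyperdeterminants and changes of coordinates. -/

section Val

open Function

variable {σ : Type*} [DecidableEq σ] [Fintype σ] {F : Type*} [Field F] {A : Type*} [CommRing A]
  [Algebra F A]

variable (A) in
/-- The multilinear form on `(A²)^σ` with coefficients `q`. -/
noncomputable def valM (q : Finset σ → F) : MultilinearMap A (fun _ : σ => A × A) A :=
  ∑ T, algebraMap F A (q T) • (MultilinearMap.mkPiAlgebra A σ A).compLinearMap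
    (fun i => if i ∈ T then LinearMap.fst A A A else LinearMap.snd A A A)

/-- The value of the multilinear form with coefficients `q`. -/
noncomputable def val (q : Finset σ → F) (w : σ → A × A) : A := valM A q w

theorem val_eq (q : Finset σ → F) (w : σ → A × A) :
    val q w = ∑ T, algebraMap F A (q T) * ∏ i, if i ∈ T then (w i).1 else (w i).2 := by
  simp only [val, valM, sum_apply, smul_apply, smul_eq_mul,
    MultilinearMap.compLinearMap_apply, MultilinearMap.mkPiAlgebra_apply]
  refine Finset.sum_congr rfl fun T _ => ?_
  congr 1
  refine Finset.prod_congr rfl fun i _ => ?_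
  split_ifs <;> rfl

theorem val_update (q : Finset σ → F) (w : σ → A × A) (i : σ) (x : A × A) :
    val q (update w i x) = x.1 * val q (update w i (1, 0)) + x.2 * val q (update w i (0, 1)) := by
  have : x = x.1 • ((1, 0) : A × A) + x.2 • ((0, 1) : A × A) := by ext <;> simp
  conv_lhs => rw [this]
  simp only [val, MultilinearMap.map_update_add, MultilinearMap.map_update_smul, smul_eq_mul]

theorem val_smul (q : Finset σ → F) (c : σ → A) (w : σ → A × A) :
    val q (fun i => c i • w i) = (∏ i, c i) * val q w := by
  simp only [val, MultilinearMap.map_smul_univ, smul_eq_mul]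

theorem map_val {B : Type*} [CommRing B] [Algebra F B] (φ : A →ₐ[F] B) (q : Finset σ → F)
    (w : σ → A × A) : φ (val q w) = val q (fun i => (φ (w i).1, φ (w i).2)) := by
  simp only [val_eq, map_sum, map_mul, AlgHom.commutes, map_prod]
  refine Finset.sum_congr rfl fun T _ => ?_
  congr 1
  refine Finset.prod_congr rfl fun i _ => ?_
  split_ifs <;> rfl

/-- The coordinate vector attached to a vertex of the cube. -/
def bv (b : Bool) : A × A := if b then (1, 0) else (0, 1)

@[simp] theorem bv_true : (bv true : A × A) = (1, 0) := rfl
@[simp] theorem bv_false : (bv false : A × A) = (0, 1) := rfl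

theorem val_vertex (q : Finset σ → F) (S : Finset σ) :
    val q (fun i => (bv (decide (i ∈ S)) : A × A)) = algebraMap F A (q S) := by
  rw [val_eq, Finset.sum_eq_single S]
  · rw [Finset.prod_eq_one, mul_one]
    intro i _
    by_cases h : i ∈ S <;> simp [h]
  · intro T _ hT
    have : ∃ i, ¬ (i ∈ T ↔ i ∈ S) := by
      by_contra h
      push Not at h
      exact hT (Finset.ext h)
    obtain ⟨i, hi⟩ := this
    rw [Finset.prod_eq_zero (Finset.mem_univ i), mul_zero]
    by_cases h : i ∈ S <;> by_cases h' : i ∈ T <;> simp_all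
  · simp

/-- The trilinear form obtained by leaving three coordinates free. -/
noncomputable def tri (q : Finset σ → F) (i j k : σ) (w : σ → A × A) (a b c : A × A) : A :=
  val q (update (update (update w i a) j b) k c)

theorem tri_right (q : Finset σ → F) (i j k : σ) (w : σ → A × A) (a b c : A × A) :
    tri q i j k w a b c = c.1 * tri q i j k w a b (1, 0) + c.2 * tri q i j k w a b (0, 1) :=
  val_update _ _ _ _

theorem tri_middle (q : Finset σ → F) {i j k : σ} (h : j ≠ k) (w : σ → A × A) (a b c : A × A) :
    tri q i j k w a b c = b.1 * tri q i j k w a (1, 0) c + b.2 * tri q i j k w a (0, 1) c := by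
  simp only [tri, update_comm h]
  exact val_update _ _ _ _

theorem tri_left (q : Finset σ → F) {i j k : σ} (hj : i ≠ j) (hk : i ≠ k) (w : σ → A × A)
    (a b c : A × A) :
    tri q i j k w a b c = a.1 * tri q i j k w (1, 0) b c + a.2 * tri q i j k w (0, 1) b c := by
  simp only [tri, update_comm hj, update_comm hk]
  exact val_update _ _ _ _

/-- Cayley's hyperdeterminant of a `2 × 2 × 2` tensor. -/
def hd (u : Bool → Bool → Bool → A) : A :=
  u false false false ^ 2 * u true true true ^ 2 + u true false false ^ 2 * u false true true ^ 2
    + u false true false ^ 2 * u true false true ^ 2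
    + u false false true ^ 2 * u true true false ^ 2
    - 2 * u false false false * u true false false * u false true true * u true true true
    - 2 * u false false false * u false true false * u true false true * u true true true
    - 2 * u false false false * u false false true * u true true false * u true true true
    - 2 * u true false false * u false true false * u true false true * u false true true
    - 2 * u true false false * u false false true * u true true false * u false true true
    - 2 * u false true false * u false false true * u true true false * u true false true
    + 4 * u false false false * u false true true * u true false true * u true true false
    + 4 * u true true true * u true false false * u false true false * u false false true

theorem hd_left (u : Bool → Bool → Bool → A) (E : Bool → A × A) :
    hd (fun x y z => (E x).1 * u true y z + (E x).2 * u false y z) =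
      ((E true).1 * (E false).2 - (E true).2 * (E false).1) ^ 2 * hd u := by
  simp only [hd]
  ring

theorem hd_middle (u : Bool → Bool → Bool → A) (E : Bool → A × A) :
    hd (fun x y z => (E y).1 * u x true z + (E y).2 * u x false z) =
      ((E true).1 * (E false).2 - (E true).2 * (E false).1) ^ 2 * hd u := by
  simp only [hd]
  ring

theorem hd_right (u : Bool → Bool → Bool → A) (E : Bool → A × A) :
    hd (fun x y z => (E z).1 * u x y true + (E z).2 * u x y false) =
      ((E true).1 * (E false).2 - (E true).2 * (E false).1) ^ 2 * hd u := by
  simp only [hd]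
  ring

/-- The hyperdeterminant in three coordinates, the others carrying the weights `w`. -/
noncomputable def hdAt (q : Finset σ → F) (i j k : σ) (w : σ → A × A) : A :=
  hd fun x y z => tri q i j k w (bv x) (bv y) (bv z)

/-- The determinant of two vectors, the coordinates of a basis. -/
def det2 (E : Bool → A × A) : A := (E true).1 * (E false).2 - (E true).2 * (E false).1

/-- The hyperdeterminant is a relative invariant: a linear substitution in one of its three factors
multiplies it by the square of the determinant. -/
theorem hd_tri (q : Finset σ → F) {i j k : σ} (hij : i ≠ j) (hik : i ≠ k) (hjk : j ≠ k)
    (w : σ → A × A) (E₁ E₂ E₃ : Bool → A × A) :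
    hd (fun x y z => tri q i j k w (E₁ x) (E₂ y) (E₃ z)) =
      (det2 E₁ * det2 E₂ * det2 E₃) ^ 2 * hdAt q i j k w := by
  have h1 : (fun x y z => tri q i j k w (E₁ x) (E₂ y) (E₃ z)) = fun x y z =>
      (E₁ x).1 * tri q i j k w (bv true) (E₂ y) (E₃ z) +
        (E₁ x).2 * tri q i j k w (bv false) (E₂ y) (E₃ z) := by
    funext x y z; exact tri_left q hij hik _ _ _ _
  have h2 : (fun x y z => tri q i j k w (bv x) (E₂ y) (E₃ z)) = fun x y z =>
      (E₂ y).1 * tri q i j k w (bv x) (bv true) (E₃ z) +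
        (E₂ y).2 * tri q i j k w (bv x) (bv false) (E₃ z) := by
    funext x y z; exact tri_middle q hjk _ _ _ _
  have h3 : (fun x y z => tri q i j k w (bv x) (bv y) (E₃ z)) = fun x y z =>
      (E₃ z).1 * tri q i j k w (bv x) (bv y) (bv true) +
        (E₃ z).2 * tri q i j k w (bv x) (bv y) (bv false) := by
    funext x y z; exact tri_right q _ _ _ _ _ _ _
  rw [h1, hd_left (fun x y z => tri q i j k w (bv x) (E₂ y) (E₃ z)), h2,
    hd_middle (fun x y z => tri q i j k w (bv x) (bv y) (E₃ z)), h3,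
    hd_right (fun x y z => tri q i j k w (bv x) (bv y) (bv z))]
  simp only [hdAt, det2]
  ring

theorem map_hdAt {B : Type*} [CommRing B] [Algebra F B] (φ : A →ₐ[F] B) (q : Finset σ → F)
    (i j k : σ) (w : σ → A × A) :
    φ (hdAt q i j k w) = hdAt q i j k (fun l => (φ (w l).1, φ (w l).2)) := by
  have h (a b c : Bool) : φ (tri q i j k w (bv a) (bv b) (bv c)) =
      tri q i j k (fun l => (φ (w l).1, φ (w l).2)) (bv a) (bv b) (bv c) := by
    have hb (b : Bool) : (φ (bv b : A × A).1, φ (bv b : A × A).2) = (bv b : B × B) := by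
      cases b <;> simp
    simp only [tri, map_val]
    congr 1
    funext l
    by_cases h1 : l = k
    · subst h1; simp [hb]
    by_cases h2 : l = j
    · subst h2; simp [h1, hb]
    by_cases h3 : l = i
    · subst h3; simp [h1, h2, hb]
    simp [h1, h2, h3]
  simp only [hdAt, hd, map_add, map_sub, map_mul, map_pow, h, map_ofNat]

theorem hdAt_update_left (q : Finset σ → F) (i j k : σ) (w : σ → A × A) (x : A × A) :
    hdAt q i j k (update w i x) = hdAt q i j k w := by
  simp only [hdAt, tri, update_idem]

theorem hdAt_update_middle (q : Finset σ → F) (i j k : σ) (w : σ → A × A) (x : A × A) :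
    hdAt q i j k (update w j x) = hdAt q i j k w := by
  by_cases h : j = i
  · subst h; simp only [hdAt, tri, update_idem]
  · simp only [hdAt, tri, update_comm h, update_idem]

theorem hdAt_update_right (q : Finset σ → F) (i j k : σ) (w : σ → A × A) (x : A × A) :
    hdAt q i j k (update w k x) = hdAt q i j k w := by
  by_cases h : k = j
  · subst h; exact hdAt_update_middle _ _ _ _ _ _
  by_cases h' : k = i
  · subst h'; exact hdAt_update_left _ _ _ _ _ _
  · simp only [hdAt, tri, update_comm h, update_comm h', update_idem]

theorem hdAt_smul (q : Finset σ → F) {i j k : σ} (c : σ → A) (w : σ → A × A) (hi : c i = 1)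
    (hj : c j = 1) (hk : c k = 1) :
    hdAt q i j k (fun l => c l • w l) = (∏ l, c l) ^ 4 * hdAt q i j k w := by
  have h (a b d : A × A) : tri q i j k (fun l => c l • w l) a b d =
      (∏ l, c l) * tri q i j k w a b d := by
    rw [tri, tri, ← val_smul]
    congr 1
    funext l
    by_cases h1 : l = k
    · subst h1; simp [hk]
    by_cases h2 : l = j
    · subst h2; simp [h1, hj]
    by_cases h3 : l = i
    · subst h3; simp [h1, h2, hi]
    simp [h1, h2, h3]
  simp only [hdAt, hd, h]
  ring

/-- All the hyperdeterminants of `q` vanish for weights in the field of coefficients. -/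
def PG (q : Finset σ → F) : Prop :=
  ∀ i j k : σ, i ≠ j → i ≠ k → j ≠ k → ∀ w : σ → F × F, hdAt q i j k w = 0

section Frames

variable {K : Type*} [Field K] [Algebra F K] {B : Type*} [CommRing B] [Algebra F B] [Algebra K B]
  [IsScalarTower F K B]

/-- The tensor `q` in the coordinates given by pairs of vectors of the planes `K²`. -/
noncomputable def chg (E : σ → Bool → K × K) (q : Finset σ → F) : Finset σ → K :=
  fun T => val q (fun l => E l (decide (l ∈ T)))

variable (B) in
/-- The image of a vector under extension of scalars. -/
def mapVec (x : K × K) : B × B := (algebraMap K B x.1, algebraMap K B x.2)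

theorem val_chg (E : σ → Bool → K × K) (q : Finset σ → F) (w : σ → B × B) :
    val (chg E q) w = val q (fun l =>
      (w l).1 • mapVec B (E l true) + (w l).2 • mapVec B (E l false)) := by
  have e := (valM B q).map_add_univ (fun l => (w l).1 • mapVec B (E l true))
    (fun l => (w l).2 • mapVec B (E l false))
  refine Eq.trans ?_ e.symm
  rw [val_eq]
  refine Finset.sum_congr rfl fun T _ => ?_
  have h1 : T.piecewise (fun l => (w l).1 • mapVec B (E l true))
      (fun l => (w l).2 • mapVec B (E l false))
      = fun l => (if l ∈ T then (w l).1 else (w l).2) • mapVec B (E l (decide (l ∈ T))) := by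
    funext l
    by_cases h : l ∈ T <;> simp [Finset.piecewise, h]
  rw [h1, MultilinearMap.map_smul_univ, smul_eq_mul, mul_comm]
  congr 1
  exact map_val (IsScalarTower.toAlgHom F K B) q _

/-- The three free directions contribute their determinants, while in the other coordinates only the
weights are transported. No invertibility is assumed, so a pair (0, w) can be used to freeze a
coordinate at w. -/
theorem hdAt_chg (E : σ → Bool → K × K) (q : Finset σ → F) {i j k : σ} (hij : i ≠ j) (hik : i ≠ k)
    (hjk : j ≠ k) (w : σ → B × B) :
    hdAt (chg E q) i j k w = (algebraMap K B (det2 (E i) * det2 (E j) * det2 (E k))) ^ 2 *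
      hdAt q i j k (fun l => (w l).1 • mapVec B (E l true) + (w l).2 • mapVec B (E l false)) := by
  have e : (fun x y z => tri (chg E q) i j k w (bv x) (bv y) (bv z)) =
      fun x y z => tri q i j k
        (fun l => (w l).1 • mapVec B (E l true) + (w l).2 • mapVec B (E l false))
        (mapVec B (E i x)) (mapVec B (E j y)) (mapVec B (E k z)) := by
    funext x y z
    rw [tri, val_chg, tri]
    congr 1
    funext l
    have hE (l : σ) (x : Bool) : (bv x : B × B).1 • mapVec B (E l true) +
        (bv x : B × B).2 • mapVec B (E l false) = mapVec B (E l x) := by cases x <;> simp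
    by_cases h1 : l = k
    · subst h1; simpa using hE l z
    by_cases h2 : l = j
    · subst h2; simpa [h1] using hE l y
    by_cases h3 : l = i
    · subst h3; simpa [h1, h2] using hE l x
    simp [h1, h2, h3]
  rw [hdAt, e, hd_tri q hij hik hjk]
  simp only [det2, mapVec, map_mul, map_sub]

theorem PG.chg {q : Finset σ → F} (h : PG q) (E : σ → Bool → F × F) : PG (chg E q) := by
  intro i j k hij hik hjk w
  rw [hdAt_chg E q hij hik hjk, h i j k hij hik hjk, mul_zero]

end Frames

end Val

/-! ### The group action and evaluation at rational weights. -/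

section Action

open Function MvPolynomial

variable {F : Type*} [Field F] {m : ℕ}

theorem coeffVec_polyOf (a : Finset (Fin m) → F) : coeffVec (polyOf a) = a := by
  classical
  funext S
  rw [coeffVec, polyOf, coeff_sum, Finset.sum_eq_single S]
  · rw [coeff_monomial, if_pos rfl]
  · intro T _ hT
    rw [coeff_monomial, if_neg]
    intro h
    exact hT (compl_injective (sum_single_injective h))
  · simp

theorem rename_polyOf (π : Equiv.Perm (Fin m)) (a : Finset (Fin m) → F) :
    rename π (polyOf a) = polyOf fun S => a (S.map π.symm.toEmbedding) := by
  classical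
  rw [polyOf, polyOf, map_sum]
  refine Fintype.sum_equiv (Equiv.finsetCongr π) _ _ fun S => ?_
  rw [rename_monomial]
  have h1 : Finsupp.mapDomain π (expo Sᶜ) = expo (Equiv.finsetCongr π S)ᶜ := by
    rw [expo, expo, Finsupp.mapDomain_finsetSum]
    have : (Equiv.finsetCongr π S)ᶜ = Sᶜ.map π.toEmbedding := by
      ext i
      simp only [Equiv.finsetCongr_apply, Finset.mem_compl, Finset.mem_map_equiv]
    rw [this, Finset.sum_map]
    refine Finset.sum_congr rfl fun i _ => ?_
    simp [Finsupp.mapDomain_single]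
  have h2 : (Equiv.finsetCongr π S).map π.symm.toEmbedding = S := by
    ext i
    simp [Equiv.finsetCongr_apply, Finset.mem_map_equiv]
  rw [h1, h2]

theorem prod_linear_eq_multiaffine (p r : Fin m → F) :
    ∏ i, (C (p i) * X i + C (r i)) = multiaffine (fun U => ∏ i, if i ∈ U then p i else r i) := by
  classical
  rw [Fintype.prod_add, multiaffine]
  refine Finset.sum_congr rfl fun U _ => ?_
  rw [Finset.prod_mul_distrib, ← map_prod, ← map_prod, Finset.prod_ite]
  have h1 : Finset.univ.filter (fun i => i ∈ U) = U := by ext; simp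
  have h2 : Finset.univ.filter (fun i => i ∉ U) = Uᶜ := by ext; simp
  rw [h1, h2, C_mul]
  ring

/-- In the coefficient of x^{[m] \ S}, the factor of index i contributes its constant term if i ∈ S
and its x_i-coefficient otherwise. -/
theorem coeffVec_slAct (γ : Fin m → Matrix.SpecialLinearGroup (Fin 2) F)
    (b : Finset (Fin m) → F) (S : Finset (Fin m)) :
    coeffVec (slAct γ (polyOf b)) S = val b fun i => if i ∈ S then
      ((γ i).1 1 1, (γ i).1 0 1) else ((γ i).1 1 0, (γ i).1 0 0) := by
  classical
  rw [coeffVec, slAct, coeffVec_polyOf, coeff_sum, val_eq]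
  refine Finset.sum_congr rfl fun T _ => ?_
  have h : (∏ i ∈ Tᶜ, (C ((γ i).1 0 0) * X i + C ((γ i).1 0 1))) *
      ∏ i ∈ T, (C ((γ i).1 1 0) * X i + C ((γ i).1 1 1)) =
      ∏ i, (C (if i ∈ T then (γ i).1 1 0 else (γ i).1 0 0) * X i +
        C (if i ∈ T then (γ i).1 1 1 else (γ i).1 0 1) : MvPolynomial (Fin m) F) := by
    rw [← Finset.prod_compl_mul_prod T]
    congr 1
    · refine Finset.prod_congr rfl fun i hi => ?_
      rw [if_neg (by simpa using hi), if_neg (by simpa using hi)]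
    · refine Finset.prod_congr rfl fun i hi => ?_
      rw [if_pos hi, if_pos hi]
  rw [coeff_C_mul, h, prod_linear_eq_multiaffine]
  change b T * coeff (∑ i ∈ Sᶜ, Finsupp.single i 1) _ = _
  rw [coeff_multiaffine]
  congr 1
  refine Finset.prod_congr rfl fun i _ => ?_
  by_cases h1 : i ∈ S <;> by_cases h2 : i ∈ T <;> simp [h1, h2]

theorem val_map_symm (π : Equiv.Perm (Fin m)) (a : Finset (Fin m) → F) (w : Fin m → F × F) :
    val (fun S => a (S.map π.symm.toEmbedding)) w = val a (fun j => w (π j)) := by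
  rw [val_eq, val_eq]
  symm
  refine Fintype.sum_equiv (Equiv.finsetCongr π) _ _ fun S => ?_
  have h2 : (Equiv.finsetCongr π S).map π.symm.toEmbedding = S := by
    ext i
    simp [Equiv.finsetCongr_apply, Finset.mem_map_equiv]
  rw [h2]
  congr 1
  refine Fintype.prod_equiv π _ _ fun i => ?_
  simp [Equiv.finsetCongr_apply]

theorem actVec_apply (g : Grp F m) (a : Finset (Fin m) → F) (S : Finset (Fin m)) :
    actVec g a S = val a fun j => if g.right j ∈ S then
      ((g.left (g.right j)).1 1 1, (g.left (g.right j)).1 0 1) else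
      ((g.left (g.right j)).1 1 0, (g.left (g.right j)).1 0 0) := by
  rw [actVec, actPoly, rename_polyOf, coeffVec_slAct, val_map_symm]

/-- Only sets S inside {1, 2, 3} enter, so every other coordinate is evaluated at its x-coefficients
(κ, α). In the three distinguished coordinates the two vectors involved form a basis of determinant
one, which invariance removes. -/
theorem hypDet_actVec (hm : 3 ≤ m) (g : Grp F m) (a : Finset (Fin m) → F) :
    hypDet hm (actVec g a) = hdAt a (g.right.symm ⟨0, by omega⟩) (g.right.symm ⟨1, by omega⟩)
      (g.right.symm ⟨2, by omega⟩)
      (fun j => ((g.left (g.right j)).1 1 0, (g.left (g.right j)).1 0 0)) := by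
  set i₀ : Fin m := ⟨0, by omega⟩ with hi₀
  set i₁ : Fin m := ⟨1, by omega⟩ with hi₁
  set i₂ : Fin m := ⟨2, by omega⟩ with hi₂
  have n01 : i₀ ≠ i₁ := by simp [hi₀, hi₁]
  have n02 : i₀ ≠ i₂ := by simp [hi₀, hi₂]
  have n12 : i₁ ≠ i₂ := by simp [hi₁, hi₂]
  let E : Fin m → Bool → F × F := fun i b => if b then ((g.left i).1 1 1, (g.left i).1 0 1) else
    ((g.left i).1 1 0, (g.left i).1 0 0)
  have hE (i : Fin m) : det2 (E i) = 1 := by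
    have h := (g.left i).2
    rw [Matrix.det_fin_two] at h
    simp only [det2, E, if_true, Bool.false_eq_true, if_false]
    linear_combination h
  have key (S : Finset (Fin m)) (x y z : Bool) (h : S = Finset.univ.filter fun i =>
      (i = i₀ ∧ x) ∨ (i = i₁ ∧ y) ∨ (i = i₂ ∧ z)) :
      actVec g a S = tri a (g.right.symm i₀) (g.right.symm i₁) (g.right.symm i₂)
        (fun j => ((g.left (g.right j)).1 1 0, (g.left (g.right j)).1 0 0))
        (E i₀ x) (E i₁ y) (E i₂ z) := by
    rw [actVec_apply, tri]
    congr 1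
    funext j
    simp only [update_apply, Equiv.eq_symm_apply, h, Finset.mem_filter, Finset.mem_univ, true_and]
    by_cases h2 : g.right j = i₂
    · simp only [h2, n02.symm, n12.symm, false_and, false_or, true_and, if_true, E]
    by_cases h1 : g.right j = i₁
    · simp only [h1, n01.symm, n12, false_and, false_or, or_false, true_and, if_true, if_false, E]
    by_cases h0 : g.right j = i₀
    · simp only [h0, n01, n02, false_and, or_false, true_and, if_true, if_false, E]
    · simp only [h0, h1, h2, false_and, or_false, if_false]
  have h2 := hd_tri a (g.right.symm.injective.ne n01) (g.right.symm.injective.ne n02)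
    (g.right.symm.injective.ne n12)
    (fun j => ((g.left (g.right j)).1 1 0, (g.left (g.right j)).1 0 0)) (E i₀) (E i₁) (E i₂)
  rw [hE, hE, hE, one_mul, one_mul, one_pow, one_mul] at h2
  rw [← h2]
  have e000 := key ∅ false false false (by simp)
  have e100 := key {i₀} true false false (by ext; simp)
  have e010 := key {i₁} false true false (by ext; simp)
  have e001 := key {i₂} false false true (by ext; simp)
  have e011 := key {i₁, i₂} false true true (by ext; simp)
  have e101 := key {i₀, i₂} true false true (by ext; simp)
  have e110 := key {i₀, i₁} true true false (by ext; simp)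
  have e111 := key {i₀, i₁, i₂} true true true (by ext; simp)
  simp only [hypDet, hd, ← hi₀, ← hi₁, ← hi₂, e000, e100, e010, e001, e011, e101, e110, e111]

theorem tri_eq_zero_of_weight_zero (q : Finset (Fin m) → F) {i j k l : Fin m} (hi : l ≠ i)
    (hj : l ≠ j) (hk : l ≠ k) {w : Fin m → F × F} (h : w l = 0) (a b c : F × F) :
    tri q i j k w a b c = 0 := by
  rw [tri, val]
  exact MultilinearMap.map_coord_zero _ l (by simp [hi, hj, hk, h])

theorem exists_specialLinear (x : F × F) (hx : x ≠ 0) :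
    ∃ γ : Matrix.SpecialLinearGroup (Fin 2) F, (γ.1 1 0, γ.1 0 0) = x := by
  by_cases h : x.2 = 0
  · have h1 : x.1 ≠ 0 := fun h1 => hx (Prod.ext h1 h)
    refine ⟨⟨!![x.2, -x.1⁻¹; x.1, 0], ?_⟩, ?_⟩
    · rw [Matrix.det_fin_two_of]; field_simp; ring
    · simp
  · refine ⟨⟨!![x.2, 0; x.1, x.2⁻¹], ?_⟩, ?_⟩
    · rw [Matrix.det_fin_two_of]; field_simp; ring
    · simp

theorem exists_perm_of_ne (hm : 3 ≤ m) {i j k : Fin m} (hij : i ≠ j) (hik : i ≠ k) (hjk : j ≠ k) :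
    ∃ π : Equiv.Perm (Fin m), π.symm ⟨0, by omega⟩ = i ∧ π.symm ⟨1, by omega⟩ = j ∧
      π.symm ⟨2, by omega⟩ = k := by
  have hinj : Injective ![i, j, k] := by
    intro a b hab
    fin_cases a <;> fin_cases b <;> simp_all
  obtain ⟨g, hg⟩ := (Equiv.Perm.isMultiplyPretransitive (Fin m) 3).exists_smul_eq
    (Fin.castLEEmb hm) ⟨_, hinj⟩
  refine ⟨g.symm, ?_, ?_, ?_⟩
  · exact DFunLike.congr_fun hg 0
  · exact DFunLike.congr_fun hg 1
  · exact DFunLike.congr_fun hg 2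

/-- The permutation moves the distinguished triple anywhere, and any nonzero vector of F² occurs as
the pair (κ, α) of some matrix in SL₂, so the orbit realises all rational weights. -/
theorem forall_hypDet_iff (a : Finset (Fin m) → F) :
    (∀ (hm : 3 ≤ m) (g : Grp F m), hypDet hm (actVec g a) = 0) ↔ PG a := by
  constructor
  · intro h i j k hij hik hjk w
    have hm : 3 ≤ m := by
      have h3 : ({i, j, k} : Finset (Fin m)).card = 3 := Finset.card_eq_three.2
        ⟨i, j, k, hij, hik, hjk, rfl⟩
      have := Finset.card_le_univ ({i, j, k} : Finset (Fin m))
      simpa [h3] using this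
    by_cases hw : ∃ l, l ≠ i ∧ l ≠ j ∧ l ≠ k ∧ w l = 0
    · obtain ⟨l, hi, hj, hk, hl⟩ := hw
      simp [hdAt, hd, tri_eq_zero_of_weight_zero a hi hj hk hl]
    push Not at hw
    obtain ⟨π, hπi, hπj, hπk⟩ := exists_perm_of_ne hm hij hik hjk
    -- The weights at i, j, k do not affect the hyperdeterminant; they are made nonzero so that
    -- matrices exist for them too.
    let w' : Fin m → F × F := update (update (update w i (1, 0)) j (1, 0)) k (1, 0)
    have hw' (l : Fin m) : w' l ≠ 0 := by
      by_cases h3 : l = k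
      · subst h3; simp [w']
      by_cases h2 : l = j
      · subst h2; simp [w', h3]
      by_cases h1 : l = i
      · subst h1; simp [w', h3, h2]
      simpa [w', h1, h2, h3] using hw l h1 h2 h3
    choose γ hγ using fun l => exists_specialLinear (w' (π.symm l)) (hw' _)
    have := h hm ⟨γ, π⟩
    rw [hypDet_actVec] at this
    simp only [hγ, Equiv.symm_apply_apply, hπi, hπj, hπk] at this
    rwa [show (fun j => w' j) = w' from rfl, hdAt_update_right, hdAt_update_middle,
      hdAt_update_left] at this
  · intro h hm g
    rw [hypDet_actVec]
    exact h _ _ _ (g.right.symm.injective.ne (by simp)) (g.right.symm.injective.ne (by simp))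
      (g.right.symm.injective.ne (by simp)) _

end Action

/-! ### Discriminants of Rayleigh differences as hyperdeterminants. -/

section Generic

open Function MvPolynomial

variable {σ : Type*} [DecidableEq σ] [Fintype σ] {F : Type*} [Field F]

theorem sum_finset_eq_sum_insert {A : Type*} [AddCommMonoid A] (i : σ) (f : Finset σ → A) :
    ∑ T : Finset σ, f T = ∑ T : Finset σ, (if i ∈ T then 0 else f T + f (insert i T)) := by
  have h1 : ∑ T : Finset σ, (if i ∈ T then 0 else f (insert i T)) =
      ∑ T : Finset σ, (if i ∈ T then f T else 0) := by
    rw [← Finset.sum_filter_add_sum_filter_not Finset.univ (fun T => i ∈ T),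
      ← Finset.sum_filter_add_sum_filter_not (Finset.univ : Finset (Finset σ)) (fun T => i ∈ T)
        (fun T => if i ∈ T then f T else 0)]
    rw [Finset.sum_eq_zero (s := {x | i ∈ x}) (by intro T hT; simp at hT; simp [hT]), zero_add]
    rw [Finset.sum_eq_zero (s := {x | i ∉ x}) (f := fun T => if i ∈ T then f T else 0)
      (by intro T hT; simp at hT; simp [hT]), add_zero]
    refine Finset.sum_nbij' (fun T => insert i T) (fun T => T.erase i) ?_ ?_ ?_ ?_ ?_
    · intro T; simp
    · intro T; simp
    · intro T hT; simp at hT; simp [hT]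
    · intro T hT; simp at hT; simp [Finset.insert_erase hT]
    · intro T hT; simp at hT; simp [hT]
  have h2 : ∑ T : Finset σ, (if i ∈ T then 0 else f T + f (insert i T)) =
      ∑ T : Finset σ, (if i ∈ T then 0 else f T) +
        ∑ T : Finset σ, (if i ∈ T then 0 else f (insert i T)) := by
    rw [← Finset.sum_add_distrib]
    refine Finset.sum_congr rfl fun T _ => ?_
    split_ifs <;> simp
  rw [h2, h1, ← Finset.sum_add_distrib]
  refine Finset.sum_congr rfl fun T _ => ?_
  split_ifs <;> simp

section Slices

variable {A : Type*} [CommRing A] [Algebra F A]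

theorem prod_ite_mem_update (w : σ → A × A) (i : σ) (x : A × A) (T : Finset σ) :
    (∏ l, if l ∈ T then (update w i x l).1 else (update w i x l).2) =
      (if i ∈ T then x.1 else x.2) * ∏ l ∈ {i}ᶜ, if l ∈ T then (w l).1 else (w l).2 := by
  rw [Fintype.prod_eq_mul_prod_compl i]
  congr 1
  · simp
  · refine Finset.prod_congr rfl fun l hl => ?_
    have : l ≠ i := by simpa using hl
    simp [this]

theorem prod_insert_compl (w : σ → A × A) (i : σ) (T : Finset σ) :
    (∏ l ∈ {i}ᶜ, if l ∈ insert i T then (w l).1 else (w l).2) =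
      ∏ l ∈ {i}ᶜ, if l ∈ T then (w l).1 else (w l).2 := by
  refine Finset.prod_congr rfl fun l hl => ?_
  have : l ≠ i := by simpa using hl
  simp [this]

theorem val_con (i : σ) (q : Finset σ → F) (w : σ → A × A) :
    val (con i q) w = (w i).2 * val q (update w i (1, 0)) := by
  have e : val (con i q) w = val (con i q) (update w i (w i)) := by rw [update_eq_self]
  rw [e, val_eq, val_eq]
  refine (sum_finset_eq_sum_insert i _).trans
    (Eq.trans ?_ (congrArg ((w i).2 * ·) (sum_finset_eq_sum_insert i _)).symm)
  simp only [Finset.mul_sum]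
  refine Finset.sum_congr rfl fun T _ => ?_
  by_cases hT : i ∈ T
  · simp [hT]
  · simp only [prod_ite_mem_update, prod_insert_compl]
    simp [hT, con]
    ring

theorem val_del (i : σ) (q : Finset σ → F) (w : σ → A × A) :
    val (del i q) w = (w i).2 * val q (update w i (0, 1)) := by
  have e : val (del i q) w = val (del i q) (update w i (w i)) := by rw [update_eq_self]
  rw [e, val_eq, val_eq]
  refine (sum_finset_eq_sum_insert i _).trans
    (Eq.trans ?_ (congrArg ((w i).2 * ·) (sum_finset_eq_sum_insert i _)).symm)
  simp only [Finset.mul_sum]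
  refine Finset.sum_congr rfl fun T _ => ?_
  by_cases hT : i ∈ T
  · simp [hT]
  · simp only [prod_ite_mem_update, prod_insert_compl]
    simp [hT, del]
    ring

/-- The coefficients of the restriction of a tensor to a vertex in one coordinate. -/
def slice (i : σ) (b : Bool) (q : Finset σ → F) : Finset σ → F := if b then con i q else del i q

theorem slice_of_mem {i : σ} {T : Finset σ} (h : i ∈ T) (b : Bool) (q : Finset σ → F) :
    slice i b q T = 0 := by
  cases b <;> simp [slice, con, del, h]

theorem slice_of_notMem {i : σ} {T : Finset σ} (h : i ∉ T) (b : Bool) (q : Finset σ → F) :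
    slice i b q T = q (if b then insert i T else T) := by
  cases b <;> simp [slice, con, del, h]

theorem val_slice (i : σ) (b : Bool) (q : Finset σ → F) (w : σ → A × A) :
    val (slice i b q) w = (w i).2 * val q (update w i (bv b)) := by
  cases b
  · exact val_del i q w
  · exact val_con i q w

theorem slice_comm {i j : σ} (h : i ≠ j) (b c : Bool) (q : Finset σ → F) :
    slice i b (slice j c q) = slice j c (slice i b q) := by
  cases b <;> cases c <;> simp only [slice, if_true, Bool.false_eq_true, if_false]
  · exact del_del _ _ _
  · exact (con_del _ _ _ h.symm).symm
  · exact con_del _ _ _ h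
  · exact con_con _ _ _ h

end Slices

theorem hdAt_swap_right {A : Type*} [CommRing A] [Algebra F A] (q : Finset σ → F) {i j k : σ}
    (hjk : j ≠ k) (w : σ → A × A) :
    hdAt q i j k w = hdAt q i k j w := by
  have e (x y z : Bool) : tri q i j k w (bv x) (bv y) (bv z) =
      tri q i k j w (bv x) (bv z) (bv y) := by
    simp only [tri, update_comm hjk]
  simp only [hdAt, hd, e]
  ring

theorem hdAt_swap_left {A : Type*} [CommRing A] [Algebra F A] (q : Finset σ → F) {i j k : σ}
    (hij : i ≠ j) (w : σ → A × A) :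
    hdAt q i j k w = hdAt q j i k w := by
  have e (x y z : Bool) : tri q i j k w (bv x) (bv y) (bv z) =
      tri q j i k w (bv y) (bv x) (bv z) := by
    simp only [tri, update_comm hij]
  simp only [hdAt, hd, e]
  ring

variable (F) in
/-- The weights `(x_l, 1)`. -/
noncomputable def affWeight (l : σ) : MvPolynomial σ F × MvPolynomial σ F := (X l, 1)

theorem val_affWeight (q : Finset σ → F) : val q (affWeight F) = multiaffine q := by
  rw [val_eq, multiaffine]
  refine Finset.sum_congr rfl fun T _ => ?_
  rw [Finset.prod_ite]
  simp [affWeight, algebraMap_eq]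

theorem tri_affWeight (q : Finset σ → F) {i j k : σ} (hij : i ≠ j) (hik : i ≠ k) (hjk : j ≠ k)
    (x y z : Bool) : tri q i j k (affWeight F) (bv x) (bv y) (bv z) =
      multiaffine (slice i x (slice j y (slice k z q))) := by
  rw [← val_affWeight, val_slice, val_slice, val_slice, tri]
  simp [affWeight, hij.symm, hik.symm, hjk.symm, update]

theorem degreeOf_multiaffine_slice (i : σ) (b : Bool) (q : Finset σ → F) :
    degreeOf i (multiaffine (slice i b q)) = 0 :=
  degreeOf_multiaffine_eq_zero fun _ hT => slice_of_mem hT b q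

theorem degreeOf_tri_affWeight (q : Finset σ → F) {i j k : σ} (hij : i ≠ j) (hik : i ≠ k)
    (hjk : j ≠ k) (x y z : Bool) :
    degreeOf k (tri q i j k (affWeight F) (bv x) (bv y) (bv z)) = 0 := by
  rw [tri_affWeight q hij hik hjk, slice_comm hjk, slice_comm hik]
  exact degreeOf_multiaffine_slice _ _ _

/-- Up to sign this is the 2 × 2 determinant of the slices in i and j, so x_i and x_j have
disappeared. -/
theorem rayleigh_eq_bilinear (q : Finset σ → F) {i j : σ} (h : i ≠ j) :
    rayleigh q i j = multiaffine (slice i true (slice j false q)) *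
      multiaffine (slice i false (slice j true q)) -
      multiaffine (slice i false (slice j false q)) *
      multiaffine (slice i true (slice j true q)) := by
  have e1 : con i (slice j true q) = slice i true (slice j true q) := rfl
  simp only [slice, if_true, Bool.false_eq_true, if_false]
  rw [rayleigh, multiaffine_eq_add j (con i q), multiaffine_eq_add i (con j q),
    multiaffine_eq_add i q, multiaffine_eq_add j (del i q), con_con j i q h.symm, 
    multiaffine_eq_add j (con i q), ← con_del i j q h, ← con_del j i q h.symm, del_del j i,
    con_con i j q h]
  ring

theorem degreeOf_mul_eq_zero {i : σ} {p r : MvPolynomial σ F} (hp : degreeOf i p = 0)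
    (hr : degreeOf i r = 0) : degreeOf i (p * r) = 0 := by
  have := degreeOf_mul_le i p r
  omega

theorem degreeOf_add_eq_zero {i : σ} {p r : MvPolynomial σ F} (hp : degreeOf i p = 0)
    (hr : degreeOf i r = 0) : degreeOf i (p + r) = 0 := by
  have := degreeOf_add_le i p r
  simp_all

theorem degreeOf_sub_eq_zero {i : σ} {p r : MvPolynomial σ F} (hp : degreeOf i p = 0)
    (hr : degreeOf i r = 0) : degreeOf i (p - r) = 0 := by
  have := degreeOf_sub_le i p r
  simp_all

/-- Each entry of the 2 × 2 determinant of slices is affine in x_k. The discriminant of the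
determinant of such a pencil is Cayley's hyperdeterminant, by Schläfli's construction. -/
theorem rayleigh_eq_quadratic (q : Finset σ → F) {i j k : σ} (hij : i ≠ j) (hik : i ≠ k)
    (hjk : j ≠ k) : ∃ A B D : MvPolynomial σ F, degreeOf k A = 0 ∧ degreeOf k B = 0 ∧
      degreeOf k D = 0 ∧ rayleigh q i j = A + B * X k + D * X k ^ 2 ∧
      hdAt q i j k (affWeight F) = B ^ 2 - 4 * A * D := by
  let u : Bool → Bool → Bool → MvPolynomial σ F := fun x y z =>
    tri q i j k (affWeight F) (bv x) (bv y) (bv z)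
  have hu (x y z) : degreeOf k (u x y z) = 0 := degreeOf_tri_affWeight q hij hik hjk x y z
  have e (x y : Bool) : multiaffine (slice i x (slice j y q)) =
      u x y false + X k * u x y true := by
    rw [multiaffine_eq_add k]
    simp only [u, tri_affWeight q hij hik hjk]
    rw [show del k (slice i x (slice j y q)) = slice k false (slice i x (slice j y q)) from rfl,
      show con k (slice i x (slice j y q)) = slice k true (slice i x (slice j y q)) from rfl,
      slice_comm hik.symm, slice_comm hjk.symm, slice_comm hik.symm, slice_comm hjk.symm]
  refine ⟨u true false false * u false true false - u false false false * u true true false,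
    u true false false * u false true true + u true false true * u false true false -
      u false false false * u true true true - u false false true * u true true false,
    u true false true * u false true true - u false false true * u true true true,
    ?_, ?_, ?_, ?_, ?_⟩
  · apply degreeOf_sub_eq_zero <;> apply degreeOf_mul_eq_zero <;> apply hu
  · apply degreeOf_sub_eq_zero
    · apply degreeOf_sub_eq_zero
      · apply degreeOf_add_eq_zero <;> apply degreeOf_mul_eq_zero <;> apply hu
      · apply degreeOf_mul_eq_zero <;> apply hu
    · apply degreeOf_mul_eq_zero <;> apply hu
  · apply degreeOf_sub_eq_zero <;> apply degreeOf_mul_eq_zero <;> apply hu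
  · rw [rayleigh_eq_bilinear q hij, e, e, e, e]
    ring
  · change hd u = _
    simp only [hd]
    ring

theorem rayleigh_comm (q : Finset σ → F) {i j : σ} (h : i ≠ j) :
    rayleigh q i j = rayleigh q j i := by
  simp only [rayleigh, con_con i j q h, mul_comm]

theorem degreeOf_rayleigh_le (q : Finset σ → F) (i j k : σ) : degreeOf k (rayleigh q i j) ≤ 2 := by
  have h (a b : Finset σ → F) : degreeOf k (multiaffine a * multiaffine b) ≤ 2 := by
    have h1 := degreeOf_mul_le k (multiaffine a) (multiaffine b)
    have h2 := degreeOf_multiaffine_le k a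
    have h3 := degreeOf_multiaffine_le k b
    omega
  exact (degreeOf_sub_le _ _ _).trans (max_le (h _ _) (h _ _))

theorem degreeOf_rayleigh_left (q : Finset σ → F) {i j : σ} (h : i ≠ j) :
    degreeOf i (rayleigh q i j) = 0 := by
  rw [rayleigh_eq_bilinear q h]
  apply degreeOf_sub_eq_zero <;> apply degreeOf_mul_eq_zero <;> apply degreeOf_multiaffine_slice

theorem degreeOf_rayleigh_right (q : Finset σ → F) {i j : σ} (h : i ≠ j) :
    degreeOf j (rayleigh q i j) = 0 := by
  rw [rayleigh_comm q h]
  exact degreeOf_rayleigh_left q h.symm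

theorem isHomogeneous_rayleigh {d : ℕ} {q : Finset σ → F} (h : IsHomTensor d q) (i j : σ) :
    (rayleigh q i j).IsHomogeneous (2 * (d - 1)) := by
  obtain _ | d := d
  · simp only [rayleigh, h.con_zero]
    have : con i (0 : Finset σ → F) = 0 := by funext T; simp [con]
    simp [this, isHomogeneous_zero]
  · have h1 := (h.con i).isHomogeneous.mul (h.con j).isHomogeneous
    have e1 : d + d = 2 * (d + 1 - 1) := by omega
    rw [e1] at h1
    refine h1.sub ?_
    obtain _ | d := d
    · rw [(h.con j).con_zero]
      simp [isHomogeneous_zero]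
    · have h2 := h.isHomogeneous.mul ((h.con j).con i).isHomogeneous
      convert h2 using 1
      omega

end Generic

/-! ### Recognising squares of multiaffine polynomials. -/

section Squares

open Function MvPolynomial

variable {σ : Type*} [DecidableEq σ] [Fintype σ] {F : Type*} [Field F]

theorem coeff_eq_zero_of_degreeOf_lt {i : σ} {p : MvPolynomial σ F} {e : σ →₀ ℕ}
    (h : degreeOf i p < e i) : coeff e p = 0 := by
  by_contra h0
  have := degreeOf_le_iff.1 (le_refl (degreeOf i p)) e (mem_support_iff.2 h0)
  omega

theorem eq_multiaffine_of_degreeOf_le_one {s : MvPolynomial σ F} (h : ∀ i, degreeOf i s ≤ 1) :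
    s = multiaffine fun T => coeff (∑ i ∈ T, Finsupp.single i 1) s := by
  ext e
  by_cases he : ∀ i, e i ≤ 1
  · have : e = ∑ i ∈ e.support, Finsupp.single i 1 := by
      ext i
      rw [sum_single_apply]
      have := he i
      split_ifs with h1
      · rw [Finsupp.mem_support_iff] at h1; omega
      · simpa using h1
    rw [this, coeff_multiaffine]
  · push Not at he
    obtain ⟨i, hi⟩ := he
    rw [coeff_eq_zero_of_degreeOf_lt (lt_of_le_of_lt (h i) hi),
      coeff_eq_zero_of_degreeOf_lt (lt_of_le_of_lt (degreeOf_multiaffine_le i _) hi)]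

theorem sum_single_two_apply (S : Finset σ) (i : σ) :
    (∑ j ∈ S, Finsupp.single j 2 : σ →₀ ℕ) i = if i ∈ S then 2 else 0 := by
  simp [Finsupp.finsetSum_apply, Finsupp.single_apply]

theorem coeff_multiaffine_mul_multiaffine (a b : Finset σ → F) (S : Finset σ) :
    coeff (∑ i ∈ S, Finsupp.single i 2) (multiaffine a * multiaffine b) = a S * b S := by
  rw [multiaffine_eq_sum_monomial, multiaffine_eq_sum_monomial, Finset.sum_mul_sum, coeff_sum]
  have key (T U : Finset σ) : (∑ i ∈ T, Finsupp.single i 1 + ∑ i ∈ U, Finsupp.single i 1 : σ →₀ ℕ)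
      = ∑ i ∈ S, Finsupp.single i 2 ↔ T = S ∧ U = S := by
    constructor
    · intro h
      have h' (i : σ) := DFunLike.congr_fun h i
      simp only [Finsupp.add_apply, sum_single_apply, sum_single_two_apply] at h'
      constructor <;>
      · ext i
        have := h' i
        split_ifs at this <;> simp_all
    · rintro ⟨rfl, rfl⟩
      ext i
      simp only [Finsupp.add_apply, sum_single_apply, sum_single_two_apply]
      split_ifs <;> rfl
  rw [Finset.sum_eq_single S, coeff_sum, Finset.sum_eq_single S]
  · rw [monomial_mul, coeff_monomial, if_pos ((key S S).2 ⟨rfl, rfl⟩)]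
  · intro U _ hU
    rw [monomial_mul, coeff_monomial, if_neg fun h => hU ((key S U).1 h).2]
  · simp
  · intro T _ hT
    rw [coeff_sum]
    refine Finset.sum_eq_zero fun U _ => ?_
    rw [monomial_mul, coeff_monomial, if_neg fun h => hT ((key T U).1 h).1]
  · simp

/-- The products of coefficients of `q` at two subsets differing by an exchange are squares. -/
def HasSquareExchanges (q : Finset σ → F) : Prop :=
  ∀ (i j : σ) (S : Finset σ), i ∉ S → j ∉ S → IsSquare (q (insert i S) * q (insert j S))

/-- The coefficient of x^{2S} is q_{S∪i} q_{S∪j} − q_S q_{S∪ij}, up to zero conventions, and the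
second product vanishes because its sets have different sizes. So these coefficients are the
products in condition (i). -/
theorem isSquare_coeff_rayleigh {d : ℕ} {q : Finset σ → F} (hom : IsHomTensor d q)
    (hq : HasSquareExchanges q) (i j : σ) (S : Finset σ) :
    IsSquare (coeff (∑ i ∈ S, Finsupp.single i 2) (rayleigh q i j)) := by
  rw [rayleigh, coeff_sub, coeff_multiaffine_mul_multiaffine, coeff_multiaffine_mul_multiaffine]
  have h : q S * con i (con j q) S = 0 := by
    by_contra h
    have h1 := hom S (left_ne_zero_of_mul h)
    have h2 := right_ne_zero_of_mul h
    simp only [con] at h2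
    split_ifs at h2 with hi hj
    · exact h2 rfl
    · exact h2 rfl
    · have h3 := hom _ h2
      rw [Finset.card_insert_of_notMem hj, Finset.card_insert_of_notMem hi] at h3
      omega
  rw [h, sub_zero]
  simp only [con]
  split_ifs with hi hj hj
  · simp
  · simp
  · simp
  · exact hq i j S hi hj

/-- The root s is multiaffine, and at a set S in its support the coefficient of x^{2S} is c times a
nonzero square, so c is a square. -/
theorem isSquare_of_eq_C_mul_sq {p s : MvPolynomial σ F} {c : F} (h : p = C c * s ^ 2)
    (hp : ∀ i, degreeOf i p ≤ 2)
    (hc : ∀ S : Finset σ, IsSquare (coeff (∑ i ∈ S, Finsupp.single i 2) p)) : IsSquare p := by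
  by_cases hp0 : p = 0
  · simp [hp0]
  have hs0 : s ≠ 0 := by rintro rfl; simp [h] at hp0
  have hc0 : c ≠ 0 := by rintro rfl; simp [h] at hp0
  have hs (i : σ) : degreeOf i s ≤ 1 := by
    have := hp i
    rw [h, sq, degreeOf_mul_eq (by simpa using hc0) (mul_ne_zero hs0 hs0),
      degreeOf_mul_eq hs0 hs0] at this
    omega
  obtain ⟨s', rfl⟩ : ∃ s', s = multiaffine s' := ⟨_, eq_multiaffine_of_degreeOf_le_one hs⟩
  have : s' ≠ 0 := by rintro rfl; simp at hs0
  obtain ⟨S, hS⟩ := Function.ne_iff.1 this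
  obtain ⟨r, hr⟩ := hc S
  rw [h, sq, coeff_C_mul, coeff_multiaffine_mul_multiaffine] at hr
  have hS' : s' S ≠ 0 := hS
  have : c = (r / s' S) ^ 2 := by
    field_simp
    linear_combination hr
  rw [h, this, map_pow, ← mul_pow]
  exact IsSquare.sq _

/-- In characteristic two a sum of squares of monomials is the square of their sum. -/
theorem isSquare_of_even_exponents {p : MvPolynomial σ F} (h2 : (2 : F) = 0)
    (hp : ∀ e, coeff e p ≠ 0 → ∀ i, e i = 0 ∨ e i = 2)
    (hc : ∀ S : Finset σ, IsSquare (coeff (∑ i ∈ S, Finsupp.single i 2) p)) : IsSquare p := by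
  choose r hr using hc
  refine ⟨multiaffine r, ?_⟩
  have : CharP F 2 := CharTwo.of_one_ne_zero_of_two_eq_zero one_ne_zero h2
  rw [← sq, multiaffine_eq_sum_monomial, CharTwo.sum_sq]
  ext e
  rw [coeff_sum]
  have hm (T : Finset σ) : 2 • (∑ i ∈ T, Finsupp.single i 1 : σ →₀ ℕ) =
      ∑ i ∈ T, Finsupp.single i 2 := by
    ext i
    simp only [Finsupp.smul_apply, sum_single_apply, sum_single_two_apply]
    split_ifs <;> rfl
  simp only [monomial_pow, hm, coeff_monomial]
  by_cases he : ∃ S : Finset σ, e = ∑ i ∈ S, Finsupp.single i 2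
  · obtain ⟨S, rfl⟩ := he
    rw [Finset.sum_eq_single S, if_pos rfl, hr, sq]
    · intro T _ hT
      rw [if_neg]
      intro h
      apply hT
      ext i
      have := DFunLike.congr_fun h i
      simp only [sum_single_two_apply] at this
      split_ifs at this <;> simp_all
    · simp
  · rw [Finset.sum_eq_zero]
    · by_contra h0
      refine he ⟨e.support, ?_⟩
      ext i
      rw [sum_single_two_apply]
      have := hp e h0 i
      simp only [Finsupp.mem_support_iff]
      split_ifs <;> omega
    · intro T _
      rw [if_neg fun h => he ⟨T, h.symm⟩]

/-- Completing the square gives 4D · p = (2D x_k + B)². If D = 0, then B = 0 too, so p is free of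
x_k and p · p serves. -/
theorem exists_isSquare_mul_of_quadratic (h2 : (2 : F) ≠ 0) {k : σ} {A B D p : MvPolynomial σ F}
    (hA : degreeOf k A = 0) (hD : degreeOf k D = 0)
    (hp : p = A + B * X k + D * X k ^ 2) (h : B ^ 2 - 4 * A * D = 0) (h0 : p ≠ 0) :
    ∃ c : MvPolynomial σ F, c ≠ 0 ∧ degreeOf k c = 0 ∧ IsSquare (c * p) := by
  have h4 : (4 : MvPolynomial σ F) = C 4 := (map_ofNat C 4).symm
  have h40 : (4 : F) ≠ 0 := by
    rw [show (4 : F) = 2 * 2 by norm_num]; exact mul_ne_zero h2 h2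
  by_cases hD0 : D = 0
  · subst hD0
    have hB : B = 0 := by simpa using h
    subst hB
    have hpA : p = A := by simpa using hp
    exact ⟨p, h0, by rw [hpA, hA], p, rfl⟩
  · refine ⟨C 4 * D, mul_ne_zero (by simpa using h40) hD0, ?_, 2 * D * X k + B, ?_⟩
    · exact degreeOf_mul_eq_zero (by simp) hD
    · rw [← h4, hp]
      linear_combination -h

/-- Strip squares of primes by descent on the degree: a prime r involving x_k has r² ∣ c·p, and it
cannot divide a nonzero c free of x_k, so r² ∣ p. The hypothesis passes to the quotient. -/
theorem exists_eq_mul_sq {P : Set σ} {p : MvPolynomial σ F} (h0 : p ≠ 0)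
    (h : ∀ k ∈ P, ∃ c : MvPolynomial σ F, c ≠ 0 ∧ degreeOf k c = 0 ∧ IsSquare (c * p)) :
    ∃ u s : MvPolynomial σ F, p = u * s ^ 2 ∧ ∀ k ∈ P, degreeOf k u = 0 := by
  induction hn : p.totalDegree using Nat.strong_induction_on generalizing p with
  | _ n ih =>
  by_cases hk : ∀ k ∈ P, degreeOf k p = 0
  · exact ⟨p, 1, by simp, hk⟩
  push Not at hk
  obtain ⟨k, hkP, hk⟩ := hk
  obtain ⟨r, hr, hrp, hrk⟩ : ∃ r, Prime r ∧ r ∣ p ∧ degreeOf k r ≠ 0 := by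
    clear ih h hn
    induction p using UniqueFactorizationMonoid.induction_on_prime with
    | h₁ => exact absurd rfl h0
    | h₂ x hx =>
      obtain ⟨c, -, rfl⟩ := (MvPolynomial.isUnit_iff_eq_C_of_isReduced.1 hx)
      exact absurd (by simp [degreeOf_C]) hk
    | h₃ a r ha hr ih =>
      by_cases hrk : degreeOf k r = 0
      · rw [degreeOf_mul_eq hr.ne_zero ha, hrk, zero_add] at hk
        obtain ⟨r', h1, h2, h3⟩ := ih ha hk
        exact ⟨r', h1, h2.mul_left _, h3⟩
      · exact ⟨r, hr, dvd_mul_right _ _, hrk⟩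
  have hsq : r ^ 2 ∣ p := by
    obtain ⟨c, hc0, hck, t, ht⟩ := h k hkP
    have hrt : r ∣ t := by
      have : r ∣ t * t := ht ▸ hrp.mul_left c
      exact (hr.dvd_or_dvd this).elim id id
    have hcp : r ^ 2 ∣ c * p := by
      rw [ht, ← sq]
      exact pow_dvd_pow_of_dvd hrt 2
    exact (hr.pow_dvd_of_dvd_mul_left 2 (not_dvd_of_degreeOf_eq_zero hrk hck hc0)) hcp
  obtain ⟨p', rfl⟩ := hsq
  have hp' : p' ≠ 0 := right_ne_zero_of_mul h0
  have hlt : p'.totalDegree < n := by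
    rw [← hn, totalDegree_mul_of_isDomain (pow_ne_zero 2 hr.ne_zero) hp', sq,
      totalDegree_mul_of_isDomain hr.ne_zero hr.ne_zero]
    have : r.totalDegree ≠ 0 := by
      intro h
      have := degreeOf_le_totalDegree r k
      omega
    omega
  obtain ⟨u, s, hus, hu⟩ := ih _ hlt hp' (by
    intro l hl
    obtain ⟨c, hc0, hcl, t, ht⟩ := h l hl
    have hrt : r ∣ t := by
      have : r ∣ t * t := by
        rw [← ht]
        exact ⟨c * (r * p'), by ring⟩
      exact (hr.dvd_or_dvd this).elim id id
    obtain ⟨t', rfl⟩ := hrt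
    refine ⟨c, hc0, hcl, t', ?_⟩
    refine mul_left_cancel₀ (pow_ne_zero 2 hr.ne_zero) ?_
    linear_combination ht) rfl
  exact ⟨u, r * s, by rw [hus]; ring, hu⟩

end Squares

/-! ### Homogeneity, and the equivalence of squares with vanishing discriminants. -/

section Homogeneous

open Function MvPolynomial

variable {σ : Type*} [DecidableEq σ] [Fintype σ] {F : Type*} [Field F]

theorem aeval_mul_of_isHomogeneous {A : Type*} [CommRing A] [Algebra F A] {N : ℕ}
    {p : MvPolynomial σ F} (h : p.IsHomogeneous N) (t : A) (y : σ → A) :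
    aeval (fun l => t * y l) p = t ^ N * aeval y p := by
  rw [aeval_def, aeval_def, eval₂_eq', eval₂_eq', Finset.mul_sum]
  refine Finset.sum_congr rfl fun e he => ?_
  have : ∑ i, e i = N := by
    rw [← Finsupp.degree_eq_sum]
    by_contra hne
    exact (mem_support_iff.1 he) (h.coeff_eq_zero hne)
  simp only [mul_pow, Finset.prod_mul_distrib, Finset.prod_pow_eq_pow_sum, this]
  ring

theorem aeval_eq_of_degreeOf_eq_zero {A : Type*} [CommRing A] [Algebra F A] {u : MvPolynomial σ F}
    {n : σ} (hu : ∀ k, k ≠ n → degreeOf k u = 0) {y z : σ → A} (h : y n = z n) :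
    aeval y u = aeval z u := by
  rw [aeval_def, aeval_def]
  refine eval₂Hom_congr' (f₁ := algebraMap F A) (f₂ := algebraMap F A) rfl (fun j hj _ => ?_) rfl
  by_cases hjn : j = n
  · rw [hjn, h]
  · exact absurd (hu j hjn) (mem_vars_iff_degreeOf_ne_zero.1 hj)

/-- Evaluate at x_l / x_n. The factor u involves only x_n and becomes the constant u(1), while
homogeneity restores p as x_n^{2e} times the value; an even power of x_n joins the square. -/
theorem exists_eq_C_mul_sq_of_isHomogeneous {e : ℕ} {p u s : MvPolynomial σ F}
    (hp : p.IsHomogeneous (2 * e)) (hus : p = u * s ^ 2) {n : σ}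
    (hu : ∀ k, k ≠ n → degreeOf k u = 0) : ∃ (c : F) (r : MvPolynomial σ F), p = C c * r ^ 2 := by
  let K := FractionRing (MvPolynomial σ F)
  let ι : MvPolynomial σ F →ₐ[F] K := IsScalarTower.toAlgHom F (MvPolynomial σ F) K
  have hι : Injective ι := IsFractionRing.injective (MvPolynomial σ F) K
  have hX : ι (X n) ≠ 0 := by
    rw [Ne, map_eq_zero_iff ι hι]; exact X_ne_zero n
  let y : σ → K := fun l => ι (X l) / ι (X n)
  have hy : ι p = ι (X n) ^ (2 * e) * aeval y p := by
    rw [← aeval_mul_of_isHomogeneous hp]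
    have : (fun l => ι (X n) * y l) = fun l => ι (X l) := by
      funext l; simp only [y]; rw [mul_div_cancel₀ _ hX]
    rw [this, ← comp_aeval_apply, aeval_X_left_apply]
  let c : F := aeval (fun _ => (1 : F)) u
  have hc : aeval y u = algebraMap F K c := by
    rw [aeval_eq_of_degreeOf_eq_zero hu (z := fun _ => (1 : K)) (by simp [y, hX])]
    have := comp_aeval_apply (R := F) (fun _ : σ => (1 : F)) (Algebra.ofId F K) u
    rw [← Algebra.ofId_apply, this]
    simp
  have hpc : ι p = algebraMap F K c * (ι (X n) ^ e * aeval y s) ^ 2 := by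
    rw [hy]
    conv_lhs => rw [hus]
    rw [map_mul, map_pow, hc]
    ring
  by_cases hc0 : c = 0
  · refine ⟨0, 0, ?_⟩
    apply hι
    rw [hpc, hc0]; simp
  set v := ι (X n) ^ e * aeval y s with hv
  have hc0' : algebraMap F K c ≠ 0 := by simpa using hc0
  have hCc : ι (C c) = algebraMap F K c := by
    rw [← algebraMap_eq]; exact ι.commutes c
  have hv2 : v ^ 2 = algebraMap (MvPolynomial σ F) K (C c⁻¹ * p) := by
    change _ = ι (C c⁻¹ * p)
    rw [map_mul, hpc, ← mul_assoc, ← hCc, ← map_mul, ← C_mul, inv_mul_cancel₀ hc0]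
    simp
  -- The root lives in the fraction field, but its square is a polynomial, so it is integral and
  -- hence itself a polynomial.
  obtain ⟨r, hr⟩ := IsIntegrallyClosed.exists_algebraMap_eq_of_isIntegral_pow
    (R := MvPolynomial σ F) (K := K) (x := v) (n := 2) (by norm_num)
    (by rw [hv2]; exact isIntegral_algebraMap)
  refine ⟨c, r, hι ?_⟩
  rw [hpc, map_mul, map_pow, hCc, ← hr]
  rfl

theorem coeff_eq_zero_of_quadratic {k : σ} {A D : MvPolynomial σ F}
    (hA : degreeOf k A = 0) {e : σ →₀ ℕ} (he : e k = 1) :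
    coeff e (A + D * X k ^ 2) = 0 := by
  rw [coeff_add, coeff_eq_zero_of_degreeOf_lt (i := k) (by omega), zero_add, X_pow_eq_monomial,
    coeff_mul_monomial', if_neg]
  intro h
  have := h k
  simp only [Finsupp.single_eq_same] at this
  omega

/-- No hyperdeterminant in the direction n is needed: the even degree of the Rayleigh difference
controls x_n. -/
theorem isSquare_rayleigh_of_hdAt {d : ℕ} {q : Finset σ → F} (hom : IsHomTensor d q)
    (hq : HasSquareExchanges q) {i j : σ} (hij : i ≠ j) (n : σ)
    (h : ∀ k, k ≠ i → k ≠ j → k ≠ n → hdAt q i j k (affWeight F) = 0) :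
    IsSquare (rayleigh q i j) := by
  by_cases h0 : rayleigh q i j = 0
  · simp [h0]
  have hhom := isHomogeneous_rayleigh hom i j
  by_cases h2 : (2 : F) = 0
  · refine isSquare_of_even_exponents h2 (fun e he => ?_) (isSquare_coeff_rayleigh hom hq i j)
    have hle (k : σ) : e k ≤ 2 := by
      by_contra hk
      exact he (coeff_eq_zero_of_degreeOf_lt
        (lt_of_le_of_lt (degreeOf_rayleigh_le q i j k) (not_le.1 hk)))
    have hne (k : σ) (hk : k ≠ n) : e k = 0 ∨ e k = 2 := by
      by_contra hcon
      have h1 : e k = 1 := by have := hle k; omega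
      by_cases hki : k = i
      · subst hki
        exact he (coeff_eq_zero_of_degreeOf_lt (i := k)
          (by rw [degreeOf_rayleigh_left q hij]; omega))
      by_cases hkj : k = j
      · subst hkj
        exact he (coeff_eq_zero_of_degreeOf_lt (i := k)
          (by rw [degreeOf_rayleigh_right q hij]; omega))
      obtain ⟨A, B, D, hA, hB, hD, hp, hd⟩ := rayleigh_eq_quadratic q hij (Ne.symm hki)
        (Ne.symm hkj)
      rw [h k hki hkj hk] at hd
      have h4 : (4 : MvPolynomial σ F) = 0 := by
        rw [show (4 : MvPolynomial σ F) = C (2 * 2) by rw [C_mul, map_ofNat]; norm_num, h2]; simp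
      -- In characteristic two the discriminant is B², so x_k cannot occur with exponent one.
      have hB0 : B = 0 := by simpa [h4] using hd.symm
      rw [hB0, zero_mul, add_zero] at hp
      rw [hp] at he
      exact he (coeff_eq_zero_of_quadratic hA h1)
    have hsum : ∑ k, e k = 2 * (d - 1) := by
      rw [← Finsupp.degree_eq_sum]
      by_contra hne
      exact he (hhom.coeff_eq_zero hne)
    -- All other exponents are even and the total degree is even, so the exponent of x_n is even as
    -- well.
    have hev : Even (∑ k ∈ {n}ᶜ, e k) := by
      refine Finset.even_sum _ fun k hk => ?_
      rcases hne k (by simpa using hk) with h | h <;> rw [h] <;> decide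
    rw [Fintype.sum_eq_add_sum_compl n] at hsum
    intro k
    by_cases hk : k = n
    · subst hk
      have := hle k
      obtain ⟨r, hr⟩ := hev
      omega
    · exact hne k hk
  · obtain ⟨u, s, hus, hu⟩ := exists_eq_mul_sq (P := {k | k ≠ n}) h0 (by
      intro k hk
      by_cases hki : k = i
      · subst hki
        exact ⟨_, h0, degreeOf_rayleigh_left q hij, _, rfl⟩
      by_cases hkj : k = j
      · subst hkj
        exact ⟨_, h0, degreeOf_rayleigh_right q hij, _, rfl⟩
      obtain ⟨A, B, D, hA, hB, hD, hp, hd⟩ := rayleigh_eq_quadratic q hij (Ne.symm hki)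
        (Ne.symm hkj)
      rw [h k hki hkj hk] at hd
      exact exists_isSquare_mul_of_quadratic h2 hA hD hp hd.symm h0)
    obtain ⟨c, r, hcr⟩ := exists_eq_C_mul_sq_of_isHomogeneous hhom hus (n := n) (fun k hk => hu k hk)
    exact isSquare_of_eq_C_mul_sq hcr (degreeOf_rayleigh_le q i j)
      (isSquare_coeff_rayleigh hom hq i j)

theorem eq_zero_of_quadratic_eq_zero {k : σ} {A B D : MvPolynomial σ F} (hA : degreeOf k A = 0)
    (hB : degreeOf k B = 0) (h : A + B * X k + D * X k ^ 2 = 0) :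
    A = 0 ∧ B = 0 ∧ D = 0 := by
  have hX : zeroAt k (X k : MvPolynomial σ F) = 0 := by simp [zeroAt]
  have hX0 : (X k : MvPolynomial σ F) ≠ 0 := X_ne_zero k
  have h1 : A = 0 := by
    have := congrArg (zeroAt k) h
    simpa [hX, zeroAt_eq_self hA] using this
  subst h1
  have h2 : B + D * X k = 0 := by
    refine (mul_eq_zero.1 (?_ : X k * (B + D * X k) = 0)).resolve_left hX0
    linear_combination h
  have h3 : B = 0 := by
    have := congrArg (zeroAt k) h2
    simpa [hX, zeroAt_eq_self hB] using this
  subst h3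
  refine ⟨rfl, rfl, ?_⟩
  rw [zero_add] at h2
  exact (mul_eq_zero.1 h2).resolve_right hX0

/-- The root is affine in x_k, so the quadratic is (α + β x_k)² and its discriminant (2αβ)² − 4α²β²
is zero. -/
theorem hdAt_affWeight_eq_zero_of_isSquare {q : Finset σ → F} {i j k : σ} (hij : i ≠ j)
    (hik : i ≠ k) (hjk : j ≠ k) (h : IsSquare (rayleigh q i j)) :
    hdAt q i j k (affWeight F) = 0 := by
  obtain ⟨A, B, D, hA, hB, hD, hp, hd⟩ := rayleigh_eq_quadratic q hij hik hjk
  obtain ⟨s, hs⟩ := h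
  have hs1 (i' : σ) : degreeOf i' s ≤ 1 := by
    by_cases hs0 : s = 0
    · simp [hs0]
    have := degreeOf_rayleigh_le q i j i'
    rw [hs, degreeOf_mul_eq hs0 hs0] at this
    omega
  rw [hp, eq_multiaffine_of_degreeOf_le_one hs1, multiaffine_eq_add k] at hs
  set α := multiaffine (del k fun T => coeff (∑ i ∈ T, Finsupp.single i 1) s)
  set β := multiaffine (con k fun T => coeff (∑ i ∈ T, Finsupp.single i 1) s)
  have hα : degreeOf k α = 0 := degreeOf_multiaffine_del _ _
  have hβ : degreeOf k β = 0 := degreeOf_multiaffine_con _ _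
  obtain ⟨h1, h2, h3⟩ := eq_zero_of_quadratic_eq_zero (k := k) (A := A - α * α)
    (B := B - C 2 * (α * β)) (D := D - β * β)
    (degreeOf_sub_eq_zero hA (degreeOf_mul_eq_zero hα hα))
    (degreeOf_sub_eq_zero hB (degreeOf_mul_eq_zero (by simp) (degreeOf_mul_eq_zero hα hβ)))
    (by rw [map_ofNat]; linear_combination hs)
  rw [map_ofNat] at h2
  rw [hd, sub_eq_zero.1 h1, sub_eq_zero.1 h2, sub_eq_zero.1 h3]
  ring

theorem isSquare_rayleigh_of_forall_hdAt {d : ℕ} {q : Finset σ → F} (hom : IsHomTensor d q)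
    (hq : HasSquareExchanges q) (n : σ) (h : ∀ i j k, i ≠ j → i ≠ k → j ≠ k → i ≠ n → j ≠ n → k ≠ n →
      hdAt q i j k (affWeight F) = 0) {i j : σ} (hij : i ≠ j) : IsSquare (rayleigh q i j) := by
  have h1 (i j : σ) (hij : i ≠ j) (hi : i ≠ n) (hj : j ≠ n) : IsSquare (rayleigh q i j) :=
    isSquare_rayleigh_of_hdAt hom hq hij n fun k hki hkj hk => h i j k hij hki.symm hkj.symm hi hj hk
  -- The hyperdeterminant is symmetric in its three directions, so the discriminant of R_in in x_k
  -- is that of R_ik in x_n, and R_ik is already known to be a square.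
  have h2 (i : σ) (hi : i ≠ n) : IsSquare (rayleigh q i n) :=
    isSquare_rayleigh_of_hdAt hom hq hi n fun k hki hkn _ => by
      rw [hdAt_swap_right q hkn.symm]
      exact hdAt_affWeight_eq_zero_of_isSquare hki.symm hi hkn (h1 i k hki.symm hi hkn)
  by_cases hi : i = n
  · subst hi
    rw [rayleigh_comm q hij]
    exact h2 j hij.symm
  by_cases hj : j = n
  · subst hj
    exact h2 i hi
  · exact h1 i j hij hi hj

end Homogeneous

/-! ### Hyperdeterminants at generic weights. -/

section GenericVanishing

open Function MvPolynomial

variable {σ : Type*} [DecidableEq σ] [Fintype σ] {F : Type*} [Field F]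

theorem hdAt_congr {A : Type*} [CommRing A] [Algebra F A] (q : Finset σ → F) {i j k : σ}
    {w w' : σ → A × A} (h : ∀ l, l ≠ i → l ≠ j → l ≠ k → w l = w' l) :
    hdAt q i j k w = hdAt q i j k w' := by
  have e (a b c : A × A) : tri q i j k w a b c = tri q i j k w' a b c := by
    rw [tri, tri]
    congr 1
    funext l
    by_cases hk : l = k
    · subst hk; simp
    by_cases hj : l = j
    · subst hj; simp [hk]
    by_cases hi : l = i
    · subst hi; simp [hk, hj]
    simp [hi, hj, hk, h l hi hj hk]
  simp only [hdAt, e]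

variable (F) in
/-- The generic weights `(x_l, y_l)`. -/
noncomputable def genWeight (l : σ) : MvPolynomial (σ × Bool) F × MvPolynomial (σ × Bool) F :=
  (X (l, true), X (l, false))

/-- All the hyperdeterminants of `q` vanish identically. -/
def Good (q : Finset σ → F) : Prop :=
  ∀ i j k : σ, i ≠ j → i ≠ k → j ≠ k → hdAt q i j k (genWeight F) = 0

theorem aeval_hdAt_genWeight {A : Type*} [CommRing A] [Algebra F A] (q : Finset σ → F)
    (i j k : σ) (w : σ → A × A) :
    aeval (fun x : σ × Bool => if x.2 then (w x.1).1 else (w x.1).2) (hdAt q i j k (genWeight F)) =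
      hdAt q i j k w := by
  rw [map_hdAt]
  simp [genWeight]

theorem Good.hdAt_eq_zero {q : Finset σ → F} (h : Good q) {A : Type*} [CommRing A] [Algebra F A]
    {i j k : σ} (hij : i ≠ j) (hik : i ≠ k) (hjk : j ≠ k) (w : σ → A × A) :
    hdAt q i j k w = 0 := by
  rw [← aeval_hdAt_genWeight, h i j k hij hik hjk, map_zero]

theorem Good.pg {q : Finset σ → F} (h : Good q) : PG q :=
  fun _ _ _ hij hik hjk w => h.hdAt_eq_zero hij hik hjk w

theorem good_of_forall_hdAt_eq_zero {q : Finset σ → F} (Ω : Type*) [Field Ω] [Infinite Ω]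
    [Algebra F Ω] (h : ∀ i j k : σ, i ≠ j → i ≠ k → j ≠ k → ∀ w : σ → Ω × Ω,
      hdAt q i j k w = 0) : Good q := by
  intro i j k hij hik hjk
  apply map_injective (algebraMap F Ω) (algebraMap F Ω).injective
  rw [map_zero]
  refine MvPolynomial.funext fun x => ?_
  rw [map_zero, eval_map, ← aeval_def]
  have := aeval_hdAt_genWeight q i j k fun l => (x (l, true), x (l, false))
  rw [h i j k hij hik hjk] at this
  rw [← this]
  congr 2
  funext ⟨l, b⟩
  cases b <;> simp

/-- The hyperdeterminant is homogeneous in each weight, so vanishing on the affine chart (x_l, 1)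
implies vanishing at (x_l, y_l). -/
theorem good_of_affWeight {q : Finset σ → F}
    (h : ∀ i j k : σ, i ≠ j → i ≠ k → j ≠ k → hdAt q i j k (affWeight F) = 0) : Good q := by
  intro i j k hij hik hjk
  let K := FractionRing (MvPolynomial (σ × Bool) F)
  let ι : MvPolynomial (σ × Bool) F →ₐ[F] K :=
    IsScalarTower.toAlgHom F (MvPolynomial (σ × Bool) F) K
  have hι : Injective ι := IsFractionRing.injective (MvPolynomial (σ × Bool) F) K
  have hX (x : σ × Bool) : ι (X x) ≠ 0 := by
    rw [Ne, map_eq_zero_iff ι hι]; exact X_ne_zero x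
  apply hι
  rw [map_zero, map_hdAt]
  let c : σ → K := fun l => if l = i ∨ l = j ∨ l = k then 1 else ι (X (l, false))
  let y : σ → K := fun l => ι (X (l, true)) / ι (X (l, false))
  rw [hdAt_congr q (w' := fun l => c l • ((y l, 1) : K × K)), hdAt_smul q c]
  · have := map_hdAt (aeval y) q i j k (affWeight F)
    rw [h i j k hij hik hjk, map_zero] at this
    simp only [affWeight, aeval_X, map_one] at this
    rw [← this, mul_zero]
  · simp [c]
  · simp [c]
  · simp [c]
  · intro l hi hj hk
    simp only [c, hi, hj, hk, or_self, if_false, genWeight, y, Prod.smul_mk, smul_eq_mul, mul_one]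
    rw [mul_div_cancel₀ _ (hX _)]

theorem IsHomTensor.val_smul_fst {A : Type*} [CommRing A] [Algebra F A] {d : ℕ} {q : Finset σ → F}
    (h : IsHomTensor d q) (t : A) (w : σ → A × A) :
    val q (fun l => (t * (w l).1, (w l).2)) = t ^ d * val q w := by
  rw [val_eq, val_eq, Finset.mul_sum]
  refine Finset.sum_congr rfl fun T _ => ?_
  by_cases hT : q T = 0
  · simp [hT]
  rw [← h T hT]
  have : (∏ l, if l ∈ T then t * (w l).1 else (w l).2) =
      (∏ l, if l ∈ T then t else 1) * ∏ l, if l ∈ T then (w l).1 else (w l).2 := by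
    rw [← Finset.prod_mul_distrib]
    refine Finset.prod_congr rfl fun l _ => ?_
    split_ifs <;> simp
  rw [this, Finset.prod_ite_mem, Finset.univ_inter, Finset.prod_const]
  ring

/-- Scaling the first component of all vectors multiplies a degree-d form by t^d. The bases `E` undo
the scaling in the three free directions at the cost of determinants. -/
theorem IsHomTensor.hdAt_scale {K : Type*} [Field K] [Algebra F K] {d : ℕ} {q : Finset σ → F}
    (h : IsHomTensor d q) {i j k : σ} (hij : i ≠ j) (hik : i ≠ k) (hjk : j ≠ k) {t : K}
    (ht : t ≠ 0) (w : σ → K × K) (hw : hdAt q i j k w = 0) :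
    hdAt q i j k (fun l => (t * (w l).1, (w l).2)) = 0 := by
  let E : Bool → K × K := fun b => if b then (t⁻¹, 0) else (0, 1)
  have e (x y z : Bool) : tri q i j k (fun l => (t * (w l).1, (w l).2)) (bv x) (bv y) (bv z) =
      t ^ d * tri q i j k w (E x) (E y) (E z) := by
    rw [tri, tri, ← h.val_smul_fst]
    congr 1
    have hE (x : Bool) : (t * (E x).1, (E x).2) = bv x := by cases x <;> simp [E, ht]
    funext l
    by_cases hk : l = k
    · subst hk; simp [hE]
    by_cases hj : l = j
    · subst hj; simp [hk, hE]
    by_cases hi : l = i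
    · subst hi; simp [hk, hj, hE]
    simp [hi, hj, hk]
  have h2 := hd_tri q hij hik hjk w E E E
  rw [hw, mul_zero] at h2
  simp only [hdAt, hd, e] at h2 ⊢
  linear_combination (t ^ d) ^ 4 * h2

end GenericVanishing

/-! ### Dehomogenising at the last coordinate. -/

section AssocVec

open Function MvPolynomial

variable {F : Type*} [Field F] {d m : ℕ} {A : Type*} [CommRing A] [Algebra F A]

theorem assocVec_eq_add (q : Subsets d (m + 1) → F) (S : Finset (Fin m)) :
    assocVec q S = extTensor q (S.map Fin.castSuccEmb) +
      extTensor q (insert (Fin.last m) (S.map Fin.castSuccEmb)) := by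
  have h := Finset.card_insert_of_notMem (last_notMem S)
  rw [Finset.card_map] at h
  unfold assocVec extTensor
  by_cases h1 : S.card = d
  · have h2 : ¬ (insert (Fin.last m) (S.map Fin.castSuccEmb)).card = d := by omega
    rw [dif_pos h1, dif_pos (by rw [Finset.card_map, h1]), dif_neg h2, add_zero]
  · by_cases h2 : S.card + 1 = d
    · rw [dif_neg h1, dif_pos h2, dif_neg (by rwa [Finset.card_map]), dif_pos (by omega), zero_add]
    · rw [dif_neg h1, dif_neg h2, dif_neg (by rwa [Finset.card_map]), dif_neg (by omega), zero_add]

/-- Passing to `assocVec` is evaluation of the last coordinate at (1,1): sets with and without the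
last index are added together. -/
theorem val_assocVec (q : Subsets d (m + 1) → F) (w : Fin m → A × A) :
    val (assocVec q) w = val (extTensor q) (Fin.snoc (α := fun _ => A × A) w (1, 1)) := by
  rw [val_eq, val_eq]
  refine Eq.trans ?_ (sum_finset_eq_sum_insert (Fin.last m) _).symm
  refine Fintype.sum_of_injective (fun S : Finset (Fin m) => S.map Fin.castSuccEmb)
    (Finset.map_injective _) _ _ ?_ ?_
  · intro T hT
    rw [if_pos]
    by_contra hl
    refine hT ⟨Finset.univ.filter fun i => i.castSucc ∈ T, ?_⟩
    ext i
    refine Fin.lastCases ?_ (fun i => ?_) i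
    · simp [hl]
    · simp
  · intro S
    rw [if_neg (last_notMem S), assocVec_eq_add, map_add, add_mul]
    simp [Fin.prod_univ_castSucc]

theorem hdAt_assocVec (q : Subsets d (m + 1) → F) (i j k : Fin m) (w : Fin m → A × A) :
    hdAt (assocVec q) i j k w = hdAt (extTensor q) i.castSucc j.castSucc k.castSucc
      (Fin.snoc (α := fun _ => A × A) w (1, 1)) := by
  simp only [hdAt, tri, val_assocVec, Fin.snoc_update]

/-- The weights (x_l, 1) arise from (x_l / x_n, 1), whose last entry is (1,1), by scaling first
components by x_n; homogeneity of `q` shows that this preserves vanishing. -/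
theorem hdAt_extTensor_eq_zero (q : Subsets d (m + 1) → F) :
    Good (assocVec q) → ∀ i j k : Fin (m + 1), i ≠ j → i ≠ k → j ≠ k → i ≠ Fin.last m →
      j ≠ Fin.last m → k ≠ Fin.last m → hdAt (extTensor q) i j k (affWeight F) = 0 := by
  intro h i j k hij hik hjk hi hj hk
  obtain ⟨i, rfl⟩ := Fin.exists_castSucc_eq.2 hi
  obtain ⟨j, rfl⟩ := Fin.exists_castSucc_eq.2 hj
  obtain ⟨k, rfl⟩ := Fin.exists_castSucc_eq.2 hk
  let K := FractionRing (MvPolynomial (Fin (m + 1)) F)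
  let ι : MvPolynomial (Fin (m + 1)) F →ₐ[F] K :=
    IsScalarTower.toAlgHom F (MvPolynomial (Fin (m + 1)) F) K
  have hι : Injective ι := IsFractionRing.injective (MvPolynomial (Fin (m + 1)) F) K
  have hX : ι (X (Fin.last m)) ≠ 0 := by
    rw [Ne, map_eq_zero_iff ι hι]; exact X_ne_zero _
  apply hι
  rw [map_zero, map_hdAt]
  let w : Fin m → K × K := fun l => (ι (X l.castSucc) / ι (X (Fin.last m)), 1)
  have hw : (fun l => (ι (affWeight F l).1, ι (affWeight F l).2)) = fun l =>
      (ι (X (Fin.last m)) * (Fin.snoc (α := fun _ => K × K) w (1, 1) l).1,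
        (Fin.snoc (α := fun _ => K × K) w (1, 1) l).2) := by
    funext l
    refine Fin.lastCases ?_ (fun l => ?_) l
    · simp [affWeight]
    · simp only [affWeight, Fin.snoc_castSucc, w]
      rw [mul_div_cancel₀ _ hX, map_one]
  rw [hw]
  refine (isHomTensor_extTensor q).hdAt_scale hij hik hjk hX _ ?_
  rw [← hdAt_assocVec]
  exact h.hdAt_eq_zero (by simpa using hij) (by simpa using hik) (by simpa using hjk) w

theorem hasSquareExchanges_extTensor_iff (q : Subsets d (m + 1) → F) :
    HasSquareExchanges (extTensor q) ↔
      ∀ (i j : Fin (m + 1)) (S : Finset (Fin (m + 1))) (hi : i ∉ S) (hj : j ∉ S)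
        (hS : S.card + 1 = d), IsSquare (q ⟨insert i S, card_insert_eq hi hS⟩ *
          q ⟨insert j S, card_insert_eq hj hS⟩) := by
  constructor
  · intro h i j S hi hj hS
    have := h i j S hi hj
    rwa [← extTensor_apply q ⟨insert i S, card_insert_eq hi hS⟩,
      ← extTensor_apply q ⟨insert j S, card_insert_eq hj hS⟩]
  · intro h i j S hi hj
    by_cases hS : S.card + 1 = d
    · have := h i j S hi hj hS
      rwa [← extTensor_apply q ⟨insert i S, card_insert_eq hi hS⟩,
        ← extTensor_apply q ⟨insert j S, card_insert_eq hj hS⟩] at this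
    · have : extTensor q (insert i S) = 0 := by
        rw [extTensor, dif_neg]
        rwa [Finset.card_insert_of_notMem hi]
      simp [this]

/-- The theorem with identical vanishing in place of vanishing on the orbit. It remains to compare
`Good` with `PG`. -/
theorem mk_mem_grassmannianSq_iff_good {q : Subsets d (m + 1) → F} (hq : q ≠ 0) :
    Projectivization.mk F q hq ∈ grassmannianSq F d (m + 1) ↔
      HasSquareExchanges (extTensor q) ∧ Good (assocVec q) := by
  rw [mk_mem_grassmannianSq_iff]
  have hQ0 : extTensor q ≠ 0 := by
    intro h
    apply hq
    apply extTensor_injective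
    rw [h]
    funext T
    simp [extTensor]
  constructor
  · rintro ⟨c, V, h⟩
    let r : Finset (Fin (m + 1)) → F := extTensor fun S => pluckerVector V S ^ 2
    have hr : multiaffine r = (gram V).det := (det_gram_eq_multiaffine V).symm
    have hqr : extTensor q = fun T => c * r T := by
      apply multiaffine_injective
      rw [multiaffine_smul, hr, h]
    have hr0 : r ≠ 0 := by
      intro h
      apply hQ0
      rw [hqr, h]
      funext T
      simp
    constructor
    · have hrs (T) : IsSquare (r T) := by
        simp only [r, extTensor]
        split_ifs
        · exact IsSquare.sq _
        · simp
      intro i j S _ _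
      rw [hqr]
      obtain ⟨x, hx⟩ := hrs (insert i S)
      obtain ⟨y, hy⟩ := hrs (insert j S)
      exact ⟨c * x * y, by simp only [hx, hy]; ring⟩
    · have hg : Good (extTensor q) := by
        refine good_of_affWeight fun i j k hij hik hjk => ?_
        refine hdAt_affWeight_eq_zero_of_isSquare hij hik hjk ?_
        rw [hqr, rayleigh_smul, rayleigh_of_eq_det hr hr0, ← mul_pow]
        exact IsSquare.sq _
      intro i j k hij hik hjk
      rw [hdAt_assocVec]
      exact hg.hdAt_eq_zero (by simpa using hij) (by simpa using hik) (by simpa using hjk) _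
  · rintro ⟨h1, h2⟩
    have h3 := hdAt_extTensor_eq_zero q h2
    obtain ⟨c, V, -, h⟩ := exists_gram (J := Finset.univ) (isHomTensor_extTensor q) (by simp) hQ0
      fun i _ j _ hij => isSquare_rayleigh_of_forall_hdAt (isHomTensor_extTensor q) h1
        (Fin.last m) h3 hij
    exact ⟨c, V, h⟩

end AssocVec

/-! ### The hyperdeterminant on a pencil of tensors. -/

section Pencils

open Function

variable {A : Type*} [CommRing A]

/-- The derivative of the hyperdeterminant at `u` in the direction `v`. -/
def hd₁ (u v : Bool → Bool → Bool → A) : A :=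
  2 * (u false false false * v false false false * u true true true ^ 2
      + u true true true * v true true true * u false false false ^ 2
      + u true false false * v true false false * u false true true ^ 2
      + u false true true * v false true true * u true false false ^ 2
      + u false true false * v false true false * u true false true ^ 2
      + u true false true * v true false true * u false true false ^ 2
      + u false false true * v false false true * u true true false ^ 2
      + u true true false * v true true false * u false false true ^ 2)
    - 2 * ((u false false false * v true true true + v false false false * u true true true) *
        (u true false false * u false true true + u false true false * u true false true
          + u false false true * u true true false)
      + u false false false * u true true true *
        (u true false false * v false true true + v true false false * u false true true
          + u false true false * v true false true + v false true false * u true false true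
          + u false false true * v true true false + v false false true * u true true false)
      + (u true false false * v false true true + v true false false * u false true true) *
        (u false true false * u true false true + u false false true * u true true false)
      + u true false false * u false true true *
        (u false true false * v true false true + v false true false * u true false true
          + u false false true * v true true false + v false false true * u true true false)
      + (u false true false * v true false true + v false true false * u true false true) *
        u false false true * u true true false
      + u false true false * u true false true *
        (u false false true * v true true false + v false false true * u true true false))
    + 4 * (v false false false * u false true true * u true false true * u true true false
      + u false false false * v false true true * u true false true * u true true false
      + u false false false * u false true true * v true false true * u true true false
      + u false false false * u false true true * u true false true * v true true false
      + v true true true * u true false false * u false true false * u false false true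
      + u true true true * v true false false * u false true false * u false false true
      + u true true true * u true false false * v false true false * u false false true
      + u true true true * u true false false * u false true false * v false false true)

/-- The middle coefficient of the hyperdeterminant on a pencil. -/
def hdMid (u v : Bool → Bool → Bool → A) : A :=
  hd (fun x y z => u x y z + v x y z) - hd u - hd v - hd₁ u v - hd₁ v u

theorem hd_pencil (u v : Bool → Bool → Bool → A) (s t : A) :
    hd (fun x y z => s * u x y z + t * v x y z) = s ^ 4 * hd u + s ^ 3 * t * hd₁ u v +
      s ^ 2 * t ^ 2 * hdMid u v + s * t ^ 3 * hd₁ v u + t ^ 4 * hd v := by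
  simp only [hdMid, hd, hd₁]
  ring

end Pencils

/-! ### From rational to generic weights when F does not have three elements. -/

section Coordinates

open Function

variable {σ : Type*} [DecidableEq σ] [Fintype σ] {F : Type*} [Field F]

theorem tri_update {A : Type*} [CommRing A] [Algebra F A] (q : Finset σ → F) {i j k l : σ}
    (hi : l ≠ i) (hj : l ≠ j) (hk : l ≠ k) (w : σ → A × A) (x a b c : A × A) :
    tri q i j k (update w l x) a b c = x.1 * tri q i j k (update w l (1, 0)) a b c +
      x.2 * tri q i j k (update w l (0, 1)) a b c := by
  simp only [tri, update_comm hi, update_comm hj, update_comm hk]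
  exact val_update _ _ _ _

theorem hdAt_update {A : Type*} [CommRing A] [Algebra F A] (q : Finset σ → F) {i j k l : σ}
    (hi : l ≠ i) (hj : l ≠ j) (hk : l ≠ k) (w : σ → A × A) (x : A × A) :
    hdAt q i j k (update w l x) = hd fun a b c =>
      x.1 * tri q i j k (update w l (1, 0)) (bv a) (bv b) (bv c) +
        x.2 * tri q i j k (update w l (0, 1)) (bv a) (bv b) (bv c) := by
  rw [hdAt]
  congr 1
  funext a b c
  exact tri_update q hi hj hk w x _ _ _

/-- Free the coordinates one at a time. When one weight varies, the other weights may already lie in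
Ω, so the pencil hypothesis must concern tensors over Ω and parameters in F. -/
theorem PG.good_of_pencil {q : Finset σ → F} (h : PG q) {Ω : Type*} [Field Ω] [Infinite Ω]
    [Algebra F Ω] (hp : ∀ u v : Bool → Bool → Bool → Ω,
      (∀ s t : F, hd (fun x y z => algebraMap F Ω s * u x y z + algebraMap F Ω t * v x y z) = 0) →
      ∀ s t : Ω, hd (fun x y z => s * u x y z + t * v x y z) = 0) : Good q := by
  refine good_of_forall_hdAt_eq_zero Ω fun i j k hij hik hjk => ?_
  have key (L : Finset σ) : ∀ w : σ → Ω × Ω,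
      (∀ l ∉ L, ∃ x : F × F, w l = (algebraMap F Ω x.1, algebraMap F Ω x.2)) →
      hdAt q i j k w = 0 := by
    induction L using Finset.induction_on with
    | empty =>
      intro w hw
      choose x hx using fun l => hw l (by simp)
      have := map_hdAt (Algebra.ofId F Ω) q i j k x
      rw [h i j k hij hik hjk, map_zero] at this
      rw [this]
      congr 1
      funext l
      exact hx l
    | insert l L hl ih =>
      intro w hw
      have hw' (x : F × F) : hdAt q i j k (update w l (algebraMap F Ω x.1, algebraMap F Ω x.2)) =
          0 := by
        refine ih _ fun l' hl' => ?_
        by_cases h' : l' = l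
        · subst h'; exact ⟨x, by simp⟩
        · simpa [h'] using hw l' (by simp [h', hl'])
      by_cases hi : l = i
      · subst hi; rw [← hdAt_update_left q l j k w]; exact hw' 0
      by_cases hj : l = j
      · subst hj; rw [← hdAt_update_middle q i l k w]; exact hw' 0
      by_cases hk : l = k
      · subst hk; rw [← hdAt_update_right q i j l w]; exact hw' 0
      have := hp (fun a b c => tri q i j k (update w l (1, 0)) (bv a) (bv b) (bv c))
        (fun a b c => tri q i j k (update w l (0, 1)) (bv a) (bv b) (bv c))
        (fun s t => by
          have := hw' (s, t)
          rwa [hdAt_update q hi hj hk] at this) (w l).1 (w l).2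
      rw [← hdAt_update q hi hj hk] at this
      simpa using this
  exact fun w => key Finset.univ w (by simp)

/-- Modulo two the hyperdeterminant is the square of the quadratic form L, and a binary quadratic
form is determined by its values at the three points present over any field. -/
theorem PG.good_of_two_eq_zero {q : Finset σ → F} (h : PG q) (h2 : (2 : F) = 0) : Good q := by
  refine h.good_of_pencil (Ω := AlgebraicClosure F) fun u v huv s t => ?_
  have e2 : (2 : AlgebraicClosure F) = 0 := by
    rw [← map_ofNat (algebraMap F (AlgebraicClosure F)) 2, h2, map_zero]
  have e4 : (4 : AlgebraicClosure F) = 0 := by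
    rw [show (4 : AlgebraicClosure F) = 2 * 2 by norm_num, e2, zero_mul]
  let L (u : Bool → Bool → Bool → AlgebraicClosure F) : AlgebraicClosure F :=
    u false false false * u true true true + u true false false * u false true true +
      u false true false * u true false true + u false false true * u true true false
  have hL (u) : hd u = L u ^ 2 := by
    have e : hd u = L u ^ 2 - 4 * (L u ^ 2 - hd u + 0) + 4 * (L u ^ 2 - hd u + 0) -
      (L u ^ 2 - hd u) := by ring
    have e3 : L u ^ 2 - hd u = 2 * (2 * (u false false false * u true true true *
        (u true false false * u false true true + u false true false * u true false true +
          u false false true * u true true false) + u true false false * u false true true *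
        (u false true false * u true false true + u false false true * u true true false) +
        u false true false * u true false true * u false false true * u true true false
        - u false false false * u false true true * u true false true * u true true false
        - u true true true * u true false false * u false true false * u false false true)) := by
      simp only [L, hd]
      ring
    rw [e2, zero_mul, sub_eq_zero] at e3
    exact e3.symm
  have h1 := huv 1 0
  have h2 := huv 0 1
  have h3 := huv 1 1
  simp only [map_one, map_zero, one_mul, zero_mul, add_zero, zero_add, hL] at h1 h2 h3
  replace h1 := pow_eq_zero_iff (two_ne_zero) |>.1 h1
  replace h2 := pow_eq_zero_iff (two_ne_zero) |>.1 h2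
  replace h3 := pow_eq_zero_iff (two_ne_zero) |>.1 h3
  rw [hL, pow_eq_zero_iff two_ne_zero]
  simp only [L] at h1 h2 h3 ⊢
  linear_combination (s ^ 2 - s * t) * h1 + (t ^ 2 - s * t) * h2 + s * t * h3

/-- On a pencil the hyperdeterminant is a quartic, so five affine parameters force all of its
coefficients to vanish. -/
theorem PG.good_of_five {q : Finset σ → F} (h : PG q) (s : Finset F) (hs : 5 ≤ s.card) :
    Good q := by
  refine h.good_of_pencil (Ω := AlgebraicClosure F) fun u v huv => ?_
  open Polynomial in
  let p : (AlgebraicClosure F)[X] := C (hd v) + C (hd₁ v u) * X + C (hdMid u v) * X ^ 2 +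
    C (hd₁ u v) * X ^ 3 + C (hd u) * X ^ 4
  have hp : p = 0 := by
    refine Polynomial.eq_zero_of_natDegree_lt_card_of_eval_eq_zero' p
      (s.map ⟨_, (algebraMap F (AlgebraicClosure F)).injective⟩) ?_ ?_
    · intro x hx
      obtain ⟨a, -, rfl⟩ := Finset.mem_map.1 hx
      have := huv a 1
      rw [hd_pencil] at this
      simp only [Embedding.coeFn_mk, p, Polynomial.eval_add, Polynomial.eval_mul,
        Polynomial.eval_C, Polynomial.eval_pow, Polynomial.eval_X]
      simp only [map_one] at this
      linear_combination this
    · rw [Finset.card_map]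
      refine lt_of_lt_of_le (Nat.lt_succ_of_le ?_) hs
      simp only [p]
      compute_degree
  have hc (n : ℕ) : p.coeff n = 0 := by rw [hp]; simp
  have h0 := hc 0
  have h1 := hc 1
  have h2 := hc 2
  have h3 := hc 3
  have h4 := hc 4
  simp [p, Polynomial.coeff_X, Polynomial.coeff_X_pow, Polynomial.coeff_C] at h0 h1 h2 h3 h4
  intro s t
  rw [hd_pencil, h0, h1, h2, h3, h4]
  ring

theorem PG.good_of_exists_ne {q : Finset σ → F} (h : PG q)
    (hF : ∃ x : F, x ≠ 0 ∧ x ≠ 1 ∧ x ≠ -1) : Good q := by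
  by_cases h2 : (2 : F) = 0
  · exact h.good_of_two_eq_zero h2
  obtain ⟨x, h0, h1, hm⟩ := hF
  have hd (y : F) (hy : y ≠ 0) : y ≠ -y := by
    intro e
    have : 2 * y = 0 := by linear_combination e
    exact (mul_ne_zero h2 hy) this
  classical
  refine h.good_of_five {0, 1, -1, x, -x} (le_of_eq ?_)
  have a1 : (-1 : F) ≠ -x := fun e => h1 (neg_injective e).symm
  have a2 : (1 : F) ≠ -x := fun e => hm (by rw [e, neg_neg])
  rw [Finset.card_insert_of_notMem, Finset.card_insert_of_notMem, Finset.card_insert_of_notMem,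
    Finset.card_insert_of_notMem, Finset.card_singleton]
  · simpa using hd x h0
  · simp [a1, hm.symm]
  · simp [hd 1 one_ne_zero, h1.symm, a2]
  · simp [h0, h0.symm]

end Coordinates

/-! ### A factorisation argument on a grid of planes. -/

section Substitution

open Function MvPolynomial

variable {σ : Type*} [DecidableEq σ] [Fintype σ] {K : Type*} [Field K]

/-- The substitution `x_l ↦ c`. -/
noncomputable def subst (l : σ) (c : K) : MvPolynomial σ K →ₐ[K] MvPolynomial σ K :=
  aeval fun j => if j = l then C c else X j

theorem subst_comm {l m : σ} (h : l ≠ m) (c d : K) (p : MvPolynomial σ K) :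
    subst l c (subst m d p) = subst m d (subst l c p) := by
  have : (subst l c).comp (subst m d) = (subst m d).comp (subst l c) := by
    ext j
    simp only [subst, AlgHom.comp_apply, aeval_X]
    by_cases h1 : j = m
    · subst h1
      simp [h.symm]
    · by_cases h2 : j = l
      · subst h2; simp [h1]
      · simp [h1, h2]
  exact DFunLike.congr_fun this p

theorem X_sub_C_dvd_sub_subst (l : σ) (c : K) (p : MvPolynomial σ K) :
    X l - C c ∣ p - subst l c p := by
  induction p using MvPolynomial.induction_on with
  | C a => simp [subst]
  | add p q hp hq =>
    rw [map_add, show p + q - (subst l c p + subst l c q) = (p - subst l c p) + (q - subst l c q) by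
      ring]
    exact dvd_add hp hq
  | mul_X p j hp =>
    rw [map_mul]
    by_cases h : j = l
    · subst h
      rw [show subst j c (X j : MvPolynomial σ K) = C c by simp [subst],
        show p * X j - subst j c p * C c = (p - subst j c p) * C c + p * (X j - C c) by ring]
      exact dvd_add (hp.mul_right _) (dvd_mul_left _ _)
    · rw [show subst l c (X j : MvPolynomial σ K) = X j by simp [subst, h], ← sub_mul]
      exact hp.mul_right _

theorem subst_X_sub_C (l : σ) (c d : K) :
    subst l d (X l - C c : MvPolynomial σ K) = C (d - c) := by
  rw [map_sub, C_sub]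
  simp [subst]

theorem X_sub_C_dvd_of_subst_eq_zero {l : σ} {c : K} {p : MvPolynomial σ K}
    (h : subst l c p = 0) : X l - C c ∣ p := by
  simpa [h] using X_sub_C_dvd_sub_subst l c p

theorem degreeOf_X_sub_C_ne_zero (l : σ) (c : K) : degreeOf l (X l - C c : MvPolynomial σ K) ≠ 0 := by
  intro h
  have h1 := zeroAt_eq_self h
  have h2 : zeroAt l (X l - C c : MvPolynomial σ K) = - C c := by simp [zeroAt]
  rw [h2, eq_sub_iff_add_eq, neg_add_cancel] at h1
  exact X_ne_zero (R := K) l h1.symm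

theorem eq_zero_of_subst_eq_zero₂ {l : σ} {c d : K} {p : MvPolynomial σ K} (hcd : c ≠ d)
    (hp : degreeOf l p ≤ 1) (hc : subst l c p = 0) (hd : subst l d p = 0) : p = 0 := by
  by_contra h0
  obtain ⟨r, rfl⟩ := X_sub_C_dvd_of_subst_eq_zero hc
  have hr : subst l d r = 0 := by
    rw [map_mul] at hd
    refine (mul_eq_zero.1 hd).resolve_left ?_
    rw [subst_X_sub_C, C_eq_zero, sub_eq_zero]
    exact hcd.symm
  obtain ⟨s, rfl⟩ := X_sub_C_dvd_of_subst_eq_zero hr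
  have h1 := degreeOf_X_sub_C_ne_zero l c
  have h2 := degreeOf_X_sub_C_ne_zero l d
  rw [degreeOf_mul_eq (left_ne_zero_of_mul h0) (right_ne_zero_of_mul h0),
    degreeOf_mul_eq (left_ne_zero_of_mul (right_ne_zero_of_mul h0))
      (right_ne_zero_of_mul (right_ne_zero_of_mul h0))] at hp
  omega

theorem eq_zero_of_subst_eq_zero₃ {l : σ} {c d e : K} {p : MvPolynomial σ K} (hcd : c ≠ d)
    (hce : c ≠ e) (hde : d ≠ e) (hp : degreeOf l p ≤ 2) (hc : subst l c p = 0)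
    (hd : subst l d p = 0) (he : subst l e p = 0) : p = 0 := by
  by_contra h0
  obtain ⟨r, rfl⟩ := X_sub_C_dvd_of_subst_eq_zero hc
  have h (d : K) (hcd : c ≠ d) (hd : subst l d ((X l - C c) * r) = 0) : subst l d r = 0 := by
    rw [map_mul] at hd
    refine (mul_eq_zero.1 hd).resolve_left ?_
    rw [subst_X_sub_C, C_eq_zero, sub_eq_zero]
    exact hcd.symm
  have h1 := degreeOf_X_sub_C_ne_zero l c
  have hr0 := right_ne_zero_of_mul h0
  rw [degreeOf_mul_eq (left_ne_zero_of_mul h0) hr0] at hp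
  exact hr0 (eq_zero_of_subst_eq_zero₂ hde (by omega) (h d hcd hd) (h e hce he))

theorem degreeOf_subst_le (l m : σ) (c : K) (p : MvPolynomial σ K) :
    degreeOf l (subst m c p) ≤ degreeOf l p := by
  rw [subst, aeval_def, eval₂_eq']
  refine (degreeOf_sum_le _ _ _).trans (Finset.sup_le fun e he => ?_)
  refine (degreeOf_mul_le _ _ _).trans ?_
  rw [algebraMap_eq, degreeOf_C, zero_add]
  refine (degreeOf_prod_le _ _ _).trans ?_
  have hj (j : σ) : degreeOf l ((if j = m then C c else X j : MvPolynomial σ K) ^ e j) ≤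
      if j = l then e l else 0 := by
    refine (degreeOf_pow_le _ _ _).trans ?_
    by_cases h1 : j = m
    · simp [h1]
    · rw [if_neg h1, degreeOf_X]
      by_cases h2 : j = l
      · subst h2; simp
      · simp [h2, Ne.symm h2]
  refine (Finset.sum_le_sum fun j _ => hj j).trans ?_
  simp only [Finset.sum_ite_eq', Finset.mem_univ, if_true]
  exact degreeOf_le_iff.1 le_rfl e he

-- Four values are covered by two sets of at most two elements each, so both have exactly two and
-- they are disjoint. Checked on Boolean functions.
set_option synthInstance.maxHeartbeats 400000 in
set_option synthInstance.maxSize 2000 in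
theorem exists_two_two {P Q : Fin 4 → Prop} (h : ∀ r, P r ∨ Q r)
    (hP : ∀ r s t, r ≠ s → r ≠ t → s ≠ t → P r → P s → P t → False)
    (hQ : ∀ r s t, r ≠ s → r ≠ t → s ≠ t → Q r → Q s → Q t → False) :
    ∃ r s t u, r ≠ s ∧ r ≠ t ∧ r ≠ u ∧ s ≠ t ∧ s ≠ u ∧ t ≠ u ∧ P r ∧ P s ∧ Q t ∧ Q u ∧
      ¬ Q r ∧ ¬ Q s ∧ ¬ P t ∧ ¬ P u := by
  have key : ∀ p q : Fin 4 → Bool, (∀ r, p r || q r) →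
      (∀ r s t, r ≠ s → r ≠ t → s ≠ t → p r → p s → p t → False) →
      (∀ r s t, r ≠ s → r ≠ t → s ≠ t → q r → q s → q t → False) →
      ∃ r s t u, r ≠ s ∧ r ≠ t ∧ r ≠ u ∧ s ≠ t ∧ s ≠ u ∧ t ≠ u ∧ p r ∧ p s ∧ q t ∧ q u ∧
      ¬ q r ∧ ¬ q s ∧ ¬ p t ∧ ¬ p u := by decide +kernel
  classical
  have := key (fun r => decide (P r)) (fun r => decide (Q r)) (by simpa using h)
    (by simpa using hP) (by simpa using hQ)
  simpa using this

/-- The polynomial factors as UW with W − U = 4αγ. If it were nonzero, then in each of the three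
directions U would vanish on exactly two of the four planes and W on the other two. Where such
planes meet, αγ vanishes, and α, γ are only affine in each variable; this forces too many zeros. -/
theorem sq_sub_eq_zero_of_subst {α γ B : MvPolynomial σ K} {l₁ l₂ l₃ : σ} (h12 : l₁ ≠ l₂)
    (h13 : l₁ ≠ l₃) (h23 : l₂ ≠ l₃) {p : Fin 4 → K} (hp : Injective p) (h2 : (2 : K) ≠ 0)
    (hα : ∀ l, degreeOf l α ≤ 1) (hγ : ∀ l, degreeOf l γ ≤ 1) (hB : ∀ l, degreeOf l B ≤ 2)
    (hD : ∀ l, l = l₁ ∨ l = l₂ ∨ l = l₃ → ∀ r, subst l (p r) (B ^ 2 - 4 * α ^ 2 * γ ^ 2) = 0) :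
    B ^ 2 - 4 * α ^ 2 * γ ^ 2 = 0 := by
  by_contra h0
  set U := B - C 2 * (α * γ) with hU
  set W := B + C 2 * (α * γ) with hW
  have h4 : C (4 : K) ≠ (0 : MvPolynomial σ K) := by
    rw [Ne, C_eq_zero, show (4 : K) = 2 * 2 by norm_num]
    exact mul_ne_zero h2 h2
  have hUW : B ^ 2 - 4 * α ^ 2 * γ ^ 2 = U * W := by rw [hU, hW, map_ofNat]; ring
  have hdiff : W - U = C 4 * (α * γ) := by rw [hU, hW, map_ofNat, map_ofNat]; ring
  rw [hUW] at h0
  simp only [hUW] at hD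
  have hU0 := left_ne_zero_of_mul h0
  have hW0 := right_ne_zero_of_mul h0
  have hdeg (l : σ) : degreeOf l (C 2 * (α * γ)) ≤ 2 := by
    have e1 := degreeOf_mul_le l (C 2) (α * γ)
    have e2 := degreeOf_mul_le l α γ
    have e3 := hα l
    have e4 := hγ l
    rw [degreeOf_C] at e1
    omega
  have hUd (l : σ) : degreeOf l U ≤ 2 :=
    (degreeOf_sub_le _ _ _).trans (max_le (hB l) (hdeg l))
  have hWd (l : σ) : degreeOf l W ≤ 2 :=
    (degreeOf_add_le _ _ _).trans (max_le (hB l) (hdeg l))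
  have hS (l : σ) (hl : l = l₁ ∨ l = l₂ ∨ l = l₃) :=
    exists_two_two (P := fun r => subst l (p r) U = 0) (Q := fun r => subst l (p r) W = 0)
      (fun r => by
        have := hD l hl r
        rwa [map_mul, mul_eq_zero] at this)
      (fun r s t hrs hrt hst hr hs ht => hU0 (eq_zero_of_subst_eq_zero₃ (hp.ne hrs) (hp.ne hrt)
        (hp.ne hst) (hUd l) hr hs ht))
      (fun r s t hrs hrt hst hr hs ht => hW0 (eq_zero_of_subst_eq_zero₃ (hp.ne hrs) (hp.ne hrt)
        (hp.ne hst) (hWd l) hr hs ht))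
  obtain ⟨a, -, -, -, -, -, -, -, -, -, hUa, -, -, -, hWa, -, -, -⟩ := hS l₁ (Or.inl rfl)
  obtain ⟨b, b', c, c', hbb, hbc, hbc', hbc₂, hbc₃, hcc, hUb, hUb', hWc, hWc', -⟩ :=
    hS l₂ (Or.inr (Or.inl rfl))
  obtain ⟨-, -, e, e', -, -, -, -, -, hee, -, -, hWe, hWe', -, -, hUe, hUe'⟩ :=
    hS l₃ (Or.inr (Or.inr rfl))
  have hdiff' (f : MvPolynomial σ K →ₐ[K] MvPolynomial σ K) :
      f W - f U = C 4 * (f α * f γ) := by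
    rw [← map_sub, hdiff, map_mul, map_mul]
    congr 1
    rw [← algebraMap_eq]
    exact f.commutes 4
  have hvan (f : MvPolynomial σ K →ₐ[K] MvPolynomial σ K) (hw : f W = 0) (hu : f U = 0) :
      f α = 0 ∨ f γ = 0 := by
    have := hdiff' f
    rw [hw, hu, sub_zero] at this
    exact mul_eq_zero.1 ((mul_eq_zero.1 this.symm).resolve_left h4)
  -- the value at a point of the first plane and one of the two good points of the second line
  have hW2 (y : Fin 4) (hyc : y ≠ c) (hyc' : y ≠ c') :
      subst l₂ (p y) (subst l₁ (p a) W) ≠ 0 := by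
    intro hy
    refine hWa (eq_zero_of_subst_eq_zero₃ (hp.ne hyc) (hp.ne hyc') (hp.ne hcc)
      ((degreeOf_subst_le _ _ _ _).trans (hWd l₂)) hy ?_ ?_)
    · rw [subst_comm h12.symm, hWc, map_zero]
    · rw [subst_comm h12.symm, hWc', map_zero]
  -- On the plane x₁ = a the factor U vanishes, so 4αγ = W there, which is nonzero on this line.
  have hαγ2 (y : Fin 4) (hyc : y ≠ c) (hyc' : y ≠ c') (hy : subst l₂ (p y) U = 0) :
      subst l₂ (p y) (subst l₁ (p a) α) ≠ 0 ∧ subst l₂ (p y) (subst l₁ (p a) γ) ≠ 0 := by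
    have h := hdiff' ((subst l₂ (p y)).comp (subst l₁ (p a)))
    simp only [AlgHom.comp_apply] at h
    rw [hUa, map_zero, sub_zero] at h
    have h' := h ▸ hW2 y hyc hyc'
    exact ⟨left_ne_zero_of_mul (right_ne_zero_of_mul h'), right_ne_zero_of_mul (right_ne_zero_of_mul h')⟩
  have hγ1 : subst l₁ (p a) γ ≠ 0 := by
    intro h
    exact (hαγ2 b hbc hbc' hUb).2 (by rw [h, map_zero])
  have key (e e' : Fin 4) (hee : e ≠ e') (hWe : subst l₃ (p e) W = 0)
      (hWe' : subst l₃ (p e') W = 0) (hUe : subst l₃ (p e) U ≠ 0)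
      (hα1 : subst l₃ (p e) (subst l₁ (p a) α) = 0) : False := by
    -- Otherwise γ vanishes on this intersection, so both α and γ vanish at (a, y, e); one of them
    -- also vanishes at (a, y, e'), hence on the whole line (a, y) by degree one in x₃, which `hαγ2`
    -- forbids.
    have h5 (y : Fin 4) (hyc : y ≠ c) (hyc' : y ≠ c') (hy : subst l₂ (p y) U = 0) :
        subst l₃ (p e) (subst l₂ (p y) α) = 0 := by
      by_contra hne
      have hγ5 := (hvan ((subst l₃ (p e)).comp (subst l₂ (p y)))
        (by rw [AlgHom.comp_apply, subst_comm h23.symm, hWe, map_zero])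
        (by rw [AlgHom.comp_apply, hy, map_zero])).resolve_left hne
      rw [AlgHom.comp_apply] at hγ5
      have hγ4 : subst l₃ (p e) (subst l₂ (p y) (subst l₁ (p a) γ)) = 0 := by
        rw [subst_comm h12.symm, subst_comm h13.symm, hγ5, map_zero]
      have hα4 : subst l₃ (p e) (subst l₂ (p y) (subst l₁ (p a) α)) = 0 := by
        rw [subst_comm h23.symm, hα1, map_zero]
      obtain ⟨n1, n2⟩ := hαγ2 y hyc hyc' hy
      rcases hvan ((subst l₃ (p e')).comp ((subst l₂ (p y)).comp (subst l₁ (p a))))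
        (by
          simp only [AlgHom.comp_apply]
          rw [subst_comm h23.symm, subst_comm h13.symm, hWe', map_zero, map_zero])
        (by simp only [AlgHom.comp_apply]; rw [hUa, map_zero, map_zero]) with h | h
      · exact n1 (eq_zero_of_subst_eq_zero₂ (hp.ne hee) ((degreeOf_subst_le _ _ _ _).trans
          ((degreeOf_subst_le _ _ _ _).trans (hα l₃))) hα4 h)
      · exact n2 (eq_zero_of_subst_eq_zero₂ (hp.ne hee) ((degreeOf_subst_le _ _ _ _).trans
          ((degreeOf_subst_le _ _ _ _).trans (hγ l₃))) hγ4 h)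
    have h6 : subst l₃ (p e) α = 0 := by
      refine eq_zero_of_subst_eq_zero₂ (hp.ne hbb) ((degreeOf_subst_le _ _ _ _).trans (hα l₂)) ?_ ?_
      · rw [subst_comm h23]; exact h5 b hbc hbc' hUb
      · rw [subst_comm h23]; exact h5 b' hbc₂ hbc₃ hUb'
    have := hdiff' (subst l₃ (p e))
    rw [hWe, h6, zero_mul, mul_zero, zero_sub, neg_eq_zero] at this
    exact hUe this
  have hv (e : Fin 4) (hWe : subst l₃ (p e) W = 0) := hvan ((subst l₃ (p e)).comp (subst l₁ (p a)))
    (by rw [AlgHom.comp_apply, subst_comm h13.symm, hWe, map_zero])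
    (by rw [AlgHom.comp_apply, hUa, map_zero])
  simp only [AlgHom.comp_apply] at hv
  -- Vanishing of α on either intersection is excluded by `key`; so γ vanishes on both, hence on the
  -- plane x₁ = a.
  rcases hv e hWe with h | h
  · exact key e e' hee hWe hWe' hUe h
  rcases hv e' hWe' with h' | h'
  · exact key e' e hee.symm hWe' hWe hUe' h'
  · exact hγ1 (eq_zero_of_subst_eq_zero₂ (hp.ne hee)
      ((degreeOf_subst_le _ _ _ _).trans (hγ l₃)) h h')

end Substitution

/-! ### Slices of hyperdeterminants and rational points. -/

section ThreeFree

open Function MvPolynomial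

variable {σ : Type*} [DecidableEq σ] [Fintype σ] {F : Type*} [Field F] {K : Type*} [Field K]
  [Algebra F K]

theorem tri_slice {A : Type*} [CommRing A] [Algebra F A] (q : Finset σ → F) {i j l k : σ}
    (hi : k ≠ i) (hj : k ≠ j) (hl : k ≠ l) (β : Bool) (w : σ → A × A) (a b c : A × A) :
    tri (slice k β q) i j l w a b c = (w k).2 * tri q i j l (update w k (bv β)) a b c := by
  rw [tri, val_slice, tri]
  congr 1
  · simp [hi, hj, hl]
  · simp only [update_comm hi, update_comm hj, update_comm hl]

theorem hdAt_slice {A : Type*} [CommRing A] [Algebra F A] (q : Finset σ → F) {i j l k : σ}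
    (hi : k ≠ i) (hj : k ≠ j) (hl : k ≠ l) (β : Bool) (w : σ → A × A) :
    hdAt (slice k β q) i j l w = (w k).2 ^ 4 * hdAt q i j l (update w k (bv β)) := by
  simp only [hdAt, hd, tri_slice q hi hj hl]
  ring

theorem hd_eq_zero_of_right {A : Type*} [CommRing A] {u : Bool → Bool → Bool → A}
    (h : ∀ x y, u x y true = 0) : hd u = 0 := by
  simp [hd, h]

theorem val_eq_zero_of_mem {A : Type*} [CommRing A] [Algebra F A] {q : Finset σ → F} {k : σ}
    (h : ∀ T, k ∈ T → q T = 0) {w : σ → A × A} (hw : (w k).2 = 0) : val q w = 0 := by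
  rw [val_eq]
  refine Finset.sum_eq_zero fun T _ => ?_
  by_cases hT : k ∈ T
  · simp [h T hT]
  · rw [Finset.prod_eq_zero (Finset.mem_univ k), mul_zero]
    simp [hT, hw]

theorem hdAt_eq_zero_of_mem {A : Type*} [CommRing A] [Algebra F A] {q : Finset σ → F} {k : σ}
    (h : ∀ T, k ∈ T → q T = 0) (i j : σ) (w : σ → A × A) : hdAt q i j k w = 0 :=
  hd_eq_zero_of_right fun _ _ => val_eq_zero_of_mem h (by simp)

theorem exists_hdAt_eq_sq_sub (q : Finset σ → F) {i j k : σ} (hij : i ≠ j) (hik : i ≠ k)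
    (hjk : j ≠ k) : ∃ B : MvPolynomial σ F, (∀ l, degreeOf l B ≤ 2) ∧
      hdAt q i j k (affWeight F) =
        B ^ 2 - 4 * rayleigh (slice k false q) i j * rayleigh (slice k true q) i j := by
  let u : Bool → Bool → Bool → MvPolynomial σ F := fun x y z =>
    multiaffine (slice i x (slice j y (slice k z q)))
  have hu : hdAt q i j k (affWeight F) = hd u := by
    rw [hdAt]
    congr 1
    funext x y z
    exact tri_affWeight q hij hik hjk x y z
  refine ⟨u true false false * u false true true + u true false true * u false true false -
      u false false false * u true true true - u false false true * u true true false,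
      fun l => ?_, ?_⟩
  · have h (a b c x y z) : degreeOf l (u a b c * u x y z) ≤ 2 := by
      have h1 := degreeOf_mul_le l (u a b c) (u x y z)
      have h2 : degreeOf l (u a b c) ≤ 1 := degreeOf_multiaffine_le l _
      have h3 : degreeOf l (u x y z) ≤ 1 := degreeOf_multiaffine_le l _
      omega
    refine (degreeOf_sub_le _ _ _).trans (max_le ((degreeOf_sub_le _ _ _).trans (max_le
      ((degreeOf_add_le _ _ _).trans (max_le ?_ ?_)) ?_)) ?_) <;> apply h
  · rw [hu, rayleigh_eq_bilinear _ hij, rayleigh_eq_bilinear _ hij]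
    simp only [hd, u]
    ring

/-- With all discriminants zero the square-free cofactor involves no variable, and over an
algebraically closed field the remaining constant is a square. -/
theorem exists_rayleigh_eq_sq [IsAlgClosed K] (h2 : (2 : K) ≠ 0) (q : Finset σ → K) {i j : σ}
    (hij : i ≠ j) (h : ∀ l, l ≠ i → l ≠ j → hdAt q i j l (affWeight K) = 0) :
    ∃ α : MvPolynomial σ K, (∀ l, degreeOf l α ≤ 1) ∧ rayleigh q i j = α ^ 2 := by
  by_cases h0 : rayleigh q i j = 0
  · exact ⟨0, by simp, by rw [h0]; ring⟩
  obtain ⟨u, s, hus, hu⟩ := exists_eq_mul_sq (P := Set.univ) h0 (by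
    intro k _
    by_cases hki : k = i
    · subst hki
      exact ⟨_, h0, degreeOf_rayleigh_left q hij, _, rfl⟩
    by_cases hkj : k = j
    · subst hkj
      exact ⟨_, h0, degreeOf_rayleigh_right q hij, _, rfl⟩
    obtain ⟨A, B, D, hA, hB, hD, hp, hd⟩ := rayleigh_eq_quadratic q hij (Ne.symm hki)
      (Ne.symm hkj)
    rw [h k hki hkj] at hd
    exact exists_isSquare_mul_of_quadratic h2 hA hD hp hd.symm h0)
  have hv : u.vars = ∅ := Finset.eq_empty_of_forall_notMem fun l hl =>
    mem_vars_iff_degreeOf_ne_zero.1 hl (hu l trivial)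
  obtain ⟨c, rfl⟩ : ∃ c, u = C c := ⟨_, vars_eq_empty_iff_eq_C.1 hv⟩
  obtain ⟨d, hd⟩ := IsAlgClosed.exists_pow_nat_eq c (n := 2) (by norm_num)
  have he : rayleigh q i j = (C d * s) ^ 2 := by
    rw [hus, ← hd, map_pow]; ring
  refine ⟨C d * s, fun l => ?_, he⟩
  have := degreeOf_rayleigh_le q i j l
  have hne : C d * s ≠ 0 := by
    intro h; rw [he, h] at h0; simp at h0
  rw [he, sq, degreeOf_mul_eq hne hne] at this
  omega

/-- Vectors of `K²` proportional to a vector of `F²`. -/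
def IsRational (F : Type*) [Field F] [Algebra F K] (v : K × K) : Prop :=
  ∃ (c : K) (s t : F), v = (c * algebraMap F K s, c * algebraMap F K t)

theorem hdAt_smul' {A : Type*} [Field A] [Algebra F A] (q : Finset σ → F) {i j k : σ}
    (w w' : σ → A × A) (h : ∀ l, l ≠ i → l ≠ j → l ≠ k → ∃ c : A, c ≠ 0 ∧ w l = c • w' l)
    (hw : hdAt q i j k w' = 0) : hdAt q i j k w = 0 := by
  choose! c hc using h
  rw [hdAt_congr q (w' := fun l => (if l = i ∨ l = j ∨ l = k then 1 else c l) • w' l),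
    hdAt_smul q _ _ (by simp) (by simp) (by simp), hw, mul_zero]
  intro l hi hj hk
  simp [hi, hj, hk, (hc l hi hj hk).2]

end ThreeFree

/-! ### Reducing three free coordinates to rational ones. -/

section ThreeFree

open Function MvPolynomial

variable {σ : Type*} [DecidableEq σ] [Fintype σ] {F : Type*} [Field F] {K : Type*} [Field K]
  [Algebra F K]

theorem eq_zero_of_forall_aeval [Infinite K] {p : MvPolynomial σ K}
    (h : ∀ ξ : σ → K, aeval ξ p = 0) : p = 0 := by
  refine MvPolynomial.funext fun ξ => ?_
  rw [map_zero, ← h ξ, aeval_eq_eval]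

/-- The parameters of the points (1:0), (0:1), (1:1), (1:−1) on the line p ↦ (pθ + 1 : p). Solving
for p gives t / (s − θt), finite by the choice of θ. -/
theorem exists_four_points (h2 : (2 : K) ≠ 0) {θ : K} (h0 : θ ≠ 0) (h1 : θ ≠ 1) (hm : θ ≠ -1) :
    ∃ p : Fin 4 → K, Injective p ∧ ∀ r, IsRational F (p r * θ + 1, p r) := by
  let s : Fin 4 → F := ![1, 0, 1, 1]
  let t : Fin 4 → F := ![0, 1, 1, -1]
  have hden (r : Fin 4) : algebraMap F K (s r) - θ * algebraMap F K (t r) ≠ 0 := by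
    fin_cases r
    · simp [s, t]
    · simpa [s, t] using h0
    · simpa [s, t, sub_eq_zero] using h1.symm
    · simp only [s, t]
      intro h
      apply hm
      simp at h
      linear_combination h
  refine ⟨fun r => algebraMap F K (t r) / (algebraMap F K (s r) - θ * algebraMap F K (t r)), ?_, ?_⟩
  · intro a b hab
    have ha := hden a
    have hb := hden b
    simp only at hab
    rw [div_eq_div_iff ha hb] at hab
    have : algebraMap F K (t a) * algebraMap F K (s b) =
      algebraMap F K (t b) * algebraMap F K (s a) := by linear_combination hab
    have h11 : (1 : K) ≠ -1 := fun h => h2 (by linear_combination h)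
    have h11' : (-1 : K) ≠ 1 := h11.symm
    fin_cases a <;> fin_cases b <;> simp [s, t, h11, h11'] at this ⊢
  · intro r
    have := hden r
    refine ⟨(algebraMap F K (s r) - θ * algebraMap F K (t r))⁻¹, s r, t r, Prod.ext ?_ ?_⟩
    · simp only; rw [div_mul_eq_mul_div, div_add_one this, inv_mul_eq_div]; congr 1; ring
    · simp only; rw [inv_mul_eq_div]

/-- Making k rational shows that the two slices in k have square Rayleigh differences α², γ², so the
hyperdeterminant is B² − 4α²γ². Making one of l₁, l₂, l₃ rational shows that it vanishes on four
planes in each of these directions, and the grid argument applies. -/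
theorem hdAt_eq_zero_of_rational [IsAlgClosed K] (h2 : (2 : K) ≠ 0) (q : Finset σ → F)
    {i j k l₁ l₂ l₃ : σ} (hn : [i, j, k, l₁, l₂, l₃].Nodup) (y : σ → K × K)
    (H : ∀ a b c m, [a, b, c, m].Nodup → (∀ n ∈ [a, b, c, m], n ∈ [i, j, k, l₁, l₂, l₃]) →
      ∀ y' : σ → K × K, (∀ n ∉ [i, j, k, l₁, l₂, l₃], y' n = y n) → IsRational F (y' m) →
        hdAt q a b c y' = 0) :
    hdAt q i j k y = 0 := by
  classical
  have : Infinite K := IsAlgClosed.instInfinite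
  have hn' := hn
  simp only [List.nodup_cons, List.mem_cons, List.not_mem_nil, or_false, not_or, not_false_eq_true,
    List.nodup_nil, and_true] at hn'
  obtain ⟨⟨ij, ik, i1, i2, i3⟩, ⟨jk, j1, j2, j3⟩, ⟨k1, k2, k3⟩, ⟨h12, h13⟩, h23⟩ := hn'
  have hl (l : σ) (hl : l = l₁ ∨ l = l₂ ∨ l = l₃) :
      l ≠ i ∧ l ≠ j ∧ l ≠ k ∧ l ∈ [i, j, k, l₁, l₂, l₃] := by
    rcases hl with h | h | h <;> rw [h]
    · exact ⟨Ne.symm i1, Ne.symm j1, Ne.symm k1, by simp⟩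
    · exact ⟨Ne.symm i2, Ne.symm j2, Ne.symm k2, by simp⟩
    · exact ⟨Ne.symm i3, Ne.symm j3, Ne.symm k3, by simp⟩
  by_cases hy0 : ∃ l, (l = l₁ ∨ l = l₂ ∨ l = l₃) ∧ y l = 0
  · obtain ⟨l, hll, hy⟩ := hy0
    obtain ⟨li, lj, lk, lm⟩ := hl l hll
    exact H i j k l (by simp [ij, ik, jk, li.symm, lj.symm, lk.symm]) (by
      intro n hn
      simp only [List.mem_cons, List.not_mem_nil, or_false] at hn
      rcases hn with h | h | h | h <;> rw [h] <;> first | exact lm | simp) y (fun _ _ => rfl) ⟨0, 0, 0, by rw [hy]; simp; rfl⟩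
  push Not at hy0
  -- θ avoids three rational points, so that four finite parameters exist, and the slopes of y at
  -- l₁, l₂, l₃, so that these vectors lie in the chart ξ(θ,1) + (1,0).
  obtain ⟨θ, hθ⟩ := Infinite.exists_notMem_finset
    ({0, 1, -1, (y l₁).1 / (y l₁).2, (y l₂).1 / (y l₂).2, (y l₃).1 / (y l₃).2} : Finset K)
  simp only [Finset.mem_insert, Finset.mem_singleton, not_or] at hθ
  obtain ⟨θ0, θ1, θm, hθ1, hθ2, hθ3⟩ := hθ
  let c : σ → K := fun l => (y l).1 - θ * (y l).2
  have hc (l : σ) (hl : l = l₁ ∨ l = l₂ ∨ l = l₃) : c l ≠ 0 := by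
    intro h
    have hyl := hy0 l hl
    have hr : θ ≠ (y l).1 / (y l).2 := by rcases hl with rfl | rfl | rfl <;> assumption
    by_cases h0 : (y l).2 = 0
    · apply hyl
      simp only [c, h0, mul_zero, sub_zero] at h
      exact Prod.ext h h0
    · apply hr
      field_simp
      simp only [c] at h
      linear_combination -h
  obtain ⟨p, hp, hpr⟩ := exists_four_points (F := F) h2 θ0 θ1 θm
  -- The pair (0, y m) freezes every coordinate outside the six at its given weight.
  let E : σ → Bool → K × K := fun m β => if m = l₁ ∨ m = l₂ ∨ m = l₃ then
    (if β then (θ, 1) else (1, 0)) else if m = i ∨ m = j ∨ m = k then bv β else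
    (if β then 0 else y m)
  have hE1 (l : σ) (hl : l = l₁ ∨ l = l₂ ∨ l = l₃) : E l true = (θ, 1) ∧ E l false = (1, 0) := by
    simp [E, hl]
  have hE2 (l : σ) (hl : l = i ∨ l = j ∨ l = k) (β : Bool) : E l β = bv β := by
    have : ¬ (l = l₁ ∨ l = l₂ ∨ l = l₃) := by
      rcases hl with rfl | rfl | rfl <;> simp [*]
    simp [E, hl, this]
  have hE3 (l : σ) (hl : l ∉ [i, j, k, l₁, l₂, l₃]) : E l true = 0 ∧ E l false = y l := by
    simp only [List.mem_cons, List.not_mem_nil, or_false, not_or] at hl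
    simp [E, hl]
  let b : Finset σ → K := chg E q
  let f : (σ → K) → σ → K × K := fun ξ m => ξ m • E m true + E m false
  have hb (a b' c' : σ) (hab : a ≠ b') (hac : a ≠ c') (hbc : b' ≠ c') (w : σ → K × K) :
      hdAt b a b' c' w = (det2 (E a) * det2 (E b') * det2 (E c')) ^ 2 * hdAt q a b' c'
        (fun l => (w l).1 • E l true + (w l).2 • E l false) := by
    rw [hdAt_chg (B := K) E q hab hac hbc]
    rfl
  have hd : hdAt b i j k (affWeight K) = 0 := by
    obtain ⟨B, hB, hdB⟩ := exists_hdAt_eq_sq_sub b ij ik jk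
    have hsl (β : Bool) (l : σ) (hli : l ≠ i) (hlj : l ≠ j) :
        hdAt (slice k β b) i j l (affWeight K) = 0 := by
      by_cases hlk : l = k
      · subst hlk
        exact hdAt_eq_zero_of_mem (fun T hT => slice_of_mem hT β b) _ _ _
      rw [hdAt_slice b (Ne.symm ik) (Ne.symm jk) (Ne.symm hlk)]
      rw [show (affWeight K k).2 = 1 from rfl, one_pow, one_mul]
      refine eq_zero_of_forall_aeval fun ξ => ?_
      have e : ∀ ψ : MvPolynomial σ K →ₐ[K] K, ψ (hdAt b i j l (update (affWeight K) k (bv β))) =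
          0 := by
        intro ψ
        rw [map_hdAt ψ, hb i j l ij (Ne.symm hli) (Ne.symm hlj)]
        by_cases hlS : l ∈ [i, j, k, l₁, l₂, l₃]
        · rw [H i j l k (by simp [ij, ik, jk, Ne.symm hli, Ne.symm hlj, hlk]) (by
            intro n hn
            simp only [List.mem_cons, List.not_mem_nil, or_false] at hn
            rcases hn with h | h | h | h <;> rw [h] <;> first | exact hlS | simp), mul_zero]
          · intro n hn
            have hnk : n ≠ k := by rintro rfl; simp at hn
            simp [hE3 n hn, hnk, affWeight]
          · refine ⟨1, if β then 1 else 0, if β then 0 else 1, ?_⟩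
            cases β <;> simp [hE2 k (by simp)]
        -- For a frozen coordinate the determinant of the frame is zero, which kills the
        -- hyperdeterminant.
        · simp [det2, hE3 l hlS]
      exact e (aeval ξ)
    have hsq (β : Bool) := exists_rayleigh_eq_sq h2 (slice k β b) ij (hsl β)
    obtain ⟨α, hα, hα2⟩ := hsq false
    obtain ⟨γ, hγ, hγ2⟩ := hsq true
    rw [hα2, hγ2] at hdB
    rw [hdB]
    refine sq_sub_eq_zero_of_subst h12 h13 h23 hp h2 hα hγ hB fun l hll r => ?_
    rw [← hdB, map_hdAt]
    obtain ⟨li, lj, lk, lm⟩ := hl l hll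
    refine eq_zero_of_forall_aeval fun ξ => ?_
    have e : ∀ ψ : MvPolynomial σ K →ₐ[K] K, ψ (hdAt b i j k
        (fun m => (subst l (p r) (affWeight K m).1, subst l (p r) (affWeight K m).2))) = 0 := by
      intro ψ
      rw [map_hdAt ψ, hb i j k ij ik jk, H i j k l, mul_zero]
      · simp [ij, ik, jk, li.symm, lj.symm, lk.symm]
      · intro n hn
        simp only [List.mem_cons, List.not_mem_nil, or_false] at hn
        rcases hn with h | h | h | h <;> rw [h] <;> first | exact lm | simp
      · intro n hn
        simp [hE3 n hn, affWeight]
      · have hC : ψ (C (p r)) = p r := ψ.commutes (p r)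
        simp only [affWeight, subst, aeval_X, if_true, hC, hE1 l hll, map_one]
        simpa using hpr r
    exact e (aeval ξ)
  let ξ : σ → K := fun l => (y l).2 / c l
  have h1 : hdAt b i j k (fun l => ((ξ l, 1) : K × K)) = 0 := by
    have := map_hdAt (aeval ξ) b i j k (affWeight K)
    rw [hd, map_zero] at this
    simpa [affWeight] using this.symm
  rw [hb i j k ij ik jk] at h1
  have hdet : det2 (E i) * det2 (E j) * det2 (E k) = 1 := by
    simp [det2, hE2]
  rw [hdet, one_pow, one_mul] at h1
  refine hdAt_smul' q y _ (fun l li lj lk => ?_) h1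
  by_cases hll : l = l₁ ∨ l = l₂ ∨ l = l₃
  · refine ⟨c l, hc l hll, ?_⟩
    have := hc l hll
    rw [(hE1 l hll).1, (hE1 l hll).2]
    refine Prod.ext ?_ ?_
    · simp only [ξ, Prod.smul_mk, smul_eq_mul, Prod.mk_add_mk]
      field_simp
      simp only [c]
      ring
    · simp only [ξ, Prod.smul_mk, smul_eq_mul, Prod.mk_add_mk]
      field_simp
      ring
  · refine ⟨1, one_ne_zero, ?_⟩
    have : l ∉ [i, j, k, l₁, l₂, l₃] := by
      simp only [not_or] at hll
      simp [li, lj, lk, hll]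
    simp [hE3 l this]

end ThreeFree

/-! ### Double roots and kernel vectors. -/

section SingularPoints

variable {F : Type*} [Field F]

theorem exists_orthogonal (a b : F) : ∃ p : F × F, p ≠ 0 ∧ p.1 * a + p.2 * b = 0 := by
  by_cases h : a = 0 ∧ b = 0
  · exact ⟨(1, 0), by simp, by simp [h]⟩
  · refine ⟨(b, -a), ?_, by ring⟩
    intro e
    rw [Prod.mk_eq_zero, neg_eq_zero] at e
    exact h ⟨e.2, e.1⟩

/-- A binary quadratic form of discriminant zero has a double root. -/
theorem exists_double_root {a b c : F} (h : b ^ 2 - 4 * a * c = 0) :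
    ∃ p : F × F, p ≠ 0 ∧ 2 * a * p.1 + b * p.2 = 0 ∧ b * p.1 + 2 * c * p.2 = 0 := by
  by_cases h0 : 2 * a = 0 ∧ b = 0
  · obtain ⟨p, hp, h1⟩ := exists_orthogonal b (2 * c)
    exact ⟨p, hp, by rw [h0.1, h0.2]; ring, by linear_combination h1⟩
  · obtain ⟨p, hp, h1⟩ := exists_orthogonal (2 * a) b
    refine ⟨p, hp, by linear_combination h1, ?_⟩
    by_cases ha : 2 * a = 0
    · have hb : b ≠ 0 := fun hb => h0 ⟨ha, hb⟩
      have : b = 0 := by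
        have : b ^ 2 = 0 := by linear_combination h + 2 * c * ha
        exact pow_eq_zero_iff two_ne_zero |>.1 this
      exact absurd this hb
    · have : 2 * a * (b * p.1 + 2 * c * p.2) = 0 := by linear_combination b * h1 - p.2 * h
      exact (mul_eq_zero.1 this).resolve_left ha

/-- A singular `2 × 2` matrix `m` in whose direction the polar form of the determinant vanishes on
`n` has kernel vectors on which `n` vanishes. -/
theorem exists_kernel_pair {m n : Bool → Bool → F}
    (h0 : m true true * m false false - m true false * m false true = 0)
    (h1 : m true true * n false false + n true true * m false false - m true false * n false true -
      n true false * m false true = 0) :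
    ∃ p r : F × F, p ≠ 0 ∧ r ≠ 0 ∧
      (∀ y, p.1 * m true y + p.2 * m false y = 0) ∧ (∀ x, r.1 * m x true + r.2 * m x false = 0) ∧
      p.1 * (r.1 * n true true + r.2 * n true false) +
        p.2 * (r.1 * n false true + r.2 * n false false) = 0 := by
  by_cases hm : ∀ x y, m x y = 0
  · obtain ⟨r, hr, h⟩ := exists_orthogonal (n true true) (n true false)
    exact ⟨(1, 0), r, by simp, hr, by simp [hm], by simp [hm], by linear_combination h⟩
  push Not at hm
  obtain ⟨x, y, hxy⟩ := hm
  have hp : ((m (!x) y, -m x y) : F × F) ≠ 0 := by simp [hxy]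
  have hp' : ((-m x y, m (!x) y) : F × F) ≠ 0 := by simp [hxy]
  have hr : ((m x (!y), -m x y) : F × F) ≠ 0 := by simp [hxy]
  have hr' : ((-m x y, m x (!y)) : F × F) ≠ 0 := by simp [hxy]
  refine ⟨if x then (m (!x) y, -m x y) else (-m x y, m (!x) y),
    if y then (m x (!y), -m x y) else (-m x y, m x (!y)), ?_, ?_, ?_, ?_, ?_⟩
  · split_ifs <;> assumption
  · split_ifs <;> assumption
  · intro z
    cases x <;> cases y <;> cases z <;> simp <;>
      first | (linear_combination h0) | (linear_combination -h0) | ring1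
  · intro z
    cases x <;> cases y <;> cases z <;> simp <;>
      first | (linear_combination h0) | (linear_combination -h0) | ring1
  · cases x <;> cases y <;> simp
    · linear_combination m false false * h1 - n false false * h0
    · linear_combination -m false true * h1 + n false true * h0
    · linear_combination -m true false * h1 + n true false * h0
    · linear_combination m true true * h1 - n true true * h0

end SingularPoints

/-! ### Singular points of trilinear forms. -/

section Singular

open Function

variable {σ : Type*} [DecidableEq σ] [Fintype σ] {F : Type*} [Field F]

/-- The hyperdeterminant is the discriminant of c ↦ det M(c), so det M has a double root c. Then
M(c) is singular and the polar form vanishes in every direction, which yields kernel vectors a, b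
annihilated by the whole pencil. -/
theorem exists_singular (h2 : (2 : F) ≠ 0) (q : Finset σ → F) {i j k : σ} (hij : i ≠ j)
    (hik : i ≠ k) (hjk : j ≠ k) (w : σ → F × F) (h : hdAt q i j k w = 0) :
    ∃ a b c : F × F, a ≠ 0 ∧ b ≠ 0 ∧ c ≠ 0 ∧ (∀ x, tri q i j k w x b c = 0) ∧
      (∀ y, tri q i j k w a y c = 0) ∧ ∀ z, tri q i j k w a b z = 0 := by
  let u : Bool → Bool → Bool → F := fun x y z => tri q i j k w (bv x) (bv y) (bv z)
  let M : F × F → Bool → Bool → F := fun c x y => c.1 * u x y true + c.2 * u x y false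
  have htri (a b c : F × F) : tri q i j k w a b c =
      a.1 * (b.1 * M c true true + b.2 * M c true false) +
        a.2 * (b.1 * M c false true + b.2 * M c false false) := by
    rw [tri_left q hij hik, tri_middle q hjk, tri_middle q hjk w (0, 1)]
    rw [tri_right, tri_right _ _ _ _ _ (1, 0) (0, 1), tri_right _ _ _ _ _ (0, 1) (1, 0),
      tri_right _ _ _ _ _ (0, 1) (0, 1)]
    rfl
  obtain ⟨c, hc, h1, h1'⟩ := exists_double_root
    (a := u true true true * u false false true - u true false true * u false true true)
    (b := u true true true * u false false false + u true true false * u false false true -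
      u true false true * u false true false - u true false false * u false true true)
    (c := u true true false * u false false false - u true false false * u false true false) (by
      rw [← h]
      simp only [hdAt, hd, u]
      ring)
  have hdet : M c true true * M c false false - M c true false * M c false true = 0 := by
    have : 2 * (M c true true * M c false false - M c true false * M c false true) = 0 := by
      simp only [M]
      linear_combination c.1 * h1 + c.2 * h1'
    exact (mul_eq_zero.1 this).resolve_left h2
  -- A vector e independent of c; vanishing on c and on e gives vanishing in the third argument.
  obtain ⟨e, he, hce⟩ : ∃ e : F × F, c.1 * e.2 - c.2 * e.1 ≠ 0 ∧
      M c true true * M e false false + M e true true * M c false false -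
        M c true false * M e false true - M e true false * M c false true = 0 := by
    by_cases h0 : c.2 = 0
    · refine ⟨(0, 1), ?_, by simp only [M]; linear_combination h1'⟩
      simp only [h0, mul_one, mul_zero, sub_zero]
      exact fun h => hc (Prod.ext h h0)
    · exact ⟨(1, 0), by simpa using h0, by simp only [M]; linear_combination h1⟩
  obtain ⟨a, b, ha, hb, h3, h4, h5⟩ := exists_kernel_pair hdet hce
  refine ⟨a, b, c, ha, hb, hc, fun x => ?_, fun y => ?_, fun z => ?_⟩
  · rw [htri]
    linear_combination x.1 * h4 true + x.2 * h4 false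
  · rw [htri]
    linear_combination y.1 * h3 true + y.2 * h3 false
  · rw [htri]
    have h6 : a.1 * (b.1 * M c true true + b.2 * M c true false) +
        a.2 * (b.1 * M c false true + b.2 * M c false false) = 0 := by
      linear_combination a.1 * h4 true + a.2 * h4 false
    have h7 : (c.1 * e.2 - c.2 * e.1) * (a.1 * (b.1 * M z true true + b.2 * M z true false) +
        a.2 * (b.1 * M z false true + b.2 * M z false false)) = 0 := by
      simp only [M] at h5 h6 ⊢
      linear_combination (z.1 * e.2 - z.2 * e.1) * h6 + (c.1 * z.2 - c.2 * z.1) * h5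
    exact (mul_eq_zero.1 h7).resolve_left he

end Singular

/-- The field with three elements. -/
class IsF3 (F : Type*) [Field F] : Prop where
  three_eq_zero : (3 : F) = 0
  cases : ∀ x : F, x = 0 ∨ x = 1 ∨ x = -1

/-! ### Vertices of the cube and local frames. -/

section Base

open Function

variable {σ : Type*} [DecidableEq σ] [Fintype σ] {F : Type*} [Field F] {A : Type*} [CommRing A]
  [Algebra F A]

theorem IsF3.three (F : Type*) [Field F] [IsF3 F] (A : Type*) [CommRing A] [Algebra F A] :
    (3 : A) = 0 := by
  rw [← map_ofNat (algebraMap F A) 3, IsF3.three_eq_zero, map_zero]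

theorem IsF3.two_ne_zero (F : Type*) [Field F] [IsF3 F] : (2 : F) ≠ 0 := by
  intro h
  exact one_ne_zero (by linear_combination IsF3.three_eq_zero (F := F) - h : (1 : F) = 0)

/-- The set `S`, with `i` added if `b` holds. -/
def addIf (i : σ) (b : Bool) (S : Finset σ) : Finset σ := if b then insert i S else S

@[simp] theorem addIf_true (i : σ) (S : Finset σ) : addIf i true S = insert i S := rfl
@[simp] theorem addIf_false (i : σ) (S : Finset σ) : addIf i false S = S := rfl

theorem mem_addIf {i j : σ} {b : Bool} {S : Finset σ} : j ∈ addIf i b S ↔ (b ∧ j = i) ∨ j ∈ S := by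
  cases b <;> simp

/-- The weights of the vertex of the cube given by `S`. -/
def vtx (S : Finset σ) (l : σ) : A × A := bv (decide (l ∈ S))

theorem val_vtx (q : Finset σ → F) (S : Finset σ) : val q (vtx S : σ → A × A) =
    algebraMap F A (q S) := val_vertex q S

theorem update_vtx {S : Finset σ} {i : σ} (hi : i ∉ S) (b : Bool) :
    update (vtx S : σ → A × A) i (bv b) = vtx (addIf i b S) := by
  funext l
  by_cases h : l = i
  · subst h; cases b <;> simp [vtx, hi]
  · rw [update_of_ne h]
    cases b
    · rfl
    · simp [vtx, h]

theorem tri_vtx (q : Finset σ → F) {i j k : σ} (hij : i ≠ j) (hik : i ≠ k) (hjk : j ≠ k)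
    {S : Finset σ} (hi : i ∉ S) (hj : j ∉ S) (hk : k ∉ S) (x y z : Bool) :
    tri q i j k (vtx S : σ → A × A) (bv x) (bv y) (bv z) =
      algebraMap F A (q (addIf k z (addIf j y (addIf i x S)))) := by
  rw [tri, update_vtx hi, update_vtx, update_vtx, val_vtx]
  · simp [mem_addIf, hk, hik.symm, hjk.symm]
  · simp [mem_addIf, hj, hij.symm]

theorem hdAt_vtx (q : Finset σ → F) {i j k : σ} (hij : i ≠ j) (hik : i ≠ k) (hjk : j ≠ k)
    {S : Finset σ} (hi : i ∉ S) (hj : j ∉ S) (hk : k ∉ S) :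
    hdAt q i j k (vtx S : σ → A × A) = hd fun x y z =>
      algebraMap F A (q (addIf k z (addIf j y (addIf i x S)))) := by
  simp only [hdAt, tri_vtx q hij hik hjk hi hj hk]

theorem tri_vtx_update (q : Finset σ → F) {i j k l : σ} (hn : [i, j, k, l].Nodup)
    {S : Finset σ} (hi : i ∉ S) (hj : j ∉ S) (hk : k ∉ S) (hl : l ∉ S) (p : A × A) (x y z : Bool) :
    tri q i j k (update (vtx S) l p) (bv x) (bv y) (bv z) =
      p.1 * algebraMap F A (q (addIf k z (addIf j y (addIf i x (insert l S))))) +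
        p.2 * algebraMap F A (q (addIf k z (addIf j y (addIf i x S)))) := by
  simp only [List.nodup_cons, List.mem_cons, List.not_mem_nil, or_false, not_or, not_false_eq_true,
    List.nodup_nil, and_true] at hn
  obtain ⟨⟨ij, ik, il⟩, ⟨jk, jl⟩, kl⟩ := hn
  rw [tri_update q (Ne.symm il) (Ne.symm jl) (Ne.symm kl), ← bv_true, ← bv_false,
    update_vtx hl, update_vtx hl, addIf_true, addIf_false, tri_vtx q ij ik jk,
    tri_vtx q ij ik jk hi hj hk]
  all_goals simp [*]

theorem hdAt_vtx_update (q : Finset σ → F) {i j k l : σ} (hn : [i, j, k, l].Nodup)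
    (p : A × A) :
    hdAt q i j k (update (vtx ∅) l p) = hd fun x y z =>
      p.1 * algebraMap F A (q (addIf k z (addIf j y (addIf i x {l})))) +
        p.2 * algebraMap F A (q (addIf k z (addIf j y (addIf i x ∅)))) := by
  simp only [hdAt, tri_vtx_update q hn (Finset.notMem_empty _) (Finset.notMem_empty _)
    (Finset.notMem_empty _) (Finset.notMem_empty _), insert_empty_eq]

theorem hdAt_vtx_update₂ (q : Finset σ → F) {i j k l m : σ} (hn : [i, j, k, l, m].Nodup)
    (p r : A × A) :
    hdAt q i j k (update (update (vtx ∅) l p) m r) = hd fun x y z =>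
      r.1 * (p.1 * algebraMap F A (q (addIf k z (addIf j y (addIf i x {l, m})))) +
        p.2 * algebraMap F A (q (addIf k z (addIf j y (addIf i x {m}))))) +
      r.2 * (p.1 * algebraMap F A (q (addIf k z (addIf j y (addIf i x {l})))) +
        p.2 * algebraMap F A (q (addIf k z (addIf j y (addIf i x ∅))))) := by
  have hn' : [i, j, k, l].Nodup := hn.sublist (by simp)
  simp only [List.nodup_cons, List.mem_cons, List.not_mem_nil, or_false, not_or, not_false_eq_true,
    List.nodup_nil, and_true] at hn
  obtain ⟨⟨ij, ik, il, im⟩, ⟨jk, jl, jm⟩, ⟨kl, km⟩, lm⟩ := hn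
  have e (b : Bool) : update (update (vtx ∅) l p) m (bv b : A × A) =
      update (vtx (addIf m b ∅)) l p := by
    rw [update_comm lm, update_vtx (Finset.notMem_empty _)]
  simp only [hdAt, tri_update q (Ne.symm im) (Ne.symm jm) (Ne.symm km) _ r]
  rw [← bv_true, ← bv_false, e, e]
  simp only [addIf_true, addIf_false, insert_empty_eq]
  have h1 := tri_vtx_update (A := A) q hn' (S := {m}) (by simpa) (by simpa) (by simpa) (by simpa) p
  have h2 := tri_vtx_update (A := A) q hn' (S := ∅) (by simp) (by simp) (by simp) (by simp) p
  simp only [h1, h2, insert_empty_eq]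

theorem tri_congr (q : Finset σ → F) {i j k : σ} {w w' : σ → A × A}
    (h : ∀ l, l ≠ i → l ≠ j → l ≠ k → w l = w' l) (a b c : A × A) :
    tri q i j k w a b c = tri q i j k w' a b c := by
  rw [tri, tri]
  congr 1
  funext l
  by_cases hk : l = k
  · subst hk; simp
  by_cases hj : l = j
  · subst hj; simp [hk]
  by_cases hi : l = i
  · subst hi; simp [hk, hj]
  simp [hi, hj, hk, h l hi hj hk]

theorem chg_eq_tri (E : σ → Bool → F × F) (q : Finset σ → F) (i j k : σ) {S : Finset σ}
    {w : σ → F × F} (hw : ∀ l, l ≠ i → l ≠ j → l ≠ k → E l (decide (l ∈ S)) = w l) :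
    chg E q S = tri q i j k w (E i (decide (i ∈ S))) (E j (decide (j ∈ S)))
      (E k (decide (k ∈ S))) := by
  rw [← tri_congr q hw, tri]
  simp only [update_eq_self]
  rfl

/-- A basis of the plane with a given vector, if that is nonzero. -/
def frame (p : F × F) [DecidableEq F] (b : Bool) : F × F :=
  if b then (if p.2 = 0 then (0, 1) else (1, 0)) else p

theorem det2_frame [DecidableEq F] {p : F × F} (hp : p ≠ 0) : det2 (frame p) ≠ 0 := by
  by_cases h : p.2 = 0
  · have : p.1 ≠ 0 := fun h' => hp (Prod.ext h' h)
    simp [frame, det2, h, this]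
  · simp [frame, det2, h]

end Base

/-! ### Pencils in characteristic three with four known zeros. -/

section Pencils

variable {A : Type*} [CommRing A]

/-- The zeros at (1:0), (0:1), (1:1), (1:−1) leave a multiple of s³t − st³: the outer coefficients
vanish, the sum of the other two conditions kills the middle one as 2 = −1, and the remaining two
are opposite. -/
theorem hd_pencil_eq (h3 : (3 : A) = 0) {u v : Bool → Bool → Bool → A} (hu : hd u = 0)
    (hv : hd v = 0) (h1 : hd (fun x y z => 1 * u x y z + 1 * v x y z) = 0)
    (h2 : hd (fun x y z => 1 * u x y z + -1 * v x y z) = 0) (s t : A) :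
    hd (fun x y z => s * u x y z + t * v x y z) = hd₁ u v * (s ^ 3 * t - s * t ^ 3) := by
  rw [hd_pencil] at h1 h2 ⊢
  rw [hu, hv] at h1 h2 ⊢
  linear_combination s ^ 2 * t ^ 2 * (hdMid u v * h3 - h1 - h2) +
    s * t ^ 3 * (h1 - hdMid u v * h3 + h1 + h2)

theorem hd_pencil_eq' (h3 : (3 : A) = 0) {u v : Bool → Bool → Bool → A} (hu : hd u = 0)
    (hv : hd v = 0) (h1 : hd (fun x y z => 1 * u x y z + 1 * v x y z) = 0)
    (h2 : hd (fun x y z => 1 * u x y z + -1 * v x y z) = 0) (s t : A) :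
    hd (fun x y z => s * u x y z + t * v x y z) = -hd₁ v u * (s ^ 3 * t - s * t ^ 3) := by
  rw [hd_pencil_eq h3 hu hv h1 h2]
  rw [hd_pencil] at h1 h2
  rw [hu, hv] at h1 h2
  linear_combination (s ^ 3 * t - s * t ^ 3) * (h1 - hdMid u v * h3 + h1 + h2)

end Pencils

/-! ### One free coordinate. -/

section OneFree

open Function

variable {σ : Type*} [DecidableEq σ] [Fintype σ] {F : Type*} [Field F] {A : Type*} [CommRing A]
  [Algebra F A] {q : Finset σ → F}

/-- Under these vanishings the hyperdeterminant at the origin reduces to (q_k q_ij)². -/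
theorem PG.apply_singleton_eq_zero (h : PG q) {i j k : σ} (hij : i ≠ j) (hik : i ≠ k) (hjk : j ≠ k)
    (h0 : q ∅ = 0) (hi : q {i} = 0) (hj : q {j} = 0) (h' : q {i, j} ≠ 0) : q {k} = 0 := by
  have := h i j k hij hik hjk (vtx ∅)
  rw [hdAt_vtx q hij hik hjk (by simp) (by simp) (by simp)] at this
  simpa [hd, addIf, h0, hi, hj, Finset.pair_comm j i, h'] using this

/-- The pencil in l is a constant times the quartic, and at such a singular vertex the constant is 4
q_l q_ij q_ik q_jk up to sign. It vanishes because q_ij ≠ 0 forces q_l = 0. -/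
theorem PG.hdAt_update_vtx_eq_zero [IsF3 F] (h : PG q) {i j k l : σ} (hn : [i, j, k, l].Nodup)
    (h0 : q ∅ = 0) (hi : q {i} = 0) (hj : q {j} = 0) (hk : q {k} = 0) (x : A × A) :
    hdAt q i j k (update (vtx ∅) l x) = 0 := by
  have hm (p : F × F) : hdAt q i j k (update (vtx ∅) l (mapVec A p)) = 0 := by
    have hn' := hn
    simp only [List.nodup_cons, List.mem_cons, List.not_mem_nil, or_false, not_or,
      not_false_eq_true, List.nodup_nil, and_true] at hn'
    have h1 := h i j k hn'.1.1 hn'.1.2.1 hn'.2.1.1 (update (vtx ∅) l p)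
    have h2 := map_hdAt (Algebra.ofId F A) q i j k (update (vtx ∅) l p)
    rw [h1, map_zero] at h2
    rw [h2]
    congr 1
    funext m
    by_cases hml : m = l
    · subst hml; simp [mapVec, Algebra.ofId_apply]
    · simp [hml, vtx]
  have hl : q {i, j} = 0 ∨ q {l} = 0 := by
    by_cases h' : q {i, j} = 0
    · exact Or.inl h'
    · simp only [List.nodup_cons, List.mem_cons, List.not_mem_nil, or_false, not_or,
        not_false_eq_true, List.nodup_nil, and_true] at hn
      exact Or.inr (h.apply_singleton_eq_zero hn.1.1 hn.1.2.2 hn.2.1.2 h0 hi hj h')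
  have h10 := hm (1, 0)
  have h01 := hm (0, 1)
  have h11 := hm (1, 1)
  have hm1 := hm (1, -1)
  simp only [hdAt_vtx_update q hn] at h10 h01 h11 hm1 ⊢
  simp only [mapVec, map_one, map_zero, one_mul, zero_mul, add_zero, zero_add] at h10 h01
  simp only [mapVec, map_one, map_neg] at h11 hm1
  rw [hd_pencil_eq' (IsF3.three F A) h10 h01 h11 hm1]
  have : hd₁ (fun x y z => algebraMap F A (q (addIf k z (addIf j y (addIf i x ∅)))))
      (fun x y z => algebraMap F A (q (addIf k z (addIf j y (addIf i x {l}))))) = 0 := by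
    rcases hl with hl | hl <;> simp [hd₁, addIf, h0, hi, hj, hk, Finset.pair_comm j i, hl]
  rw [this, neg_zero, zero_mul]

/-- The hyperdeterminants vanish if one coordinate is free and the others are rational. -/
theorem PG.hdAt_update_eq_zero [IsF3 F] (h : PG q) {i j k l : σ} (hn : [i, j, k, l].Nodup)
    (w : σ → F × F) (x : A × A) : hdAt q i j k (update (fun m => mapVec A (w m)) l x) = 0 := by
  classical
  have hn' := hn
  simp only [List.nodup_cons, List.mem_cons, List.not_mem_nil, or_false, not_or,
    not_false_eq_true, List.nodup_nil, and_true] at hn'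
  obtain ⟨⟨ij, ik, il⟩, ⟨jk, jl⟩, kl⟩ := hn'
  obtain ⟨a, b, c, ha, hb, hc, h1, h2, h3⟩ := exists_singular (IsF3.two_ne_zero F) q ij ik jk
    (update w l (0, 1)) (h i j k ij ik jk _)
  -- Moves a singular point of the trilinear form to the origin in i, j, k, keeps l as it is, and
  -- freezes the other coordinates.
  let E : σ → Bool → F × F := fun m β => if m = i then frame a β else if m = j then frame b β else
    if m = k then frame c β else if m = l then bv β else if β then 0 else w m
  have hE (S : Finset σ) (hS : ∀ m ∈ S, m = i ∨ m = j ∨ m = k) : HypDetGr.chg E q S =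
      tri q i j k (update w l (0, 1)) (E i (decide (i ∈ S))) (E j (decide (j ∈ S)))
        (E k (decide (k ∈ S))) := by
    refine chg_eq_tri E q i j k fun m mi mj mk => ?_
    have : m ∉ S := fun hm => by rcases hS m hm with h | h | h <;> contradiction
    by_cases hml : m = l
    · subst hml; simp [E, mi, mj, mk, this]
    · simp [E, mi, mj, mk, hml, this]
  have key := (h.chg E).hdAt_update_vtx_eq_zero (A := A) hn
    (by rw [hE _ (by simp)]; simpa [E, frame, Ne.symm ij, Ne.symm ik, Ne.symm jk] using h1 _)
    (by rw [hE _ (by simp)]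
        simpa [E, frame, Ne.symm ij, Ne.symm ik, Ne.symm jk] using h1 _)
    (by rw [hE _ (by simp)]
        simpa [E, frame, ij, Ne.symm ij, Ne.symm ik, Ne.symm jk] using h2 _)
    (by rw [hE _ (by simp)]
        simpa [E, frame, ij, ik, jk, Ne.symm ij, Ne.symm ik, Ne.symm jk] using h3 _) x
  rw [hdAt_chg E q ij ik jk] at key
  have hu : IsUnit ((algebraMap F A (det2 (E i) * det2 (E j) * det2 (E k))) ^ 2) := by
    refine ((isUnit_iff_ne_zero.2 ?_).map (algebraMap F A)).pow 2
    have e1 : E i = frame a := by funext β; simp [E]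
    have e2 : E j = frame b := by funext β; simp [E, Ne.symm ij]
    have e3 : E k = frame c := by funext β; simp [E, Ne.symm ik, Ne.symm jk]
    rw [e1, e2, e3]
    exact mul_ne_zero (mul_ne_zero (det2_frame ha) (det2_frame hb)) (det2_frame hc)
  rw [hu.mul_right_eq_zero] at key
  rw [← key]
  refine hdAt_congr q fun m mi mj mk => ?_
  by_cases hml : m = l
  · subst hml; simp [E, mi, mj, mk, mapVec]
  · simp [E, mi, mj, mk, hml, vtx]

end OneFree

/-! ### Two free coordinates and badness. -/

section TwoFree

open Function Polynomial

variable {σ : Type*} [DecidableEq σ] [Fintype σ] {F : Type*} [Field F] {A : Type*} [CommRing A]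
  [Algebra F A] (K : Type*) [Field K] [Algebra F K] {q : Finset σ → F}

/-- The binary quartic form with the four rational roots. -/
def quartic (p : A × A) : A := p.1 ^ 3 * p.2 - p.1 * p.2 ^ 3

/-- The hyperdeterminant in the coordinates `i`, `j`, `k` does not vanish identically in the
coordinates `l`, `m` at the rational weights `w`. -/
def Bad (q : Finset σ → F) (i j k l m : σ) (w : σ → F × F) : Prop :=
  ∃ x y : K × K, hdAt q i j k (update (update (fun n => mapVec K (w n)) l x) m y) ≠ 0

variable {K}

theorem map_hdAt_update₂ {B : Type*} [CommRing B] [Algebra F B] (φ : A →ₐ[F] B)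
    (q : Finset σ → F) (i j k l m : σ) (w : σ → F × F) (x y : A × A) :
    φ (hdAt q i j k (update (update (fun n => mapVec A (w n)) l x) m y)) =
      hdAt q i j k (update (update (fun n => mapVec B (w n)) l (φ x.1, φ x.2)) m
        (φ y.1, φ y.2)) := by
  rw [map_hdAt]
  congr 1
  funext n
  by_cases hm : n = m
  · subst hm; simp
  by_cases hl : n = l
  · subst hl; simp [hm]
  simp [hm, hl, mapVec]

/-- Making either coordinate rational gives zero, so the value is divisible by the quartic in each
of them. The arguments range over K[X] so that both weights can later move along curves and orders
of vanishing can be compared. -/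
theorem PG.exists_eq_quartic [IsF3 F] [Infinite K] (h : PG q) {i j k l m : σ}
    (hn : [i, j, k, l, m].Nodup) (w : σ → F × F) : ∃ c : K, (Bad K q i j k l m w ↔ c ≠ 0) ∧
      ∀ x y : K[X] × K[X], hdAt q i j k (update (update (fun n => mapVec K[X] (w n)) l x) m y) =
        C c * quartic x * quartic y := by
  classical
  have hn1 : [i, j, k, l].Nodup := hn.sublist (by simp)
  have hn2 : [i, j, k, m].Nodup := hn.sublist (by simp)
  have hn' := hn
  simp only [List.nodup_cons, List.mem_cons, List.not_mem_nil, or_false, not_or,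
    not_false_eq_true, List.nodup_nil, and_true] at hn'
  obtain ⟨⟨ij, ik, il, im⟩, ⟨jk, jl, jm⟩, ⟨kl, km⟩, lm⟩ := hn'
  let D : K[X] × K[X] → K[X] × K[X] → K[X] := fun x y =>
    hdAt q i j k (update (update (fun n => mapVec K[X] (w n)) l x) m y)
  have hDm (x : K[X] × K[X]) (p : F × F) : D x (mapVec K[X] p) = 0 := by
    have := h.hdAt_update_eq_zero hn1 (update w m p) x
    rw [← this]
    refine hdAt_congr q fun n _ _ _ => ?_
    by_cases hm : n = m
    · subst hm; simp [Ne.symm lm]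
    by_cases hl : n = l
    · subst hl; simp [hm]
    simp [hm, hl]
  have hDl (y : K[X] × K[X]) (p : F × F) : D (mapVec K[X] p) y = 0 := by
    have := h.hdAt_update_eq_zero hn2 (update w l p) y
    rw [← this]
    refine hdAt_congr q fun n _ _ _ => ?_
    by_cases hm : n = m
    · subst hm; simp
    by_cases hl : n = l
    · subst hl; simp [hm]
    simp [hm, hl]
  have hpm (x : K[X] × K[X]) : ∃ g : K[X], ∀ y, D x y = g * quartic y := by
    have e (y) := hdAt_update q (Ne.symm im) (Ne.symm jm) (Ne.symm km)
      (update (fun n => mapVec K[X] (w n)) l x) y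
    have e1 := (e (mapVec K[X] (1, 0))).symm.trans (hDm x _)
    have e2 := (e (mapVec K[X] (0, 1))).symm.trans (hDm x _)
    have e3 := (e (mapVec K[X] (1, 1))).symm.trans (hDm x _)
    have e4 := (e (mapVec K[X] (1, -1))).symm.trans (hDm x _)
    simp only [mapVec, map_one, map_zero, one_mul, zero_mul, add_zero, zero_add] at e1 e2
    simp only [mapVec, map_one, map_neg] at e3 e4
    exact ⟨_, fun y => (e y).trans (hd_pencil_eq (IsF3.three F K[X]) e1 e2 e3 e4 y.1 y.2)⟩
  have hpl (y : K[X] × K[X]) : ∃ g : K[X], ∀ x, D x y = g * quartic x := by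
    have e0 (x) : D x y =
        hdAt q i j k (update (update (fun n => mapVec K[X] (w n)) m y) l x) := by
      rw [update_comm (Ne.symm lm)]
    have e (x) := (e0 x).trans (hdAt_update q (Ne.symm il) (Ne.symm jl) (Ne.symm kl)
      (update (fun n => mapVec K[X] (w n)) m y) x)
    have e1 := (e (mapVec K[X] (1, 0))).symm.trans (hDl y _)
    have e2 := (e (mapVec K[X] (0, 1))).symm.trans (hDl y _)
    have e3 := (e (mapVec K[X] (1, 1))).symm.trans (hDl y _)
    have e4 := (e (mapVec K[X] (1, -1))).symm.trans (hDl y _)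
    simp only [mapVec, map_one, map_zero, one_mul, zero_mul, add_zero, zero_add] at e1 e2
    simp only [mapVec, map_one, map_neg] at e3 e4
    exact ⟨_, fun x => (e x).trans (hd_pencil_eq (IsF3.three F K[X]) e1 e2 e3 e4 x.1 x.2)⟩
  -- At the point (θ, 1) the quartic is nonzero, and the constant c is read off there.
  obtain ⟨θ, hθ⟩ := Infinite.exists_notMem_finset ({0, 1, -1} : Finset K)
  simp only [Finset.mem_insert, Finset.mem_singleton, not_or] at hθ
  have hz : quartic ((θ, 1) : K × K) ≠ 0 := by
    have : quartic ((θ, 1) : K × K) = θ * (θ - 1) * (θ - -1) := by simp only [quartic]; ring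
    rw [this]
    exact mul_ne_zero (mul_ne_zero hθ.1 (sub_ne_zero.2 hθ.2.1)) (sub_ne_zero.2 hθ.2.2)
  let T : K[X] × K[X] := (C θ, 1)
  have hT : quartic T = C (quartic ((θ, 1) : K × K)) := by simp [quartic, T]
  let d : K := hdAt q i j k (update (update (fun n => mapVec K (w n)) l (θ, 1)) m (θ, 1))
  have hd : D T T = C d := by
    have := map_hdAt_update₂ (CAlgHom (R := F) (A := K)) q i j k l m w (θ, 1) (θ, 1)
    simp only [CAlgHom_apply, map_one] at this
    exact this.symm
  have hform (x y : K[X] × K[X]) :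
      D x y = C (d / quartic ((θ, 1) : K × K) ^ 2) * quartic x * quartic y := by
    obtain ⟨g, hg⟩ := hpm x
    obtain ⟨g', hg'⟩ := hpl T
    have h1 := hg T
    have h2 := hg' T
    rw [hg' x] at h1
    rw [hd] at h2
    rw [hg y]
    have hne : C (quartic ((θ, 1) : K × K)) ≠ 0 := by simpa using hz
    have hc : C d = C (d / quartic ((θ, 1) : K × K) ^ 2) *
        C (quartic ((θ, 1) : K × K)) ^ 2 := by
      rw [← C_pow, ← C_mul, div_mul_cancel₀ _ (pow_ne_zero 2 hz)]
    rw [hT] at h1 h2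
    have : C (quartic ((θ, 1) : K × K)) ^ 2 * (g * quartic y) =
        C (quartic ((θ, 1) : K × K)) ^ 2 *
          (C (d / quartic ((θ, 1) : K × K) ^ 2) * quartic x * quartic y) := by
      linear_combination (-C (quartic ((θ, 1) : K × K)) * quartic y) * h1 -
        quartic x * quartic y * h2 + quartic x * quartic y * hc
    exact mul_left_cancel₀ (pow_ne_zero 2 hne) this
  refine ⟨_, ⟨?_, fun hc => ⟨(θ, 1), (θ, 1), fun h0 => hc ?_⟩⟩, hform⟩
  · rintro ⟨x, y, hxy⟩ hc
    apply hxy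
    have h1 := hform (C x.1, C x.2) (C y.1, C y.2)
    rw [hc] at h1
    simp only [map_zero, zero_mul] at h1
    have h2 := map_hdAt_update₂ (CAlgHom (R := F) (A := K)) q i j k l m w x y
    simp only [CAlgHom_apply] at h2
    rw [← C_eq_zero, h2]
    exact h1
  · rw [show d = 0 from h0, zero_div]

theorem Bad.congr {i j k l m : σ} {w w' : σ → F × F} (hb : Bad K q i j k l m w)
    (h : ∀ n ∉ [i, j, k, l, m], w n = w' n) : Bad K q i j k l m w' := by
  obtain ⟨x, y, hxy⟩ := hb
  refine ⟨x, y, ?_⟩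
  rwa [hdAt_congr q]
  intro n hi hj hk
  by_cases hm : n = m
  · subst hm; simp
  by_cases hl : n = l
  · subst hl; simp [hm]
  simp [hm, hl, h n (by simp [*])]

theorem bad_chg_iff {E : σ → Bool → F × F} {i j k l m : σ} (hn : [i, j, k, l, m].Nodup)
    (hE : ∀ n ∈ [i, j, k, l, m], det2 (E n) ≠ 0) (w : σ → F × F) :
    Bad K (chg E q) i j k l m w ↔
      Bad K q i j k l m fun n => (w n).1 • E n true + (w n).2 • E n false := by
  simp only [List.nodup_cons, List.mem_cons, List.not_mem_nil, or_false, not_or,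
    not_false_eq_true, List.nodup_nil, and_true] at hn
  obtain ⟨⟨ij, ik, il, im⟩, ⟨jk, jl, jm⟩, ⟨kl, km⟩, lm⟩ := hn
  have hu : (algebraMap F K (det2 (E i) * det2 (E j) * det2 (E k))) ^ 2 ≠ 0 := by
    refine pow_ne_zero 2 ?_
    rw [_root_.map_ne_zero]
    exact mul_ne_zero (mul_ne_zero (hE i (by simp)) (hE j (by simp))) (hE k (by simp))
  have key (x y : K × K) : hdAt (chg E q) i j k (update (update (fun n => mapVec K (w n)) l x) m y)
      = (algebraMap F K (det2 (E i) * det2 (E j) * det2 (E k))) ^ 2 *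
        hdAt q i j k (update (update
          (fun n => mapVec K ((w n).1 • E n true + (w n).2 • E n false)) l
          (x.1 • mapVec K (E l true) + x.2 • mapVec K (E l false))) m
          (y.1 • mapVec K (E m true) + y.2 • mapVec K (E m false))) := by
    rw [hdAt_chg E q ij ik jk]
    congr 2
    funext n
    by_cases hm : n = m
    · subst hm; simp
    by_cases hl : n = l
    · subst hl; simp [hm]
    simp [hm, hl, mapVec, Algebra.smul_def]
  have hs (n : σ) (hd : det2 (E n) ≠ 0) (x : K × K) :
      ∃ y : K × K, y.1 • mapVec K (E n true) + y.2 • mapVec K (E n false) = x := by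
    have hd' : algebraMap F K (E n true).1 * algebraMap F K (E n false).2 -
        algebraMap F K (E n true).2 * algebraMap F K (E n false).1 ≠ 0 := by
      rw [← map_mul, ← map_mul, ← map_sub, _root_.map_ne_zero]
      exact hd
    obtain ⟨r, hr⟩ : ∃ r, (algebraMap F K (E n true).1 * algebraMap F K (E n false).2 -
        algebraMap F K (E n true).2 * algebraMap F K (E n false).1) * r = 1 :=
      ⟨_, mul_inv_cancel₀ hd'⟩
    refine ⟨((x.1 * algebraMap F K (E n false).2 - x.2 * algebraMap F K (E n false).1) * r,
      (algebraMap F K (E n true).1 * x.2 - algebraMap F K (E n true).2 * x.1) * r), ?_⟩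
    refine Prod.ext ?_ ?_
    · simp only [mapVec, Prod.smul_mk, Prod.mk_add_mk, smul_eq_mul]
      linear_combination x.1 * hr
    · simp only [mapVec, Prod.smul_mk, Prod.mk_add_mk, smul_eq_mul]
      linear_combination x.2 * hr
  constructor
  · rintro ⟨x, y, hxy⟩
    rw [key] at hxy
    exact ⟨_, _, right_ne_zero_of_mul hxy⟩
  · rintro ⟨x, y, hxy⟩
    obtain ⟨x, rfl⟩ := hs l (hE l (by simp)) x
    obtain ⟨y, rfl⟩ := hs m (hE m (by simp)) y
    exact ⟨x, y, by rw [key]; exact mul_ne_zero hu hxy⟩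

end TwoFree

/-- A quadratic form vanishing on the vectors `(x², y², (x + y)²)`. -/
def conic {A : Type*} [CommRing A] (x y z : A) : A :=
  x ^ 2 + y ^ 2 + z ^ 2 - 2 * x * y - 2 * x * z - 2 * y * z

/-! ### Finite computations over the field with three elements. -/

section Tables

variable {F : Type*} [Field F]

theorem IsF3.exists_hom (F : Type*) [Field F] [IsF3 F] :
    ∃ f : ZMod 3 →+* F, Function.Surjective f := by
  have : CharP F 3 := ringChar.of_eq
    (CharP.ringChar_of_prime_eq_zero Nat.prime_three (by exact_mod_cast IsF3.three_eq_zero))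
  refine ⟨ZMod.castHom (dvd_refl 3) F, fun x => ?_⟩
  rcases IsF3.cases x with rfl | rfl | rfl
  · exact ⟨0, map_zero _⟩
  · exact ⟨1, map_one _⟩
  · exact ⟨-1, by rw [map_neg, map_one]⟩

theorem conic_map {A B : Type*} [CommRing A] [CommRing B] (f : A →+* B) (x y z : A) :
    conic (f x) (f y) (f z) = f (conic x y z) := by
  simp only [conic, map_sub, map_add, map_mul, map_pow, map_ofNat]

theorem zmod_conic_eq : ∀ x y z : ZMod 3, conic x y z = 0 → x ≠ 0 → y ≠ 0 → z ≠ 0 → x = y := by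
  unfold conic
  decide

theorem conic_eq [IsF3 F] {x y z : F} (h : conic x y z = 0) (hx : x ≠ 0) (hy : y ≠ 0)
    (hz : z ≠ 0) : x = y := by
  obtain ⟨f, hf⟩ := IsF3.exists_hom F
  obtain ⟨x, rfl⟩ := hf x
  obtain ⟨y, rfl⟩ := hf y
  obtain ⟨z, rfl⟩ := hf z
  rw [conic_map, map_eq_zero] at h
  rw [Ne, map_eq_zero] at hx hy hz
  rw [zmod_conic_eq x y z h hx hy hz]

-- A finite check: under the five conic relations the combined quantity is nonzero exactly when
-- every variable is. It will express badness at a null point.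
set_option synthInstance.maxSize 4096 in
set_option synthInstance.maxHeartbeats 400000 in
set_option maxRecDepth 100000 in
theorem zmod_conic_add : ∀ x y z : ZMod 3, conic x y z = 0 → ∀ x' y' z' : ZMod 3,
    conic x' y' z' = 0 → ∀ m : ZMod 3, conic (x * y') (y * x') m = 0 →
    conic (x * z') (z * x') m = 0 → conic (y * z') (z * y') m = 0 →
    (conic (x + x') (y + y') (z + z') + 4 * m ≠ 0 ↔
      x ≠ 0 ∧ y ≠ 0 ∧ z ≠ 0 ∧ x' ≠ 0 ∧ y' ≠ 0 ∧ z' ≠ 0 ∧ m ≠ 0) := by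
  unfold conic
  decide

theorem conic_add_ne_zero_iff [IsF3 F] {x y z x' y' z' m : F} (h : conic x y z = 0)
    (h' : conic x' y' z' = 0) (h1 : conic (x * y') (y * x') m = 0)
    (h2 : conic (x * z') (z * x') m = 0) (h3 : conic (y * z') (z * y') m = 0) :
    conic (x + x') (y + y') (z + z') + 4 * m ≠ 0 ↔
      x ≠ 0 ∧ y ≠ 0 ∧ z ≠ 0 ∧ x' ≠ 0 ∧ y' ≠ 0 ∧ z' ≠ 0 ∧ m ≠ 0 := by
  obtain ⟨f, hf⟩ := IsF3.exists_hom F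
  obtain ⟨x, rfl⟩ := hf x
  obtain ⟨y, rfl⟩ := hf y
  obtain ⟨z, rfl⟩ := hf z
  obtain ⟨x', rfl⟩ := hf x'
  obtain ⟨y', rfl⟩ := hf y'
  obtain ⟨z', rfl⟩ := hf z'
  obtain ⟨m, rfl⟩ := hf m
  rw [← map_ofNat f 4]
  simp only [← map_mul, ← map_add, conic_map, map_eq_zero, ne_eq] at h h' h1 h2 h3 ⊢
  exact zmod_conic_add x y z h x' y' z' h' m h1 h2 h3

theorem eq_smul_or_eq_zero {ι : Type*} {f g : ι → F} (h : ∀ a b, f a * g b = g a * f b) :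
    f = 0 ∨ ∃ c, ∀ a, g a = c * f a := by
  by_cases hf : f = 0
  · exact Or.inl hf
  obtain ⟨b, hb⟩ := Function.ne_iff.1 hf
  refine Or.inr ⟨g b / f b, fun a => ?_⟩
  rw [Pi.zero_apply] at hb
  field_simp
  linear_combination -h a b

end Tables

/-! ### Relations between low-order coefficients. -/

section Relations

open Function

variable {σ : Type*} [DecidableEq σ] [Fintype σ] {F : Type*} [Field F] {q : Finset σ → F}

theorem mapVec_vtx (A : Type*) [CommRing A] [Algebra F A] (S : Finset σ) :
    (fun n => mapVec A (vtx S n : F × F)) = vtx S := by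
  funext n
  by_cases h : n ∈ S <;> simp [vtx, h, mapVec]

/-- With one free coordinate the pencil vanishes over the algebraic closure, so all five
coefficients vanish; a parameter outside {0, 1, −1} separates those that rational points cannot.
These are the relations on `q` used from here on. -/
theorem PG.pencil_coeffs [IsF3 F] (h : PG q) {i j k l : σ} (hn : [i, j, k, l].Nodup) :
    let u : Bool → Bool → Bool → F := fun x y z => q (addIf k z (addIf j y (addIf i x {l})))
    let v : Bool → Bool → Bool → F := fun x y z => q (addIf k z (addIf j y (addIf i x ∅)))
    hd u = 0 ∧ hd v = 0 ∧ hd₁ u v = 0 ∧ hd₁ v u = 0 ∧ hdMid u v = 0 := by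
  classical
  intro u v
  let K := AlgebraicClosure F
  have hP (x : K × K) : hd (fun a b c => x.1 * algebraMap F K (u a b c) +
      x.2 * algebraMap F K (v a b c)) = 0 := by
    rw [← h.hdAt_update_eq_zero hn (vtx ∅) x, mapVec_vtx, hdAt_vtx_update q hn]
  simp only [hd_pencil] at hP
  have h1 : hd (fun a b c => algebraMap F K (u a b c)) = 0 := by simpa using hP (1, 0)
  have h2 : hd (fun a b c => algebraMap F K (v a b c)) = 0 := by simpa using hP (0, 1)
  simp only [h1, h2] at hP
  have h3 := hP (1, 1)
  have h4 := hP (1, -1)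
  have three := IsF3.three F K
  have : Infinite K := IsAlgClosed.instInfinite
  obtain ⟨θ, hθ⟩ := Infinite.exists_notMem_finset ({0, 1, -1} : Finset K)
  simp only [Finset.mem_insert, Finset.mem_singleton, not_or] at hθ
  have h5 := hP (θ, 1)
  have hm : hdMid (fun a b c => algebraMap F K (u a b c))
      (fun a b c => algebraMap F K (v a b c)) = 0 := by
    linear_combination hdMid (fun a b c => algebraMap F K (u a b c))
      (fun a b c => algebraMap F K (v a b c)) * three - h3 - h4
  rw [hm] at h3 h5
  have hs : hd₁ (fun a b c => algebraMap F K (u a b c))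
      (fun a b c => algebraMap F K (v a b c)) = -hd₁ (fun a b c => algebraMap F K (v a b c))
      (fun a b c => algebraMap F K (u a b c)) := by
    linear_combination h3
  rw [hs] at h5
  have hv : hd₁ (fun a b c => algebraMap F K (v a b c))
      (fun a b c => algebraMap F K (u a b c)) = 0 := by
    have : (θ * (θ - 1) * (θ - -1)) * hd₁ (fun a b c => algebraMap F K (v a b c))
        (fun a b c => algebraMap F K (u a b c)) = 0 := by
      linear_combination -h5
    exact (mul_eq_zero.1 this).resolve_left
      (mul_ne_zero (mul_ne_zero hθ.1 (sub_ne_zero.2 hθ.2.1)) (sub_ne_zero.2 hθ.2.2))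
  rw [hv, neg_zero] at hs
  have e0 (u : Bool → Bool → Bool → F) : hd (fun a b c => algebraMap F K (u a b c)) =
      algebraMap F K (hd u) := by
    simp only [hd, map_sub, map_add, map_mul, map_pow, map_ofNat]
  have e1 (u v : Bool → Bool → Bool → F) : hd₁ (fun a b c => algebraMap F K (u a b c))
      (fun a b c => algebraMap F K (v a b c)) = algebraMap F K (hd₁ u v) := by
    simp only [hd₁, map_sub, map_add, map_mul, map_pow, map_ofNat]
  have e2 : hdMid (fun a b c => algebraMap F K (u a b c))
      (fun a b c => algebraMap F K (v a b c)) = algebraMap F K (hdMid u v) := by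
    simp only [hdMid, e0, e1, ← map_add, map_sub]
  rw [e0, map_eq_zero] at h1 h2
  rw [e1, map_eq_zero] at hs hv
  rw [e2, map_eq_zero] at hm
  exact ⟨h1, h2, hs, hv, hm⟩

/-- The middle pencil coefficient, when all terms of order at most one vanish. -/
theorem PG.conic_eq_zero [IsF3 F] (h : PG q) {i j k l : σ} (hn : [i, j, k, l].Nodup)
    (h0 : q ∅ = 0) (hi : q {i} = 0) (hj : q {j} = 0) (hk : q {k} = 0) (hl : q {l} = 0) :
    conic (q {i, l} * q {j, k}) (q {j, l} * q {i, k}) (q {k, l} * q {i, j}) = 0 := by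
  have hm := (h.pencil_coeffs hn).2.2.2.2
  simp only [hdMid, hd, hd₁, addIf_true, addIf_false, insert_empty_eq, h0, hi, hj, hk, hl] at hm
  rw [Finset.pair_comm j i, Finset.pair_comm k i, Finset.pair_comm k j] at hm
  rw [conic]
  linear_combination hm

theorem PG.mul_eq_mul [IsF3 F] (h : PG q) {i j k l : σ} (hn : [i, j, k, l].Nodup)
    (h0 : q ∅ = 0) (hi : q {i} = 0) (hj : q {j} = 0) (hk : q {k} = 0) (hl : q {l} = 0)
    (hq : ∀ a ∈ [i, j, k, l], ∀ b ∈ [i, j, k, l], a ≠ b → q {a, b} ≠ 0) :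
    q {i, l} * q {j, k} = q {j, l} * q {i, k} := by
  have hc := h.conic_eq_zero hn h0 hi hj hk hl
  simp only [List.nodup_cons, List.mem_cons, List.not_mem_nil, or_false, not_or,
    not_false_eq_true, List.nodup_nil, and_true] at hn
  obtain ⟨⟨ij, ik, il⟩, ⟨jk, jl⟩, kl⟩ := hn
  exact conic_eq hc
    (mul_ne_zero (hq i (by simp) l (by simp) il) (hq j (by simp) k (by simp) jk))
    (mul_ne_zero (hq j (by simp) l (by simp) jl) (hq i (by simp) k (by simp) ik))
    (mul_ne_zero (hq k (by simp) l (by simp) kl) (hq i (by simp) j (by simp) ij))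

end Relations

/-! ### Orders of vanishing of the hyperdeterminant. -/

section Degenerations

variable {A : Type*} [CommRing A]

/-- The hyperdeterminant is homogeneous of degree two in each face of the cube. -/
theorem exists_hd_eq_of_face {u : Bool → Bool → Bool → A} {g : Bool → Bool → A} {c : A}
    (h : ∀ y z, u false y z = c * g y z) : ∃ G, hd u = c ^ 2 * G := by
  refine ⟨hd fun x y z => if x then u true y z else g y z, ?_⟩
  simp only [hd, h, if_true, Bool.false_eq_true, if_false]
  ring

theorem hd_null_pencil {u g : Bool → Bool → Bool → A} {t : A}
    (h0 : u false false false = t ^ 2 * g false false false)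
    (h1 : u true false false = t * g true false false)
    (h2 : u false true false = t * g false true false)
    (h3 : u false false true = t * g false false true)
    (h4 : ∀ x y z, (x && y || x && z || y && z) → u x y z = g x y z) :
    hd u = t ^ 2 * (conic (g true false false * g false true true)
        (g false true false * g true false true) (g false false true * g true true false)
        + 4 * (g false false false * g true true false * g true false true * g false true true)) +
      t ^ 3 * (4 * g true true true * g true false false * g false true false * g false false true -
        2 * g false false false * g true true true * (g true false false * g false true true +
          g false true false * g true false true + g false false true * g true true false)) +
      t ^ 4 * (g false false false ^ 2 * g true true true ^ 2) := by
  simp only [hd, h0, h1, h2, h3, h4 true true false rfl, h4 true false true rfl,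
    h4 false true true rfl, h4 true true true rfl, conic]
  ring

end Degenerations

/-! ### Badness of five indices at a null point. -/

section FivePoints

open Function Polynomial

variable {σ : Type*} [DecidableEq σ] [Fintype σ] {F : Type*} [Field F] {q : Finset σ → F}
  {K : Type*} [Field K] [Algebra F K]

/-- For the triple j, l, m with pencil direction k, a whole edge of the cube is zero, so the two end
coefficients are squares of 2 × 2 minors, and the middle one is then the square of their mixed form.
-/
theorem PG.minor_eq_zero [IsF3 F] (h : PG q) {j k l m : σ} (hn : [j, k, l, m].Nodup)
    (h0 : q ∅ = 0) (hj : q {j} = 0) (hk : q {k} = 0) (hjk : q {j, k} = 0) :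
    (q {l} * q {j, m} = q {m} * q {j, l}) ∧
      (q {k, l} * q {k, j, m} = q {k, m} * q {k, j, l}) ∧
      q {l} * q {k, j, m} + q {k, l} * q {j, m} - q {m} * q {k, j, l} - q {k, m} * q {j, l} = 0 := by
  have hn' : [j, l, m, k].Nodup := by
    refine (List.Perm.nodup_iff ?_).1 hn
    exact List.Perm.cons j (List.perm_append_comm (l₁ := [k]) (l₂ := [l, m]))
  obtain ⟨h1, h2, -, -, h3⟩ := h.pencil_coeffs hn'
  have e3 (a : σ) : q {a, j, k} = q {k, j, a} := by
    rw [Finset.pair_comm j k, Finset.insert_comm, Finset.pair_comm a j]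
  simp only [hd, hd₁, hdMid, addIf_true, addIf_false, insert_empty_eq, h0, hj, hk, hjk, e3,
    Finset.pair_comm l j, Finset.pair_comm m j, Finset.pair_comm l k, Finset.pair_comm m k]
    at h1 h2 h3
  have a1 : (q {l} * q {j, m} - q {m} * q {j, l}) ^ 2 = 0 := by linear_combination h2
  have a2 : (q {k, l} * q {k, j, m} - q {k, m} * q {k, j, l}) ^ 2 = 0 := by linear_combination h1
  rw [pow_eq_zero_iff two_ne_zero] at a1 a2
  have a3 : (q {l} * q {k, j, m} + q {k, l} * q {j, m} - q {m} * q {k, j, l} -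
      q {k, m} * q {j, l}) ^ 2 = 0 := by
    linear_combination h3 - 2 * a1 * (q {k, l} * q {k, j, m} - q {k, m} * q {k, j, l})
  rw [pow_eq_zero_iff two_ne_zero] at a3
  exact ⟨sub_eq_zero.1 a1, sub_eq_zero.1 a2, a3⟩

/-- At a point singular for three coordinates, a nonzero hyperdeterminant forces nonzero second
derivatives. -/
theorem PG.pair_ne_zero_of_bad [IsF3 F] [Infinite K] (h : PG q) {i j k l m : σ}
    (hn : [i, j, k, l, m].Nodup) (h0 : q ∅ = 0) (hj : q {j} = 0) (hk : q {k} = 0)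
    (hb : Bad K q i j k l m (vtx ∅)) : q {j, k} ≠ 0 := by
  classical
  intro hjk
  have hn4 : [j, k, l, m].Nodup := hn.sublist (by simp)
  have hn4' : [k, j, l, m].Nodup := by
    refine (List.Perm.nodup_iff ?_).1 hn4
    exact List.Perm.swap _ _ _
  obtain ⟨a1, a2, a3⟩ := h.minor_eq_zero hn4 h0 hj hk hjk
  obtain ⟨b1, b2, b3⟩ := h.minor_eq_zero hn4' h0 hk hj (by rwa [Finset.pair_comm])
  rw [Finset.insert_comm j k, Finset.insert_comm j k] at b2 b3
  have two := IsF3.two_ne_zero F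
  have c1 : q {k, l} * q {j, m} - q {k, m} * q {j, l} = 0 := by
    have : 2 * (q {k, l} * q {j, m} - q {k, m} * q {j, l}) = 0 := by
      linear_combination a3 - b3
    exact (mul_eq_zero.1 this).resolve_left two
  have c2 : q {l} * q {k, j, m} = q {m} * q {k, j, l} := by linear_combination a3 - c1
  -- All 2 × 2 minors of the slices at l and m in the directions j, k vanish, so the two slices are
  -- proportional. A curve can then be chosen along which one face of the cube vanishes faster than
  -- the product of quartics permits.
  have hfg : ∀ a b : Bool × Bool,
      q (addIf k a.2 (addIf j a.1 {l})) * q (addIf k b.2 (addIf j b.1 {m})) =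
        q (addIf k a.2 (addIf j a.1 {m})) * q (addIf k b.2 (addIf j b.1 {l})) := by
    rintro ⟨a, b⟩ ⟨c, d⟩
    cases a <;> cases b <;> cases c <;> cases d <;> simp only [addIf_true, addIf_false] <;>
      first | ring1 | (linear_combination a1) | (linear_combination -a1) | (linear_combination b1) |
        (linear_combination -b1) | (linear_combination a2) | (linear_combination -a2) |
        (linear_combination b2) | (linear_combination -b2) | (linear_combination c1) |
        (linear_combination -c1) | (linear_combination c2) | (linear_combination -c2)
  obtain ⟨c, hc, hform⟩ := h.exists_eq_quartic (K := K) hn (vtx ∅)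
  have hc0 := hc.1 hb
  simp only [mapVec_vtx] at hform
  have hz (y z : Bool) : q (addIf k z (addIf j y ∅)) = 0 := by
    cases y <;> cases z <;> simp [h0, hj, hk, hjk, Finset.pair_comm k j]
  let N : Bool → Bool → K[X] := fun y z => algebraMap F K[X] (q (addIf k z (addIf j y {l, m})))
  let M : σ → Bool → Bool → K[X] := fun l y z => algebraMap F K[X] (q (addIf k z (addIf j y {l})))
  obtain ⟨θ, hθ⟩ := Infinite.exists_notMem_finset ({0, 1, -1} : Finset K)
  simp only [Finset.mem_insert, Finset.mem_singleton, not_or] at hθ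
  have hq : θ ^ 3 - θ ≠ 0 := by
    have : θ ^ 3 - θ = θ * (θ - 1) * (θ - -1) := by ring
    rw [this]
    exact mul_ne_zero (mul_ne_zero hθ.1 (sub_ne_zero.2 hθ.2.1)) (sub_ne_zero.2 hθ.2.2)
  have key (p r : K[X] × K[X]) (s : K[X]) (g : Bool → Bool → K[X])
      (hg : ∀ y z, r.1 * (p.1 * N y z + p.2 * M m y z) + r.2 * (p.1 * M l y z) = s * g y z) :
      ∃ G, C c * quartic p * quartic r = s ^ 2 * G := by
    rw [← hform, hdAt_vtx_update₂ q hn]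
    refine exists_hd_eq_of_face (g := g) fun y z => ?_
    simp only [addIf_false, hz, map_zero, mul_zero, add_zero]
    exact hg y z
  rcases eq_smul_or_eq_zero hfg with hf | ⟨ν, hν⟩
  · have hM (y z) : M l y z = 0 := by
      have := congrFun hf (y, z)
      simp only [Pi.zero_apply] at this
      simp [M, this]
    -- The face is divisible by X, hence the hyperdeterminant by X², while the product of quartics
    -- vanishes only to order one.
    obtain ⟨G, hG⟩ := key (C θ, 1) (X, 1) X (fun y z => C θ * N y z + M m y z) (by
      intro y z
      simp only [hM]
      ring)
    have h1 : X ^ 1 * (C c * C (θ ^ 3 - θ) * (X ^ 2 - 1)) = X ^ 2 * G := by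
      rw [← hG]
      simp only [quartic, C_sub, C_pow]
      ring
    have h2 := congrArg (coeff · 1) h1
    simp [coeff_X_pow_mul', hq, hc0, coeff_zero_eq_eval_zero] at h2
  · have hM (y z) : M m y z = algebraMap F K[X] ν * M l y z := by
      have := hν (y, z)
      simp only at this
      simp [M, this]
    by_cases hν0 : ν = 0
    · obtain ⟨G, hG⟩ := key (X, 1) (C θ, 1) X (fun y z => C θ * N y z + M l y z) (by
        intro y z
        simp only [hM, hν0, map_zero]
        ring)
      have h1 : X ^ 1 * (C c * C (θ ^ 3 - θ) * (X ^ 2 - 1)) = X ^ 2 * G := by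
        rw [← hG]
        simp only [quartic, C_sub, C_pow]
        ring
      have h2 := congrArg (coeff · 1) h1
      simp [coeff_X_pow_mul', hq, hc0, coeff_zero_eq_eval_zero] at h2
    -- On this curve the two proportional slices cancel, so the face is divisible by X² and the
    -- hyperdeterminant by X⁴, against order two on the other side.
    · obtain ⟨G, hG⟩ := key (-algebraMap F K[X] ν * X, 1) (X, 1) (X ^ 2)
        (fun y z => -algebraMap F K[X] ν * N y z) (by
        intro y z
        simp only [hM]
        ring)
      have e : algebraMap F K[X] ν = C (algebraMap F K ν) := rfl
      rw [e] at hG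
      have h1 : X ^ 2 * (C c * C (algebraMap F K ν) * (C (algebraMap F K ν) ^ 2 * X ^ 2 - 1) *
          (1 - X ^ 2)) = X ^ 4 * G := by
        have : X ^ 4 * G = (X ^ 2) ^ 2 * G := by ring
        rw [this, ← hG]
        simp only [quartic]
        ring
      have h2 := congrArg (coeff · 2) h1
      simp [coeff_X_pow_mul', hc0, hν0, coeff_zero_eq_eval_zero] at h2

/-- Along the curve with both weights (X, 1), the product of quartics is X² times a unit at X = 0.
The X²-coefficient of the hyperdeterminant at a null point involves only second-order terms, and it
equals c. -/
theorem PG.bad_iff_conic_of_null [IsF3 F] [Infinite K] (h : PG q) {i j k l m : σ}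
    (hn : [i, j, k, l, m].Nodup) (h0 : q ∅ = 0) (h1 : ∀ n ∈ [i, j, k, l, m], q {n} = 0) :
    Bad K q i j k l m (vtx ∅) ↔ conic (q {i, l} * q {j, k} + q {i, m} * q {j, k})
      (q {j, l} * q {i, k} + q {j, m} * q {i, k}) (q {k, l} * q {i, j} + q {k, m} * q {i, j}) +
      4 * (q {l, m} * q {i, j} * q {i, k} * q {j, k}) ≠ 0 := by
  obtain ⟨c, hc, hform⟩ := h.exists_eq_quartic (K := K) hn (vtx ∅)
  simp only [mapVec_vtx] at hform
  have hi := h1 i (by simp)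
  have hj := h1 j (by simp)
  have hk := h1 k (by simp)
  have hl := h1 l (by simp)
  have hm := h1 m (by simp)
  have hval : c = algebraMap F K (conic (q {i, l} * q {j, k} + q {i, m} * q {j, k})
      (q {j, l} * q {i, k} + q {j, m} * q {i, k}) (q {k, l} * q {i, j} + q {k, m} * q {i, j}) +
      4 * (q {l, m} * q {i, j} * q {i, k} * q {j, k})) := by
    have h2 := hform (X, 1) (X, 1)
    rw [hdAt_vtx_update₂ q hn] at h2
    let φ : Finset σ → K[X] := fun S => C (algebraMap F K (q S))
    let ψ : Finset σ → K[X] := fun S => X * φ (insert l (insert m S)) + φ (insert m S) +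
      φ (insert l S)
    let g : Bool → Bool → Bool → K[X] := fun x y z =>
      match x, y, z with
      | false, false, false => φ {l, m}
      | true, false, false => X * φ {i, l, m} + φ {i, m} + φ {i, l}
      | false, true, false => X * φ {j, l, m} + φ {j, m} + φ {j, l}
      | false, false, true => X * φ {k, l, m} + φ {k, m} + φ {k, l}
      | true, true, false => X * (X * φ {j, i, l, m} + φ {j, i, m} + φ {j, i, l}) + φ {j, i}
      | true, false, true => X * (X * φ {k, i, l, m} + φ {k, i, m} + φ {k, i, l}) + φ {k, i}
      | false, true, true => X * (X * φ {k, j, l, m} + φ {k, j, m} + φ {k, j, l}) + φ {k, j}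
      | true, true, true =>
        X * (X * φ {k, j, i, l, m} + φ {k, j, i, m} + φ {k, j, i, l}) + φ {k, j, i}
    have e (S : Finset σ) : algebraMap F K[X] (q S) = φ S := rfl
    have e0 (S : Finset σ) (hS : q S = 0) : φ S = 0 := by simp [φ, hS]
    rw [hd_null_pencil (t := X) (g := g)] at h2
    · have h4 : C c * (X ^ 2 - 1) * (X ^ 2 - 1) = (conic (g true false false * g false true true)
          (g false true false * g true false true) (g false false true * g true true false)
        + 4 * (g false false false * g true true false * g true false true * g false true true)) +
        X * (4 * g true true true * g true false false * g false true false * g false false true -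
          2 * g false false false * g true true true * (g true false false * g false true true +
          g false true false * g true false true + g false false true * g true true false)) +
        X ^ 2 * (g false false false ^ 2 * g true true true ^ 2) := by
        refine mul_left_cancel₀ (pow_ne_zero 2 (X_ne_zero (R := K))) ?_
        simp only [quartic] at h2
        linear_combination -h2
      have h5 := congrArg (Polynomial.eval 0) h4
      simp only [eval_add, eval_mul, eval_sub, eval_X, eval_C, eval_pow, conic, g, φ, eval_one,
        eval_ofNat, ne_eq, OfNat.ofNat_ne_zero, not_false_eq_true, zero_pow, zero_mul, zero_add,
        add_zero, zero_sub, mul_neg, mul_one, neg_neg] at h5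
      rw [h5, Finset.pair_comm j i, Finset.pair_comm k i, Finset.pair_comm k j]
      simp only [conic, map_add, map_sub, map_mul, map_pow, map_ofNat]
      ring
    · simp only [e, addIf_false, e0 _ h0, e0 _ hl, e0 _ hm, g]
      ring
    · simp only [e, addIf_false, addIf_true, insert_empty_eq, e0 _ hi, g]
      ring
    · simp only [e, addIf_false, addIf_true, insert_empty_eq, e0 _ hj, g]
      ring
    · simp only [e, addIf_false, addIf_true, insert_empty_eq, e0 _ hk, g]
      ring
    · intro x y z hxyz
      cases x <;> cases y <;> cases z <;> simp at hxyz <;>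
        simp only [e, addIf_false, addIf_true, insert_empty_eq, g] <;> ring
  rw [hc, hval, _root_.map_ne_zero]

/-- At a point where all first derivatives vanish. -/
theorem PG.bad_iff_of_null [IsF3 F] [Infinite K] (h : PG q) {i j k l m : σ}
    (hn : [i, j, k, l, m].Nodup) (h0 : q ∅ = 0) (h1 : ∀ n ∈ [i, j, k, l, m], q {n} = 0) :
    Bad K q i j k l m (vtx ∅) ↔
      ∀ a ∈ [i, j, k, l, m], ∀ b ∈ [i, j, k, l, m], a ≠ b → q {a, b} ≠ 0 := by
  have hi := h1 i (by simp)
  have hj := h1 j (by simp)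
  have hk := h1 k (by simp)
  have hl := h1 l (by simp)
  have hm := h1 m (by simp)
  have hn' := hn
  simp only [List.nodup_cons, List.mem_cons, List.not_mem_nil, or_false, not_or,
    not_false_eq_true, List.nodup_nil, and_true] at hn'
  obtain ⟨⟨ij, ik, il, im⟩, ⟨jk, jl, jm⟩, ⟨kl, km⟩, lm⟩ := hn'
  have r1 := h.conic_eq_zero (i := i) (j := j) (k := k) (l := l) (by simp [*]) h0 hi hj hk hl
  have r2 := h.conic_eq_zero (i := i) (j := j) (k := k) (l := m) (by simp [*]) h0 hi hj hk hm
  have r3 := h.conic_eq_zero (i := i) (j := j) (k := l) (l := m) (by simp [*]) h0 hi hj hl hm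
  have r4 := h.conic_eq_zero (i := i) (j := k) (k := l) (l := m) (by simp [*]) h0 hi hk hl hm
  have r5 := h.conic_eq_zero (i := j) (j := k) (k := l) (l := m) (by simp [*]) h0 hj hk hl hm
  -- The conic relations of the other three quadruples enter after multiplication by a square that
  -- brings them to common products.
  have table := conic_add_ne_zero_iff (m := q {l, m} * q {i, j} * q {i, k} * q {j, k}) r1 r2
    (by simp only [conic] at r3 ⊢; linear_combination (q {i, k} * q {j, k}) ^ 2 * r3)
    (by simp only [conic] at r4 ⊢; linear_combination (q {i, j} * q {j, k}) ^ 2 * r4)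
    (by simp only [conic] at r5 ⊢; linear_combination (q {i, j} * q {i, k}) ^ 2 * r5)
  rw [h.bad_iff_conic_of_null hn h0 h1, table]
  simp only [mul_ne_zero_iff]
  constructor
  · intro H
    have : Std.Symm fun a b => q {a, b} ≠ 0 := ⟨fun a b hab => by rwa [Finset.pair_comm]⟩
    refine List.Pairwise.forall (R := fun a b => q {a, b} ≠ 0) ?_
    simp only [List.pairwise_cons, List.mem_cons, List.not_mem_nil, or_false, forall_eq_or_imp,
      forall_eq, List.Pairwise.nil, false_imp_iff, implies_true, and_true]
    tauto
  · intro H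
    refine ⟨⟨?_, ?_⟩, ⟨?_, ?_⟩, ⟨?_, ?_⟩, ⟨?_, ?_⟩, ⟨?_, ?_⟩, ⟨?_, ?_⟩, ⟨⟨?_, ?_⟩, ?_⟩, ?_⟩ <;>
      exact H _ (by simp) _ (by simp) (by assumption)

end FivePoints

/-! ### If nothing is bad, all hyperdeterminants vanish. -/

section Reduction

open Function

variable {σ : Type*} [DecidableEq σ] [Fintype σ] {F : Type*} [Field F] {q : Finset σ → F}
  {K : Type*} [Field K] [Algebra F K]

theorem IsRational.exists_smul {v : K × K} (h : IsRational F v) :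
    ∃ c : K, c ≠ 0 ∧ ∃ p : F × F, v = c • mapVec K p := by
  obtain ⟨c, s, t, rfl⟩ := h
  by_cases hc : c = 0
  · exact ⟨1, one_ne_zero, 0, by simp [hc, mapVec]⟩
  · exact ⟨c, hc, (s, t), by simp [mapVec]⟩

theorem PG.hdAt_eq_zero_of_card_le [IsF3 F] (h : PG q)
    (hb : ∀ i j k l m w, [i, j, k, l, m].Nodup → ¬ Bad K q i j k l m w) {i j k : σ} (hij : i ≠ j)
    (hik : i ≠ k) (hjk : j ≠ k) {L : Finset σ} (hL : L.card ≤ 2) (hi : i ∉ L) (hj : j ∉ L)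
    (hk : k ∉ L) (w : σ → K × K)
    (hw : ∀ l, l ∉ L → l ≠ i → l ≠ j → l ≠ k → IsRational F (w l)) : hdAt q i j k w = 0 := by
  have hw' : ∀ l, ∃ c : K, c ≠ 0 ∧ ∃ p : F × F, l ∉ L → l ≠ i → l ≠ j → l ≠ k →
      w l = c • mapVec K p := by
    intro l
    by_cases h : l ∉ L ∧ l ≠ i ∧ l ≠ j ∧ l ≠ k
    · obtain ⟨c, hc, p, hp⟩ := (hw l h.1 h.2.1 h.2.2.1 h.2.2.2).exists_smul
      exact ⟨c, hc, p, fun _ _ _ _ => hp⟩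
    · exact ⟨1, one_ne_zero, 0, fun a b c d => absurd ⟨a, b, c, d⟩ h⟩
  choose c hc p hp using hw'
  refine hdAt_smul' q w (fun l => if l ∈ L then w l else mapVec K (p l)) (fun l li lj lk => ?_) ?_
  · by_cases hl : l ∈ L
    · exact ⟨1, one_ne_zero, by simp [hl]⟩
    · exact ⟨c l, hc l, by simp only [hl, if_false]; exact hp l hl li lj lk⟩
  obtain hL0 | hL1 | hL2 : L.card = 0 ∨ L.card = 1 ∨ L.card = 2 := by omega
  · rw [Finset.card_eq_zero] at hL0
    subst hL0
    have := map_hdAt (Algebra.ofId F K) q i j k p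
    rw [h i j k hij hik hjk, map_zero] at this
    rw [this]
    simp [mapVec, Algebra.ofId_apply]
  · obtain ⟨l, rfl⟩ := Finset.card_eq_one.1 hL1
    rw [Finset.mem_singleton] at hi hj hk
    rw [← h.hdAt_update_eq_zero (i := i) (j := j) (k := k) (l := l) (by simp [*]) p (w l)]
    congr 1
    funext n
    by_cases hn : n = l
    · subst hn; simp
    · simp [hn]
  · obtain ⟨l, m, hlm, rfl⟩ := Finset.card_eq_two.1 hL2
    simp only [Finset.mem_insert, Finset.mem_singleton, not_or] at hi hj hk
    have := hb i j k l m p (by simp [*])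
    simp only [Bad, not_exists, not_not] at this
    rw [← this (w l) (w m)]
    congr 1
    funext n
    by_cases hm : n = m
    · subst hm; simp
    by_cases hl : n = l
    · subst hl; simp [hm]
    simp [hl, hm]

/-- Induction on the number of possibly irrational weights outside the three directions. Up to two
is the hypothesis together with the one-free case; with at least three, `hdAt_eq_zero_of_rational`
reduces to fewer. -/
theorem PG.good_of_forall_not_bad [IsF3 F] [IsAlgClosed K] (h : PG q)
    (hb : ∀ i j k l m w, [i, j, k, l, m].Nodup → ¬ Bad K q i j k l m w) : Good q := by
  have : Infinite K := IsAlgClosed.instInfinite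
  have two : (2 : K) ≠ 0 := by
    rw [← map_ofNat (algebraMap F K) 2, Ne, map_eq_zero]
    exact IsF3.two_ne_zero F
  have key (n : ℕ) : ∀ (i j k : σ), i ≠ j → i ≠ k → j ≠ k → ∀ L : Finset σ, L.card ≤ n → i ∉ L →
      j ∉ L → k ∉ L → ∀ w : σ → K × K,
      (∀ l, l ∉ L → l ≠ i → l ≠ j → l ≠ k → IsRational F (w l)) → hdAt q i j k w = 0 := by
    induction n with
    | zero =>
      intro i j k hij hik hjk L hL hi hj hk w hw
      exact h.hdAt_eq_zero_of_card_le hb hij hik hjk (by omega) hi hj hk w hw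
    | succ n ih =>
      intro i j k hij hik hjk L hL hi hj hk w hw
      by_cases hL2 : L.card ≤ 2
      · exact h.hdAt_eq_zero_of_card_le hb hij hik hjk hL2 hi hj hk w hw
      obtain ⟨l₁, h1, l₂, h2, l₃, h3, h12, h13, h23⟩ := Finset.two_lt_card.1 (not_le.1 hL2)
      have hne {l : σ} (hl : l ∈ L) : i ≠ l ∧ j ≠ l ∧ k ≠ l :=
        ⟨fun e => hi (e ▸ hl), fun e => hj (e ▸ hl), fun e => hk (e ▸ hl)⟩
      obtain ⟨i1, j1, k1⟩ := hne h1
      obtain ⟨i2, j2, k2⟩ := hne h2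
      obtain ⟨i3, j3, k3⟩ := hne h3
      refine hdAt_eq_zero_of_rational two q (i := i) (j := j) (k := k) (l₁ := l₁) (l₂ := l₂)
        (l₃ := l₃) (by simp [*]) w ?_
      intro a b c m hn hmem y' hy' hm
      have hsub : ({a, b, c, m} : Finset σ) ⊆ L ∪ {i, j, k} := by
        intro x hx
        simp only [Finset.mem_insert, Finset.mem_singleton] at hx
        have := hmem x (by simpa using hx)
        simp only [List.mem_cons, List.not_mem_nil, or_false] at this
        simp only [Finset.mem_union, Finset.mem_insert, Finset.mem_singleton]
        rcases this with rfl | rfl | rfl | rfl | rfl | rfl <;> simp [*]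
      have hc4 : ({a, b, c, m} : Finset σ).card = 4 := by
        have := List.toFinset_card_of_nodup hn
        simpa using this
      have hc3 : ({i, j, k} : Finset σ).card = 3 := Finset.card_eq_three.2 ⟨i, j, k, hij, hik, hjk, rfl⟩
      have hcu := Finset.card_union_le L {i, j, k}
      have hcs := Finset.card_sdiff_of_subset hsub
      simp only [List.nodup_cons, List.mem_cons, List.not_mem_nil, or_false, not_or,
        not_false_eq_true, List.nodup_nil, and_true] at hn
      -- The old directions may become irrational weights, but the four indices a, b, c, m leave the
      -- count, so it drops by one.
      refine ih a b c hn.1.1 hn.1.2.1 hn.2.1.1 ((L ∪ {i, j, k}) \ {a, b, c, m}) (by omega)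
        (by simp) (by simp) (by simp) y' fun l hl la lb lc => ?_
      by_cases hlm : l = m
      · rw [hlm]; exact hm
      have hl' : l ∉ L ∧ l ≠ i ∧ l ≠ j ∧ l ≠ k := by
        simp only [Finset.mem_sdiff, Finset.mem_union, Finset.mem_insert, Finset.mem_singleton]
          at hl
        tauto
      rw [hy' l]
      · exact hw l hl'.1 hl'.2.1 hl'.2.2.1 hl'.2.2.2
      · have hlL := hl'.1
        simp only [List.mem_cons, List.not_mem_nil, or_false, not_or]
        refine ⟨hl'.2.1, hl'.2.2.1, hl'.2.2.2, ?_, ?_, ?_⟩ <;> rintro rfl <;> contradiction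
  refine good_of_forall_hdAt_eq_zero K fun i j k hij hik hjk w => ?_
  exact key _ i j k hij hik hjk (Finset.univ \ {i, j, k}) le_rfl (by simp) (by simp) (by simp) w
    fun l hl li lj lk => absurd (by simp [li, lj, lk]) hl

end Reduction

/-! ### Bad sets of five indices. -/

section Pentads

open Function

variable {σ : Type*} [DecidableEq σ] [Fintype σ] {F : Type*} [Field F]
  {q : Finset σ → F} {K : Type*} [Field K] [Algebra F K]

variable (K) in
/-- The five indices in `P` are bad in some order. -/
def BadSet (q : Finset σ → F) (P : Finset σ) (w : σ → F × F) : Prop :=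
  ∃ i j k l m, [i, j, k, l, m].Nodup ∧ P = {i, j, k, l, m} ∧ Bad K q i j k l m w

/-- All first derivatives in the directions of `P` vanish at the origin, and no mixed second
derivative does. -/
structure IsUni (q : Finset σ → F) (P : Finset σ) : Prop where
  empty : q ∅ = 0
  single : ∀ n ∈ P, q {n} = 0
  pair : ∀ a ∈ P, ∀ b ∈ P, a ≠ b → q {a, b} ≠ 0

theorem IsUni.mono {P P' : Finset σ} (h : IsUni q P) (hP : P' ⊆ P) : IsUni q P' :=
  ⟨h.empty, fun n hn => h.single n (hP hn), fun a ha b hb => h.pair a (hP ha) b (hP hb)⟩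

theorem BadSet.congr {P : Finset σ} {w w' : σ → F × F} (hb : BadSet K q P w)
    (h : ∀ n ∉ P, w n = w' n) : BadSet K q P w' := by
  obtain ⟨i, j, k, l, m, hn, rfl, hb⟩ := hb
  exact ⟨i, j, k, l, m, hn, rfl, hb.congr fun n hn => h n (by simpa using hn)⟩

theorem badSet_chg_iff {E : σ → Bool → F × F} {P : Finset σ} (hE : ∀ n ∈ P, det2 (E n) ≠ 0)
    (w : σ → F × F) : BadSet K (chg E q) P w ↔
      BadSet K q P fun n => (w n).1 • E n true + (w n).2 • E n false := by
  constructor <;> rintro ⟨i, j, k, l, m, hn, rfl, hb⟩ <;> refine ⟨i, j, k, l, m, hn, rfl, ?_⟩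
  · exact (bad_chg_iff hn (by simpa using hE) w).1 hb
  · exact (bad_chg_iff hn (by simpa using hE) w).2 hb

/-- At a null point the criterion is symmetric in the five indices, so the roles of directions and
free weights may be exchanged. -/
theorem PG.badSet_iff_of_null [IsF3 F] [Infinite K] (h : PG q) {P : Finset σ} (hP : P.card = 5)
    (h0 : q ∅ = 0) (h1 : ∀ n ∈ P, q {n} = 0) : BadSet K q P (vtx ∅) ↔ IsUni q P := by
  constructor
  · rintro ⟨i, j, k, l, m, hn, rfl, hb⟩
    refine ⟨h0, h1, ?_⟩
    have := (h.bad_iff_of_null hn h0 (by simpa using h1)).1 hb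
    intro a ha b hb hab
    exact this a (by simpa using ha) b (by simpa using hb) hab
  · intro hu
    have hl : P.toList.length = 5 := by rw [Finset.length_toList, hP]
    obtain ⟨i, j, k, l, m, hlist⟩ : ∃ i j k l m, P.toList = [i, j, k, l, m] := by
      match hL : P.toList, hl with
      | [i, j, k, l, m], _ => exact ⟨i, j, k, l, m, rfl⟩
    have hn := P.nodup_toList
    rw [hlist] at hn
    have hmem (n : σ) : n ∈ P ↔ n ∈ [i, j, k, l, m] := by rw [← hlist, Finset.mem_toList]
    refine ⟨i, j, k, l, m, hn, by ext n; rw [hmem]; simp, ?_⟩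
    exact (h.bad_iff_of_null hn h0 fun n hn => h1 n ((hmem n).2 hn)).2
      fun a ha b hb hab => hu.pair a ((hmem a).2 ha) b ((hmem b).2 hb) hab

theorem Bad.ne_zero {i j k l m : σ} {w : σ → F × F} (hb : Bad K q i j k l m w) {n : σ}
    (hn : n ∉ [i, j, k, l, m]) : w n ≠ 0 := by
  intro h0
  obtain ⟨x, y, hxy⟩ := hb
  simp only [List.mem_cons, List.not_mem_nil, or_false, not_or] at hn
  obtain ⟨ni, nj, nk, nl, nm⟩ := hn
  apply hxy
  have e : update (update (fun n => mapVec K (w n)) l x) m y =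
      update (update (update (fun n => mapVec K (w n)) l x) m y) n 0 := by
    rw [eq_update_self_iff]
    simp [nl, nm, h0, mapVec]
  rw [e, hdAt_update q ni nj nk]
  simp [hd]

variable [DecidableEq F]

/-- Take a singular point in the directions i, j, k with the other weights unchanged. Badness there
forces q_jk ≠ 0, which in turn kills the first derivatives at l and m. -/
theorem PG.exists_null [IsF3 F] [Infinite K] (h : PG q) {i j k l m : σ}
    (hn : [i, j, k, l, m].Nodup) (w : σ → F × F) (hl : w l ≠ 0) (hm : w m ≠ 0)
    (hb : Bad K q i j k l m w) : ∃ w' : σ → F × F, (∀ n ∉ [i, j, k], w' n = w n) ∧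
      (∀ n ∈ [i, j, k], w' n ≠ 0) ∧ HypDetGr.chg (fun n => frame (w' n)) q ∅ = 0 ∧
      ∀ n ∈ [i, j, k, l, m], HypDetGr.chg (fun n => frame (w' n)) q {n} = 0 := by
  have hn' := hn
  simp only [List.nodup_cons, List.mem_cons, List.not_mem_nil, or_false, not_or,
    not_false_eq_true, List.nodup_nil, and_true] at hn'
  obtain ⟨⟨ij, ik, il, im⟩, ⟨jk, jl, jm⟩, ⟨kl, km⟩, lm⟩ := hn'
  obtain ⟨a, b, c, ha, hb', hc, h1, h2, h3⟩ := exists_singular (IsF3.two_ne_zero F) q ij ik jk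
    w (h i j k ij ik jk _)
  let w' : σ → F × F := fun n => if n = i then a else if n = j then b else if n = k then c else w n
  let E : σ → Bool → F × F := fun n => frame (w' n)
  have hw'i : w' i = a := by simp [w']
  have hw'j : w' j = b := by simp [w', Ne.symm ij]
  have hw'k : w' k = c := by simp [w', Ne.symm ik, Ne.symm jk]
  have hw'n (n : σ) (ni : n ≠ i) (nj : n ≠ j) (nk : n ≠ k) : w' n = w n := by
    simp [w', ni, nj, nk]
  have hE (S : Finset σ) (hS : ∀ n ∈ S, n = i ∨ n = j ∨ n = k) : HypDetGr.chg E q S =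
      tri q i j k w (frame a (decide (i ∈ S))) (frame b (decide (j ∈ S)))
        (frame c (decide (k ∈ S))) := by
    rw [chg_eq_tri E q i j k (w := w) fun n ni nj nk => ?_]
    · simp only [E, hw'i, hw'j, hw'k]
    · have : n ∉ S := fun hm => by rcases hS n hm with h | h | h <;> contradiction
      simp [E, frame, this, hw'n n ni nj nk]
  have f0 : HypDetGr.chg E q ∅ = 0 := by
    rw [hE _ (by simp)]; simpa [frame] using h1 _
  have fi : HypDetGr.chg E q {i} = 0 := by
    rw [hE _ (by simp)]; simpa [frame, Ne.symm ij, Ne.symm ik] using h1 _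
  have fj : HypDetGr.chg E q {j} = 0 := by
    rw [hE _ (by simp)]; simpa [frame, ij, Ne.symm jk] using h2 _
  have fk : HypDetGr.chg E q {k} = 0 := by
    rw [hE _ (by simp)]; simpa [frame, ik, jk] using h3 _
  have hdet : ∀ n ∈ [i, j, k, l, m], det2 (E n) ≠ 0 := by
    intro n hn
    refine det2_frame ?_
    simp only [List.mem_cons, List.not_mem_nil, or_false] at hn
    rcases hn with rfl | rfl | rfl | rfl | rfl
    · rwa [hw'i]
    · rwa [hw'j]
    · rwa [hw'k]
    · rwa [hw'n _ (Ne.symm il) (Ne.symm jl) (Ne.symm kl)]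
    · rwa [hw'n _ (Ne.symm im) (Ne.symm jm) (Ne.symm km)]
  have hbad : Bad K (HypDetGr.chg E q) i j k l m (vtx ∅) := by
    rw [bad_chg_iff hn hdet]
    refine hb.congr fun n hn => ?_
    simp only [List.mem_cons, List.not_mem_nil, or_false, not_or] at hn
    simp [vtx, E, frame, hw'n n hn.1 hn.2.1 hn.2.2.1]
  have hjk := (h.chg E).pair_ne_zero_of_bad hn f0 fj fk hbad
  refine ⟨w', fun n hn => ?_, fun n hn => ?_, f0, fun n hn => ?_⟩
  · simp only [List.mem_cons, List.not_mem_nil, or_false, not_or] at hn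
    exact hw'n n hn.1 hn.2.1 hn.2.2
  · simp only [List.mem_cons, List.not_mem_nil, or_false] at hn
    rcases hn with rfl | rfl | rfl
    · rwa [hw'i]
    · rwa [hw'j]
    · rwa [hw'k]
  · simp only [List.mem_cons, List.not_mem_nil, or_false] at hn
    rcases hn with rfl | rfl | rfl | rfl | rfl
    · exact fi
    · exact fj
    · exact fk
    · exact (h.chg E).apply_singleton_eq_zero jk jl kl f0 fj fk hjk
    · exact (h.chg E).apply_singleton_eq_zero jk jm km f0 fj fk hjk

end Pentads

/-- Any two edges of a complete graph are linked by a chain of edges in which neighbours share a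
vertex. -/
theorem eq_of_adjacent {σ X : Type*} {P : Finset σ} {f : σ → σ → X} (hs : ∀ a b, f a b = f b a)
    (h : ∀ i ∈ P, ∀ j ∈ P, ∀ k ∈ P, i ≠ j → i ≠ k → j ≠ k → f i k = f j k) :
    ∀ a ∈ P, ∀ b ∈ P, ∀ c ∈ P, ∀ d ∈ P, a ≠ b → c ≠ d → f a b = f c d := by
  have h' : ∀ i ∈ P, ∀ j ∈ P, ∀ k ∈ P, i ≠ k → j ≠ k → f i k = f j k := by
    intro i hi j hj k hk hik hjk
    by_cases hij : i = j
    · rw [hij]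
    · exact h i hi j hj k hk hij hik hjk
  intro a ha b hb c hc d hd hab hcd
  by_cases hbc : b = c
  · subst hbc
    rw [h' a ha d hd b hb hab (Ne.symm hcd), hs]
  · rw [h' a ha c hc b hb hab (Ne.symm hbc), hs, h' b hb d hd c hc hbc (Ne.symm hcd), hs]

/-! ### Null points with prescribed coordinates; tame coordinates. -/

section Words

open Function

variable {σ : Type*} [DecidableEq σ] [Fintype σ] {F : Type*} [Field F]
  {q : Finset σ → F} {K : Type*} [Field K] [Algebra F K]

theorem BadSet.card {P : Finset σ} {w : σ → F × F} (hb : BadSet K q P w) : P.card = 5 := by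
  obtain ⟨i, j, k, l, m, hn, rfl, -⟩ := hb
  have := List.toFinset_card_of_nodup hn
  simpa using this

theorem BadSet.ne_zero {P : Finset σ} {w : σ → F × F} (hb : BadSet K q P w) {n : σ}
    (hn : n ∉ P) : w n ≠ 0 := by
  obtain ⟨i, j, k, l, m, -, rfl, hb⟩ := hb
  exact hb.ne_zero (by simpa using hn)

theorem IsUni.apply_singleton_eq_zero {P : Finset σ} (hu : IsUni q P) (h : PG q)
    (hP : 2 ≤ P.card) {l : σ} (hl : l ∉ P) : q {l} = 0 := by
  obtain ⟨a, ha, b, hb, hab⟩ := Finset.one_lt_card.1 hP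
  have hla : l ≠ a := fun e => hl (e ▸ ha)
  have hlb : l ≠ b := fun e => hl (e ▸ hb)
  exact h.apply_singleton_eq_zero hab (Ne.symm hla) (Ne.symm hlb) hu.empty (hu.single a ha)
    (hu.single b hb) (hu.pair a ha b hb hab)

/-- With two of its three arguments zero, the conic relation is the square of q_kl q_ij. -/
theorem IsUni.apply_pair_eq_zero [IsF3 F] {P : Finset σ} (hu : IsUni q P) (h : PG q)
    {l i j k : σ} (hl : l ∉ P) (hi : i ∈ P) (hj : j ∈ P) (hk : k ∈ P)
    (hij : i ≠ j) (hil : q {i, l} = 0) (hjl : q {j, l} = 0) : q {k, l} = 0 := by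
  by_cases hik : i = k
  · rw [← hik, hil]
  by_cases hjk : j = k
  · rw [← hjk, hjl]
  have hli : l ≠ i := fun e => hl (e ▸ hi)
  have hlj : l ≠ j := fun e => hl (e ▸ hj)
  have hlk : l ≠ k := fun e => hl (e ▸ hk)
  have hc := h.conic_eq_zero (i := i) (j := j) (k := k) (l := l)
    (by simp [hij, hik, hjk, Ne.symm hli, Ne.symm hlj, Ne.symm hlk]) hu.empty (hu.single i hi)
    (hu.single j hj) (hu.single k hk)
    (hu.apply_singleton_eq_zero h (Finset.one_lt_card.2 ⟨i, hi, j, hj, hij⟩) hl)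
  have : (q {k, l} * q {i, j}) ^ 2 = 0 := by
    rw [hil, hjl] at hc
    simp only [conic] at hc
    linear_combination hc
  rw [pow_eq_zero_iff two_ne_zero] at this
  exact (mul_eq_zero.1 this).resolve_right (hu.pair i hi j hj hij)

theorem det2_bv : det2 (bv : Bool → F × F) ≠ 0 := by simp [det2]

theorem PG.badSet_of_val [IsF3 F] [Infinite K] (h : PG q) {P : Finset σ} (hP : P.card = 5)
    {w : σ → F × F} (hw : ∀ n ∈ P, w n = (0, 1)) (h0 : val q w = 0)
    (h1 : ∀ n ∈ P, val q (update w n (1, 0)) = 0)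
    (h2 : ∀ a ∈ P, ∀ b ∈ P, a ≠ b → val q (update (update w a (1, 0)) b (1, 0)) ≠ 0) :
    BadSet K q P w := by
  classical
  let E : σ → Bool → F × F := fun n b => if n ∈ P then bv b else if b then 0 else w n
  have hE : ∀ n ∈ P, det2 (E n) ≠ 0 := by
    intro n hn
    have : E n = bv := by funext b; simp [E, hn]
    rw [this]
    exact det2_bv
  have e0 : HypDetGr.chg E q ∅ = 0 := by
    rw [← h0, HypDetGr.chg]
    congr 1
    funext n
    by_cases hn : n ∈ P <;> simp [E, hn, hw]
  have e1 : ∀ a ∈ P, HypDetGr.chg E q {a} = 0 := by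
    intro a ha
    rw [← h1 a ha, HypDetGr.chg]
    congr 1
    funext n
    by_cases hna : n = a
    · subst hna; simp [E, ha]
    · by_cases hn : n ∈ P <;> simp [E, hn, hw, hna]
  have e2 : ∀ a ∈ P, ∀ b ∈ P, a ≠ b → HypDetGr.chg E q {a, b} ≠ 0 := by
    intro a ha b hb hab
    have : HypDetGr.chg E q {a, b} = val q (update (update w a (1, 0)) b (1, 0)) := by
      rw [HypDetGr.chg]
      congr 1
      funext n
      by_cases hnb : n = b
      · subst hnb; simp [E, hb]
      by_cases hna : n = a
      · subst hna; simp [E, ha, hnb]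
      by_cases hn : n ∈ P <;> simp [E, hn, hw, hna, hnb]
    rw [this]
    exact h2 a ha b hb hab
  have hb := ((h.chg E).badSet_iff_of_null (K := K) hP e0 e1).2 ⟨e0, e1, e2⟩
  rw [badSet_chg_iff hE] at hb
  refine hb.congr fun n hn => ?_
  simp [vtx, E, hn]

theorem val_update_vtx (q : Finset σ → F) {S : Finset σ} {l : σ} (hl : l ∉ S) (x : F × F) :
    val q (update (vtx S) l x) = x.1 * q (insert l S) + x.2 * q S := by
  rw [val_update, ← bv_true, ← bv_false, update_vtx hl, update_vtx hl, val_vtx, val_vtx]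
  simp

theorem val_update_update_vtx (q : Finset σ → F) {S : Finset σ} {l m : σ} (hlm : l ≠ m)
    (hl : l ∉ S) (hm : m ∉ S) (x y : F × F) :
    val q (update (update (vtx S) l x) m y) =
      x.1 * y.1 * q (insert l (insert m S)) + x.1 * y.2 * q (insert l S) +
        x.2 * y.1 * q (insert m S) + x.2 * y.2 * q S := by
  rw [val_update, update_comm hlm, update_comm hlm, ← bv_true, ← bv_false, update_vtx hm,
    update_vtx hm, addIf_true, addIf_false, val_update_vtx q hl, val_update_vtx q]
  · ring
  · simp [hl, hlm]

variable (K) in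
/-- No hyperdeterminant is bad when the coordinate `l` has the value `y`. -/
def Avoids (q : Finset σ → F) (l : σ) (y : F × F) : Prop :=
  ∀ P w, l ∉ P → w l = y → ¬ BadSet K q P w

variable (K) in
/-- Two points of the projective line in the coordinate `l` avoid all bad hyperdeterminants. -/
def Tame (q : Finset σ → F) (l : σ) : Prop :=
  ∃ y y' : F × F, y.1 * y'.2 - y.2 * y'.1 ≠ 0 ∧ Avoids K q l y ∧ Avoids K q l y'

theorem Tame.exists_ne_zero {l : σ} (h : Tame K q l) : ∃ y, y ≠ 0 ∧ Avoids K q l y := by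
  obtain ⟨y, y', hy, h, -⟩ := h
  refine ⟨y, ?_, h⟩
  rintro rfl
  simp at hy

/-- A nonzero linear form cannot vanish at two independent vectors. -/
theorem Tame.exists_form_ne_zero {l : σ} (h : Tame K q l) {a b : F} (hab : a ≠ 0 ∨ b ≠ 0) :
    ∃ y, a * y.1 + b * y.2 ≠ 0 ∧ Avoids K q l y := by
  obtain ⟨y, y', hy, h, h'⟩ := h
  by_contra! hc
  have h1 := mt (hc y) (not_not.2 h)
  have h2 := mt (hc y') (not_not.2 h')
  rw [not_not] at h1 h2
  have ha : a * (y.1 * y'.2 - y.2 * y'.1) = 0 := by linear_combination y'.2 * h1 - y.2 * h2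
  have hb : b * (y.1 * y'.2 - y.2 * y'.1) = 0 := by linear_combination y.1 * h2 - y'.1 * h1
  rcases hab with hab | hab
  · exact mul_ne_zero hab hy ha
  · exact mul_ne_zero hab hy hb

theorem Tame.chg {l : σ} (h : Tame K q l) {E : σ → Bool → F × F} (hE : ∀ n, det2 (E n) ≠ 0) :
    Tame K (chg E q) l := by
  obtain ⟨y, y', hy, h, h'⟩ := h
  let z : F × F → F × F := fun y =>
    ((y.1 * (E l false).2 - y.2 * (E l false).1) / det2 (E l),
      ((E l true).1 * y.2 - (E l true).2 * y.1) / det2 (E l))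
  have hz (y : F × F) : (z y).1 • E l true + (z y).2 • E l false = y := by
    have := hE l
    refine Prod.ext ?_ ?_
    · simp only [z, Prod.fst_add, Prod.smul_fst, smul_eq_mul]
      field_simp
      simp only [det2]
      ring
    · simp only [z, Prod.snd_add, Prod.smul_snd, smul_eq_mul]
      field_simp
      simp only [det2]
      ring
  have ha (y : F × F) (h : Avoids K q l y) : Avoids K (HypDetGr.chg E q) l (z y) := by
    intro P w hl hw hb
    rw [badSet_chg_iff fun n _ => hE n] at hb
    refine h P _ hl ?_ hb
    simp only [hw]
    exact hz y
  refine ⟨z y, z y', fun h0 => hy ?_, ha y h, ha y' h'⟩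
  have e1 := congrArg Prod.fst (hz y)
  have e2 := congrArg Prod.snd (hz y)
  have e3 := congrArg Prod.fst (hz y')
  have e4 := congrArg Prod.snd (hz y')
  simp only [Prod.fst_add, Prod.snd_add, Prod.smul_fst, Prod.smul_snd, smul_eq_mul] at e1 e2 e3 e4
  rw [← e1, ← e2, ← e3, ← e4]
  have h1 : ((z y).1 * (z y').2 - (z y).2 * (z y').1) * det2 (E l) = 0 := by rw [h0, zero_mul]
  simp only [det2] at h1
  linear_combination h1

/-- Otherwise the first derivatives vanish for every weight at l, and the second derivatives are
linear forms in that weight, all proportional. Where these are nonzero P is bad, yet tameness offers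
such a weight at which nothing is bad. -/
theorem IsUni.exists_pair_ne_zero [IsF3 F] [Infinite K] {P : Finset σ} (hu : IsUni q P)
    (h : PG q) (hP : P.card = 5) {l : σ} (hl : l ∉ P) (ht : Tame K q l) :
    ∃ i ∈ P, q {i, l} ≠ 0 := by
  by_contra! hz
  have hne {n : σ} (hn : n ∈ P) : n ≠ l := fun e => hl (e ▸ hn)
  have key : ∀ i ∈ P, ∀ j ∈ P, ∀ k ∈ P, i ≠ j → i ≠ k → j ≠ k →
      q (insert l {i, k}) / q {i, k} = q (insert l {j, k}) / q {j, k} := by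
    intro i hi j hj k hk hij hik hjk
    have hc := (h.pencil_coeffs (i := i) (j := j) (k := l) (l := k)
      (by simp [hij, hik, hjk, hne hi, hne hj, (hne hk).symm])).1
    have hkl := hz k hk
    rw [Finset.pair_comm] at hkl
    simp only [hd, addIf_true, addIf_false, hu.single k hk, hkl] at hc
    rw [div_eq_div_iff (hu.pair i hi k hk hik) (hu.pair j hj k hk hjk)]
    have : (q (insert l {i, k}) * q {j, k} - q (insert l {j, k}) * q {i, k}) ^ 2 = 0 := by
      linear_combination hc
    rw [pow_eq_zero_iff two_ne_zero] at this
    exact sub_eq_zero.1 this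
  have hconst := eq_of_adjacent (f := fun a b => q (insert l {a, b}) / q {a, b})
    (fun a b => by rw [Finset.pair_comm]) key
  obtain ⟨a, ha, b, hb, hab⟩ := Finset.one_lt_card.1 (by omega : 1 < P.card)
  obtain ⟨y, hy, hav⟩ := ht.exists_form_ne_zero (a := q (insert l {a, b})) (b := q {a, b})
    (Or.inr (hu.pair a ha b hb hab))
  refine hav P (update (vtx ∅) l y) hl (by simp) (h.badSet_of_val hP ?_ ?_ ?_ ?_)
  · intro n hn
    simp [hne hn, vtx]
  · rw [val_update_vtx q (by simp), insert_empty_eq, hu.apply_singleton_eq_zero h (by omega) hl,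
      hu.empty]
    ring
  · intro n hn
    rw [update_comm (hne hn).symm, ← bv_true, update_vtx (by simp),
      val_update_vtx q (by simpa using (hne hn).symm), addIf_true, insert_empty_eq,
      Finset.pair_comm, hz n hn, hu.single n hn]
    ring
  · intro c hc d hd hcd
    rw [update_comm (hne hc).symm, update_comm (hne hd).symm, ← bv_true, update_vtx (by simp),
      update_vtx (by simpa using hcd.symm), val_update_vtx q (by
        simp only [addIf_true, Finset.mem_insert, insert_empty_eq, Finset.mem_singleton, not_or]
        exact ⟨(hne hd).symm, (hne hc).symm⟩)]
    simp only [addIf_true, insert_empty_eq]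
    have e := hconst d hd c hc a ha b hb hcd.symm hab
    have h1 := hu.pair d hd c hc hcd.symm
    have h2 := hu.pair a ha b hb hab
    rw [div_eq_div_iff h1 h2] at e
    intro h0
    apply mul_ne_zero hy h1
    linear_combination q {a, b} * h0 - y.1 * e

variable [DecidableEq F]

/-- Badness does not depend on the weights inside P, and at a null point it is symmetric in P. So
one null point is reached first, then the indices are renamed to make a, b the free pair, whose
weights can be prescribed. -/
theorem PG.exists_word [IsF3 F] [Infinite K] (h : PG q) {P : Finset σ} {w : σ → F × F}
    (hb : BadSet K q P w) {a b : σ} (ha : a ∈ P) (hbP : b ∈ P) (hab : a ≠ b) {x y : F × F}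
    (hx : x ≠ 0) (hy : y ≠ 0) : ∃ w' : σ → F × F, (∀ n, w' n ≠ 0) ∧ (∀ n ∉ P, w' n = w n) ∧
      w' a = x ∧ w' b = y ∧ IsUni (HypDetGr.chg (fun n => frame (w' n)) q) P := by
  have hP := hb.card
  have huni {w' : σ → F × F} (hw : ∀ n ∉ P, w' n = w n) (hw0 : ∀ n, w' n ≠ 0)
      (h0 : HypDetGr.chg (fun n => frame (w' n)) q ∅ = 0)
      (h1 : ∀ n ∈ P, HypDetGr.chg (fun n => frame (w' n)) q {n} = 0) :
      IsUni (HypDetGr.chg (fun n => frame (w' n)) q) P := by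
    refine ((h.chg _).badSet_iff_of_null (K := K) hP h0 h1).1 ?_
    rw [badSet_chg_iff fun n _ => det2_frame (hw0 n)]
    refine hb.congr fun n hn => ?_
    simp [vtx, frame, hw n hn]
  have hb' := hb
  obtain ⟨i, j, k, l, m, hn, rfl, hb1⟩ := hb'
  have hlm : l ≠ m := by
    simp only [List.nodup_cons, List.mem_cons, List.not_mem_nil, or_false, not_or,
      not_false_eq_true, List.nodup_nil, and_true] at hn
    exact hn.2.2.2
  -- The weights (1, 0) at l and m are arbitrary nonzero choices.
  obtain ⟨w₁, hw1, hw1', h10, h11⟩ := h.exists_null (K := K) hn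
    (update (update w l (1, 0)) m (1, 0)) (by simp [hlm]) (by simp) (hb1.congr (by
      intro n hn
      simp only [List.mem_cons, List.not_mem_nil, or_false, not_or] at hn
      simp [hn.2.2.2.1, hn.2.2.2.2]))
  have hw1n : ∀ n ∉ ({i, j, k, l, m} : Finset σ), w₁ n = w n := by
    intro n hn
    simp only [Finset.mem_insert, Finset.mem_singleton, not_or] at hn
    rw [hw1 n (by simp [hn])]
    simp [hn.2.2.2.1, hn.2.2.2.2]
  have hw10 : ∀ n, w₁ n ≠ 0 := by
    intro n
    by_cases h1 : n ∈ [i, j, k]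
    · exact hw1' n h1
    rw [hw1 n h1]
    by_cases h2 : n = m
    · subst h2; simp
    by_cases h3 : n = l
    · subst h3; simp [h2]
    simp only [ne_eq, h2, not_false_eq_true, update_of_ne, h3]
    exact hb.ne_zero (by simp_all)
  have hu1 := huni hw1n hw10 h10 (by simpa using h11)
  have hc : (({i, j, k, l, m} : Finset σ) \ {a, b}).card = 3 := by
    rw [Finset.card_sdiff_of_subset, Finset.card_pair hab, hP]
    intro n hn
    simp only [Finset.mem_insert, Finset.mem_singleton] at hn
    rcases hn with rfl | rfl <;> assumption
  obtain ⟨c, d, e, hcd, hce, hde, hset⟩ := Finset.card_eq_three.1 hc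
  generalize ({i, j, k, l, m} : Finset σ) = P at *
  have hmem (n : σ) : n ∈ P ∧ n ≠ a ∧ n ≠ b ↔ n = c ∨ n = d ∨ n = e := by
    have := Finset.ext_iff.1 hset n
    simpa using this
  obtain ⟨hcP, hca, hcb⟩ := (hmem c).2 (by simp)
  obtain ⟨hdP, hda, hdb⟩ := (hmem d).2 (by simp)
  obtain ⟨heP, hea, heb⟩ := (hmem e).2 (by simp)
  have hn' : [c, d, e, a, b].Nodup := by simp [*]
  have hPl (n : σ) : n ∈ P ↔ n ∈ [c, d, e, a, b] := by
    have := hmem n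
    simp only [List.mem_cons, List.not_mem_nil, or_false]
    constructor
    · intro hn
      by_cases h1 : n = a
      · simp [h1]
      by_cases h2 : n = b
      · simp [h2]
      have := this.1 ⟨hn, h1, h2⟩
      tauto
    · rintro (rfl | rfl | rfl | rfl | rfl) <;> assumption
  have hbad : Bad K (HypDetGr.chg (fun n => frame (w₁ n)) q) c d e a b (vtx ∅) := by
    refine ((h.chg _).bad_iff_of_null hn' hu1.empty fun n hn => hu1.single n ((hPl n).2 hn)).2 ?_
    exact fun n hn n' hn' hnn => hu1.pair n ((hPl n).2 hn) n' ((hPl n').2 hn') hnn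
  rw [bad_chg_iff hn' fun n _ => det2_frame (hw10 n)] at hbad
  obtain ⟨w', hw', hw'', h20, h21⟩ := h.exists_null (K := K) hn'
    (update (update w a x) b y) (by simpa [hab]) (by simpa) (hbad.congr (by
      intro n hn
      have hnP : n ∉ P := by rwa [hPl]
      simp only [List.mem_cons, List.not_mem_nil, or_false, not_or] at hn
      simp [hn.2.2.2.1, hn.2.2.2.2, vtx, frame, hw1n n hnP]))
  have hw'P : ∀ n ∉ P, w' n = w n := by
    intro n hn
    rw [hPl] at hn
    simp only [List.mem_cons, List.not_mem_nil, or_false, not_or] at hn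
    rw [hw' n (by simp [hn])]
    simp [hn.2.2.2.1, hn.2.2.2.2]
  have hwa : w' a = x := by
    rw [hw' a (by simp [hca.symm, hda.symm, hea.symm])]
    simp [hab]
  have hwb : w' b = y := by
    rw [hw' b (by simp [hcb.symm, hdb.symm, heb.symm])]
    simp
  have hw0 : ∀ n, w' n ≠ 0 := by
    intro n
    by_cases hnP : n ∈ P
    · rw [hPl] at hnP
      simp only [List.mem_cons, List.not_mem_nil, or_false] at hnP
      rcases hnP with rfl | rfl | rfl | rfl | rfl
      · exact hw'' _ (by simp)
      · exact hw'' _ (by simp)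
      · exact hw'' _ (by simp)
      · rwa [hwa]
      · rwa [hwb]
    · rw [hw'P n hnP]
      exact hb.ne_zero hnP
  exact ⟨w', hw0, hw'P, hwa, hwb, huni hw'P hw0 h20 fun n hn => h21 n ((hPl n).1 hn)⟩

end Words

/-! ### Joining a sixth index. -/

section FreeWords

open Function

variable {σ : Type*} [DecidableEq σ] [Fintype σ] {F : Type*} [Field F]
  {q : Finset σ → F} {K : Type*} [Field K] [Algebra F K]

theorem IsUni.insert_index {P : Finset σ} (hu : IsUni q P) {l : σ} (hl : q {l} = 0)
    (hp : ∀ i ∈ P, q {i, l} ≠ 0) : IsUni q (insert l P) := by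
  refine ⟨hu.empty, fun n hn => ?_, fun a ha b hb hab => ?_⟩
  · rcases Finset.mem_insert.1 hn with rfl | hn
    · exact hl
    · exact hu.single n hn
  · rcases Finset.mem_insert.1 ha with h | ha <;> rcases Finset.mem_insert.1 hb with h' | hb
    · exact absurd (h.trans h'.symm) hab
    · rw [h, Finset.pair_comm]; exact hp b hb
    · rw [h']; exact hp a ha
    · exact hu.pair a ha b hb hab

theorem card_insert_erase {P : Finset σ} {l j : σ} (hl : l ∉ P) (hj : j ∈ P) :
    (insert l (P.erase j)).card = P.card := by
  rw [Finset.card_insert_of_notMem (fun h => hl (Finset.mem_of_mem_erase h)),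
    Finset.card_erase_add_one hj]

theorem IsUni.insert_or [IsF3 F] [Infinite K] {P : Finset σ} (hu : IsUni q P) (h : PG q)
    (hP : 5 ≤ P.card) {l : σ} (hl : l ∉ P) (ht : ∃ i ∈ P, q {i, l} ≠ 0) :
    IsUni q (insert l P) ∨ ∃ j ∈ P, q {j, l} = 0 ∧ IsUni q (insert l (P.erase j)) := by
  have hl0 := hu.apply_singleton_eq_zero h (by omega) hl
  by_cases hf : ∀ i ∈ P, q {i, l} ≠ 0
  · exact Or.inl (hu.insert_index hl0 hf)
  push Not at hf
  obtain ⟨j, hj, hjl⟩ := hf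
  refine Or.inr ⟨j, hj, hjl, (hu.mono (Finset.erase_subset j P)).insert_index hl0 fun i hi hil => ?_⟩
  obtain ⟨hij, hi⟩ := Finset.mem_erase.1 hi
  obtain ⟨k, hk, hkl⟩ := ht
  exact hkl (hu.apply_pair_eq_zero h hl hi hj hk hij hil hjl)

variable [DecidableEq F]

/-- At a null point of P either l joins, or exactly one index j of P drops out and is replaced by l
in another bad set. Two null points with different dropped indices can be merged into one, and there
nothing can drop. -/
theorem PG.exists_free_word [IsF3 F] [Infinite K] (h : PG q) {P : Finset σ} {w : σ → F × F}
    (hb : BadSet K q P w) {l : σ} (hl : l ∉ P) (htl : Tame K q l) (htP : ∀ n ∈ P, Tame K q n) :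
    ∃ w' : σ → F × F, (∀ n, w' n ≠ 0) ∧
      IsUni (HypDetGr.chg (fun n => frame (w' n)) q) (insert l P) := by
  have hP := hb.card
  have hA (w' : σ → F × F) (hw : ∀ n, w' n ≠ 0)
      (hu : IsUni (HypDetGr.chg (fun n => frame (w' n)) q) P) :
      IsUni (HypDetGr.chg (fun n => frame (w' n)) q) (insert l P) ∨
        ∃ j ∈ P, BadSet K q (insert l (P.erase j)) w' := by
    have hdet : ∀ n, det2 (frame (w' n)) ≠ 0 := fun n => det2_frame (hw n)
    refine (hu.insert_or (K := K) (h.chg _) hP.ge hl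
      (hu.exists_pair_ne_zero (K := K) (h.chg _) hP hl (htl.chg hdet))).imp_right ?_
    rintro ⟨j, hj, -, hu'⟩
    refine ⟨j, hj, ?_⟩
    have hb' := ((h.chg _).badSet_iff_of_null (K := K) ((card_insert_erase hl hj).trans hP)
      hu'.empty hu'.single).2 hu'
    rw [badSet_chg_iff fun n _ => hdet n] at hb'
    exact hb'.congr fun n _ => by simp [vtx, frame]
  have hB (w' : σ → F × F) (hw : ∀ n, w' n ≠ 0)
      (hu : IsUni (HypDetGr.chg (fun n => frame (w' n)) q) P) {j : σ} (hj : j ∈ P)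
      (hbj : BadSet K q (insert l (P.erase j)) w') {i : σ} (hi : i ∈ P) (hij : i ≠ j) :
      HypDetGr.chg (fun n => frame (w' n)) q {i, l} ≠ 0 := by
    have hb' : BadSet K (HypDetGr.chg (fun n => frame (w' n)) q) (insert l (P.erase j))
        (vtx ∅) := by
      rw [badSet_chg_iff fun n _ => det2_frame (hw n)]
      exact hbj.congr fun n _ => by simp [vtx, frame]
    have hl0 := hu.apply_singleton_eq_zero (h.chg _) (by omega) hl
    rw [(h.chg _).badSet_iff_of_null ((card_insert_erase hl hj).trans hP) hu.empty] at hb'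
    · exact hb'.pair i (by simp [hi, hij]) l (by simp) (fun e => hl (e ▸ hi))
    · intro n hn
      rcases Finset.mem_insert.1 hn with rfl | hn
      · exact hl0
      · exact hu.single n (Finset.mem_of_mem_erase hn)
  obtain ⟨a, ha, b, hbP, hab⟩ := Finset.one_lt_card.1 (by omega : 1 < P.card)
  have h10 : ((1, 0) : F × F) ≠ 0 := by simp
  obtain ⟨w₁, hw1, hw1P, -, -, hu1⟩ := h.exists_word hb ha hbP hab h10 h10
  rcases hA w₁ hw1 hu1 with hf | ⟨j₁, hj1, hb1⟩
  · exact ⟨w₁, hw1, hf⟩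
  -- Placing j₁ at a value where nothing is bad prevents it from being the dropped index a second
  -- time.
  obtain ⟨y, hy, hav⟩ := (htP j₁ hj1).exists_ne_zero
  obtain ⟨c, hc, hcj⟩ := Finset.exists_mem_ne (by omega : 1 < P.card) j₁
  obtain ⟨w₂, hw2, hw2P, hw2j, -, hu2⟩ := h.exists_word hb hj1 hc hcj.symm hy h10
  rcases hA w₂ hw2 hu2 with hf | ⟨j₂, hj2, hb2⟩
  · exact ⟨w₂, hw2, hf⟩
  have hlj : j₁ ≠ l := fun e => hl (e ▸ hj1)
  have hjj : j₁ ≠ j₂ := by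
    rintro rfl
    exact hav _ w₂ (by simp [hlj]) hw2j hb2
  -- Badness of a set depends only on the weights outside it, so copying the weight of j₁ from w₁
  -- and that of j₂ from w₂ keeps both exchanged sets bad.
  obtain ⟨w₃, hw3, hw3P, hw31, hw32, hu3⟩ := h.exists_word hb hj1 hj2 hjj (hw1 j₁) (hw2 j₂)
  have hb1' : BadSet K q (insert l (P.erase j₁)) w₃ := by
    refine hb1.congr fun n hn => ?_
    by_cases hn1 : n = j₁
    · rw [hn1, hw31]
    · have : n ∉ P := fun hnP => hn (by simp [hn1, hnP])
      rw [hw1P n this, hw3P n this]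
  have hb2' : BadSet K q (insert l (P.erase j₂)) w₃ := by
    refine hb2.congr fun n hn => ?_
    by_cases hn1 : n = j₂
    · rw [hn1, hw32]
    · have : n ∉ P := fun hnP => hn (by simp [hn1, hnP])
      rw [hw2P n this, hw3P n this]
  refine ⟨w₃, hw3, hu3.insert_index (hu3.apply_singleton_eq_zero (h.chg _) (by omega) hl)
    fun i hi => ?_⟩
  by_cases hij : i = j₁
  · exact hB w₃ hw3 hu3 hj2 hb2' hi (hij ▸ hjj)
  · exact hB w₃ hw3 hu3 hj1 hb1' hi hij

end FreeWords

/-! ### Rescaling second derivatives to one. -/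

section Normalisation

variable {σ : Type*} [DecidableEq σ] [Fintype σ] {F : Type*} [Field F]
  {q : Finset σ → F} {K : Type*} [Field K] [Algebra F K]

theorem val_const_mul {A : Type*} [CommRing A] [Algebra F A] (c : F) (q : Finset σ → F)
    (w : σ → A × A) : val (fun S => c * q S) w = algebraMap F A c * val q w := by
  simp only [val_eq, Finset.mul_sum, map_mul, mul_assoc]

theorem hdAt_const_mul {A : Type*} [CommRing A] [Algebra F A] (c : F) (q : Finset σ → F)
    (i j k : σ) (w : σ → A × A) :
    hdAt (fun S => c * q S) i j k w = algebraMap F A c ^ 4 * hdAt q i j k w := by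
  simp only [hdAt, hd, tri, val_const_mul]
  ring

theorem PG.const_mul (h : PG q) (c : F) : PG fun S => c * q S := by
  intro i j k hij hik hjk w
  rw [hdAt_const_mul, h i j k hij hik hjk, mul_zero]

theorem Tame.const_mul {l : σ} (h : Tame K q l) (c : F) :
    Tame K (fun S => c * q S) l := by
  obtain ⟨y, y', hy, h, h'⟩ := h
  have ha (y : F × F) (h : Avoids K q l y) : Avoids K (fun S => c * q S) l y := by
    rintro P w hl hw ⟨i, j, k, l, m, hn, hP, x, y, hb⟩
    rw [hdAt_const_mul] at hb
    exact h P w hl hw ⟨i, j, k, l, m, hn, hP, x, y, right_ne_zero_of_mul hb⟩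
  exact ⟨y, y', hy, ha y h, ha y' h'⟩

theorem IsF3.sq_eq_one [IsF3 F] {x : F} (hx : x ≠ 0) : x ^ 2 = 1 := by
  rcases IsF3.cases x with rfl | rfl | rfl
  · exact absurd rfl hx
  · ring
  · ring

/-- The diagonal change of coordinates. -/
def diag (t : σ → F) (n : σ) (b : Bool) : F × F := if b then (t n, 0) else (0, 1)

theorem chg_diag (t : σ → F) (q : Finset σ → F) (S : Finset σ) :
    chg (diag t) q S = (∏ n ∈ S, t n) * q S := by
  have e : (fun n => diag t n (decide (n ∈ S))) =
      fun n => (if n ∈ S then t n else 1) • (bv (decide (n ∈ S)) : F × F) := by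
    funext n
    by_cases hn : n ∈ S <;> simp [diag, hn]
  rw [chg, e, val_smul, val_vertex, Finset.prod_ite_mem, Finset.univ_inter]
  rfl

theorem det2_diag {t : σ → F} {n : σ} (h : t n ≠ 0) : det2 (diag t n) ≠ 0 := by
  simpa [det2, diag] using h

/-- Nonzero elements are ±1, so the q_ab form a signing of a complete graph. By the conic relations
all triangles through o have the same product c, and scaling index n by c q_on then normalises every
pair. -/
theorem IsUni.exists_diag [IsF3 F] {P : Finset σ} (hu : IsUni q P) (h : PG q) (hP : 3 ≤ P.card) :
    ∃ (c : F) (t : σ → F), c ≠ 0 ∧ (∀ n, t n ≠ 0) ∧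
      ∀ a ∈ P, ∀ b ∈ P, a ≠ b → c * (t a * t b * q {a, b}) = 1 := by
  classical
  obtain ⟨o, x, z, ho, hx, hz, hox, hoz, hxz⟩ := Finset.two_lt_card_iff.1 (by omega : 2 < P.card)
  have hconst := eq_of_adjacent (P := P.erase o) (f := fun a b => q {o, a} * q {o, b} * q {a, b})
    (fun a b => by rw [Finset.pair_comm a b]; ring) (by
      intro i hi j hj k hk hij hik hjk
      rw [Finset.mem_erase] at hi hj hk
      have hm := h.mul_eq_mul (i := i) (j := j) (k := k) (l := o)
        (by simp [hij, hik, hjk, hi.1, hj.1, hk.1]) hu.empty (hu.single i hi.2)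
        (hu.single j hj.2) (hu.single k hk.2) (hu.single o ho) (by
          intro a ha b hb hab
          refine hu.pair a ?_ b ?_ hab
          · simp only [List.mem_cons, List.not_mem_nil, or_false] at ha
            rcases ha with rfl | rfl | rfl | rfl <;> simp [*]
          · simp only [List.mem_cons, List.not_mem_nil, or_false] at hb
            rcases hb with rfl | rfl | rfl | rfl <;> simp [*])
      rw [Finset.pair_comm o i, Finset.pair_comm o j, Finset.pair_comm o k]
      have h1 := IsF3.sq_eq_one (hu.pair i hi.2 k hk.2 hik)
      have h2 := IsF3.sq_eq_one (hu.pair j hj.2 k hk.2 hjk)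
      linear_combination (q {k, o} * q {i, k} * q {j, k}) * hm -
        q {i, o} * q {i, k} * q {k, o} * h2 + q {j, o} * q {j, k} * q {k, o} * h1)
  let c : F := q {o, x} * q {o, z} * q {x, z}
  have hc : c ≠ 0 := mul_ne_zero (mul_ne_zero (hu.pair o ho x hx hox) (hu.pair o ho z hz hoz))
    (hu.pair x hx z hz hxz)
  have hc2 := IsF3.sq_eq_one hc
  refine ⟨c, fun n => if n ∈ P ∧ n ≠ o then c * q {o, n} else 1, hc, fun n => ?_, ?_⟩
  · by_cases hn : n ∈ P ∧ n ≠ o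
    · simp only [hn, ne_eq, not_false_eq_true, and_self, if_true]
      exact mul_ne_zero hc (hu.pair o ho n hn.1 (Ne.symm hn.2))
    · simp [hn]
  · intro a ha b hb hab
    by_cases hao : a = o
    · subst hao
      have := IsF3.sq_eq_one (hu.pair a ha b hb hab)
      simp only [ne_eq, not_true_eq_false, and_false, if_false, hb, hab.symm, not_false_eq_true,
        and_self, if_true]
      linear_combination q {a, b} ^ 2 * hc2 + this
    by_cases hbo : b = o
    · subst hbo
      have := IsF3.sq_eq_one (hu.pair a ha b hb hab)
      simp only [ne_eq, not_true_eq_false, and_false, if_false, ha, hab, not_false_eq_true,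
        and_self, if_true, Finset.pair_comm b a]
      linear_combination q {a, b} ^ 2 * hc2 + this
    · have e : q {o, a} * q {o, b} * q {a, b} = c := hconst a (by simp [*]) b (by simp [*]) x
        (by simp [hx, Ne.symm hox]) z (by simp [hz, Ne.symm hoz]) hab hxz
      simp only [ne_eq, ha, hao, hb, hbo, not_false_eq_true, and_self, if_true]
      linear_combination c ^ 3 * e + (c ^ 2 + 1) * hc2

end Normalisation

/-! ### Third derivatives, and excluding a vanishing pair. -/

section Triples

open Function

variable {σ : Type*} [DecidableEq σ] [Fintype σ] {F : Type*} [Field F]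
  {q : Finset σ → F} {K : Type*} [Field K] [Algebra F K]

theorem PG.conic_add_eq_zero [IsF3 F] (h : PG q) {i j k l : σ} (hn : [i, j, k, l].Nodup)
    (hl : q {l} = 0) :
    conic (q {i, l} * q {j, k, l}) (q {j, l} * q {i, k, l}) (q {k, l} * q {i, j, l}) +
      4 * q {i, j, k, l} * q {i, l} * q {j, l} * q {k, l} = 0 := by
  have hm := (h.pencil_coeffs hn).1
  simp only [hd, addIf_true, addIf_false, hl] at hm
  rw [Finset.insert_comm j i, Finset.insert_comm k i, Finset.insert_comm k j,
    Finset.insert_comm k i] at hm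
  rw [conic]
  linear_combination hm

theorem PG.sum_triples_eq_zero [IsF3 F] (h : PG q) {i j k l : σ} (hn : [i, j, k, l].Nodup)
    (h0 : q ∅ = 0) (h1 : ∀ a ∈ [i, j, k, l], q {a} = 0)
    (h2 : ∀ a ∈ [i, j, k, l], ∀ b ∈ [i, j, k, l], a ≠ b → q {a, b} = 1) :
    q {i, j, k} + q {i, j, l} + q {i, k, l} + q {j, k, l} = 0 := by
  have hm := (h.pencil_coeffs hn).2.2.1
  have hn' := hn
  simp only [List.nodup_cons, List.mem_cons, List.not_mem_nil, or_false, not_or,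
    not_false_eq_true, List.nodup_nil, and_true] at hn'
  obtain ⟨⟨ij, ik, il⟩, ⟨jk, jl⟩, kl⟩ := hn'
  simp only [hd₁, addIf_true, addIf_false, insert_empty_eq] at hm
  rw [Finset.insert_comm j i, Finset.insert_comm k i {l}, Finset.insert_comm k j {l},
    Finset.pair_comm j i, Finset.pair_comm k i, Finset.pair_comm k j,
    Finset.insert_comm k i, Finset.insert_comm k i, Finset.insert_comm k j,
    Finset.pair_comm k j] at hm
  simp only [h0, h1 i (by simp), h1 j (by simp), h1 k (by simp), h1 l (by simp),
    h2 i (by simp) j (by simp) ij, h2 i (by simp) k (by simp) ik, h2 i (by simp) l (by simp) il,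
    h2 j (by simp) k (by simp) jk, h2 j (by simp) l (by simp) jl,
    h2 k (by simp) l (by simp) kl] at hm
  linear_combination hm - (q {i, j, k} - q {i, j, l} - q {i, k, l} - q {j, k, l}) *
    IsF3.three_eq_zero (F := F)

/-- Among five indices, an edge at k away from l, m is compared with the edge lm through the
triangles on four vertices; as 3 = 0 they agree, so adjacent edges agree. -/
theorem eq_of_sum_triangles [IsF3 F] {P : Finset σ} (hP : P.card = 5) {c : σ → σ → F}
    (hs : ∀ a b, c a b = c b a)
    (h : ∀ i ∈ P, ∀ j ∈ P, ∀ k ∈ P, i ≠ j → i ≠ k → j ≠ k → c i j + c i k + c j k = 0) :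
    ∀ a ∈ P, ∀ b ∈ P, ∀ a' ∈ P, ∀ b' ∈ P, a ≠ b → a' ≠ b' → c a b = c a' b' := by
  refine eq_of_adjacent hs fun i hi j hj k hk hij hik hjk => ?_
  have hc : (P \ {i, j, k}).card = 2 := by
    rw [Finset.card_sdiff_of_subset, hP, Finset.card_eq_three.2 ⟨i, j, k, hij, hik, hjk, rfl⟩]
    intro n hn
    simp only [Finset.mem_insert, Finset.mem_singleton] at hn
    rcases hn with rfl | rfl | rfl <;> assumption
  obtain ⟨l, m, hlm, hset⟩ := Finset.card_eq_two.1 hc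
  have hl : l ∈ P \ {i, j, k} := by simp [hset]
  have hm : m ∈ P \ {i, j, k} := by simp [hset]
  simp only [Finset.mem_sdiff, Finset.mem_insert, Finset.mem_singleton, not_or] at hl hm
  have key (a : σ) (ha : a ∈ P) (hak : a ≠ k) (hal : a ≠ l) (ham : a ≠ m) : c a k = c l m := by
    have h1 := h a ha k hk l hl.1 hak hal (Ne.symm hl.2.2.2)
    have h2 := h a ha k hk m hm.1 hak ham (Ne.symm hm.2.2.2)
    have h3 := h a ha l hl.1 m hm.1 hal ham hlm
    have h4 := h k hk l hl.1 m hm.1 (Ne.symm hl.2.2.2) (Ne.symm hm.2.2.2) hlm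
    linear_combination (c a k - c l m) * IsF3.three_eq_zero (F := F) - h1 - h2 + h3 + h4
  rw [key i hi hik (Ne.symm hl.2.1) (Ne.symm hm.2.1),
    key j hj hjk (Ne.symm hl.2.2.1) (Ne.symm hm.2.2.1)]

/-- The relations make g = q_ilm and c = q_ijl − q_ijm independent of the indices in P. A suitable
joint choice of weights at l and m keeps all first derivatives zero and makes every second
derivative one and the same square, so P is bad at a value of m that tameness excludes. -/
theorem PG.false_of_pairs_eq_one [IsF3 F] [Infinite K] (h : PG q) {P : Finset σ}
    (hP : P.card = 5) {l m : σ} (hl : l ∉ P) (hm : m ∉ P) (hlm : l ≠ m) (h0 : q ∅ = 0)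
    (h1 : ∀ a, a = l ∨ a = m ∨ a ∈ P → q {a} = 0)
    (h2 : ∀ a ∈ P, ∀ b, b = l ∨ b = m ∨ b ∈ P → a ≠ b → q {a, b} = 1) (hlm0 : q {l, m} = 0)
    (ht : Tame K q m) : False := by
  have three := IsF3.three_eq_zero (F := F)
  have nl {n : σ} (hn : n ∈ P) : n ≠ l := fun e => hl (e ▸ hn)
  have nm {n : σ} (hn : n ∈ P) : n ≠ m := fun e => hm (e ▸ hn)
  have hg : ∀ i ∈ P, ∀ j ∈ P, q {i, l, m} = q {j, l, m} := by
    intro i hi j hj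
    by_cases hij : i = j
    · rw [hij]
    have := h.conic_add_eq_zero (i := i) (j := j) (k := l) (l := m)
      (by simp [hij, nl hi, nm hi, nl hj, nm hj, hlm]) (h1 m (by simp))
    rw [hlm0, h2 i hi m (by simp) (nm hi), h2 j hj m (by simp) (nm hj)] at this
    simp only [conic] at this
    have : (q {i, l, m} - q {j, l, m}) ^ 2 = 0 := by linear_combination this
    rw [pow_eq_zero_iff two_ne_zero] at this
    exact sub_eq_zero.1 this
  have hT (n : σ) (hn : n = l ∨ n = m) (i : σ) (hi : i ∈ P) (j : σ) (hj : j ∈ P) (k : σ)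
      (hk : k ∈ P) (hij : i ≠ j) (hik : i ≠ k) (hjk : j ≠ k) :
      q {i, j, k} + q {i, j, n} + q {i, k, n} + q {j, k, n} = 0 := by
    have hnP {a : σ} (ha : a ∈ P) : a ≠ n := by
      rcases hn with rfl | rfl
      exacts [nl ha, nm ha]
    have hmem : ∀ a ∈ [i, j, k, n], a = l ∨ a = m ∨ a ∈ P := by
      simp only [List.mem_cons, List.not_mem_nil, or_false]
      rintro a (rfl | rfl | rfl | rfl) <;> tauto
    have hmem' : ∀ a ∈ [i, j, k, n], a ≠ n → a ∈ P := by
      simp only [List.mem_cons, List.not_mem_nil, or_false]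
      rintro a (rfl | rfl | rfl | rfl) <;> tauto
    refine h.sum_triples_eq_zero (by simp [hij, hik, hjk, hnP hi, hnP hj, hnP hk]) h0
      (fun a ha => h1 a (hmem a ha)) fun a ha b hb hab => ?_
    by_cases han : a = n
    · rw [Finset.pair_comm]
      exact h2 b (hmem' b hb fun e => hab (han.trans e.symm)) a (hmem a ha) hab.symm
    · exact h2 a (hmem' a ha han) b (hmem b hb) hab
  have hc := eq_of_sum_triangles hP (c := fun i j => q {i, j, l} - q {i, j, m})
    (fun a b => by rw [Finset.insert_comm a b, Finset.insert_comm a b])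
    fun i hi j hj k hk hij hik hjk => by
      linear_combination hT l (by simp) i hi j hj k hk hij hik hjk -
        hT m (by simp) i hi j hj k hk hij hik hjk
  obtain ⟨o, o', ho, ho', hoo⟩ := Finset.one_lt_card_iff.1 (by omega : 1 < P.card)
  set g := q {o, l, m} with hgdef
  set c := q {o, o', l} - q {o, o', m} with hcdef
  -- With weight (s, t) at m, the weight (−s, t + sg) at l cancels every first derivative, and the
  -- second derivatives become ((c − g)s + t)².
  obtain ⟨⟨s, t⟩, hy, hav⟩ := ht.exists_form_ne_zero (a := c - g) (b := 1) (Or.inr one_ne_zero)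
  have hup (S : Finset σ) (hS : S ⊆ P) :
      val q (update (update (vtx S) l (-s, t + s * g)) m (s, t)) =
      -s * s * q (insert l (insert m S)) + -s * t * q (insert l S) +
        (t + s * g) * s * q (insert m S) + (t + s * g) * t * q S :=
    val_update_update_vtx q hlm (fun hn => hl (hS hn)) (fun hn => hm (hS hn)) _ _
  have hcomm (w : σ → F × F) {n : σ} (hn : n ∈ P) (x y z : F × F) :
      update (update (update w l x) m y) n z = update (update (update w n z) l x) m y := by
    rw [update_comm (nm hn).symm, update_comm (nl hn).symm]
  refine hav P (update (update (vtx ∅) l (-s, t + s * g)) m (s, t)) hm (by simp)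
    (h.badSet_of_val hP ?_ ?_ ?_ ?_)
  · intro n hn
    simp [nl hn, nm hn, vtx]
  · rw [hup ∅ (by simp), insert_empty_eq, insert_empty_eq, hlm0, h1 l (by simp), h1 m (by simp),
      h0]
    ring
  · intro i hi
    rw [hcomm _ hi, ← bv_true, update_vtx (by simp), addIf_true, insert_empty_eq,
      hup _ (by simpa using hi),
      (show ({l, m, i} : Finset σ) = {i, l, m} by
        ext n; simp only [Finset.mem_insert, Finset.mem_singleton]; tauto), Finset.pair_comm m i, Finset.pair_comm l i, hg i hi o ho, h1 i (by simp [hi]),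
      h2 i hi l (by simp) (nl hi), h2 i hi m (by simp) (nm hi)]
    ring
  · intro i hi j hj hij
    rw [hcomm _ hi, hcomm _ hj, ← bv_true, update_vtx (by simp), addIf_true, insert_empty_eq,
      update_vtx (by simpa using hij.symm), addIf_true,
      hup _ (by simp [Finset.insert_subset_iff, hi, hj])]
    have hR := h.conic_add_eq_zero (i := l) (j := m) (k := i) (l := j)
      (by simp [hij, hlm, (nl hi).symm, (nm hi).symm, (nl hj).symm, (nm hj).symm])
      (h1 j (by simp [hj]))
    have hc' := hc i hi j hj o ho o' ho' hij hoo
    have e2 : ({l, i, j} : Finset σ) = {i, j, l} := by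
      ext n; simp only [Finset.mem_insert, Finset.mem_singleton]; tauto
    have e3 : ({m, i, j} : Finset σ) = {i, j, m} := by
      ext n; simp only [Finset.mem_insert, Finset.mem_singleton]; tauto
    rw [Finset.pair_comm l j, Finset.pair_comm m j, h2 j hj l (by simp) (nl hj),
      h2 j hj m (by simp) (nm hj), h2 i hi j (by simp [hj]) hij, Finset.insert_comm l j,
      e2, e3, hg j hj o ho, ← hgdef] at hR
    simp only [← hcdef] at hc'
    rw [Finset.pair_comm j i, e2, e3, h2 i hi j (by simp [hj]) hij]
    have hx : q {i, j, l} = q {i, j, m} + c := by linear_combination hc'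
    rw [hx] at hR ⊢
    simp only [conic] at hR
    have : -s * s * q {l, i, j, m} + -s * t * (q {i, j, m} + c) + (t + s * g) * s * q {i, j, m} +
        (t + s * g) * t * 1 = ((c - g) * s + 1 * t) ^ 2 := by
      linear_combination -s ^ 2 * hR + (s ^ 2 * q {l, i, j, m} - s ^ 2 * g * q {i, j, m} -
        (c - g) * s * t) * three
    rw [this]
    exact pow_ne_zero 2 hy

theorem IsUni.const_mul_chg_diag {P : Finset σ} (hu : IsUni q P) {c : F} {t : σ → F}
    (hc : c ≠ 0) (ht : ∀ n, t n ≠ 0) : IsUni (fun S => c * HypDetGr.chg (diag t) q S) P := by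
  refine ⟨?_, fun n hn => ?_, fun a ha b hb hab => ?_⟩
  · simp [chg_diag, hu.empty]
  · simp [chg_diag, hu.single n hn]
  · simp only [chg_diag]
    exact mul_ne_zero hc (mul_ne_zero (Finset.prod_ne_zero_iff.2 fun n _ => ht n)
      (hu.pair a ha b hb hab))

theorem PG.pair_ne_zero_of_pairs_eq_one [IsF3 F] [Infinite K] (h : PG q) {P : Finset σ}
    (hP : P.card = 5) {l m : σ} (hl : l ∉ P) (hm : m ∉ P) (hlm : l ≠ m)
    (hul : IsUni q (insert l P)) (hum : IsUni q (insert m P))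
    (h2 : ∀ a ∈ insert l P, ∀ b ∈ insert l P, a ≠ b → q {a, b} = 1) (ht : Tame K q m) :
    q {l, m} ≠ 0 := by
  intro hq
  have nl {n : σ} (hn : n ∈ P) : n ≠ l := fun e => hl (e ▸ hn)
  have nm {n : σ} (hn : n ∈ P) : n ≠ m := fun e => hm (e ▸ hn)
  have hmem {n n' : σ} (hn : n ∈ P) : n ∈ insert n' P := Finset.mem_insert_of_mem hn
  obtain ⟨o, ho⟩ : P.Nonempty := Finset.card_pos.1 (by omega)
  have hconst : ∀ i ∈ P, q {i, m} = q {o, m} := by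
    intro i hi
    by_cases hio : i = o
    · rw [hio]
    obtain ⟨k, hk, hki, hko⟩ : ∃ k ∈ P, k ≠ i ∧ k ≠ o := by
      obtain ⟨k, hk⟩ : (P \ {i, o}).Nonempty := by
        rw [← Finset.card_pos]
        have := Finset.le_card_sdiff {i, o} P
        have := Finset.card_pair hio
        omega
      simp only [Finset.mem_sdiff, Finset.mem_insert, Finset.mem_singleton, not_or] at hk
      exact ⟨k, hk⟩
    have := h.mul_eq_mul (i := i) (j := o) (k := k) (l := m)
      (by simp [hio, hki.symm, hko.symm, nm hi, nm ho, nm hk]) hum.empty (hum.single i (hmem hi))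
      (hum.single o (hmem ho)) (hum.single k (hmem hk)) (hum.single m (by simp)) (by
        have hm' : ∀ a ∈ [i, o, k, m], a ∈ insert m P := by simp [hi, ho, hk]
        exact fun a ha b hb => hum.pair a (hm' a ha) b (hm' b hb))
    rwa [h2 o (hmem ho) k (hmem hk) hko.symm, h2 i (hmem hi) k (hmem hk) hki.symm, mul_one,
      mul_one] at this
  set ε := q {o, m} with hε
  have hε0 : ε ≠ 0 := hum.pair o (hmem ho) m (by simp) (nm ho)
  -- The pairs at m share the value ε = ±1; rescaling m alone turns them into one without disturbing
  -- the others.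
  let t : σ → F := fun n => if n = m then ε else 1
  have htn (n : σ) : t n ≠ 0 := by
    by_cases hn : n = m <;> simp [t, hn, hε0]
  have hul' := hul.const_mul_chg_diag one_ne_zero htn
  have hum' := hum.const_mul_chg_diag one_ne_zero htn
  refine ((h.chg (diag t)).const_mul 1).false_of_pairs_eq_one (K := K) hP hl hm hlm hul'.empty ?_
    ?_ ?_ ((ht.chg fun n => det2_diag (htn n)).const_mul 1)
  · rintro a (rfl | rfl | ha)
    · exact hul'.single a (by simp)
    · exact hum'.single a (by simp)
    · exact hul'.single a (hmem ha)
  · intro a ha b hb hab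
    rw [chg_diag, one_mul, Finset.prod_pair hab]
    by_cases hbm : b = m
    · subst hbm
      simp only [t, nm ha, if_false, if_true, hconst a ha]
      linear_combination IsF3.sq_eq_one hε0
    · have hb' : b ∈ insert l P := by
        rcases hb with rfl | rfl | hb
        · simp
        · exact absurd rfl hbm
        · exact hmem hb
      simp [t, nm ha, hbm, h2 a (hmem ha) b hb' hab]
  · simp [chg_diag, hq]

theorem PG.pair_ne_zero_of_isUni [IsF3 F] [Infinite K] (h : PG q) {P : Finset σ}
    (hP : P.card = 5) {l m : σ} (hl : l ∉ P) (hm : m ∉ P) (hlm : l ≠ m)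
    (hul : IsUni q (insert l P)) (hum : IsUni q (insert m P)) (ht : Tame K q m) :
    q {l, m} ≠ 0 := by
  intro hq
  obtain ⟨c, t, hc, htn, h2⟩ := hul.exists_diag h (by
    have := Finset.card_le_card (Finset.subset_insert l P); omega)
  refine ((h.chg (diag t)).const_mul c).pair_ne_zero_of_pairs_eq_one hP hl hm hlm
    (hul.const_mul_chg_diag hc htn) (hum.const_mul_chg_diag hc htn) ?_
    ((ht.chg fun n => det2_diag (htn n)).const_mul c) (by simp [chg_diag, hq])
  intro a ha b hb hab
  rw [chg_diag, Finset.prod_pair hab]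
  exact h2 a ha b hb hab

end Triples

/-! ### Excluding seven indices, and the conclusion for tame coordinates. -/

section Seven

open Function

variable {σ : Type*} [DecidableEq σ] [Fintype σ] {F : Type*} [Field F]
  {q : Finset σ → F} {K : Type*} [Field K] [Algebra F K]

/-- With z fixed, the relations express all triples through the edge function g_ij = q_ijz, which
satisfies an exchange relation on the other six indices. Hence g is, up to a constant, a sum of
vertex values after one more index f is set aside. -/
theorem PG.exists_triple_eq_add [IsF3 F] (h : PG q) {P : Finset σ} (hP : P.card = 7)
    (h0 : q ∅ = 0) (h1 : ∀ a ∈ P, q {a} = 0) (h2 : ∀ a ∈ P, ∀ b ∈ P, a ≠ b → q {a, b} = 1) :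
    ∃ P' ⊆ P, P'.card = 5 ∧ ∃ c : σ → F, ∀ i ∈ P', ∀ j ∈ P', ∀ k ∈ P', i ≠ j → i ≠ k → j ≠ k →
      q {i, j, k} = c i + c j + c k := by
  have three := IsF3.three_eq_zero (F := F)
  obtain ⟨z, hz⟩ : P.Nonempty := Finset.card_pos.1 (by omega)
  have hS : (P.erase z).card = 6 := by rw [Finset.card_erase_of_mem hz, hP]
  obtain ⟨f, hf⟩ : (P.erase z).Nonempty := Finset.card_pos.1 (by omega)
  have hT (i j k l : σ) (hi : i ∈ P) (hj : j ∈ P) (hk : k ∈ P) (hl : l ∈ P)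
      (hn : [i, j, k, l].Nodup) :
      q {i, j, k} + q {i, j, l} + q {i, k, l} + q {j, k, l} = 0 := by
    have hm : ∀ a ∈ [i, j, k, l], a ∈ P := by simp [*]
    exact h.sum_triples_eq_zero hn h0 (fun a ha => h1 a (hm a ha))
      fun a ha b hb => h2 a (hm a ha) b (hm b hb)
  set S := P.erase z with hSdef
  let g : σ → σ → F := fun i j => q {i, j, z}
  have hgs (i j : σ) : g i j = g j i := congrArg q (Finset.insert_comm _ _ _)
  have hg : ∀ i ∈ S, ∀ j ∈ S, ∀ k ∈ S, i ≠ j → i ≠ k → j ≠ k →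
      q {i, j, k} + g i j + g i k + g j k = 0 := by
    intro i hi j hj k hk hij hik hjk
    obtain ⟨iz, hi⟩ := Finset.mem_erase.1 hi
    obtain ⟨jz, hj⟩ := Finset.mem_erase.1 hj
    obtain ⟨kz, hk⟩ := Finset.mem_erase.1 hk
    exact hT i j k z hi hj hk hz (by simp [*])
  have hquad : ∀ i ∈ S, ∀ j ∈ S, ∀ k ∈ S, ∀ l ∈ S, [i, j, k, l].Nodup →
      g i j + g i k + g i l + g j k + g j l + g k l = 0 := by
    intro i hi j hj k hk l hl hn
    have := hT i j k l (Finset.mem_of_mem_erase hi) (Finset.mem_of_mem_erase hj)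
      (Finset.mem_of_mem_erase hk) (Finset.mem_of_mem_erase hl) hn
    simp only [List.nodup_cons, List.mem_cons, List.not_mem_nil, or_false, not_or,
      not_false_eq_true, List.nodup_nil, and_true] at hn
    obtain ⟨⟨ij, ik, il⟩, ⟨jk, jl⟩, kl⟩ := hn
    linear_combination this - hg i hi j hj k hk ij ik jk - hg i hi j hj l hl ij il jl -
      hg i hi k hk l hl ik il kl - hg j hj k hk l hl jk jl kl +
      (g i j + g i k + g i l + g j k + g j l + g k l) * three
  have hex : ∀ i ∈ S, ∀ j ∈ S, ∀ l ∈ S, ∀ m ∈ S, [i, j, l, m].Nodup →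
      g i l + g j m = g i m + g j l := by
    intro i hi j hj l hl m hm hn
    -- Two further indices are needed to cancel the common edges; this is where six indices besides
    -- z are required.
    have hc : (S \ {i, j, l, m}).card = 2 := by
      rw [Finset.card_sdiff_of_subset, hS]
      · have := List.toFinset_card_of_nodup hn
        have h4 : ({i, j, l, m} : Finset σ).card = 4 := by simpa using this
        rw [h4]
      · intro n hn
        simp only [Finset.mem_insert, Finset.mem_singleton] at hn
        rcases hn with rfl | rfl | rfl | rfl <;> assumption
    obtain ⟨k, n, hkn, hset⟩ := Finset.card_eq_two.1 hc
    have hk : k ∈ S \ {i, j, l, m} := by simp [hset]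
    have hn' : n ∈ S \ {i, j, l, m} := by simp [hset]
    simp only [Finset.mem_sdiff, Finset.mem_insert, Finset.mem_singleton, not_or] at hk hn'
    simp only [List.nodup_cons, List.mem_cons, List.not_mem_nil, or_false, not_or,
      not_false_eq_true, List.nodup_nil, and_true] at hn
    obtain ⟨⟨ij, il, im⟩, ⟨jl, jm⟩, lm⟩ := hn
    obtain ⟨hk, ki, kj, kl, km⟩ := hk
    obtain ⟨hn, ni, nj, nl, nm⟩ := hn'
    have e1 := hquad i hi k hk n hn l hl (by simp [*, Ne.symm ki, Ne.symm ni])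
    have e2 := hquad i hi k hk n hn m hm (by simp [*, Ne.symm ki, Ne.symm ni])
    have e3 := hquad j hj k hk n hn l hl (by simp [*, Ne.symm kj, Ne.symm nj])
    have e4 := hquad j hj k hk n hn m hm (by simp [*, Ne.symm kj, Ne.symm nj])
    linear_combination e1 - e2 - e3 + e4
  have hne : ∀ i ∈ S.erase f, i ∈ S ∧ i ≠ f := fun i hi => (Finset.mem_erase.1 hi).symm
  have hconst := eq_of_adjacent (P := S.erase f) (f := fun i j => g i j - g i f - g j f)
    (fun i j => by rw [hgs]; ring) (by
      intro i hi j hj k hk hij hik hjk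
      obtain ⟨hi, fi⟩ := hne i hi
      obtain ⟨hj, fj⟩ := hne j hj
      obtain ⟨hk, fk⟩ := hne k hk
      linear_combination hex i hi j hj k hk f hf (by simp [*]))
  have hc5 : (S.erase f).card = 5 := by rw [Finset.card_erase_of_mem hf, hS]
  obtain ⟨a, b, ha, hb, hab⟩ := Finset.one_lt_card_iff.1 (by omega : 1 < (S.erase f).card)
  refine ⟨S.erase f, (Finset.erase_subset _ _).trans (Finset.erase_subset _ _), hc5,
    fun i => g i f - (g a b - g a f - g b f), fun i hi j hj k hk hij hik hjk => ?_⟩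
  have e1 := hconst i hi j hj a ha b hb hij hab
  have e2 := hconst i hi k hk a ha b hb hik hab
  have e3 := hconst j hj k hk a ha b hb hjk hab
  linear_combination hg i (hne i hi).1 j (hne j hj).1 k (hne k hk).1 hij hik hjk - e1 - e2 - e3 -
    (g i f + g j f + g k f) * three

/-- The relations also kill the fourth-order terms, leaving only V = q_ijklm. Two rational weights
then give (V + 1)² = 0 and (V − 1)² = 0. -/
theorem PG.false_of_triples_eq_zero [IsF3 F] (h : PG q) {i j k l m : σ}
    (hn : [i, j, k, l, m].Nodup) (h0 : q ∅ = 0) (h1 : ∀ a ∈ [i, j, k, l, m], q {a} = 0)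
    (h2 : ∀ a ∈ [i, j, k, l, m], ∀ b ∈ [i, j, k, l, m], a ≠ b → q {a, b} = 1)
    (h3 : ∀ a ∈ [i, j, k, l, m], ∀ b ∈ [i, j, k, l, m], ∀ c ∈ [i, j, k, l, m], a ≠ b → a ≠ c →
      b ≠ c → q {a, b, c} = 0) : False := by
  have three := IsF3.three_eq_zero (F := F)
  have hn' := hn
  simp only [List.nodup_cons, List.mem_cons, List.not_mem_nil, or_false, not_or,
    not_false_eq_true, List.nodup_nil, and_true] at hn'
  obtain ⟨⟨ij, ik, il, im⟩, ⟨jk, jl, jm⟩, ⟨kl, km⟩, lm⟩ := hn'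
  have h4 (a b c d : σ) (hn4 : [a, b, c, d].Nodup)
      (hm : ∀ n ∈ [a, b, c, d], n ∈ [i, j, k, l, m]) : q {a, b, c, d} = 0 := by
    have hR := h.conic_add_eq_zero hn4 (h1 d (hm d (by simp)))
    simp only [List.nodup_cons, List.mem_cons, List.not_mem_nil, or_false, not_or,
      not_false_eq_true, List.nodup_nil, and_true] at hn4
    obtain ⟨⟨ab, ac, ad⟩, ⟨bc, bd⟩, cd⟩ := hn4
    rw [h2 a (hm a (by simp)) d (hm d (by simp)) ad, h2 b (hm b (by simp)) d (hm d (by simp)) bd,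
      h2 c (hm c (by simp)) d (hm d (by simp)) cd,
      h3 a (hm a (by simp)) b (hm b (by simp)) d (hm d (by simp)) ab ad bd,
      h3 a (hm a (by simp)) c (hm c (by simp)) d (hm d (by simp)) ac ad cd,
      h3 b (hm b (by simp)) c (hm c (by simp)) d (hm d (by simp)) bc bd cd] at hR
    simp only [conic] at hR
    linear_combination hR - q {a, b, c, d} * three
  have hD (x : F × F) := h i j k ij ik jk (update (update (vtx ∅) l x) m x)
  simp only [hdAt_vtx_update₂ q hn, hd, addIf_true, addIf_false, insert_empty_eq] at hD
  simp only [h0, h1 i (by simp), h1 j (by simp), h1 k (by simp), h1 l (by simp),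
    h1 m (by simp),
    h2 j (by simp) i (by simp) (Ne.symm ij), h2 k (by simp) i (by simp) (Ne.symm ik),
    h2 k (by simp) j (by simp) (Ne.symm jk), h2 l (by simp) m (by simp) lm,
    h2 i (by simp) l (by simp) il, h2 i (by simp) m (by simp) im,
    h2 j (by simp) l (by simp) jl, h2 j (by simp) m (by simp) jm,
    h2 k (by simp) l (by simp) kl, h2 k (by simp) m (by simp) km,
    h3 i (by simp) l (by simp) m (by simp) il im lm,
    h3 j (by simp) l (by simp) m (by simp) jl jm lm,
    h3 k (by simp) l (by simp) m (by simp) kl km lm,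
    h3 k (by simp) j (by simp) i (by simp) (Ne.symm jk) (Ne.symm ik) (Ne.symm ij),
    h3 k (by simp) j (by simp) l (by simp) (Ne.symm jk) kl jl,
    h3 k (by simp) j (by simp) m (by simp) (Ne.symm jk) km jm,
    h3 k (by simp) i (by simp) l (by simp) (Ne.symm ik) kl il,
    h3 k (by simp) i (by simp) m (by simp) (Ne.symm ik) km im,
    h3 j (by simp) i (by simp) l (by simp) (Ne.symm ij) jl il,
    h3 j (by simp) i (by simp) m (by simp) (Ne.symm ij) jm im,
    h4 k j i l (by simp [*, Ne.symm jk, Ne.symm ik, Ne.symm ij]) (by simp),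
    h4 k j i m (by simp [*, Ne.symm jk, Ne.symm ik, Ne.symm ij]) (by simp),
    h4 k j l m (by simp [*, Ne.symm jk]) (by simp),
    h4 k i l m (by simp [*, Ne.symm ik]) (by simp),
    h4 j i l m (by simp [*, Ne.symm ij]) (by simp), map_zero, map_one,
    Algebra.algebraMap_self, RingHom.id_apply] at hD
  have d1 := hD (1, 1)
  have d2 := hD (-1, 1)
  set V := q {k, j, i, l, m}
  have v1 : (V + 1) ^ 2 = 0 := by linear_combination d1 + (3 - 6 * V) * three
  have v2 : (V - 1) ^ 2 = 0 := by linear_combination d2 + (3 + 6 * V) * three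
  rw [pow_eq_zero_iff two_ne_zero] at v1 v2
  exact IsF3.two_ne_zero F (by linear_combination v1 - v2)

/-- The change of coordinates that moves the origin to the point with coordinates `-c`. -/
def shear (c : σ → F) (n : σ) (b : Bool) : F × F := if b then (1, -c n) else (0, 1)

theorem chg_shear_empty (c : σ → F) : chg (shear c) q ∅ = q ∅ := by
  have := val_vtx (A := F) q ∅
  simp only [Algebra.algebraMap_self, RingHom.id_apply] at this
  rw [← this, chg]
  congr 1

theorem chg_shear_singleton (c : σ → F) (a : σ) :
    chg (shear c) q {a} = q {a} - c a * q ∅ := by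
  have e : (fun n => shear c n (decide (n ∈ ({a} : Finset σ)))) =
      update (vtx ∅) a (1, -c a) := by
    funext n
    by_cases hn : n = a
    · subst hn; simp [shear]
    · simp [hn, shear, vtx]
  rw [chg, e, val_update_vtx q (by simp)]
  simp only [insert_empty_eq]
  ring

theorem chg_shear_pair (c : σ → F) {a b : σ} (hab : a ≠ b) :
    chg (shear c) q {a, b} = q {a, b} - c b * q {a} - c a * q {b} + c a * c b * q ∅ := by
  have e : (fun n => shear c n (decide (n ∈ ({a, b} : Finset σ)))) =
      update (update (vtx ∅) a (1, -c a)) b (1, -c b) := by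
    funext n
    by_cases hb : n = b
    · subst hb; simp [shear]
    by_cases hn : n = a
    · subst hn; simp [shear, hb]
    · simp [hn, shear, vtx, hb]
  rw [chg, e, val_update_update_vtx q hab (by simp) (by simp)]
  simp only [insert_empty_eq]
  ring

theorem chg_shear_triple (c : σ → F) {a b d : σ} (hab : a ≠ b) (had : a ≠ d) (hbd : b ≠ d)
    (h0 : q ∅ = 0) (ha : q {a} = 0) (hb : q {b} = 0) (hd : q {d} = 0) :
    chg (shear c) q {a, b, d} = q {a, b, d} - c d * q {a, b} - c b * q {a, d} - c a * q {b, d} := by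
  have e : (fun n => shear c n (decide (n ∈ ({a, b, d} : Finset σ)))) =
      update (update (update (vtx ∅) a (1, -c a)) b (1, -c b)) d (1, -c d) := by
    funext n
    by_cases hd : n = d
    · subst hd; simp [shear]
    by_cases hb : n = b
    · subst hb; simp [shear, hd]
    by_cases hn : n = a
    · subst hn; simp [shear, hb, hd]
    · simp [hn, shear, vtx, hb, hd]
  rw [chg, e, val_update, update_comm hbd, update_comm had, update_comm hbd, update_comm had,
    ← bv_true, ← bv_false, update_vtx (by simp), update_vtx (by simp),
    val_update_update_vtx q hab (by simpa using had) (by simpa using hbd),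
    val_update_update_vtx q hab (by simp) (by simp)]
  simp only [insert_empty_eq, addIf_true, addIf_false, h0, ha, hb, hd]
  ring

/-- Normalise the pairs to one; on five of the indices the triples are then sums of vertex values,
which a shear removes, contradicting the previous computation. -/
theorem PG.not_isUni_of_card_eq_seven [IsF3 F] (h : PG q) {P : Finset σ} (hP : P.card = 7) :
    ¬ IsUni q P := by
  intro hu
  obtain ⟨c, t, hc, htn, h2⟩ := hu.exists_diag h (by omega)
  have hu' := hu.const_mul_chg_diag hc htn
  have h' := (h.chg (diag t)).const_mul c
  have h2' : ∀ a ∈ P, ∀ b ∈ P, a ≠ b → c * HypDetGr.chg (diag t) q {a, b} = 1 := by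
    intro a ha b hb hab
    rw [chg_diag, Finset.prod_pair hab]
    exact h2 a ha b hb hab
  generalize hr : (fun S => c * HypDetGr.chg (diag t) q S) = r at hu' h'
  replace h2' : ∀ a ∈ P, ∀ b ∈ P, a ≠ b → r {a, b} = 1 := by
    intro a ha b hb hab
    rw [← hr]
    exact h2' a ha b hb hab
  obtain ⟨P', hPP, hP', e, he⟩ := h'.exists_triple_eq_add hP hu'.empty hu'.single h2'
  have hl : P'.toList.length = 5 := by rw [Finset.length_toList, hP']
  obtain ⟨i, j, k, l, m, hlist⟩ : ∃ i j k l m, P'.toList = [i, j, k, l, m] := by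
    match hL : P'.toList, hl with
    | [i, j, k, l, m], _ => exact ⟨i, j, k, l, m, rfl⟩
  have hn := P'.nodup_toList
  have hmem' (n : σ) (hn : n ∈ P'.toList) : n ∈ P' := Finset.mem_toList.1 hn
  rw [hlist] at hn hmem'
  have hmem (n : σ) (hn : n ∈ [i, j, k, l, m]) : n ∈ P := hPP (hmem' n hn)
  refine (h'.chg (shear e)).false_of_triples_eq_zero hn ?_ ?_ ?_ ?_
  · rw [chg_shear_empty, hu'.empty]
  · intro a ha
    rw [chg_shear_singleton, hu'.empty, hu'.single a (hmem a ha)]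
    ring
  · intro a ha b hb hab
    rw [chg_shear_pair e hab, hu'.empty, hu'.single a (hmem a ha), hu'.single b (hmem b hb),
      h2' a (hmem a ha) b (hmem b hb) hab]
    ring
  · intro a ha b hb d hd hab had hbd
    rw [chg_shear_triple e hab had hbd hu'.empty (hu'.single a (hmem a ha))
      (hu'.single b (hmem b hb)) (hu'.single d (hmem d hd)), h2' a (hmem a ha) b (hmem b hb) hab,
      h2' a (hmem a ha) d (hmem d hd) had, h2' b (hmem b hb) d (hmem d hd) hbd,
      he a (hmem' a ha) b (hmem' b hb) d (hmem' d hd) hab had hbd]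
    ring

variable [DecidableEq F]

/-- After l has joined P freely, m either joins too, giving seven indices, or drops some j with q_jm
= 0 while both j and m are compatible with the other five. Both are impossible. -/
theorem PG.not_badSet_of_tame [IsF3 F] [Infinite K] (h : PG q) {P : Finset σ} {w : σ → F × F}
    {l m : σ} (hl : l ∉ P) (hm : m ∉ P) (hlm : l ≠ m)
    (ht : ∀ n, n = l ∨ n = m ∨ n ∈ P → Tame K q n) : ¬ BadSet K q P w := by
  intro hb
  have hP := hb.card
  obtain ⟨w', hw', hu⟩ := h.exists_free_word hb hl (ht l (by simp)) fun n hn => ht n (by simp [hn])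
  have h' := h.chg fun n => frame (w' n)
  have ht' (n : σ) (hn : n = l ∨ n = m ∨ n ∈ P) := (ht n hn).chg fun n => det2_frame (hw' n)
  generalize HypDetGr.chg (fun n => frame (w' n)) q = r at hu h' ht'
  have hc : (insert l P).card = 6 := by rw [Finset.card_insert_of_notMem hl, hP]
  have hml : m ∉ insert l P := by simp [hm, hlm.symm]
  obtain ⟨i, hi, him⟩ := (hu.mono (Finset.subset_insert l P)).exists_pair_ne_zero h' hP hm
    (ht' m (by simp))
  rcases hu.insert_or (K := K) h' (by omega) hml ⟨i, Finset.mem_insert_of_mem hi, him⟩ with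
    hu7 | ⟨j, hj, hjm, huj⟩
  · exact h'.not_isUni_of_card_eq_seven (by rw [Finset.card_insert_of_notMem hml, hc]) hu7
  · refine h'.pair_ne_zero_of_isUni (K := K) (P := (insert l P).erase j) (l := j) (m := m)
      (by rw [Finset.card_erase_of_mem hj, hc]) (by simp) (fun hn => hml (Finset.mem_of_mem_erase hn))
      (fun e => hml (e ▸ hj)) (by rwa [Finset.insert_erase hj]) huj (ht' m (by simp)) hjm

end Seven

/-! ### Scaling laws for a sum of two homogeneous tensors. -/

section Scaling

open Function Polynomial

variable {σ : Type*} [DecidableEq σ] [Fintype σ] {F : Type*} [Field F] {A : Type*} [CommRing A]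
  [Algebra F A]

/-- The hyperdeterminant of the combination of two tensors with coefficients `y`. -/
noncomputable def hdPair (a₀ a₁ : Finset σ → F) (i j k : σ) (w : σ → A × A) (y : A × A) : A :=
  hd fun b c d => y.1 * tri a₀ i j k w (bv b) (bv c) (bv d) +
    y.2 * tri a₁ i j k w (bv b) (bv c) (bv d)

variable {a a₀ a₁ : Finset σ → F} {i j k : σ}

theorem hdPair_one (ha : ∀ S, a S = a₀ S + a₁ S) (w : σ → A × A) :
    hdPair a₀ a₁ i j k w (1, 1) = hdAt a i j k w := by
  have h (w : σ → A × A) : val a w = val a₀ w + val a₁ w := by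
    simp only [val_eq, ha, map_add, add_mul, Finset.sum_add_distrib]
  simp only [hdPair, hdAt, tri, h, one_mul]

theorem hdPair_mul (w : σ → A × A) (t : A) (y : A × A) :
    hdPair a₀ a₁ i j k w (t * y.1, t * y.2) = t ^ 4 * hdPair a₀ a₁ i j k w y := by
  simp only [hdPair, hd]
  ring

theorem tri_smul (q : Finset σ → F) {c : σ → A} (hi : c i = 1) (hj : c j = 1) (hk : c k = 1)
    (w : σ → A × A) (x y z : A × A) :
    tri q i j k (fun n => c n • w n) x y z = (∏ n, c n) * tri q i j k w x y z := by
  rw [tri, tri, ← val_smul]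
  congr 1
  funext n
  by_cases hnk : n = k
  · subst hnk; simp [hk]
  by_cases hnj : n = j
  · subst hnj; simp [hj, hnk]
  by_cases hni : n = i
  · subst hni; simp [hi, hnk, hnj]
  simp [hni, hnj, hnk]

theorem hdPair_smul {c : σ → A} (hi : c i = 1) (hj : c j = 1) (hk : c k = 1)
    (w : σ → A × A) (y : A × A) :
    hdPair a₀ a₁ i j k (fun n => c n • w n) y = (∏ n, c n) ^ 4 * hdPair a₀ a₁ i j k w y := by
  simp only [hdPair, hd, tri_smul _ hi hj hk]
  ring

theorem IsHomTensor.tri_scale {d : ℕ} {q : Finset σ → F} (h : IsHomTensor d q) (hij : i ≠ j)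
    (hik : i ≠ k) (hjk : j ≠ k) (t : A) (w : σ → A × A) (x y z : Bool) :
    (if x then t else 1) * (if y then t else 1) * (if z then t else 1) *
      tri q i j k (fun n => (t * (w n).1, (w n).2)) (bv x) (bv y) (bv z) =
      t ^ d * tri q i j k w (bv x) (bv y) (bv z) := by
  let c : σ → A := fun n => if n = i then (if x then t else 1) else
    if n = j then (if y then t else 1) else if n = k then (if z then t else 1) else 1
  have hc : ∏ n, c n = (if x then t else 1) * (if y then t else 1) * (if z then t else 1) := by
    have : ∏ n, c n = ∏ n ∈ {i, j, k}, c n := by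
      refine (Finset.prod_subset (Finset.subset_univ _) fun n _ hn => ?_).symm
      simp only [Finset.mem_insert, Finset.mem_singleton, not_or] at hn
      simp [c, hn]
    rw [this, Finset.prod_insert (by simp [hij, hik]), Finset.prod_pair hjk]
    simp [c, hij.symm, hik.symm, hjk.symm, mul_assoc]
  rw [tri, tri, ← h.val_smul_fst, ← hc, ← val_smul]
  congr 1
  funext n
  by_cases hnk : n = k
  · subst hnk; cases z <;> simp [c, hik.symm, hjk.symm]
  by_cases hnj : n = j
  · subst hnj; cases y <;> simp [c, hij.symm, hnk]
  by_cases hni : n = i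
  · subst hni; cases x <;> simp [c, hnk, hnj]
  simp [c, hni, hnj, hnk]

/-- The pair y acts as the weight of an additional coordinate that makes the sum homogeneous of
degree e + 1; t⁶ accounts for the three free directions, each contributing t². -/
theorem hdPair_scale {e : ℕ} (h₀ : IsHomTensor e a₀) (h₁ : IsHomTensor (e + 1) a₁) (hij : i ≠ j)
    (hik : i ≠ k) (hjk : j ≠ k) (t : A) (w : σ → A × A) (y : A × A) :
    t ^ 6 * hdPair a₀ a₁ i j k (fun n => (t * (w n).1, (w n).2)) (t * y.1, y.2) =
      t ^ (4 * (e + 1)) * hdPair a₀ a₁ i j k w y := by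
  let u : Bool → Bool → Bool → A := fun b c d => t * y.1 *
    tri a₀ i j k (fun n => (t * (w n).1, (w n).2)) (bv b) (bv c) (bv d) +
    y.2 * tri a₁ i j k (fun n => (t * (w n).1, (w n).2)) (bv b) (bv c) (bv d)
  let v : Bool → Bool → Bool → A := fun b c d =>
    y.1 * tri a₀ i j k w (bv b) (bv c) (bv d) + y.2 * tri a₁ i j k w (bv b) (bv c) (bv d)
  have huv (b c d : Bool) : (if b then t else 1) * (if c then t else 1) * (if d then t else 1) *
      u b c d = t ^ (e + 1) * v b c d := by
    have e0 := h₀.tri_scale hij hik hjk t w b c d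
    have e1 := h₁.tri_scale hij hik hjk t w b c d
    simp only [u, v]
    linear_combination t * y.1 * e0 + y.2 * e1
  have e1 : hd (fun b c d => (if b then t else 1) * (if c then t else 1) * (if d then t else 1) *
      u b c d) = t ^ 6 * hd u := by
    simp only [hd, if_true, Bool.false_eq_true, if_false]
    ring
  have e2 : hd (fun b c d => t ^ (e + 1) * v b c d) = t ^ (4 * (e + 1)) * hd v := by
    simp only [hd]
    ring
  simp only [huv] at e1
  rw [e2] at e1
  exact e1.symm

theorem map_hdPair {B : Type*} [CommRing B] [Algebra F B] (φ : A →ₐ[F] B) (w : σ → A × A)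
    (y : A × A) : φ (hdPair a₀ a₁ i j k w y) =
      hdPair a₀ a₁ i j k (fun n => (φ (w n).1, φ (w n).2)) (φ y.1, φ y.2) := by
  have h (q : Finset σ → F) (a b c : Bool) : φ (tri q i j k w (bv a) (bv b) (bv c)) =
      tri q i j k (fun l => (φ (w l).1, φ (w l).2)) (bv a) (bv b) (bv c) := by
    have hb (b : Bool) : (φ (bv b : A × A).1, φ (bv b : A × A).2) = (bv b : B × B) := by
      cases b <;> simp
    rw [tri, map_val, tri]
    congr 1
    funext n
    by_cases hnk : n = k
    · subst hnk; simp [hb]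
    by_cases hnj : n = j
    · subst hnj; simp [hb, hnk]
    by_cases hni : n = i
    · subst hni; simp [hb, hnk, hnj]
    simp [hni, hnj, hnk]
  simp only [hdPair, hd, map_add, map_sub, map_mul, map_pow, map_ofNat, h]

end Scaling

/-! ### Degree restrictions on badness. -/

section Extremal

open Function Polynomial

variable {σ : Type*} [DecidableEq σ] [Fintype σ] {F : Type*} [Field F] {K : Type*} [Field K]
  [Algebra F K] {a a₀ a₁ : Finset σ → F} {i j k l m : σ} {e : ℕ}

theorem X_pow_mul_hdPair (ha : ∀ S, a S = a₀ S + a₁ S) (h₀ : IsHomTensor e a₀)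
    (h₁ : IsHomTensor (e + 1) a₁) (hn : [i, j, k, l, m].Nodup) (w : σ → F × F) :
    X ^ 14 * hdPair a₀ a₁ i j k (update (update (fun n => (X * (mapVec K[X] (w n)).1,
      (mapVec K[X] (w n)).2)) l (1, 1)) m (1, 1)) (X, 1) = X ^ (4 * (e + 1)) *
        hdAt a i j k (update (update (fun n => mapVec K[X] (w n)) l (1, X)) m (1, X)) := by
  simp only [List.nodup_cons, List.mem_cons, List.not_mem_nil, or_false, not_or,
    not_false_eq_true, List.nodup_nil, and_true] at hn
  obtain ⟨⟨ij, ik, il, im⟩, ⟨jk, jl, jm⟩, ⟨kl, km⟩, lm⟩ := hn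
  rw [← hdPair_one ha, ← hdPair_scale h₀ h₁ ij ik jk]
  have hc : ∏ n, (if n = l ∨ n = m then (X : K[X]) else 1) = X ^ 2 := by
    rw [Finset.prod_ite, Finset.prod_const_one, mul_one, Finset.prod_const]
    congr 1
    rw [← Finset.card_pair lm]
    congr 1
    ext n
    simp
  have hs := hdPair_smul (a₀ := a₀) (a₁ := a₁) (i := i) (j := j) (k := k)
    (c := fun n => if n = l ∨ n = m then (X : K[X]) else 1) (by simp [il, im]) (by simp [jl, jm])
    (by simp [kl, km]) (update (update (fun n => (X * (mapVec K[X] (w n)).1,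
      (mapVec K[X] (w n)).2)) l (1, 1)) m (1, 1)) (X, 1)
  have hw : (fun n => (X * (update (update (fun n => mapVec K[X] (w n)) l (1, X)) m (1, X) n).1,
      (update (update (fun n => mapVec K[X] (w n)) l (1, X)) m (1, X) n).2)) =
      fun n => (if n = l ∨ n = m then (X : K[X]) else 1) • (update (update (fun n =>
        (X * (mapVec K[X] (w n)).1, (mapVec K[X] (w n)).2)) l (1, 1)) m (1, 1)) n := by
    funext n
    by_cases hm : n = m
    · subst hm; simp
    by_cases hl : n = l
    · subst hl; simp [hm]
    simp [hm, hl]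
  rw [hw, mul_one, hs, hc]
  ring

theorem X_pow_mul_hdAt (ha : ∀ S, a S = a₀ S + a₁ S) (h₀ : IsHomTensor e a₀)
    (h₁ : IsHomTensor (e + 1) a₁) (hn : [i, j, k, l, m].Nodup) {Z : Finset σ}
    (hZ : ∀ n ∈ [i, j, k, l, m], n ∉ Z) (w : σ → F × F) (hw : ∀ n ∉ Z, (w n).1 = 0) :
    X ^ (10 + 4 * Z.card) *
        hdAt a i j k (update (update (fun n => mapVec K[X] (w n)) l (X, 1)) m (X, 1)) =
      X ^ (4 * (e + 1)) * hdPair a₀ a₁ i j k (update (update (fun n => if n ∈ Z then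
        ((mapVec K[X] (w n)).1, X * (mapVec K[X] (w n)).2) else mapVec K[X] (w n)) l (1, 1)) m
          (1, 1)) (1, X) := by
  simp only [List.nodup_cons, List.mem_cons, List.not_mem_nil, or_false, not_or,
    not_false_eq_true, List.nodup_nil, and_true] at hn
  obtain ⟨⟨ij, ik, il, im⟩, ⟨jk, jl, jm⟩, ⟨kl, km⟩, lm⟩ := hn
  rw [← hdPair_one ha, ← hdPair_scale h₀ h₁ ij ik jk]
  have hc : ∏ n, (if n ∈ Z then (X : K[X]) else 1) = X ^ Z.card := by
    rw [Finset.prod_ite_mem, Finset.univ_inter, Finset.prod_const]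
  have hs := hdPair_smul (a₀ := a₀) (a₁ := a₁) (i := i) (j := j) (k := k)
    (c := fun n => if n ∈ Z then (X : K[X]) else 1) (by simp [hZ]) (by simp [hZ])
    (by simp [hZ]) (update (update (fun n => mapVec K[X] (w n)) l (X, 1)) m (X, 1)) (X, X)
  have hX := hdPair_mul (a₀ := a₀) (a₁ := a₁) (i := i) (j := j) (k := k)
    (update (update (fun n => mapVec K[X] (w n)) l (X, 1)) m (X, 1)) (X : K[X]) (1, 1)
  simp only [mul_one] at hX
  rw [hX, hc] at hs
  have hw' : (fun n => (X * (update (update (fun n => if n ∈ Z then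
        ((mapVec K[X] (w n)).1, X * (mapVec K[X] (w n)).2) else mapVec K[X] (w n)) l (1, 1)) m
          (1, 1) n).1, (update (update (fun n => if n ∈ Z then
        ((mapVec K[X] (w n)).1, X * (mapVec K[X] (w n)).2) else mapVec K[X] (w n)) l (1, 1)) m
          (1, 1) n).2)) =
      fun n => (if n ∈ Z then (X : K[X]) else 1) •
        (update (update (fun n => mapVec K[X] (w n)) l (X, 1)) m (X, 1)) n := by
    funext n
    by_cases hm : n = m
    · subst hm; simp [hZ]
    by_cases hl : n = l
    · subst hl; simp [hm, hZ]
    by_cases hnZ : n ∈ Z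
    · simp only [hm, hl, hnZ, ne_eq, not_false_eq_true, update_of_ne, if_true]
      rfl
    · simp [hm, hl, hnZ, hw n hnZ, mapVec]
  rw [hw', mul_one, hs]
  ring

variable [Infinite K] [IsF3 F]

/-- Move both free weights along (1, X), where the hyperdeterminant is c X²(1 − X²)². Scaling turns
this into X^{8−4e} G = c(1 − X²)², and G at X = 0 sees only the second components of the weights. -/
theorem PG.bad_iff_of_hom (h : PG a) (ha : ∀ S, a S = a₀ S + a₁ S) (h₀ : IsHomTensor e a₀)
    (h₁ : IsHomTensor (e + 1) a₁) (hn : [i, j, k, l, m].Nodup) (he : e ≤ 2) (w : σ → F × F) :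
    (Bad K a i j k l m w ↔ Bad K a i j k l m fun n => (0, (w n).2)) ∧
      (e < 2 → ¬ Bad K a i j k l m w) := by
  let φ : K[X] →ₐ[F] K := (aeval (0 : K)).restrictScalars F
  let x : K := hdPair a₀ a₁ i j k
    (update (update (fun n => ((0 : K), algebraMap F K (w n).2)) l (1, 1)) m (1, 1)) (0, 1)
  have hφX : φ X = 0 := by simp [φ]
  have key (w' : σ → F × F) (hw : ∀ n, (w' n).2 = (w n).2) (c : K)
      (hc : ∀ x y : K[X] × K[X], hdAt a i j k (update (update (fun n => mapVec K[X] (w' n)) l x) m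
        y) = C c * quartic x * quartic y) : c = 0 ^ (8 - 4 * e) * x := by
    have h1 := X_pow_mul_hdPair (K := K) ha h₀ h₁ hn w'
    rw [hc] at h1
    set G := hdPair a₀ a₁ i j k (update (update (fun n => (X * (mapVec K[X] (w' n)).1,
      (mapVec K[X] (w' n)).2)) l (1, 1)) m (1, 1)) (X, 1) with hG
    have h2 : X ^ (4 * e + 6) * (X ^ (8 - 4 * e) * G) =
        X ^ (4 * e + 6) * (C c * (1 - X ^ 2) ^ 2) := by
      rw [← mul_assoc, ← pow_add, show 4 * e + 6 + (8 - 4 * e) = 14 by omega, h1]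
      simp only [quartic]
      ring
    have h3 := congrArg φ (mul_left_cancel₀ (pow_ne_zero _ X_ne_zero) h2)
    have hφC : φ (C c) = c := by simp [φ]
    have hφG : φ G = x := by
      rw [hG, map_hdPair]
      simp only [x]
      congr 1
      · funext n
        by_cases hm : n = m
        · subst hm; simp
        by_cases hl : n = l
        · subst hl; simp [hm]
        simp [hm, hl, mapVec, ← hw, φ]
      · simp [hφX]
    simp only [map_mul, map_pow, map_sub, map_one, hφX, hφC, hφG] at h3
    linear_combination -h3
  obtain ⟨c, hc, hc'⟩ := h.exists_eq_quartic (K := K) hn w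
  obtain ⟨c', hd, hd'⟩ := h.exists_eq_quartic (K := K) hn fun n => (0, (w n).2)
  have e1 := key _ (fun _ => rfl) c hc'
  have e2 := key (fun n => (0, (w n).2)) (fun _ => rfl) c' hd'
  clear_value x
  have he' : e < 2 → 8 - 4 * e ≠ 0 := by omega
  refine ⟨by rw [hc, hd, e1, e2], fun he2 => ?_⟩
  have h0 : c = 0 := by rw [e1, zero_pow (he' he2), zero_mul]
  exact fun hb => hc.1 hb h0

/-- Along (X, 1) the comparison reads c(1 − X²)² = X^{4e−8−4|Z|} G. For empty Z the exponent is
positive. Otherwise c is a multiple of G(0), which is the same after replacing the weight in Z by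
its first component, where badness is excluded. -/
theorem PG.not_bad_of_hom (h : PG a) (ha : ∀ S, a S = a₀ S + a₁ S) (h₀ : IsHomTensor e a₀)
    (h₁ : IsHomTensor (e + 1) a₁) (hn : [i, j, k, l, m].Nodup) (he : 3 ≤ e) {Z : Finset σ}
    (hZ : ∀ n ∈ [i, j, k, l, m], n ∉ Z) (hZ1 : Z.card ≤ 1) (w : σ → F × F)
    (hw : ∀ n ∉ Z, (w n).1 = 0)
    (hb : Z.Nonempty → ¬ Bad K a i j k l m fun n => if n ∈ Z then ((w n).1, 0) else w n) :
    ¬ Bad K a i j k l m w := by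
  let φ : K[X] →ₐ[F] K := (aeval (0 : K)).restrictScalars F
  have hφX : φ X = 0 := by simp [φ]
  let x : K := hdPair a₀ a₁ i j k
    (update (update (fun n => if n ∈ Z then (algebraMap F K (w n).1, 0) else mapVec K (w n)) l
      (1, 1)) m (1, 1)) (1, 0)
  have key (w' : σ → F × F) (hw' : ∀ n, (w' n).1 = (w n).1) (hwZ : ∀ n ∉ Z, w' n = w n) (c : K)
      (hc : ∀ x y : K[X] × K[X], hdAt a i j k (update (update (fun n => mapVec K[X] (w' n)) l x) m
        y) = C c * quartic x * quartic y) :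
      c = 0 ^ (4 * e - 8 - 4 * Z.card) * x ∧ (c = 0 → x = 0) := by
    have h1 := X_pow_mul_hdAt (K := K) ha h₀ h₁ hn hZ w' fun n hn => by rw [hw', hw n hn]
    rw [hc] at h1
    set G := hdPair a₀ a₁ i j k (update (update (fun n => if n ∈ Z then
        ((mapVec K[X] (w' n)).1, X * (mapVec K[X] (w' n)).2) else mapVec K[X] (w' n)) l (1, 1)) m
          (1, 1)) (1, X) with hG
    have h2 : X ^ (12 + 4 * Z.card) * (C c * (1 - X ^ 2) ^ 2) =
        X ^ (12 + 4 * Z.card) * (X ^ (4 * e - 8 - 4 * Z.card) * G) := by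
      rw [← mul_assoc (X ^ (12 + 4 * Z.card)) (X ^ _), ← pow_add,
        show 12 + 4 * Z.card + (4 * e - 8 - 4 * Z.card) = 4 * (e + 1) by omega, ← h1]
      simp only [quartic]
      ring
    have hφC : φ (C c) = c := by simp [φ]
    have hφG : φ G = x := by
      rw [hG, map_hdPair]
      simp only [x]
      congr 1
      · funext n
        by_cases hm : n = m
        · subst hm; simp
        by_cases hl : n = l
        · subst hl; simp [hm]
        by_cases hnZ : n ∈ Z
        · simp [hm, hl, mapVec, ← hw', φ, hnZ]
        · simp [hm, hl, mapVec, φ, hnZ, hwZ n hnZ]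
      · simp [hφX]
    have h3 := mul_left_cancel₀ (pow_ne_zero _ X_ne_zero) h2
    have h4 := congrArg φ h3
    simp only [map_mul, map_pow, map_sub, map_one, hφX, hφC, hφG] at h4
    refine ⟨by linear_combination h4, fun h0 => ?_⟩
    rw [h0, map_zero, zero_mul] at h3
    rw [← hφG, (mul_eq_zero.1 h3.symm).resolve_left (pow_ne_zero _ X_ne_zero), map_zero]
  obtain ⟨c, hc, hc'⟩ := h.exists_eq_quartic (K := K) hn w
  obtain ⟨e1, -⟩ := key _ (fun _ => rfl) (fun _ _ => rfl) c hc'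
  clear_value x
  rw [hc, not_not, e1]
  by_cases hZn : Z.Nonempty
  · obtain ⟨c', hd, hd'⟩ := h.exists_eq_quartic (K := K) hn
      fun n => if n ∈ Z then ((w n).1, 0) else w n
    obtain ⟨-, e2⟩ := key (fun n => if n ∈ Z then ((w n).1, 0) else w n)
      (fun n => by split_ifs <;> rfl) (fun n hn => by simp [hn]) c' hd'
    rw [e2 (not_not.1 (mt hd.2 (hb hZn))), mul_zero]
  · rw [Finset.not_nonempty_iff_eq_empty.1 hZn, zero_pow (by simp; omega), zero_mul]

end Extremal

/-! ### Slices, supports and the case of degrees two and three. -/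

section Support

open Function

variable {σ : Type*} [DecidableEq σ] [Fintype σ] {F : Type*} [Field F] {a : Finset σ → F}

theorem PG.restrict (h : PG a) (k : σ) (b : Bool) : PG (slice k b a) := by
  intro i j l hij hil hjl w
  have h0 : ∀ T, k ∈ T → slice k b a T = 0 := fun T hT => slice_of_mem hT b a
  by_cases hl : k = l
  · subst hl
    exact hdAt_eq_zero_of_mem h0 _ _ _
  by_cases hj : k = j
  · subst hj
    rw [hdAt_swap_right _ hjl]
    exact hdAt_eq_zero_of_mem h0 _ _ _
  by_cases hi : k = i
  · subst hi
    rw [hdAt_swap_left _ hij, hdAt_swap_right _ hil]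
    exact hdAt_eq_zero_of_mem h0 _ _ _
  rw [hdAt_slice a hi hj hl, h i j l hij hil hjl, mul_zero]

theorem val_eq_prod_mul {A : Type*} [CommRing A] [Algebra F A] {J : Finset σ}
    (hJ : ∀ S, a S ≠ 0 → S ⊆ J) (w : σ → A × A) :
    val a w = (∏ n, if n ∈ J then 1 else (w n).2) *
      val a fun n => if n ∈ J then w n else (0, 1) := by
  rw [val_eq, val_eq, Finset.mul_sum]
  refine Finset.sum_congr rfl fun T _ => ?_
  by_cases hT : a T = 0
  · simp [hT]
  rw [mul_left_comm, ← Finset.prod_mul_distrib]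
  congr 1
  refine Finset.prod_congr rfl fun n _ => ?_
  by_cases hn : n ∈ J
  · simp [hn]
  · have hnT : n ∉ T := fun h => hn (hJ T hT h)
    simp [hn, hnT]

theorem hdAt_eq_prod_mul {A : Type*} [CommRing A] [Algebra F A] {J : Finset σ}
    (hJ : ∀ S, a S ≠ 0 → S ⊆ J) {i j k : σ} (hi : i ∈ J) (hj : j ∈ J) (hk : k ∈ J)
    (w : σ → A × A) :
    hdAt a i j k w = (∏ n, if n ∈ J then 1 else (w n).2) ^ 4 *
      hdAt a i j k fun n => if n ∈ J then w n else (0, 1) := by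
  have e (x y z : A × A) : tri a i j k w x y z = (∏ n, if n ∈ J then 1 else (w n).2) *
      tri a i j k (fun n => if n ∈ J then w n else (0, 1)) x y z := by
    have h1 : ∀ n ∉ J, update (update (update w i x) j y) k z n = w n := by
      intro n hn
      rw [update_of_ne (fun e => hn (by rwa [e])), update_of_ne (fun e => hn (by rwa [e])),
        update_of_ne (fun e => hn (by rwa [e]))]
    rw [tri, tri, val_eq_prod_mul hJ]
    congr 1
    · refine Finset.prod_congr rfl fun n _ => ?_
      by_cases hn : n ∈ J
      · simp [hn]
      · simp [hn, h1 n hn]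
    · congr 1
      funext n
      by_cases hn : n ∈ J
      · simp only [hn, if_true]
        simp only [update_apply, hn, if_true]
      · simp only [hn, if_false]
        rw [update_of_ne (fun e => hn (by rwa [e])), update_of_ne (fun e => hn (by rwa [e])),
          update_of_ne (fun e => hn (by rwa [e])), if_neg hn]
  simp only [hdAt, hd, e]
  ring

variable {K : Type*} [Field K] [Algebra F K]

theorem Bad.restrict {J : Finset σ} (hJ : ∀ S, a S ≠ 0 → S ⊆ J) {i j k l m : σ}
    (hm : ∀ n ∈ [i, j, k, l, m], n ∈ J) {w : σ → F × F} (hb : Bad K a i j k l m w) :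
    Bad K a i j k l m fun n => if n ∈ J then w n else (0, 1) := by
  obtain ⟨x, y, hxy⟩ := hb
  refine ⟨x, y, ?_⟩
  rw [hdAt_eq_prod_mul hJ (hm i (by simp)) (hm j (by simp)) (hm k (by simp))] at hxy
  convert right_ne_zero_of_mul hxy using 3
  rename_i n
  have hmJ := hm m (by simp)
  have hlJ := hm l (by simp)
  by_cases hn : n ∈ J
  · by_cases h1 : n = m
    · subst h1; simp [hn]
    by_cases h2 : n = l
    · subst h2; simp [hn, h1]
    simp [hn, h1, h2]
  · rw [update_of_ne (fun e => hn (by rwa [e])), update_of_ne (fun e => hn (by rwa [e])),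
      if_neg hn]
    simp [mapVec, hn]

/-- A weight proportional to a vertex turns the hyperdeterminant into one of the slice, up to a
nonzero factor. -/
theorem not_bad_of_good_slice {z : σ} {b : Bool} (hg : Good (slice z b a)) {i j k l m : σ}
    (hn : [i, j, k, l, m].Nodup) (hz : z ∉ [i, j, k, l, m]) {w : σ → F × F}
    (hw : ∃ c : F, w z = c • (bv b : F × F)) : ¬ Bad K a i j k l m w := by
  intro hb
  have hw0 := hb.ne_zero hz
  obtain ⟨c, hc⟩ := hw
  have hc0 : c ≠ 0 := by
    rintro rfl
    exact hw0 (by rw [hc, zero_smul])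
  obtain ⟨x, y, hxy⟩ := hb
  simp only [List.nodup_cons, List.mem_cons, List.not_mem_nil, or_false, not_or,
    not_false_eq_true, List.nodup_nil, and_true] at hn hz
  obtain ⟨zi, zj, zk, zl, zm⟩ := hz
  set W : σ → K × K := update (update (fun n => mapVec K (w n)) l x) m y with hW
  refine hxy (hdAt_smul' a W (update W z (bv b)) (fun n _ _ _ => ?_) ?_)
  · by_cases hnz : n = z
    · subst hnz
      refine ⟨algebraMap F K c, by simpa using hc0, ?_⟩
      rw [hW, update_of_ne zm, update_of_ne zl, update_self, hc]
      cases b <;> simp [mapVec, Algebra.algebraMap_eq_smul_one]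
    · exact ⟨1, one_ne_zero, by simp [hnz]⟩
  · have := hdAt_slice a zi zj zk b (update W z (0, 1))
    rw [hg.hdAt_eq_zero hn.1.1 hn.1.2.1 hn.2.1.1] at this
    simpa using this.symm

theorem avoids_of_good_slice {z : σ} {b : Bool} (hg : Good (slice z b a)) :
    Avoids K a z (bv b) := by
  rintro P w hz hw ⟨i, j, k, l, m, hn, rfl, hb⟩
  exact not_bad_of_good_slice hg hn (by simpa using hz) ⟨1, by rw [hw, one_smul]⟩ hb

theorem tame_of_good_slice {z : σ} (h : ∀ b, Good (slice z b a)) : Tame K a z :=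
  ⟨bv true, bv false, by simp, avoids_of_good_slice (h true), avoids_of_good_slice (h false)⟩

variable [IsF3 F] [Infinite K]

/-- If z ∈ P occurs in no set of the support, the form vanishes at weight (1, 0) in z; yet a null
point with that weight at z and nonzero second derivatives would exist. -/
theorem BadSet.subset_of_support {J : Finset σ} (hJ : ∀ S, a S ≠ 0 → S ⊆ J) (h : PG a)
    {P : Finset σ} {w : σ → F × F} (hb : BadSet K a P w) : P ⊆ J := by
  classical
  intro z hz
  by_contra hzJ
  have hc := hb.card
  obtain ⟨x, hx, hxz⟩ := Finset.exists_mem_ne (by omega : 1 < P.card) z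
  obtain ⟨w', -, -, hw, -, hu⟩ := h.exists_word hb hz hx hxz.symm (x := (1, 0)) (y := (1, 0))
    (by simp) (by simp)
  obtain ⟨y, hy, hyx, hyz⟩ : ∃ y ∈ P, y ≠ x ∧ y ≠ z := by
    obtain ⟨k, hk⟩ : (P \ {x, z}).Nonempty := by
      rw [← Finset.card_pos]
      have := Finset.le_card_sdiff {x, z} P
      have := Finset.card_pair hxz
      omega
    simp only [Finset.mem_sdiff, Finset.mem_insert, Finset.mem_singleton, not_or] at hk
    exact ⟨k, hk⟩
  refine hu.pair x hx y hy hyx.symm (val_eq_zero_of_mem (k := z) (fun T hT => ?_) ?_)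
  · by_contra hT0
    exact hzJ (hJ T hT0 hT)
  · simp [hxz.symm, hyz.symm, frame, hw]

/-- Badness makes all pairs nonzero and, after exchanging the two vertices in every coordinate of P,
all triples too. The square condition equates each triple with its pairs, so all share one value c,
and the hyperdeterminant at the weights (1, 1) forces c⁴ = 0. -/
theorem PG.not_badSet_vtx_of_card (h : PG a) (hc : ∀ S, a S ≠ 0 → S.card = 2 ∨ S.card = 3)
    (hs : ∀ i S, i ∉ S → IsSquare (a S * a (insert i S))) {P : Finset σ} :
    ¬ BadSet K a P (vtx ∅) := by
  intro hb
  have hP := hb.card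
  have hc0 (S : Finset σ) (h2 : S.card ≠ 2) (h3 : S.card ≠ 3) : a S = 0 := by
    by_contra h0
    rcases hc S h0 with h | h <;> contradiction
  have hu := (h.badSet_iff_of_null hP (hc0 _ (by simp) (by simp))
    fun n _ => hc0 _ (by simp) (by simp)).1 hb
  -- Complementation inside P: sizes two and three are interchanged, so the flipped tensor also has
  -- a null point at the origin.
  let E : σ → Bool → F × F := fun n b => if n ∈ P then bv (!b) else bv b
  have hE : ∀ n ∈ P, det2 (E n) ≠ 0 := by
    intro n hn
    simp [E, hn, det2]
  have hchg (S : Finset σ) (hS : S ⊆ P) : HypDetGr.chg E a S = a (P \ S) := by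
    have := val_vertex (A := F) a (P \ S)
    simp only [Algebra.algebraMap_self, RingHom.id_apply] at this
    rw [← this, HypDetGr.chg]
    congr 1
    funext n
    by_cases hn : n ∈ P
    · by_cases hnS : n ∈ S <;> simp [E, hn, hnS]
    · have hnS : n ∉ S := fun h => hn (hS h)
      simp [E, hn, hnS]
  have hb' : BadSet K (HypDetGr.chg E a) P (vtx ∅) := by
    rw [badSet_chg_iff hE]
    exact hb.congr fun n hn => by simp [E, hn, vtx]
  have hu' := ((h.chg E).badSet_iff_of_null hP (by
      rw [hchg _ (by simp)]
      exact hc0 _ (by simp [hP]) (by simp [hP])) fun n hn => by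
      rw [hchg _ (by simpa using hn)]
      have : (P \ {n}).card = 4 := by
        rw [Finset.card_sdiff_of_subset (by simpa using hn), hP, Finset.card_singleton]
      exact hc0 _ (by omega) (by omega)).1 hb'
  have h3 : ∀ x ∈ P, ∀ y ∈ P, ∀ z ∈ P, x ≠ y → x ≠ z → y ≠ z → a {x, y, z} ≠ 0 := by
    intro x hx y hy z hz hxy hxz hyz
    have hsub : ({x, y, z} : Finset σ) ⊆ P := by simp [Finset.insert_subset_iff, hx, hy, hz]
    have hcard : (P \ {x, y, z}).card = 2 := by
      rw [Finset.card_sdiff_of_subset hsub, hP,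
        Finset.card_eq_three.2 ⟨x, y, z, hxy, hxz, hyz, rfl⟩]
    obtain ⟨s, t, hst, hset⟩ := Finset.card_eq_two.1 hcard
    have hss : ({s, t} : Finset σ) ⊆ P := hset ▸ Finset.sdiff_subset
    rw [← Finset.sdiff_sdiff_eq_self hsub, hset, ← hchg _ hss]
    exact hu'.pair s (hss (by simp)) t (hss (by simp)) hst
  have h23 : ∀ x ∈ P, ∀ y ∈ P, ∀ z ∈ P, x ≠ y → x ≠ z → y ≠ z → a {x, y, z} = a {x, y} := by
    intro x hx y hy z hz hxy hxz hyz
    have e1 := h3 x hx y hy z hz hxy hxz hyz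
    have e2 := hu.pair x hx y hy hxy
    have e3 := IsF3.sq_eq_one e2
    obtain ⟨r, hr⟩ := hs z {x, y} (by simp [hxz.symm, hyz.symm])
    have e4 : ({z, x, y} : Finset σ) = {x, y, z} := by
      ext n; simp only [Finset.mem_insert, Finset.mem_singleton]; tauto
    rw [e4] at hr
    have hr0 : r ≠ 0 := by
      rintro rfl
      exact mul_ne_zero e2 e1 (by simpa using hr)
    have := IsF3.sq_eq_one hr0
    linear_combination a {x, y} * hr + a {x, y} * this - a {x, y, z} * e3
  have hpair := eq_of_adjacent (P := P) (f := fun x y => a {x, y})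
    (fun x y => by rw [Finset.pair_comm]) fun x hx y hy z hz hxy hxz hyz => by
      rw [← h23 x hx z hz y hy hxz hxy hyz.symm, ← h23 y hy z hz x hx hyz hxy.symm hxz.symm]
      congr 1
      ext n; simp only [Finset.mem_insert, Finset.mem_singleton]; tauto
  obtain ⟨i, j, k, l, m, hn, rfl, -⟩ := hb
  have hn' := hn
  simp only [List.nodup_cons, List.mem_cons, List.not_mem_nil, or_false, not_or,
    not_false_eq_true, List.nodup_nil, and_true] at hn'
  obtain ⟨⟨ij, ik, il, im⟩, ⟨jk, jl, jm⟩, ⟨kl, km⟩, lm⟩ := hn'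
  have ji := Ne.symm ij
  have ki := Ne.symm ik
  have kj := Ne.symm jk
  set c := a {l, m} with hcdef
  have p2 (x : σ) (hx : x ∈ ({i, j, k, l, m} : Finset σ)) (y : σ)
      (hy : y ∈ ({i, j, k, l, m} : Finset σ)) (hxy : x ≠ y) : a {x, y} = c :=
    hpair x hx y hy l (by simp) m (by simp) hxy lm
  have p3 (x : σ) (hx : x ∈ ({i, j, k, l, m} : Finset σ)) (y : σ)
      (hy : y ∈ ({i, j, k, l, m} : Finset σ)) (z : σ) (hz : z ∈ ({i, j, k, l, m} : Finset σ))
      (hxy : x ≠ y) (hxz : x ≠ z) (hyz : y ≠ z) : a {x, y, z} = c := by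
    rw [h23 x hx y hy z hz hxy hxz hyz, p2 x hx y hy hxy]
  have p4 (x y z t : σ) (hn : [x, y, z, t].Nodup) : a {x, y, z, t} = 0 := by
    have : ({x, y, z, t} : Finset σ).card = 4 := by
      simpa using List.toFinset_card_of_nodup hn
    exact hc0 _ (by omega) (by omega)
  have p1 (x : σ) : a {x} = 0 := hc0 _ (by simp) (by simp)
  have p5 : a {k, j, i, l, m} = 0 := by
    have : ({k, j, i, l, m} : Finset σ) = {i, j, k, l, m} := by
      ext n; simp only [Finset.mem_insert, Finset.mem_singleton]; tauto
    rw [this]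
    exact hc0 _ (by omega) (by omega)
  have hD := h i j k ij ik jk (update (update (vtx ∅) l (1, 1)) m (1, 1))
  simp only [hdAt_vtx_update₂ a hn, hd, addIf_true, addIf_false, insert_empty_eq,
    Algebra.algebraMap_self, RingHom.id_apply, one_mul] at hD
  rw [p5, hc0 ∅ (by simp) (by simp), p4 k j i l (by simp [*]), p4 k j i m (by simp [*]),
    p4 k j l m (by simp [*]), p4 k i l m (by simp [*]), p4 j i l m (by simp [*]),
    p3 k (by simp) j (by simp) i (by simp) kj ki ji, p3 k (by simp) j (by simp) l (by simp) kj kl jl,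
    p3 k (by simp) j (by simp) m (by simp) kj km jm, p3 k (by simp) i (by simp) l (by simp) ki kl il,
    p3 k (by simp) i (by simp) m (by simp) ki km im, p3 j (by simp) i (by simp) l (by simp) ji jl il,
    p3 j (by simp) i (by simp) m (by simp) ji jm im, p3 k (by simp) l (by simp) m (by simp) kl km lm,
    p3 j (by simp) l (by simp) m (by simp) jl jm lm, p3 i (by simp) l (by simp) m (by simp) il im lm,
    p2 k (by simp) j (by simp) kj, p2 k (by simp) i (by simp) ki, p2 j (by simp) i (by simp) ji,
    p2 k (by simp) l (by simp) kl, p2 k (by simp) m (by simp) km, p2 j (by simp) l (by simp) jl,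
    p2 j (by simp) m (by simp) jm, p2 i (by simp) l (by simp) il, p2 i (by simp) m (by simp) im,
    p2 l (by simp) m (by simp) lm, p1, p1, p1, p1, p1] at hD
  have hc1 : c ^ 4 = 0 := by
    -- The hyperdeterminant evaluates to −80 c⁴, which is c⁴ modulo three.
    linear_combination hD + 27 * c ^ 4 * IsF3.three_eq_zero (F := F)
  exact hu.pair l (by simp) m (by simp) lm (by simpa using hc1)

end Support

/-! ### Induction on the support over the field with three elements. -/

section Induction

open Function

variable {σ : Type*} [DecidableEq σ] [Fintype σ] {F : Type*} [Field F] [IsF3 F]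

/-- By induction every slice in a coordinate of J is good, so all these coordinates are tame with
the two vertices as values. Hence at most one index of J lies outside a bad set, and the degree
restrictions finish. -/
theorem PG.good_of_support {J : Finset σ} : ∀ {a : Finset σ → F} {e : ℕ}, PG a →
    (∀ S, a S ≠ 0 → S.card = e ∨ S.card = e + 1) →
    (∀ i S, i ∉ S → IsSquare (a S * a (insert i S))) → (∀ S, a S ≠ 0 → S ⊆ J) → Good a := by
  classical
  induction J using Finset.strongInduction with
  | H J ih =>
  intro a e h hom hs hJ
  have hslice : ∀ z ∈ J, ∀ b, Good (slice z b a) := by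
    intro z hz b
    -- Truncation in e − 1 is harmless: for e = 0 the slice at z is supported on the empty set only.
    refine ih _ (Finset.erase_ssubset hz) (e := if b then e - 1 else e) (h.restrict z b) ?_ ?_ ?_
    · intro S hS
      have hzS : z ∉ S := fun hzS => hS (slice_of_mem hzS b a)
      rw [slice_of_notMem hzS] at hS
      have := hom _ hS
      cases b
      · simpa using this
      · simp only [if_true, Finset.card_insert_of_notMem hzS] at this ⊢
        omega
    · intro i S hi
      by_cases hzS : z ∈ insert i S
      · simp [slice_of_mem hzS]
      simp only [Finset.mem_insert, not_or] at hzS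
      rw [slice_of_notMem hzS.2, slice_of_notMem (by simpa using hzS)]
      cases b
      · exact hs i S hi
      · simp only [if_true]
        rw [Finset.insert_comm]
        exact hs i _ (by simp [hi, Ne.symm hzS.1])
    · intro S hS
      have hzS : z ∉ S := fun hzS => hS (slice_of_mem hzS b a)
      rw [slice_of_notMem hzS] at hS
      have := hJ _ hS
      intro n hn
      refine Finset.mem_erase.2 ⟨fun e => hzS (e ▸ hn), this ?_⟩
      cases b <;> simp [hn]
  let K := AlgebraicClosure F
  have : Infinite K := IsAlgClosed.instInfinite
  refine h.good_of_forall_not_bad (K := K) fun i j k l m w hn hb => ?_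
  let P : Finset σ := {i, j, k, l, m}
  have hPmem (n : σ) : n ∈ P ↔ n ∈ [i, j, k, l, m] := by simp [P]
  have hbP : BadSet K a P w := ⟨i, j, k, l, m, hn, rfl, hb⟩
  have hPJ := hbP.subset_of_support hJ h
  have hZ : (J \ P).card ≤ 1 := by
    by_contra hc
    obtain ⟨x, hx, y, hy, hxy⟩ := Finset.one_lt_card.1 (not_le.1 hc)
    rw [Finset.mem_sdiff] at hx hy
    refine h.not_badSet_of_tame hx.2 hy.2 hxy (fun n hn => tame_of_good_slice (hslice n ?_)) hbP
    rcases hn with rfl | rfl | hn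
    exacts [hx.1, hy.1, hPJ hn]
  let w' : σ → F × F := fun n => if n ∈ J \ P then w n else (0, 1)
  have hb' : Bad K a i j k l m w' := by
    refine (hb.restrict hJ fun n hn => hPJ ((hPmem n).2 hn)).congr fun n hn => ?_
    rw [← hPmem] at hn
    by_cases hnJ : n ∈ J <;> simp [w', hn, hnJ]
  have hw' : ∀ n ∉ J \ P, w' n = (0, 1) := fun n hn => by simp only [w', hn, if_false]
  let a₀ : Finset σ → F := fun S => if S.card = e then a S else 0
  let a₁ : Finset σ → F := fun S => if S.card = e + 1 then a S else 0
  have ha : ∀ S, a S = a₀ S + a₁ S := by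
    intro S
    by_cases h0 : a S = 0
    · simp [a₀, a₁, h0]
    rcases hom S h0 with h | h <;> simp [a₀, a₁, h]
  have h₀ : IsHomTensor e a₀ := fun T hT => by
    by_contra hc
    simp [a₀, hc] at hT
  have h₁ : IsHomTensor (e + 1) a₁ := fun T hT => by
    by_contra hc
    simp [a₁, hc] at hT
  by_cases he : e ≤ 2
  · obtain ⟨h1, h2⟩ := h.bad_iff_of_hom (K := K) ha h₀ h₁ hn he w'
    by_cases he2 : e < 2
    · exact h2 he2 hb'
    have hb0 := h1.1 hb'
    -- Replacing first components by zero puts any remaining index at a vertex, where the good slice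
    -- excludes badness.
    have hZ0 : J \ P = ∅ := by
      by_contra hne
      obtain ⟨z, hz⟩ := Finset.nonempty_iff_ne_empty.2 hne
      rw [Finset.mem_sdiff, hPmem] at hz
      exact not_bad_of_good_slice (hslice z hz.1 false) hn hz.2 ⟨(w' z).2, by simp⟩ hb0
    obtain rfl : e = 2 := by omega
    refine h.not_badSet_vtx_of_card hom hs (K := K) (P := P) ⟨i, j, k, l, m, hn, rfl, ?_⟩
    refine hb0.congr fun n _ => ?_
    rw [hw' n (by simp [hZ0])]
    simp [vtx]
  · refine h.not_bad_of_hom (K := K) ha h₀ h₁ hn (by omega) (Z := J \ P) (fun n hn => ?_) hZ w'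
      (fun n hn => by rw [hw' n hn]) ?_ hb'
    · rw [← hPmem] at hn
      simp [hn]
    · rintro ⟨z, hz⟩
      have hz' := hz
      rw [Finset.mem_sdiff, hPmem] at hz'
      exact not_bad_of_good_slice (hslice z hz'.1 true) hn hz'.2 ⟨(w' z).1, by simp [hz]⟩

end Induction

/-! ### The associated vector satisfies the hypotheses. -/

section AssocVec

variable {F : Type*} [Field F] {d m : ℕ}

/-- Inserting i into S corresponds to exchanging the last index for i in the sets of size d, so this
is condition (i) with the last index as one of the two. -/
theorem isSquare_assocVec {q : Subsets d (m + 1) → F} (h : HasSquareExchanges (extTensor q))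
    {i : Fin m} {S : Finset (Fin m)} (hi : i ∉ S) :
    IsSquare (assocVec q S * assocVec q (insert i S)) := by
  by_cases h1 : S.card + 1 = d
  · have e1 : assocVec q S = extTensor q (insert (Fin.last m) (S.map Fin.castSuccEmb)) := by
      rw [assocVec_eq_add, extTensor, dif_neg (by rw [Finset.card_map]; omega), zero_add]
    have e2 : assocVec q (insert i S) =
        extTensor q (insert i.castSucc (S.map Fin.castSuccEmb)) := by
      have hc : (insert i S).card = d := by rw [Finset.card_insert_of_notMem hi, h1]
      have e3 : extTensor q (insert (Fin.last m) ((insert i S).map Fin.castSuccEmb)) = 0 := by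
        rw [extTensor, dif_neg]
        rw [Finset.card_insert_of_notMem (last_notMem _), Finset.card_map, hc]
        omega
      rw [assocVec_eq_add, e3, add_zero, Finset.map_insert]
      rfl
    rw [e1, e2]
    exact h _ _ _ (last_notMem S) (by simpa using hi)
  · by_cases h2 : S.card = d
    · have hc := Finset.card_insert_of_notMem hi
      have e : assocVec q (insert i S) = 0 := by
        rw [assocVec, dif_neg (by omega), dif_neg (by omega)]
      rw [e, mul_zero]
      exact IsSquare.zero
    · rw [assocVec, dif_neg h2, dif_neg h1, zero_mul]
      exact IsSquare.zero

/-- Three cases: an element other than 0, 1, −1 exists, characteristic two, or the field with three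
elements. -/
theorem good_assocVec_of_pg {q : Subsets d (m + 1) → F} (h : HasSquareExchanges (extTensor q))
    (hg : PG (assocVec q)) : Good (assocVec q) := by
  by_cases hF : ∃ x : F, x ≠ 0 ∧ x ≠ 1 ∧ x ≠ -1
  · exact hg.good_of_exists_ne hF
  by_cases h2 : (2 : F) = 0
  · exact hg.good_of_two_eq_zero h2
  push Not at hF
  have hcases (x : F) : x = 0 ∨ x = 1 ∨ x = -1 := by
    by_cases h0 : x = 0
    · exact Or.inl h0
    by_cases h1 : x = 1
    · exact Or.inr (Or.inl h1)
    exact Or.inr (Or.inr (hF x h0 h1))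
  have : IsF3 F := by
    refine ⟨?_, hcases⟩
    rcases hcases 2 with h | h | h
    · exact absurd h h2
    · exact absurd (by linear_combination h : (1 : F) = 0) one_ne_zero
    · linear_combination h
  -- The sizes are d − 1 and d; for d = 0 the truncated value e = 0 still covers the only size that
  -- occurs.
  refine hg.good_of_support (J := Finset.univ) (e := d - 1) (fun S hS => ?_)
    (fun i S hi => isSquare_assocVec h hi) fun S _ => Finset.subset_univ S
  unfold assocVec at hS
  split_ifs at hS with h1 h2
  · omega
  · omega
  · exact absurd rfl hS

end AssocVec
end HypDetGr

theorem mainTheorem11 {F : Type*} [Field F] (d m : ℕ)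
    (q : HypDetGr.Subsets d (m + 1) → F) (hq : q ≠ 0) :
    Projectivization.mk F q hq ∈ HypDetGr.grassmannianSq F d (m + 1) ↔
      (∀ (i j : Fin (m + 1)) (S : Finset (Fin (m + 1))) (hi : i ∉ S) (hj : j ∉ S)
        (hS : S.card + 1 = d),
        IsSquare (q ⟨insert i S, HypDetGr.card_insert_eq hi hS⟩ *
          q ⟨insert j S, HypDetGr.card_insert_eq hj hS⟩)) ∧
      (∀ (hm : 3 ≤ m) (g : HypDetGr.Grp F m),
        HypDetGr.hypDet hm (HypDetGr.actVec g (HypDetGr.assocVec q)) = 0) := by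
  rw [HypDetGr.mk_mem_grassmannianSq_iff_good hq, ← HypDetGr.hasSquareExchanges_extTensor_iff,
    HypDetGr.forall_hypDet_iff]
  exact and_congr_right fun h => ⟨fun hg => hg.pg, fun hg => HypDetGr.good_assocVec_of_pg h hg⟩
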